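/- There is an algorithm (a program for a random access machine in which every operation costs one step and whose words have $O(\log(n+k))$ bits) with the following property. For every integer $k\ge 2$ and every tree $T$ on $n\ge 1$ vertices, given by $k$ and the adjacency lists of $T$ (in arbitrary order), the algorithm computes in $O(kn)$ steps, with an absolute implied constant, a $k$-section $(V_1,\dots,V_k)$ of $T$, that is, a partition of $V(T)$ into $k$ (possibly empty) sets with $\lfloor n/k\rfloor\le |V_\ell|\le\lceil n/k\rceil$ for all $\ell\in\{1,\dots,k\}$, whose width $e_T(V_1,\dots,V_k)$, the number of edges of $T$ with ends in two different sets $V_\ell$, satisfies $$e_T(V_1,\dots,V_k)\ \le\ (k-1)\cdot\left(2+\frac{16\,n}{\operatorname{diam}(T)}\right)\cdot\Delta(T).$$ In particular, such a $k$-section exists. Here $\Delta(T)$ is the maximum degree of $T$ and $\operatorname{diam}(T)$ is the length (number of edges) of a longest path in $T$; for $n=1$ the right-hand side is read as $0$, as $\Delta(T)=0$. -/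

import Mathlib

/-! ### Cuts and `k`-sections -/

/-- A cut: a partition `(V_1, …, V_k)` of the vertex set into `k` (possibly empty) sets. -/
structure IsCut {V : Type*} {k : ℕ} (P : Fin k → Finset V) : Prop where
  disjoint : ∀ l h : Fin k, l ≠ h → Disjoint (P l) (P h)
  cover : ∀ v : V, ∃ l : Fin k, v ∈ P l

/-- A `k`-section: a cut into `k` sets, each of size between `⌊n / k⌋` and `⌈n / k⌉`, where `n` is
the number of vertices. -/
structure IsKSection {V : Type*} [Fintype V] {k : ℕ} (P : Fin k → Finset V) : Prop where
  isCut : IsCut P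
  floor_le : ∀ l : Fin k, ⌊(Fintype.card V : ℚ) / k⌋₊ ≤ (P l).card
  le_ceil : ∀ l : Fin k, (P l).card ≤ ⌈(Fintype.card V : ℚ) / k⌉₊

/-- The edges of `G` that are cut by `(V_1, …, V_k)`: their ends lie in different sets. -/
def cutEdges {V : Type*} (G : SimpleGraph V) {k : ℕ} (P : Fin k → Finset V) : Set (Sym2 V) :=
  {e | e ∈ G.edgeSet ∧ ∃ l h : Fin k, l ≠ h ∧ ∃ v w : V, e = s(v, w) ∧ v ∈ P l ∧ w ∈ P h}

/-- The width `e_G(V_1, …, V_k)` of a cut: the number of edges that are cut. -/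
noncomputable def cutWidth {V : Type*} (G : SimpleGraph V) {k : ℕ} (P : Fin k → Finset V) : ℕ :=
  (cutEdges G P).ncard

/-! ### Random access machine with bounded words, in structured form

A program uses registers and arrays (finitely many of each, since a program is a finite term whose
register and array names are literals); array entries are addressed by computed indices.  Every
operation has unit cost, and every number that occurs in a computation has to fit into a machine
word, i.e. must not exceed a bound `W`. -/

namespace RAM

/-- The contents of the registers and of the arrays. -/
structure State where
  reg : ℕ → ℕ
  arr : ℕ → ℕ → ℕ

/-- Arithmetic expressions: constants, registers, array entries, and the four basic operations. -/
inductive Expr where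
  | const (c : ℕ)
  | reg (r : ℕ)
  | load (a : ℕ) (i : Expr)
  | add (e f : Expr)
  | sub (e f : Expr)
  | mul (e f : Expr)
  | div (e f : Expr)

namespace Expr

/-- The value of an expression; subtraction is truncated at `0`, division rounds down
(and division by `0` gives `0`). -/
def val (σ : State) : Expr → ℕ
  | const c => c
  | reg r => σ.reg r
  | load a i => σ.arr a (i.val σ)
  | add e f => e.val σ + f.val σ
  | sub e f => e.val σ - f.val σ
  | mul e f => e.val σ * f.val σ
  | div e f => e.val σ / f.val σ

/-- The cost of evaluating an expression: one step for each constant, register access, array access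
and arithmetic operation. -/
def cost : Expr → ℕ
  | const _ => 1
  | reg _ => 1
  | load _ i => i.cost + 1
  | add e f => e.cost + f.cost + 1
  | sub e f => e.cost + f.cost + 1
  | mul e f => e.cost + f.cost + 1
  | div e f => e.cost + f.cost + 1

/-- All values occurring in the evaluation (also intermediate results and indices) are at
most `W`. -/
def Fits (W : ℕ) (σ : State) : Expr → Prop
  | const c => c ≤ W
  | reg r => σ.reg r ≤ W
  | load a i => i.Fits W σ ∧ σ.arr a (i.val σ) ≤ W
  | add e f => e.Fits W σ ∧ f.Fits W σ ∧ e.val σ + f.val σ ≤ W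
  | sub e f => e.Fits W σ ∧ f.Fits W σ
  | mul e f => e.Fits W σ ∧ f.Fits W σ ∧ e.val σ * f.val σ ≤ W
  | div e f => e.Fits W σ ∧ f.Fits W σ

end Expr

/-- Tests: comparisons and their Boolean combinations. -/
inductive Test where
  | eq (e f : Expr)
  | lt (e f : Expr)
  | not (b : Test)
  | and (b c : Test)

namespace Test

/-- The test succeeds. -/
def Holds (σ : State) : Test → Prop
  | eq e f => e.val σ = f.val σ
  | lt e f => e.val σ < f.val σ
  | not b => ¬ b.Holds σ
  | and b c => b.Holds σ ∧ c.Holds σ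

/-- The cost of a test; both sides of a conjunction are evaluated. -/
def cost : Test → ℕ
  | eq e f => e.cost + f.cost + 1
  | lt e f => e.cost + f.cost + 1
  | not b => b.cost + 1
  | and b c => b.cost + c.cost + 1

/-- All values occurring in the test are at most `W`. -/
def Fits (W : ℕ) (σ : State) : Test → Prop
  | eq e f => e.Fits W σ ∧ f.Fits W σ
  | lt e f => e.Fits W σ ∧ f.Fits W σ
  | not b => b.Fits W σ
  | and b c => b.Fits W σ ∧ c.Fits W σ

end Test

/-- Programs. -/
inductive Program where
  | skip
  | assign (r : ℕ) (e : Expr)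
  | store (a : ℕ) (i e : Expr)
  | seq (p q : Program)
  | branch (b : Test) (p q : Program)
  | loop (b : Test) (p : Program)

/-- Write `x` into register `r`. -/
def State.setReg (σ : State) (r x : ℕ) : State :=
  { σ with reg := Function.update σ.reg r x }

/-- Write `x` into entry `i` of array `a`. -/
def State.setArr (σ : State) (a i x : ℕ) : State :=
  { σ with arr := Function.update σ.arr a (Function.update (σ.arr a) i x) }

/-- `Exec W p σ t τ`: the program `p`, started in state `σ`, halts after exactly `t` steps in
state `τ`, and all numbers occurring on the way are at most `W`. -/
inductive Exec (W : ℕ) : Program → State → ℕ → State → Prop where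
  | skip (σ : State) : Exec W Program.skip σ 1 σ
  | assign (r : ℕ) (e : Expr) (σ : State) (hfit : e.Fits W σ) :
      Exec W (Program.assign r e) σ (e.cost + 1) (σ.setReg r (e.val σ))
  | store (a : ℕ) (i e : Expr) (σ : State) (hi : i.Fits W σ) (he : e.Fits W σ) :
      Exec W (Program.store a i e) σ (i.cost + e.cost + 1) (σ.setArr a (i.val σ) (e.val σ))
  | seq {p q : Program} {σ ρ τ : State} {t u : ℕ} (hp : Exec W p σ t ρ) (hq : Exec W q ρ u τ) :
      Exec W (Program.seq p q) σ (t + u) τ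
  | branch_true {b : Test} {p q : Program} {σ τ : State} {t : ℕ} (hfit : b.Fits W σ)
      (hb : b.Holds σ) (hp : Exec W p σ t τ) :
      Exec W (Program.branch b p q) σ (b.cost + 1 + t) τ
  | branch_false {b : Test} {p q : Program} {σ τ : State} {t : ℕ} (hfit : b.Fits W σ)
      (hb : ¬ b.Holds σ) (hq : Exec W q σ t τ) :
      Exec W (Program.branch b p q) σ (b.cost + 1 + t) τ
  | loop_true {b : Test} {p : Program} {σ ρ τ : State} {t u : ℕ} (hfit : b.Fits W σ)
      (hb : b.Holds σ) (hp : Exec W p σ t ρ) (hl : Exec W (Program.loop b p) ρ u τ) :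
      Exec W (Program.loop b p) σ (b.cost + 1 + t + u) τ
  | loop_false {b : Test} {p : Program} {σ : State} (hfit : b.Fits W σ) (hb : ¬ b.Holds σ) :
      Exec W (Program.loop b p) σ (b.cost + 1) σ

end RAM

/-! ### Input and output -/

/-- `adj` lists, in an arbitrary order, the neighbours of every vertex of `G`. -/
structure IsAdjacencyList {n : ℕ} (G : SimpleGraph (Fin n)) (adj : Fin n → List (Fin n)) :
    Prop where
  nodup : ∀ v, (adj v).Nodup
  mem_iff : ∀ v w, w ∈ adj v ↔ G.Adj v w

/-- The input `(k, G)` with `G` given by adjacency lists: register `0` holds `k`, register `1`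
holds the number `n` of vertices, array `1` holds the adjacency lists of the vertices `0, …, n - 1`
one after the other, and array `0` holds at `v ≤ n` the position where the list of `v` starts (so
that it ends just before the entry of array `0` at `v + 1`).  All else is `0`. -/
def inputState (k : ℕ) {n : ℕ} (adj : Fin n → List (Fin n)) : RAM.State where
  reg r := if r = 0 then k else if r = 1 then n else 0
  arr a i :=
    if a = 0 then
      if i ≤ n then ∑ u : Fin n, (if u.val < i then (adj u).length else 0) else 0
    else if a = 1 then (((List.finRange n).flatMap adj).map Fin.val).getD i 0
    else 0

/-- The state `σ` outputs the cut `(V_1, …, V_k)`: entry `v` of array `2` is the index (counted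
from `0`) of the set that contains the vertex `v`. -/
def OutputsCut (σ : RAM.State) {k n : ℕ} (P : Fin k → Finset (Fin n)) : Prop :=
  ∀ (l : Fin k) (v : Fin n), v ∈ P l ↔ σ.arr 2 v.val = l.val

/-! Let `N` be the number of vertices of a longest path. Without the edges of the path the tree
falls into `N` subtrees, one at each path vertex. If the vertices are listed subtree by subtree, the
subtrees become intervals (`Blocks`), and a boundary between two intervals is crossed by one edge
only (`Blocks.par_lt_start_iff`). If the diameter is at most `16 * (k - 1)`, the claimed bound is at
least `n`, which exceeds the number of edges, and every `k`-section will do (`RAM.Layout.width_le`).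

Otherwise take `k - 1` disjoint windows of `W = N / (3 * (k - 1))` consecutive blocks with at most
`n / (2 * (k - 1))` vertices each (`runs_selectTools`), and chop the forest outside of them into
pieces of at most `W` vertices by isolating at most `n / (W + 1)` vertices (`runs_chop`). The
colours are completed in turn. Colour `l` takes pieces while they fit. Then at most as many vertices
are missing as window `l` has (`Progress.fill`); they are cut off from that window, and the rest of
it goes to colour `l + 1` (`Filled.cutOff`). `Division.cut_le` adds up the isolated vertices, the
window ends and the cuts inside the windows.

The heart is `runs_cutOff`: from a window of `Z` blocks with `u` vertices one can cut off exactly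
`t` vertices by at most `7 * u * Δ / Z` edges. Arrange the positions in a cycle and consider
intervals of length `t` that begin where a block begins; only the block containing the end, the
target, is expensive. If some target has at most `4 * u / Z` vertices, the interval itself serves.
Otherwise look for a subwindow that avoids the target and has many blocks for its number of
vertices. The target then needs to be chopped only into pieces as large as the subwindow, and what
is still missing is cut off from the subwindow recursively.

Such a subwindow exists among the runs of blocks with a common target or among the runs of small
blocks (`exists_dense_window`). If all runs of the first kind fail, then the large blocks contain at
least `7 / 15` of the vertices (`le_bigMass_of_runs`); if all of the second kind fail, at most `10 /
23` (`bigMass_le_of_clusters`); and `10 / 23 < 7 / 15`. Each recursion shrinks the window by the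
factor `14 / 19`, so the time is linear.

On the machine, correctness and cost are separated: `Run` only counts passes through loops and
bounds the values that are written, and `Run.exec` converts this into steps and word size. After the
layout, a vertex is addressed by its position in the list: array `4` holds the vertex, `5` the
parent, `7` the block, `8` the block starts, `10` the colours, and `11`, `12`, `13` the weights,
marks and roots of pieces. -/

/-! ### Reasoning about programs -/

namespace RAM

infixl:65 " +ₑ " => Expr.add
infixl:65 " -ₑ " => Expr.sub
infixl:70 " *ₑ " => Expr.mul
infixl:70 " /ₑ " => Expr.div
infix:50 " =ₑ " => Test.eq
infix:50 " <ₑ " => Test.lt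
infix:45 " ⟵ " => Program.assign
infixr:40 " ;; " => Program.seq

/-- Register access. -/
abbrev R (r : ℕ) : Expr := Expr.reg r

/-- Constants. -/
abbrev K (c : ℕ) : Expr := Expr.const c

/-- Array access. -/
abbrev A (a : ℕ) (i : Expr) : Expr := Expr.load a i

@[simp] theorem State.setReg_reg (σ : State) (r x r' : ℕ) :
    (σ.setReg r x).reg r' = if r' = r then x else σ.reg r' := by
  simp [State.setReg, Function.update_apply]

@[simp] theorem State.setReg_arr (σ : State) (r x : ℕ) : (σ.setReg r x).arr = σ.arr := rfl

@[simp] theorem State.setArr_reg (σ : State) (a i x : ℕ) : (σ.setArr a i x).reg = σ.reg := rfl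

@[simp] theorem State.setArr_arr (σ : State) (a i x a' : ℕ) :
    (σ.setArr a i x).arr a' = if a' = a then Function.update (σ.arr a) i x else σ.arr a' := by
  simp [State.setArr, Function.update_apply]

/-- All entries of the state are at most `B`. -/
structure State.Bounded (B : ℕ) (σ : State) : Prop where
  reg : ∀ r, σ.reg r ≤ B
  arr : ∀ a i, σ.arr a i ≤ B

/-- `Run B p σ m τ`: the program `p` leads from `σ` to `τ` with `m` passes through loop bodies, and
all values that are written are at most `B`. -/
inductive Run (B : ℕ) : Program → State → ℕ → State → Prop where
  | skip (σ : State) : Run B Program.skip σ 0 σ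
  | assign (r : ℕ) (e : Expr) (σ : State) (h : e.val σ ≤ B) :
      Run B (Program.assign r e) σ 0 (σ.setReg r (e.val σ))
  | store (a : ℕ) (i e : Expr) (σ : State) (h : e.val σ ≤ B) :
      Run B (Program.store a i e) σ 0 (σ.setArr a (i.val σ) (e.val σ))
  | seq {p q : Program} {σ ρ τ : State} {m l : ℕ} (hp : Run B p σ m ρ) (hq : Run B q ρ l τ) :
      Run B (Program.seq p q) σ (m + l) τ
  | branch_true {b : Test} {p q : Program} {σ τ : State} {m : ℕ} (hb : b.Holds σ)
      (hp : Run B p σ m τ) : Run B (Program.branch b p q) σ m τ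
  | branch_false {b : Test} {p q : Program} {σ τ : State} {m : ℕ} (hb : ¬ b.Holds σ)
      (hp : Run B q σ m τ) : Run B (Program.branch b p q) σ m τ
  | loop_true {b : Test} {p : Program} {σ ρ τ : State} {m l : ℕ} (hb : b.Holds σ)
      (hp : Run B p σ m ρ) (hl : Run B (Program.loop b p) ρ l τ) :
      Run B (Program.loop b p) σ (m + 1 + l) τ
  | loop_false {b : Test} {p : Program} {σ : State} (hb : ¬ b.Holds σ) :
      Run B (Program.loop b p) σ 0 σ

namespace Expr

/-- The largest constant of an expression. -/
def maxConst : Expr → ℕ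
  | const c => c
  | reg _ => 0
  | load _ i => i.maxConst
  | add e f => max e.maxConst f.maxConst
  | sub e f => max e.maxConst f.maxConst
  | mul e f => max e.maxConst f.maxConst
  | div e f => max e.maxConst f.maxConst

theorem one_le_cost (e : Expr) : 1 ≤ e.cost := by
  cases e <;> simp [cost]

/-- Leaves are at most `B`, and an operation costs one more than its operands together. A product
adds the exponents; for a sum the extra unit of cost pays the factor `2 ≤ B`. -/
theorem val_le_pow {B : ℕ} {σ : State} (hσ : σ.Bounded B) (hB : 2 ≤ B) :
    ∀ e : Expr, e.maxConst ≤ B → e.val σ ≤ B ^ e.cost := by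
  have hpow : ∀ x c, 1 ≤ c → x ≤ B → x ≤ B ^ c := fun x c hc hx =>
    hx.trans (by simpa using Nat.pow_le_pow_right (by omega : 0 < B) hc)
  intro e
  induction e with
  | const c => intro h; exact hpow _ _ (one_le_cost _) h
  | reg r => intro _; exact hpow _ _ (one_le_cost _) (hσ.reg r)
  | load a i ih => intro _; exact hpow _ _ (one_le_cost _) (hσ.arr a _)
  | add e f ihe ihf =>
    intro h
    simp only [maxConst, max_le_iff] at h
    have h1 := ihe h.1
    have h2 := ihf h.2
    have h3 : B ^ e.cost ≤ B ^ (e.cost + f.cost) := Nat.pow_le_pow_right (by omega) (by omega)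
    have h4 : B ^ f.cost ≤ B ^ (e.cost + f.cost) := Nat.pow_le_pow_right (by omega) (by omega)
    have h5 : 2 * B ^ (e.cost + f.cost) ≤ B ^ (e.cost + f.cost + 1) := by
      rw [pow_succ, mul_comm]; exact Nat.mul_le_mul_left _ hB
    simp only [val, cost]
    omega
  | sub e f ihe ihf =>
    intro h
    simp only [maxConst, max_le_iff] at h
    have h1 := ihe h.1
    have h3 : B ^ e.cost ≤ B ^ (e.cost + f.cost + 1) := Nat.pow_le_pow_right (by omega) (by omega)
    simp only [val, cost]
    omega
  | mul e f ihe ihf =>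
    intro h
    simp only [maxConst, max_le_iff] at h
    simp only [val, cost]
    calc e.val σ * f.val σ ≤ B ^ e.cost * B ^ f.cost := Nat.mul_le_mul (ihe h.1) (ihf h.2)
      _ = B ^ (e.cost + f.cost) := (pow_add _ _ _).symm
      _ ≤ _ := Nat.pow_le_pow_right (by omega) (by omega)
  | div e f ihe ihf =>
    intro h
    simp only [maxConst, max_le_iff] at h
    have h1 := ihe h.1
    have h2 : e.val σ / f.val σ ≤ e.val σ := Nat.div_le_self _ _
    have h3 : B ^ e.cost ≤ B ^ (e.cost + f.cost + 1) := Nat.pow_le_pow_right (by omega) (by omega)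
    simp only [val, cost]
    omega

theorem fits_of_bounded {B W : ℕ} {σ : State} (hσ : σ.Bounded B) (hB : 2 ≤ B) :
    ∀ e : Expr, e.maxConst ≤ B → B ^ e.cost ≤ W → e.Fits W σ := by
  intro e
  have key : ∀ e f : Expr, B ^ (e.cost + f.cost + 1) ≤ W → B ^ e.cost ≤ W ∧ B ^ f.cost ≤ W :=
    fun e f h => ⟨(Nat.pow_le_pow_right (by omega) (by omega)).trans h,
      (Nat.pow_le_pow_right (by omega) (by omega)).trans h⟩
  induction e with
  | const c => intro h hW; exact (val_le_pow hσ hB (const c) h).trans hW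
  | reg r => intro h hW; exact (val_le_pow hσ hB (reg r) h).trans hW
  | load a i ih =>
    intro h hW
    exact ⟨ih h ((Nat.pow_le_pow_right (by omega) (by simp [cost])).trans hW),
      (val_le_pow hσ hB (load a i) h).trans hW⟩
  | add e f ihe ihf =>
    intro h hW
    have h' := max_le_iff.1 h
    exact ⟨ihe h'.1 (key e f hW).1, ihf h'.2 (key e f hW).2,
      (val_le_pow hσ hB (add e f) h).trans hW⟩
  | sub e f ihe ihf =>
    intro h hW
    have h' := max_le_iff.1 h
    exact ⟨ihe h'.1 (key e f hW).1, ihf h'.2 (key e f hW).2⟩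
  | mul e f ihe ihf =>
    intro h hW
    have h' := max_le_iff.1 h
    exact ⟨ihe h'.1 (key e f hW).1, ihf h'.2 (key e f hW).2,
      (val_le_pow hσ hB (mul e f) h).trans hW⟩
  | div e f ihe ihf =>
    intro h hW
    have h' := max_le_iff.1 h
    exact ⟨ihe h'.1 (key e f hW).1, ihf h'.2 (key e f hW).2⟩

end Expr

namespace Test

/-- The largest constant of a test. -/
def maxConst : Test → ℕ
  | eq e f => max e.maxConst f.maxConst
  | lt e f => max e.maxConst f.maxConst
  | not b => b.maxConst
  | and b c => max b.maxConst c.maxConst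

theorem fits_of_bounded {B W : ℕ} {σ : State} (hσ : σ.Bounded B) (hB : 2 ≤ B) :
    ∀ b : Test, b.maxConst ≤ B → B ^ b.cost ≤ W → b.Fits W σ := by
  intro b
  have mono : ∀ c d, c ≤ d → B ^ d ≤ W → B ^ c ≤ W := fun c d hcd h =>
    (Nat.pow_le_pow_right (by omega) hcd).trans h
  induction b with
  | eq e f =>
    intro h hW
    have h' := max_le_iff.1 h
    exact ⟨e.fits_of_bounded hσ hB h'.1 (mono _ _ (by simp [cost]; omega) hW),
      f.fits_of_bounded hσ hB h'.2 (mono _ _ (by simp [cost]; omega) hW)⟩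
  | lt e f =>
    intro h hW
    have h' := max_le_iff.1 h
    exact ⟨e.fits_of_bounded hσ hB h'.1 (mono _ _ (by simp [cost]; omega) hW),
      f.fits_of_bounded hσ hB h'.2 (mono _ _ (by simp [cost]; omega) hW)⟩
  | not b ih => intro h hW; exact ih h (mono _ _ (by simp [cost]) hW)
  | and b c ihb ihc =>
    intro h hW
    have h' := max_le_iff.1 h
    exact ⟨ihb h'.1 (mono _ _ (by simp [cost]; omega) hW),
      ihc h'.2 (mono _ _ (by simp [cost]; omega) hW)⟩

end Test

namespace Program

/-- The largest constant of a program. -/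
def maxConst : Program → ℕ
  | skip => 0
  | assign _ e => e.maxConst
  | store _ i e => max i.maxConst e.maxConst
  | seq p q => max p.maxConst q.maxConst
  | branch b p q => max b.maxConst (max p.maxConst q.maxConst)
  | loop b p => max b.maxConst p.maxConst

/-- The cost of all parts of the program together; every expression and every test of the program
costs at most that much, and so does one execution without repetitions of loops. -/
def unit : Program → ℕ
  | skip => 1
  | assign _ e => e.cost + 1
  | store _ i e => i.cost + e.cost + 1
  | seq p q => p.unit + q.unit
  | branch b p q => b.cost + 1 + (p.unit + q.unit)
  | loop b p => b.cost + 1 + p.unit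

/-- The program contains an assignment to register `r`. -/
def writesReg (r : ℕ) : Program → Bool
  | skip => false
  | assign s _ => r == s
  | store _ _ _ => false
  | seq p q => p.writesReg r || q.writesReg r
  | branch _ p q => p.writesReg r || q.writesReg r
  | loop _ p => p.writesReg r

/-- The program contains an assignment to an entry of array `a`. -/
def writesArr (a : ℕ) : Program → Bool
  | skip => false
  | assign _ _ => false
  | store b _ _ => a == b
  | seq p q => p.writesArr a || q.writesArr a
  | branch _ p q => p.writesArr a || q.writesArr a
  | loop _ p => p.writesArr a

end Program

theorem State.Bounded.setReg {B : ℕ} {σ : State} (hσ : σ.Bounded B) {x : ℕ} (hx : x ≤ B) (r : ℕ) :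
    (σ.setReg r x).Bounded B where
  reg r' := by
    rw [State.setReg_reg]
    split_ifs
    exacts [hx, hσ.reg r']
  arr := hσ.arr

theorem State.Bounded.setArr {B : ℕ} {σ : State} (hσ : σ.Bounded B) {x : ℕ} (hx : x ≤ B)
    (a i : ℕ) : (σ.setArr a i x).Bounded B where
  reg := hσ.reg
  arr a' j := by
    rw [State.setArr_arr]
    split_ifs
    · rw [Function.update_apply]
      split_ifs
      exacts [hx, hσ.arr a j]
    · exact hσ.arr a' j

/-- Between two passes every part of the program is executed at most once, hence the factor `p.unit`
per pass. No expression costs more than `p.unit`, so intermediate results stay below `B ^ p.unit`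
although only the written values are assumed to be at most `B`. As the program is fixed, this
exponent is a constant. -/
theorem Run.exec {B W : ℕ} {p : Program} {σ τ : State} {m : ℕ} (h : Run B p σ m τ) (hB : 2 ≤ B) :
    σ.Bounded B → p.maxConst ≤ B → B ^ p.unit ≤ W →
      ∃ t, t ≤ p.unit * (m + 1) ∧ Exec W p σ t τ ∧ τ.Bounded B := by
  have mono : ∀ c d, c ≤ d → B ^ d ≤ W → B ^ c ≤ W := fun c d hcd h =>
    (Nat.pow_le_pow_right (by omega) hcd).trans h
  induction h with
  | skip σ => intro hσ _ _; exact ⟨1, by simp [Program.unit], Exec.skip σ, hσ⟩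
  | assign r e σ h =>
    intro hσ hc hW
    exact ⟨e.cost + 1, by simp [Program.unit], Exec.assign r e σ
      (e.fits_of_bounded hσ hB hc (mono _ _ (by simp [Program.unit]) hW)), hσ.setReg h r⟩
  | store a i e σ h =>
    intro hσ hc hW
    have hc' := max_le_iff.1 hc
    exact ⟨i.cost + e.cost + 1, by simp [Program.unit], Exec.store a i e σ
      (i.fits_of_bounded hσ hB hc'.1 (mono _ _ (by simp [Program.unit]; omega) hW))
      (e.fits_of_bounded hσ hB hc'.2 (mono _ _ (by simp [Program.unit]; omega) hW)),
      hσ.setArr h a _⟩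
  | @seq p q σ ρ τ m l hp hq ihp ihq =>
    intro hσ hc hW
    have hc' := max_le_iff.1 hc
    obtain ⟨t, ht, het, hρ⟩ := ihp hσ hc'.1 (mono _ _ (by simp [Program.unit]) hW)
    obtain ⟨u, hu, heu, hτ⟩ := ihq hρ hc'.2 (mono _ _ (by simp [Program.unit]) hW)
    refine ⟨t + u, ?_, Exec.seq het heu, hτ⟩
    simp only [Program.unit]
    nlinarith [Nat.zero_le (p.unit * l), Nat.zero_le (q.unit * m)]
  | @branch_true b p q σ τ m hb hp ih =>
    intro hσ hc hW
    have hc' := max_le_iff.1 hc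
    have hc'' := max_le_iff.1 hc'.2
    obtain ⟨t, ht, het, hτ⟩ := ih hσ hc''.1 (mono _ _ (by simp [Program.unit]; omega) hW)
    refine ⟨b.cost + 1 + t, ?_, Exec.branch_true
      (b.fits_of_bounded hσ hB hc'.1 (mono _ _ (by simp [Program.unit]; omega) hW)) hb het, hτ⟩
    simp only [Program.unit]
    nlinarith [Nat.zero_le (b.cost * m), Nat.zero_le (q.unit * (m + 1))]
  | @branch_false b p q σ τ m hb hp ih =>
    intro hσ hc hW
    have hc' := max_le_iff.1 hc
    have hc'' := max_le_iff.1 hc'.2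
    obtain ⟨t, ht, het, hτ⟩ := ih hσ hc''.2 (mono _ _ (by simp [Program.unit]; omega) hW)
    refine ⟨b.cost + 1 + t, ?_, Exec.branch_false
      (b.fits_of_bounded hσ hB hc'.1 (mono _ _ (by simp [Program.unit]; omega) hW)) hb het, hτ⟩
    simp only [Program.unit]
    nlinarith [Nat.zero_le (b.cost * m), Nat.zero_le (p.unit * (m + 1))]
  | @loop_true b p σ ρ τ m l hb hp hl ihp ihl =>
    intro hσ hc hW
    have hc' := max_le_iff.1 hc
    obtain ⟨t, ht, het, hρ⟩ := ihp hσ hc'.2 (mono _ _ (by simp [Program.unit]) hW)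
    obtain ⟨u, hu, heu, hτ⟩ := ihl hρ hc hW
    refine ⟨b.cost + 1 + t + u, ?_, Exec.loop_true
      (b.fits_of_bounded hσ hB hc'.1 (mono _ _ (by simp [Program.unit]; omega) hW)) hb het heu, hτ⟩
    simp only [Program.unit] at hu ⊢
    nlinarith [Nat.zero_le (b.cost * m)]
  | @loop_false b p σ hb =>
    intro hσ hc hW
    have hc' := max_le_iff.1 hc
    exact ⟨b.cost + 1, by simp [Program.unit], Exec.loop_false
      (b.fits_of_bounded hσ hB hc'.1 (mono _ _ (by simp [Program.unit]; omega) hW)) hb, hσ⟩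

/-- The states `σ` and `τ` agree wherever the program `p` does not write. -/
structure Same (p : Program) (σ τ : State) : Prop where
  reg : ∀ r, p.writesReg r = false → τ.reg r = σ.reg r
  arr : ∀ a, p.writesArr a = false → τ.arr a = σ.arr a

theorem Same.refl (p : Program) (σ : State) : Same p σ σ := ⟨fun _ _ => rfl, fun _ _ => rfl⟩

theorem Same.trans {p : Program} {σ ρ τ : State} (h : Same p σ ρ) (h' : Same p ρ τ) :
    Same p σ τ :=
  ⟨fun r hr => (h'.reg r hr).trans (h.reg r hr), fun a ha => (h'.arr a ha).trans (h.arr a ha)⟩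

/-- A frame rule. `writesReg` and `writesArr` compute on concrete programs, so its side conditions
are mostly closed by `rfl`. -/
theorem Run.same {B : ℕ} {p : Program} {σ τ : State} {m : ℕ} (h : Run B p σ m τ) :
    Same p σ τ := by
  induction h with
  | skip σ => exact Same.refl _ _
  | assign r e σ h =>
    refine ⟨fun s hs => ?_, fun _ _ => rfl⟩
    simp only [Program.writesReg, beq_eq_false_iff_ne] at hs
    simp [hs]
  | store a i e σ h =>
    refine ⟨fun _ _ => rfl, fun s hs => ?_⟩
    simp only [Program.writesArr, beq_eq_false_iff_ne] at hs
    simp [hs]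
  | seq _ _ ihp ihq =>
    refine ⟨fun r hr => ?_, fun a ha => ?_⟩
    · simp only [Program.writesReg, Bool.or_eq_false_iff] at hr
      exact (ihq.reg r hr.2).trans (ihp.reg r hr.1)
    · simp only [Program.writesArr, Bool.or_eq_false_iff] at ha
      exact (ihq.arr a ha.2).trans (ihp.arr a ha.1)
  | branch_true _ _ ih =>
    refine ⟨fun r hr => ?_, fun a ha => ?_⟩
    · simp only [Program.writesReg, Bool.or_eq_false_iff] at hr
      exact ih.reg r hr.1
    · simp only [Program.writesArr, Bool.or_eq_false_iff] at ha
      exact ih.arr a ha.1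
  | branch_false _ _ ih =>
    refine ⟨fun r hr => ?_, fun a ha => ?_⟩
    · simp only [Program.writesReg, Bool.or_eq_false_iff] at hr
      exact ih.reg r hr.2
    · simp only [Program.writesArr, Bool.or_eq_false_iff] at ha
      exact ih.arr a ha.2
  | loop_true _ _ _ ihp ihl =>
    refine ⟨fun r hr => ?_, fun a ha => ?_⟩
    · exact (ihl.reg r hr).trans (ihp.reg r hr)
    · exact (ihl.arr a ha).trans (ihp.arr a ha)
  | loop_false _ => exact Same.refl _ _

/-- The program `p`, started in `σ`, halts after a number `m` of passes through loop bodies in a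
state `τ` such that `Q m τ`. -/
def Runs (B : ℕ) (p : Program) (σ : State) (Q : ℕ → State → Prop) : Prop :=
  ∃ m τ, Run B p σ m τ ∧ Q m τ

/-! ### Rules for total correctness -/

variable {B : ℕ} {σ : State} {Q : ℕ → State → Prop}

-- The rules for constructs without loops are equivalences, so that `simp only` rewrites a loop-free
-- program into its verification condition.
@[simp] theorem runs_skip : Runs B Program.skip σ Q ↔ Q 0 σ := by
  constructor
  · rintro ⟨_, _, h, hQ⟩
    cases h
    exact hQ
  · exact fun h => ⟨0, σ, Run.skip σ, h⟩

@[simp] theorem runs_assign {r : ℕ} {e : Expr} :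
    Runs B (Program.assign r e) σ Q ↔ e.val σ ≤ B ∧ Q 0 (σ.setReg r (e.val σ)) := by
  constructor
  · rintro ⟨_, _, h, hQ⟩
    cases h with
    | assign _ _ _ h => exact ⟨h, hQ⟩
  · exact fun h => ⟨0, _, Run.assign r e σ h.1, h.2⟩

@[simp] theorem runs_store {a : ℕ} {i e : Expr} :
    Runs B (Program.store a i e) σ Q ↔
      e.val σ ≤ B ∧ Q 0 (σ.setArr a (i.val σ) (e.val σ)) := by
  constructor
  · rintro ⟨_, _, h, hQ⟩
    cases h with
    | store _ _ _ _ h => exact ⟨h, hQ⟩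
  · exact fun h => ⟨0, _, Run.store a i e σ h.1, h.2⟩

@[simp] theorem runs_seq {p q : Program} :
    Runs B (p ;; q) σ Q ↔ Runs B p σ fun m τ => Runs B q τ fun l ρ => Q (m + l) ρ := by
  constructor
  · rintro ⟨_, _, h, hQ⟩
    cases h with
    | seq hp hq => exact ⟨_, _, hp, _, _, hq, hQ⟩
  · rintro ⟨_, _, hp, _, _, hq, hQ⟩
    exact ⟨_, _, Run.seq hp hq, hQ⟩

@[simp] theorem runs_branch {b : Test} {p q : Program} :
    Runs B (Program.branch b p q) σ Q ↔
      (b.Holds σ → Runs B p σ Q) ∧ (¬ b.Holds σ → Runs B q σ Q) := by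
  constructor
  · rintro ⟨_, _, h, hQ⟩
    cases h with
    | branch_true hb hp => exact ⟨fun _ => ⟨_, _, hp, hQ⟩, fun h => absurd hb h⟩
    | branch_false hb hp => exact ⟨fun h => absurd h hb, fun _ => ⟨_, _, hp, hQ⟩⟩
  · rintro ⟨h1, h2⟩
    by_cases hb : b.Holds σ
    · obtain ⟨m, τ, h, hQ⟩ := h1 hb
      exact ⟨m, τ, Run.branch_true hb h, hQ⟩
    · obtain ⟨m, τ, h, hQ⟩ := h2 hb
      exact ⟨m, τ, Run.branch_false hb h, hQ⟩

/-- The frame information is supplied for free here; specifications of subprograms therefore mention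
only what these change. -/
theorem Runs.mono {p : Program} {Q' : ℕ → State → Prop} (h : Runs B p σ Q)
    (hQ : ∀ m τ, Same p σ τ → Q m τ → Q' m τ) : Runs B p σ Q' := by
  obtain ⟨m, τ, hr, hq⟩ := h
  exact ⟨m, τ, hr, hQ m τ hr.same hq⟩

theorem runs_loop_of_false {b : Test} {p : Program} (hb : ¬ b.Holds σ) (hQ : Q 0 σ) :
    Runs B (Program.loop b p) σ Q :=
  ⟨0, σ, Run.loop_false hb, hQ⟩

theorem runs_loop_of_true {b : Test} {p : Program} (hb : b.Holds σ)
    (h : Runs B p σ fun m τ => Runs B (Program.loop b p) τ fun l ρ => Q (m + 1 + l) ρ) :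
    Runs B (Program.loop b p) σ Q := by
  obtain ⟨_, _, hp, _, _, hq, hQ⟩ := h
  exact ⟨_, _, Run.loop_true hb hp hq, hQ⟩

/-- The rule for loops: `I m σ` is an invariant, where `m` is the number of passes so far, and `μ`
decreases. -/
theorem runs_loop {b : Test} {p : Program} (I : ℕ → State → Prop) (μ : State → ℕ) (h0 : I 0 σ)
    (hstep : ∀ m τ, Same p σ τ → I m τ → b.Holds τ →
      Runs B p τ fun l ρ => I (m + l + 1) ρ ∧ μ ρ < μ τ)
    (hQ : ∀ m τ, Same p σ τ → I m τ → ¬ b.Holds τ → Q m τ) :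
    Runs B (Program.loop b p) σ Q := by
  have key : ∀ d m τ, μ τ ≤ d → Same p σ τ → I m τ →
      Runs B (Program.loop b p) τ fun l ρ => Q (m + l) ρ := by
    intro d
    induction d with
    | zero =>
      intro m τ hd hs hI
      by_cases hb : b.Holds τ
      -- Another pass would make the measure negative.
      · obtain ⟨_, _, _, _, h⟩ := hstep m τ hs hI hb
        omega
      · exact runs_loop_of_false hb (hQ m τ hs hI hb)
    | succ d ih =>
      intro m τ hd hs hI
      by_cases hb : b.Holds τ
      · refine runs_loop_of_true hb ((hstep m τ hs hI hb).mono fun l ρ hs' h => ?_)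
        refine (ih (m + l + 1) ρ (by omega) (hs.trans hs') h.1).mono fun l' ρ' _ hq => ?_
        rwa [show m + (l + 1 + l') = m + l + 1 + l' by omega]
      · exact runs_loop_of_false hb (hQ m τ hs hI hb)
  simpa using key (μ σ) 0 σ le_rfl (Same.refl _ _) h0

end RAM


/-! ### Chopping a forest into small pieces -/

namespace RAM

/-- The vertex `c` belongs to the same piece as its parent. -/
abbrev Attached (S : Finset ℕ) (par mark rt : ℕ → ℕ) (c : ℕ) : Prop :=
  c ∈ S ∧ rt c = 0 ∧ mark c = 0 ∧ mark (par c) = 0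

/-- The forest induced on `S` is divided into pieces of size at most `q`: marked vertices are pieces,
and the others form pieces with roots that are unattached and have their size as weight. -/
structure Pieces (q : ℕ) (S : Finset ℕ) (par w mark rt : ℕ → ℕ) : Prop where
  weight_le : ∀ p ∈ S, w p ≤ q
  weight_marked : ∀ p ∈ S, mark p ≠ 0 → w p = 1
  weight_eq : ∀ p ∈ S, mark p = 0 →
    w p = 1 + ∑ c ∈ S, if Attached S par mark rt c ∧ par c = p then w c else 0
  rt_eq : ∀ p ∈ S, (rt p = 0 ↔ par p ∈ S ∧ par p < p)
  card_le : (q + 1) * (S.filter fun p => mark p ≠ 0).card ≤ S.card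

/-- The state of the bottom-up computation after the vertices `p ≥ cur` have been treated. -/
structure ChopInv (q : ℕ) (S : Finset ℕ) (par : ℕ → ℕ) (cur : ℕ) (w mark rt : ℕ → ℕ) : Prop where
  weight_le : ∀ p ∈ S, cur ≤ p → w p ≤ q
  weight_marked : ∀ p ∈ S, cur ≤ p → mark p ≠ 0 → w p = 1
  weight_eq : ∀ p ∈ S, (cur ≤ p → mark p = 0) →
    w p = 1 + ∑ c ∈ S, if cur ≤ c ∧ rt c = 0 ∧ mark c = 0 ∧ par c = p then w c else 0
  rt_eq : ∀ p ∈ S, cur ≤ p → (rt p = 0 ↔ par p ∈ S ∧ par p < p)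
  card_le : (∑ p ∈ S, if p < cur then w p else 0) +
    (q + 1) * (∑ p ∈ S, if cur ≤ p ∧ mark p ≠ 0 then 1 else 0) ≤ S.card

variable {q : ℕ} {S : Finset ℕ} {par w mark rt : ℕ → ℕ} {cur : ℕ}

theorem ChopInv.init {h : ℕ} (hS : ∀ p ∈ S, p < h) (hw : ∀ p ∈ S, w p = 1) :
    ChopInv q S par h w mark rt where
  weight_le p hp hc := absurd (hS p hp) (by omega)
  weight_marked p hp hc := absurd (hS p hp) (by omega)
  weight_eq p hp _ := by
    rw [hw p hp, Finset.sum_eq_zero fun c hc => if_neg fun hcc => by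
      have := hS c hc
      omega, add_zero]
  rt_eq p hp hc := absurd (hS p hp) (by omega)
  card_le := by
    have h1 : ∑ p ∈ S, (if p < h then w p else 0) = S.card := by
      rw [Finset.card_eq_sum_ones]
      exact Finset.sum_congr rfl fun p hp => by rw [if_pos (hS p hp), hw p hp]
    have h2 : ∑ p ∈ S, (if h ≤ p ∧ mark p ≠ 0 then 1 else 0) = 0 := by
      apply Finset.sum_eq_zero
      intro p hp
      rw [if_neg]
      have := hS p hp
      omega
    rw [h1, h2]
    simp

/-- While the computation runs, the mark of a parent is not yet known, so the invariant cannot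
demand that it be `0`. At the end this condition of `Attached` is automatic in `weight_eq`, where
only an unmarked `p` is considered. -/
theorem ChopInv.pieces {l : ℕ} (h : ChopInv q S par l w mark rt) (hS : ∀ p ∈ S, l ≤ p) :
    Pieces q S par w mark rt where
  weight_le p hp := h.weight_le p hp (hS p hp)
  weight_marked p hp := h.weight_marked p hp (hS p hp)
  weight_eq p hp hm := by
    rw [h.weight_eq p hp fun _ => hm]
    congr 1
    refine Finset.sum_congr rfl fun c hc => ?_
    refine if_congr ?_ rfl rfl
    constructor
    · rintro ⟨_, h1, h2, h3⟩
      exact ⟨⟨hc, h1, h2, by rw [h3]; exact hm⟩, h3⟩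
    · rintro ⟨⟨_, h1, h2, _⟩, h3⟩
      exact ⟨hS c hc, h1, h2, h3⟩
  rt_eq p hp := h.rt_eq p hp (hS p hp)
  card_le := by
    have h1 := h.card_le
    have h2 : ∑ p ∈ S, (if l ≤ p ∧ mark p ≠ 0 then 1 else 0)
        = (S.filter fun p => mark p ≠ 0).card := by
      rw [Finset.card_filter]
      refine Finset.sum_congr rfl fun p hp => if_congr ?_ rfl rfl
      simp [hS p hp]
    rw [h2] at h1
    omega

theorem ChopInv.skip (h : ChopInv q S par (cur + 1) w mark rt) (hcur : cur ∉ S) :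
    ChopInv q S par cur w mark rt := by
  have key : ∀ p ∈ S, (cur + 1 ≤ p ↔ cur ≤ p) := fun p hp => by
    have : p ≠ cur := fun h => hcur (h ▸ hp)
    omega
  have key' : ∀ p ∈ S, (p < cur + 1 ↔ p < cur) := fun p hp => by
    have : p ≠ cur := fun h => hcur (h ▸ hp)
    omega
  refine ⟨fun p hp hc => h.weight_le p hp ((key p hp).2 hc),
    fun p hp hc => h.weight_marked p hp ((key p hp).2 hc), fun p hp hc => ?_,
    fun p hp hc => h.rt_eq p hp ((key p hp).2 hc), ?_⟩
  · rw [h.weight_eq p hp fun h' => hc ((key p hp).1 h')]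
    congr 1
    exact Finset.sum_congr rfl fun c hc => by simp only [key c hc]
  · have h1 := h.card_le
    have e1 : ∑ p ∈ S, (if p < cur + 1 then w p else 0) = ∑ p ∈ S, if p < cur then w p else 0 :=
      Finset.sum_congr rfl fun p hp => by simp only [key' p hp]
    have e2 : ∑ p ∈ S, (if cur + 1 ≤ p ∧ mark p ≠ 0 then 1 else 0)
        = ∑ p ∈ S, if cur ≤ p ∧ mark p ≠ 0 then 1 else 0 :=
      Finset.sum_congr rfl fun p hp => by simp only [key p hp]
    rwa [e1, e2] at h1

/-- Both weights are still pending, and `card_le` bounds the total pending weight. This keeps the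
weights within the word size. -/
theorem ChopInv.weight_add_le (h : ChopInv q S par (cur + 1) w mark rt) (hcur : cur ∈ S) {r : ℕ}
    (hr : r ∈ S) (hlt : r < cur) : w r + w cur ≤ S.card := by
  refine le_trans ?_ ((Nat.le_add_right _ _).trans h.card_le)
  rw [← Finset.sum_filter]
  have h1 : ({r, cur} : Finset ℕ) ⊆ S.filter (· < cur + 1) := by
    intro x hx
    simp only [Finset.mem_insert, Finset.mem_singleton] at hx
    rcases hx with rfl | rfl <;> simp [*]
    omega
  refine le_trans ?_ (Finset.sum_le_sum_of_subset h1)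
  rw [Finset.sum_pair (by omega)]

/-- Amortisation: the pending weight drops by `w cur`, which is at least `q + 1` and so pays for the
new mark in `card_le`. The children of a marked vertex become roots of pieces of their own. -/
theorem ChopInv.step_mark (h : ChopInv q S par (cur + 1) w mark rt) (hcur : cur ∈ S) {x : ℕ}
    (hx : x = 0 ↔ par cur ∈ S ∧ par cur < cur) (hw : q < w cur) (hq : 1 ≤ q) :
    ChopInv q S par cur (Function.update w cur 1) (Function.update mark cur 1)
      (Function.update rt cur x) := by
  refine ⟨fun p hp hc => ?_, fun p hp hc hm => ?_, fun p hp hc => ?_, fun p hp hc => ?_, ?_⟩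
  · rcases eq_or_ne p cur with rfl | hne
    · simpa using hq
    · rw [Function.update_of_ne hne]
      exact h.weight_le p hp (by omega)
  · rcases eq_or_ne p cur with rfl | hne
    · simp
    · rw [Function.update_of_ne hne] at hm ⊢
      exact h.weight_marked p hp (by omega) hm
  · rcases eq_or_ne p cur with rfl | hne
    · simp at hc
    · rw [Function.update_of_ne hne] at hc ⊢
      rw [h.weight_eq p hp fun h' => hc (by omega)]
      congr 1
      refine Finset.sum_congr rfl fun c _ => ?_
      rcases eq_or_ne c cur with rfl | hne'
      · simp
      · simp only [Function.update_of_ne hne']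
        refine if_congr ?_ rfl rfl
        have : cur + 1 ≤ c ↔ cur ≤ c := by omega
        rw [this]
  · rcases eq_or_ne p cur with rfl | hne
    · simpa using hx
    · rw [Function.update_of_ne hne]
      exact h.rt_eq p hp (by omega)
  · have h1 := h.card_le
    rw [← Finset.add_sum_erase _ _ hcur, ← Finset.add_sum_erase _ _ hcur] at h1 ⊢
    have e1 : ∑ p ∈ S.erase cur, (if p < cur then Function.update w cur 1 p else 0)
        = ∑ p ∈ S.erase cur, (if p < cur + 1 then w p else 0) := by
      refine Finset.sum_congr rfl fun p hp => ?_
      have hne := Finset.ne_of_mem_erase hp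
      rw [Function.update_of_ne hne]
      exact if_congr (by omega) rfl rfl
    have e2 : ∑ p ∈ S.erase cur, (if cur ≤ p ∧ Function.update mark cur 1 p ≠ 0 then 1 else 0)
        = ∑ p ∈ S.erase cur, (if cur + 1 ≤ p ∧ mark p ≠ 0 then 1 else 0) := by
      refine Finset.sum_congr rfl fun p hp => ?_
      have hne := Finset.ne_of_mem_erase hp
      rw [Function.update_of_ne hne]
      refine if_congr ?_ rfl rfl
      have : cur + 1 ≤ p ↔ cur ≤ p := by omega
      rw [this]
    rw [e1, e2]
    rw [if_neg (lt_irrefl _), if_pos ⟨le_rfl, by simp⟩, mul_add]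
    rw [if_pos (by omega), if_neg (by omega), zero_add] at h1
    omega

/-- A light vertex without parent in `S` closes its piece: its weight leaves the pending sum and is
handed to nobody. -/
theorem ChopInv.step_root (h : ChopInv q S par (cur + 1) w mark rt) (hcur : cur ∈ S) {x : ℕ}
    (hx : x = 0 ↔ par cur ∈ S ∧ par cur < cur) (hx0 : x ≠ 0) (hw : w cur ≤ q) :
    ChopInv q S par cur w (Function.update mark cur 0) (Function.update rt cur x) := by
  refine ⟨fun p hp hc => ?_, fun p hp hc hm => ?_, fun p hp hc => ?_, fun p hp hc => ?_, ?_⟩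
  · rcases eq_or_ne p cur with rfl | hne
    · exact hw
    · exact h.weight_le p hp (by omega)
  · rcases eq_or_ne p cur with rfl | hne
    · simp at hm
    · rw [Function.update_of_ne hne] at hm
      exact h.weight_marked p hp (by omega) hm
  · rw [h.weight_eq p hp]
    · congr 1
      refine Finset.sum_congr rfl fun c _ => ?_
      rcases eq_or_ne c cur with rfl | hne'
      · simp [hx0]
      · simp only [Function.update_of_ne hne']
        refine if_congr ?_ rfl rfl
        have : cur + 1 ≤ c ↔ cur ≤ c := by omega
        rw [this]
    · intro h'
      have := hc (by omega)
      rwa [Function.update_of_ne (by omega)] at this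
  · rcases eq_or_ne p cur with rfl | hne
    · simpa using hx
    · rw [Function.update_of_ne hne]
      exact h.rt_eq p hp (by omega)
  · have h1 := h.card_le
    rw [← Finset.add_sum_erase _ _ hcur, ← Finset.add_sum_erase _ _ hcur] at h1 ⊢
    have e1 : ∑ p ∈ S.erase cur, (if p < cur then w p else 0)
        = ∑ p ∈ S.erase cur, (if p < cur + 1 then w p else 0) := by
      refine Finset.sum_congr rfl fun p hp => ?_
      have hne := Finset.ne_of_mem_erase hp
      exact if_congr (by omega) rfl rfl
    have e2 : ∑ p ∈ S.erase cur, (if cur ≤ p ∧ Function.update mark cur 0 p ≠ 0 then 1 else 0)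
        = ∑ p ∈ S.erase cur, (if cur + 1 ≤ p ∧ mark p ≠ 0 then 1 else 0) := by
      refine Finset.sum_congr rfl fun p hp => ?_
      have hne := Finset.ne_of_mem_erase hp
      rw [Function.update_of_ne hne]
      refine if_congr ?_ rfl rfl
      have : cur + 1 ≤ p ↔ cur ≤ p := by omega
      rw [this]
    rw [e1, e2]
    rw [if_neg (lt_irrefl _), if_neg (by simp), zero_add, zero_add]
    rw [if_pos (by omega), if_neg (by omega), zero_add] at h1
    omega

/-- The weight moves to the parent, which is still pending, so the pending sum does not change.
Whether the child stays attached is decided later, by the mark of the parent. -/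
theorem ChopInv.step_attach (h : ChopInv q S par (cur + 1) w mark rt) (hcur : cur ∈ S)
    (hr : par cur ∈ S) (hlt : par cur < cur) (hw : w cur ≤ q) :
    ChopInv q S par cur (Function.update w (par cur) (w (par cur) + w cur))
      (Function.update mark cur 0) (Function.update rt cur 0) := by
  have hne : cur ≠ par cur := by omega
  refine ⟨fun p hp hc => ?_, fun p hp hc hm => ?_, fun p hp hc => ?_, fun p hp hc => ?_, ?_⟩
  · rw [Function.update_of_ne (by omega)]
    rcases eq_or_ne p cur with rfl | hne
    · exact hw
    · exact h.weight_le p hp (by omega)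
  · rw [Function.update_of_ne (by omega)]
    rcases eq_or_ne p cur with rfl | hne
    · simp at hm
    · rw [Function.update_of_ne hne] at hm
      exact h.weight_marked p hp (by omega) hm
  · have h0 : w p = _ := h.weight_eq p hp (by
      intro h'
      have := hc (by omega)
      rwa [Function.update_of_ne (by omega)] at this)
    rw [← Finset.add_sum_erase _ _ hcur] at h0 ⊢
    have e1 : ∑ c ∈ S.erase cur, (if cur ≤ c ∧ Function.update rt cur 0 c = 0 ∧
          Function.update mark cur 0 c = 0 ∧ par c = p then
            Function.update w (par cur) (w (par cur) + w cur) c else 0)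
        = ∑ c ∈ S.erase cur, (if cur + 1 ≤ c ∧ rt c = 0 ∧ mark c = 0 ∧ par c = p then w c
            else 0) := by
      refine Finset.sum_congr rfl fun c hc => ?_
      have hne := Finset.ne_of_mem_erase hc
      rw [Function.update_of_ne hne, Function.update_of_ne hne]
      by_cases hcc : cur ≤ c
      · rw [Function.update_of_ne (by omega)]
        refine if_congr ?_ rfl rfl
        have : cur + 1 ≤ c ↔ cur ≤ c := by omega
        rw [this]
      · rw [if_neg (by omega), if_neg (by omega)]
    rw [e1]
    simp only [Nat.not_succ_le_self, false_and, if_false, zero_add] at h0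
    simp only [le_refl, Function.update_self, true_and]
    rw [Function.update_of_ne hne]
    rcases eq_or_ne p (par cur) with rfl | hp'
    · rw [if_pos rfl, Function.update_self]
      omega
    · rw [if_neg (Ne.symm hp'), Function.update_of_ne hp']
      omega
  · rcases eq_or_ne p cur with rfl | hne
    · simp [hr, hlt]
    · rw [Function.update_of_ne hne]
      exact h.rt_eq p hp (by omega)
  · have h1 := h.card_le
    have hr' : par cur ∈ S.erase cur := Finset.mem_erase.2 ⟨hne.symm, hr⟩
    have e2 : ∑ p ∈ S, (if cur ≤ p ∧ Function.update mark cur 0 p ≠ 0 then 1 else 0)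
        = ∑ p ∈ S, (if cur + 1 ≤ p ∧ mark p ≠ 0 then 1 else 0) := by
      refine Finset.sum_congr rfl fun p hp => ?_
      rcases eq_or_ne p cur with rfl | hne
      · simp
      · rw [Function.update_of_ne hne]
        refine if_congr ?_ rfl rfl
        have : cur + 1 ≤ p ↔ cur ≤ p := by omega
        rw [this]
    rw [e2]
    rw [← Finset.add_sum_erase _ _ hcur, ← Finset.add_sum_erase _ _ hr'] at h1 ⊢
    have e1 : ∑ p ∈ (S.erase cur).erase (par cur),
          (if p < cur then Function.update w (par cur) (w (par cur) + w cur) p else 0)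
        = ∑ p ∈ (S.erase cur).erase (par cur), (if p < cur + 1 then w p else 0) := by
      refine Finset.sum_congr rfl fun p hp => ?_
      have hne := Finset.ne_of_mem_erase hp
      have hne' := Finset.ne_of_mem_erase (Finset.mem_of_mem_erase hp)
      rw [Function.update_of_ne hne]
      exact if_congr (by omega) rfl rfl
    rw [e1, if_neg (lt_irrefl _), if_pos hlt, Function.update_self]
    rw [if_pos (by omega), if_pos (by omega)] at h1
    omega

/-- One step of the bottom-up computation of weights and marks. -/
def chopStep : Program :=
  Program.branch (Test.and (Test.not (R 14 =ₑ R 18)) (A 10 (A 5 (R 14)) =ₑ R 0))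
    (Program.store 13 (R 14) (K 0)) (Program.store 13 (R 14) (K 1)) ;;
  Program.branch (R 20 <ₑ A 11 (R 14))
    (Program.store 12 (R 14) (K 1) ;; Program.store 11 (R 14) (K 1))
    (Program.store 12 (R 14) (K 0) ;;
      Program.branch (A 13 (R 14) =ₑ K 0)
        (Program.store 11 (A 5 (R 14)) (A 11 (A 5 (R 14)) +ₑ A 11 (R 14))) Program.skip)

/-- Chop the forest induced on the vertices of colour `k` between positions `lo` (register `18`)
and `hi` (register `19`) into pieces of size at most `q` (register `20`). -/
def chop : Program :=
  14 ⟵ R 18 ;;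
  Program.loop (R 14 <ₑ R 19) (Program.store 11 (R 14) (K 1) ;; 14 ⟵ R 14 +ₑ K 1) ;;
  Program.loop (R 18 <ₑ R 14)
    (14 ⟵ R 14 -ₑ K 1 ;; Program.branch (A 10 (R 14) =ₑ R 0) chopStep Program.skip)

theorem runs_chop {B : ℕ} {σ : State} (hB : σ.reg 19 + 1 ≤ B) (hlh : σ.reg 18 ≤ σ.reg 19)
    (hq : 1 ≤ σ.reg 20)
    (hpar : ∀ p, σ.reg 18 < p → p < σ.reg 19 → σ.reg 18 ≤ σ.arr 5 p ∧ σ.arr 5 p < p) :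
    Runs B chop σ fun m τ => m ≤ 2 * (σ.reg 19 - σ.reg 18) ∧
      Pieces (σ.reg 20) ((Finset.Ico (σ.reg 18) (σ.reg 19)).filter fun p => σ.arr 10 p = σ.reg 0)
        (σ.arr 5) (τ.arr 11) (τ.arr 12) (τ.arr 13) := by
  set lo := σ.reg 18 with hlo
  set hi := σ.reg 19 with hhi
  set S := (Finset.Ico lo hi).filter fun p => σ.arr 10 p = σ.reg 0 with hS
  have hScard : S.card ≤ hi := by
    refine (Finset.card_filter_le _ _).trans ?_
    simp
  simp only [chop, runs_seq, runs_assign, zero_add]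
  refine ⟨by simp [Expr.val]; omega, ?_⟩
  refine runs_loop (fun m τ => lo ≤ τ.reg 14 ∧ τ.reg 14 ≤ hi ∧ m + lo = τ.reg 14 ∧
    ∀ p, lo ≤ p → p < τ.reg 14 → τ.arr 11 p = 1) (fun τ => hi - τ.reg 14) ?_ ?_ ?_
  · simp only [State.setReg_reg, Expr.val, if_true]
    exact ⟨le_rfl, hlh, by omega, fun p _ _ => by omega⟩
  · intro m τ hs ⟨h1, h2, h3, h4⟩ hb
    have e19 : τ.reg 19 = hi := by rw [hs.reg 19 rfl]; simp [hhi]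
    simp only [Test.Holds, Expr.val, e19] at hb
    simp only [runs_seq, runs_store, runs_assign, Expr.val, State.setReg_reg, State.setArr_reg,
      if_true, State.setReg_arr, State.setArr_arr]
    refine ⟨by omega, by omega, ⟨by omega, by omega, by omega, fun p hp hp' => ?_⟩, by omega⟩
    rcases eq_or_ne p (τ.reg 14) with rfl | hne
    · simp
    · rw [Function.update_of_ne hne]
      exact h4 p hp (by omega)
  · intro m0 τ hs ⟨h1, h2, h3, h4⟩ hb
    have e19 : τ.reg 19 = hi := by rw [hs.reg 19 rfl]; simp [hhi]
    have e18 : τ.reg 18 = lo := by rw [hs.reg 18 rfl]; simp [hlo]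
    have e20 : τ.reg 20 = σ.reg 20 := by rw [hs.reg 20 rfl]; simp
    have e0 : τ.reg 0 = σ.reg 0 := by rw [hs.reg 0 rfl]; simp
    have e5 : τ.arr 5 = σ.arr 5 := by rw [hs.arr 5 rfl]; simp
    have e10 : τ.arr 10 = σ.arr 10 := by rw [hs.arr 10 rfl]; simp
    simp only [Test.Holds, Expr.val, e19] at hb
    have e14 : τ.reg 14 = hi := by omega
    refine runs_loop (fun m ρ => lo ≤ ρ.reg 14 ∧ ρ.reg 14 ≤ hi ∧ m + ρ.reg 14 = hi ∧
      ChopInv (σ.reg 20) S (σ.arr 5) (ρ.reg 14) (ρ.arr 11) (ρ.arr 12) (ρ.arr 13))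
      (fun ρ => ρ.reg 14) ?_ ?_ ?_
    · refine ⟨by omega, by omega, by omega, ?_⟩
      rw [e14]
      refine ChopInv.init (fun p hp => ?_) fun p hp => ?_
      · simp only [hS, Finset.mem_filter, Finset.mem_Ico] at hp
        exact hp.1.2
      · simp only [hS, Finset.mem_filter, Finset.mem_Ico] at hp
        exact h4 p hp.1.1 (by omega)
    · intro m ρ hs' ⟨g1, g2, g3, g4⟩ hb'
      have f18 : ρ.reg 18 = lo := by rw [hs'.reg 18 rfl, e18]
      have f20 : ρ.reg 20 = σ.reg 20 := by rw [hs'.reg 20 rfl, e20]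
      have f0 : ρ.reg 0 = σ.reg 0 := by rw [hs'.reg 0 rfl, e0]
      have f5 : ρ.arr 5 = σ.arr 5 := by rw [hs'.arr 5 rfl, e5]
      have f10 : ρ.arr 10 = σ.arr 10 := by rw [hs'.arr 10 rfl, e10]
      simp only [Test.Holds, Expr.val, f18] at hb'
      obtain ⟨c, hc⟩ : ∃ c, ρ.reg 14 = c + 1 := ⟨ρ.reg 14 - 1, by omega⟩
      rw [hc] at g4
      have hcS : c ∈ S ↔ σ.arr 10 c = σ.reg 0 := by
        simp only [hS, Finset.mem_filter, Finset.mem_Ico]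
        constructor
        · exact fun h => h.2
        · exact fun h => ⟨⟨by omega, by omega⟩, h⟩
      -- The program singles out the position `lo`, whose parent may lie outside the interval; for
      -- all others `hpar` places the parent between `lo` and the position, so that only its colour
      -- has to be tested.
      have hx : (¬ c = lo ∧ σ.arr 10 (σ.arr 5 c) = σ.reg 0) ↔
          σ.arr 5 c ∈ S ∧ σ.arr 5 c < c := by
        simp only [hS, Finset.mem_filter, Finset.mem_Ico]
        constructor
        · rintro ⟨h, h'⟩
          have := hpar c (by omega) (by omega)
          exact ⟨⟨⟨this.1, by omega⟩, h'⟩, this.2⟩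
        · rintro ⟨⟨h, h'⟩, h''⟩
          refine ⟨?_, h'⟩
          rintro rfl
          omega
      simp only [chopStep, runs_seq, runs_store, runs_assign, runs_branch, runs_skip, Test.Holds,
        Expr.val, State.setReg_reg, State.setArr_reg, if_true, State.setReg_arr,
        State.setArr_arr, hc, Nat.add_sub_cancel, f18, f20, f0, f5, f10, Nat.reduceEqDiff,
        if_false, Function.update_self, Nat.add_zero]
      refine ⟨by omega, fun hcol => ⟨fun hroot => ⟨by omega, fun hw => ⟨by omega, by omega, ?_,
          by omega⟩,
        fun hw => ⟨by omega, fun _ => ⟨?_, ?_, by omega⟩, fun hf => absurd trivial hf⟩⟩,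
        fun hroot => ⟨by omega, fun hw => ⟨by omega, by omega, ?_, by omega⟩,
        fun hw => ⟨by omega, fun hf => absurd hf (by simp), fun _ => ⟨?_, by omega⟩⟩⟩⟩,
        fun hcol => ⟨⟨by omega, by omega, by omega, g4.skip (fun h => hcol (hcS.1 h))⟩, by omega⟩⟩
      · exact ⟨by omega, by omega, by omega,
          g4.step_mark (hcS.2 hcol) (by rw [hx] at hroot; simpa using hroot) hw hq⟩
      · rw [hx] at hroot
        have := g4.weight_add_le (hcS.2 hcol) hroot.1 hroot.2
        omega
      · rw [hx] at hroot
        exact ⟨by omega, by omega, by omega,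
          g4.step_attach (hcS.2 hcol) hroot.1 hroot.2 (by omega)⟩
      · exact ⟨by omega, by omega, by omega,
          g4.step_mark (hcS.2 hcol) (by rw [hx] at hroot; simpa using hroot) hw hq⟩
      · exact ⟨by omega, by omega, by omega,
          g4.step_root (hcS.2 hcol) (by rw [hx] at hroot; simpa using hroot) one_ne_zero (by omega)⟩
    · intro m ρ hs' ⟨g1, g2, g3, g4⟩ hb'
      have f18 : ρ.reg 18 = lo := by rw [hs'.reg 18 rfl, e18]
      simp only [Test.Holds, Expr.val, f18] at hb'
      have : ρ.reg 14 = lo := by omega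
      rw [this] at g4
      refine ⟨by omega, g4.pieces fun p hp => ?_⟩
      simp only [hS, Finset.mem_filter, Finset.mem_Ico] at hp
      exact hp.1.1

end RAM


/-! ### Distributing the pieces -/

namespace RAM

/-- The state of the distribution of the pieces in two colours `c₁` and `c₂`, after the positions
below `cur` have been treated: `col₀` is the colouring before, `t₀` and `t` are the numbers of
vertices of colour `c₁` that are wanted before and now. -/
structure FillInv (q k c₁ c₂ lo hi : ℕ) (S : Finset ℕ) (par w mark rt col₀ : ℕ → ℕ) (t₀ cur : ℕ)
    (col : ℕ → ℕ) (t : ℕ) : Prop where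
  eq_of_ge : ∀ p, p < lo ∨ cur ≤ p → col p = col₀ p
  eq_of_ne : ∀ p, col₀ p ≠ k → col p = col₀ p
  eq_or_eq : ∀ p, lo ≤ p → p < cur → col₀ p = k → col p = c₁ ∨ col p = c₂
  attached : ∀ c, lo ≤ c → c < cur → Attached S par mark rt c → col c = col (par c)
  count : t₀ = t + (∑ p ∈ Finset.Ico lo cur, if col₀ p = k ∧ col p = c₁ then 1 else 0) +
    ∑ c ∈ S, if cur ≤ c ∧ Attached S par mark rt c ∧ par c < cur ∧ col₀ c = k ∧ col (par c) = c₁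
      then w c else 0
  lt_or : t < q ∨ ∀ p, lo ≤ p → p < cur → col₀ p = k → col p = c₁

variable {q k c₁ c₂ lo hi : ℕ} {S : Finset ℕ} {par w mark rt col₀ : ℕ → ℕ} {t₀ cur : ℕ}
  {col : ℕ → ℕ} {t : ℕ}

theorem Pieces.par_lt (hP : Pieces q S par w mark rt) {c : ℕ} (hc : Attached S par mark rt c) :
    par c ∈ S ∧ par c < c :=
  (hP.rt_eq c hc.1).1 hc.2.1

theorem FillInv.init (hP : Pieces q S par w mark rt) (hS : ∀ p ∈ S, lo ≤ p) :
    FillInv q k c₁ c₂ lo hi S par w mark rt col₀ t₀ lo col₀ t₀ where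
  eq_of_ge _ _ := rfl
  eq_of_ne _ _ := rfl
  eq_or_eq p _ _ := by omega
  attached p _ _ := by omega
  count := by
    rw [Finset.Ico_self, Finset.sum_empty, Finset.sum_eq_zero]
    · rfl
    · intro c _
      rw [if_neg]
      rintro ⟨_, h, h', _⟩
      have := hS _ (hP.par_lt h).1
      omega
  lt_or := Or.inr fun p _ _ => by omega

theorem FillInv.skip (h : FillInv q k c₁ c₂ lo hi S par w mark rt col₀ t₀ cur col t)
    (hlo : lo ≤ cur) (hk : col₀ cur ≠ k)
    (hcol₀ : ∀ c, Attached S par mark rt c → col₀ c = col₀ (par c)) :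
    FillInv q k c₁ c₂ lo hi S par w mark rt col₀ t₀ (cur + 1) col t where
  eq_of_ge p hp := h.eq_of_ge p (by omega)
  eq_of_ne := h.eq_of_ne
  eq_or_eq p hp hp' hpk := by
    have : p ≠ cur := by
      rintro rfl
      exact hk hpk
    exact h.eq_or_eq p hp (by omega) hpk
  attached c hc hc' ha := by
    rcases eq_or_ne c cur with rfl | hne
    · rw [h.eq_of_ne c hk, h.eq_of_ne (par c), hcol₀ c ha]
      rw [← hcol₀ c ha]
      exact hk
    · exact h.attached c hc (by omega) ha
  count := by
    rw [Finset.sum_Ico_succ_top hlo, if_neg (by simp [hk]), add_zero]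
    refine h.count.trans ?_
    congr 1
    refine Finset.sum_congr rfl fun c _ => if_congr ?_ rfl rfl
    constructor
    · rintro ⟨h1, h2, h3, h4, h5⟩
      have : c ≠ cur := by
        rintro rfl
        exact hk h4
      exact ⟨by omega, h2, by omega, h4, h5⟩
    · rintro ⟨h1, h2, h3, h4, h5⟩
      have : par c ≠ cur := by
        rintro he
        rw [hcol₀ c h2, he] at h4
        exact hk h4
      exact ⟨by omega, h2, by omega, h4, h5⟩
  lt_or := by
    refine h.lt_or.imp id fun h' p hp hp' hpk => ?_
    have : p ≠ cur := by
      rintro rfl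
      exact hk hpk
    exact h' p hp (by omega) hpk

/-- A vertex is coloured; `t'` is the number of vertices wanted afterwards. -/
theorem FillInv.step (h : FillInv q k c₁ c₂ lo hi S par w mark rt col₀ t₀ cur col t)
    (hlo : lo ≤ cur) (hk : col₀ cur = k) (hcur : cur ∈ S) (hS : ∀ p ∈ S, lo ≤ p)
    (hcol₀ : ∀ c, Attached S par mark rt c → col₀ c = col₀ (par c))
    (hP : Pieces q S par w mark rt) {x t' : ℕ} (hx : x = c₁ ∨ x = c₂)
    (hatt : Attached S par mark rt cur → x = col (par cur) ∧ t' = t)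
    (hnatt : ¬ Attached S par mark rt cur → t = t' + if x = c₁ then w cur else 0)
    (hlt : ¬ Attached S par mark rt cur → x ≠ c₁ → t' < q) :
    FillInv q k c₁ c₂ lo hi S par w mark rt col₀ t₀ (cur + 1) (Function.update col cur x) t' where
  eq_of_ge p hp := by
    rw [Function.update_of_ne (by omega)]
    exact h.eq_of_ge p (by omega)
  eq_of_ne p hp := by
    rw [Function.update_of_ne]
    · exact h.eq_of_ne p hp
    · rintro rfl
      exact hp hk
  eq_or_eq p hp hp' hpk := by
    rcases eq_or_ne p cur with rfl | hne
    · simpa using hx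
    · rw [Function.update_of_ne hne]
      exact h.eq_or_eq p hp (by omega) hpk
  attached c hc hc' ha := by
    have hlt' := (hP.par_lt ha).2
    rw [Function.update_of_ne (show par c ≠ cur by omega)]
    rcases eq_or_ne c cur with rfl | hne
    · rw [Function.update_self]
      exact (hatt ha).1
    · rw [Function.update_of_ne hne]
      exact h.attached c hc (by omega) ha
  -- The whole weight of a piece is subtracted from `t` when its root gets the colour `c₁`. The last
  -- sum is the part of this weight that belongs to vertices not yet reached.
  count := by
    have hc := h.count
    rw [Finset.sum_Ico_succ_top hlo, Function.update_self]
    have e1 : ∑ p ∈ Finset.Ico lo cur,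
          (if col₀ p = k ∧ Function.update col cur x p = c₁ then 1 else 0)
        = ∑ p ∈ Finset.Ico lo cur, (if col₀ p = k ∧ col p = c₁ then 1 else 0) := by
      refine Finset.sum_congr rfl fun p hp => ?_
      rw [Finset.mem_Ico] at hp
      rw [Function.update_of_ne (by omega)]
    have e2 : ∑ c ∈ S, (if cur + 1 ≤ c ∧ Attached S par mark rt c ∧ par c < cur + 1 ∧ col₀ c = k ∧
          Function.update col cur x (par c) = c₁ then w c else 0)
        = (∑ c ∈ S, if Attached S par mark rt c ∧ par c = cur ∧ x = c₁ then w c else 0) +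
          ∑ c ∈ S.erase cur, if cur ≤ c ∧ Attached S par mark rt c ∧ par c < cur ∧ col₀ c = k ∧
            col (par c) = c₁ then w c else 0 := by
      rw [← Finset.add_sum_erase _ _ hcur, if_neg (by omega), zero_add,
        ← Finset.add_sum_erase (a := cur) _ (fun c => if Attached S par mark rt c ∧ par c =
            cur ∧ x = c₁
          then w c else 0) hcur, if_neg, zero_add, ← Finset.sum_add_distrib]
      · refine Finset.sum_congr rfl fun c hc => ?_
        have hne := Finset.ne_of_mem_erase hc
        by_cases ha : Attached S par mark rt c
        · have hlt' := (hP.par_lt ha).2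
          rcases eq_or_ne (par c) cur with he | he
          · have hk' : col₀ c = k := by rw [hcol₀ c ha, he, hk]
            rw [if_neg (show ¬ (cur ≤ c ∧ Attached S par mark rt c ∧ par c < cur ∧ col₀ c = k ∧
              col (par c) = c₁) from fun h => by have := h.2.2.1; omega), add_zero]
            refine if_congr ?_ rfl rfl
            constructor
            · rintro ⟨_, _, _, _, h5⟩
              rw [he, Function.update_self] at h5
              exact ⟨ha, he, h5⟩
            · rintro ⟨_, _, h5⟩
              exact ⟨by omega, ha, by omega, hk', by rw [he, Function.update_self, h5]⟩
          · rw [Function.update_of_ne he, if_neg (show ¬ (Attached S par mark rt c ∧ par c =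
              cur ∧ _) from
              fun h => he h.2.1), zero_add]
            refine if_congr ?_ rfl rfl
            have h1 : cur + 1 ≤ c ↔ cur ≤ c := by omega
            have h2 : par c < cur + 1 ↔ par c < cur := by omega
            rw [h1, h2]
        · rw [if_neg (fun h => ha h.2.1), if_neg (fun h => ha h.1), if_neg (fun h => ha h.2.1)]
      · rintro ⟨ha, he, _⟩
        have := (hP.par_lt ha).2
        omega
    -- The attached children of `cur` carry the weight of its subpiece except for `cur` itself. A
    -- marked vertex has weight `1` and no attached children.
    have e3 : (∑ c ∈ S, if Attached S par mark rt c ∧ par c = cur ∧ x = c₁ then w c else 0)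
        = if x = c₁ then w cur - 1 else 0 := by
      by_cases hxc : x = c₁
      · rw [if_pos hxc]
        by_cases hm : mark cur = 0
        · rw [hP.weight_eq cur hcur hm, Nat.add_sub_cancel_left]
          exact Finset.sum_congr rfl fun c _ => if_congr (by simp [hxc]) rfl rfl
        · rw [hP.weight_marked cur hcur hm]
          apply Finset.sum_eq_zero
          intro c _
          rw [if_neg]
          rintro ⟨ha, he, _⟩
          exact hm (he ▸ ha.2.2.2)
      · rw [if_neg hxc]
        apply Finset.sum_eq_zero
        intro c _
        rw [if_neg]
        exact fun h => hxc h.2.2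
    have hw1 : 1 ≤ w cur := by
      by_cases hm : mark cur = 0
      · rw [hP.weight_eq cur hcur hm]
        omega
      · rw [hP.weight_marked cur hcur hm]
    rw [e1, e2, e3]
    rw [← Finset.add_sum_erase _ _ hcur] at hc
    by_cases ha : Attached S par mark rt cur
    · obtain ⟨hx', rfl⟩ := hatt ha
      have hlt' := (hP.par_lt ha).2
      by_cases hxc : x = c₁
      · rw [if_pos (by refine ⟨le_rfl, ha, hlt', hk, ?_⟩; rw [← hx', hxc])] at hc
        rw [if_pos ⟨hk, hxc⟩, if_pos hxc]
        omega
      · rw [if_neg (by rintro ⟨_, _, _, _, h5⟩; exact hxc (hx'.trans h5))] at hc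
        rw [if_neg (fun h => hxc h.2), if_neg hxc]
        omega
    · have ht := hnatt ha
      rw [if_neg (fun h => ha h.2.1)] at hc
      by_cases hxc : x = c₁
      · rw [if_pos hxc] at ht
        rw [if_pos ⟨hk, hxc⟩, if_pos hxc]
        omega
      · rw [if_neg hxc] at ht
        rw [if_neg (fun h => hxc h.2), if_neg hxc]
        omega
  -- The wanted number never increases, so the first alternative persists. The second one ends only
  -- when a piece is refused, and then `hlt` yields the first.
  lt_or := by
    have htt : t' ≤ t := by
      by_cases ha : Attached S par mark rt cur
      · exact (hatt ha).2.le
      · have := hnatt ha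
        omega
    rcases h.lt_or with h' | h'
    · exact Or.inl (by omega)
    · by_cases ha : Attached S par mark rt cur
      · refine Or.inr fun p hp hp' hpk => ?_
        rcases eq_or_ne p cur with rfl | hne
        · rw [Function.update_self, (hatt ha).1]
          exact h' _ (hS _ (hP.par_lt ha).1) (hP.par_lt ha).2 (by rw [← hcol₀ p ha, hk])
        · rw [Function.update_of_ne hne]
          exact h' p hp (by omega) hpk
      · by_cases hxc : x = c₁
        · refine Or.inr fun p hp hp' hpk => ?_
          rcases eq_or_ne p cur with rfl | hne
          · rw [Function.update_self, hxc]
          · rw [Function.update_of_ne hne]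
            exact h' p hp (by omega) hpk
        · exact Or.inl (hlt ha hxc)

/-- Colour the vertex at the position in register `14`. -/
def fillStep : Program :=
  Program.branch (Test.and (A 13 (R 14) =ₑ K 0)
      (Test.and (A 12 (R 14) =ₑ K 0) (A 12 (A 5 (R 14)) =ₑ K 0)))
    (Program.store 10 (R 14) (A 10 (A 5 (R 14))))
    (Program.branch (R 17 <ₑ A 11 (R 14))
      (Program.store 10 (R 14) (R 22))
      (Program.store 10 (R 14) (R 21) ;; 17 ⟵ R 17 -ₑ A 11 (R 14)))

/-- Give the colour in register `21` to pieces of colour `k`, as long as they do not contain more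
vertices than register `17` says, and the colour in register `22` to the other pieces. -/
def fill : Program :=
  14 ⟵ R 18 ;;
  Program.loop (R 14 <ₑ R 19)
    (Program.branch (A 10 (R 14) =ₑ R 0) fillStep Program.skip ;; 14 ⟵ R 14 +ₑ K 1)

/-- The set `S` may contain vertices of pieces that were coloured earlier; they are passed over, and
`hcol` ensures that a piece is available either as a whole or not at all. A refused piece has more
than `t` and at most `q` vertices, hence the alternative in `lt_or`. -/
theorem runs_fill {B : ℕ} {σ : State} {q : ℕ} {S : Finset ℕ} (hB : σ.reg 19 + 1 ≤ B)
    (hc₁ : σ.reg 21 ≤ B) (hc₂ : σ.reg 22 ≤ B) (ht : σ.reg 17 ≤ B) (hlh : σ.reg 18 ≤ σ.reg 19)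
    (hcB : ∀ p, σ.arr 10 p ≤ B) (hne : σ.reg 21 ≠ σ.reg 22)
    (hS : ∀ p ∈ S, σ.reg 18 ≤ p)
    (hSk : ∀ p, σ.reg 18 ≤ p → p < σ.reg 19 → σ.arr 10 p = σ.reg 0 → p ∈ S)
    (hP : Pieces q S (σ.arr 5) (σ.arr 11) (σ.arr 12) (σ.arr 13))
    (hcol : ∀ c, Attached S (σ.arr 5) (σ.arr 12) (σ.arr 13) c →
      σ.arr 10 c = σ.arr 10 (σ.arr 5 c)) :
    Runs B fill σ fun m τ => m ≤ σ.reg 19 - σ.reg 18 ∧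
      FillInv q (σ.reg 0) (σ.reg 21) (σ.reg 22) (σ.reg 18) (σ.reg 19) S (σ.arr 5) (σ.arr 11)
        (σ.arr 12) (σ.arr 13) (σ.arr 10) (σ.reg 17) (σ.reg 19) (τ.arr 10) (τ.reg 17) := by
  simp only [fill, runs_seq, runs_assign, zero_add]
  refine ⟨by simp [Expr.val]; omega, ?_⟩
  refine runs_loop (fun m τ => σ.reg 18 ≤ τ.reg 14 ∧ τ.reg 14 ≤ σ.reg 19 ∧
    m + σ.reg 18 = τ.reg 14 ∧ τ.reg 17 ≤ σ.reg 17 ∧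
      FillInv q (σ.reg 0) (σ.reg 21) (σ.reg 22) (σ.reg 18) (σ.reg 19) S (σ.arr 5) (σ.arr 11)
        (σ.arr 12) (σ.arr 13) (σ.arr 10) (σ.reg 17) (τ.reg 14) (τ.arr 10) (τ.reg 17))
    (fun τ => σ.reg 19 - τ.reg 14) ?_ ?_ ?_
  · simp only [State.setReg_reg, Expr.val, if_true, State.setReg_arr, Nat.reduceEqDiff, if_false]
    exact ⟨le_rfl, hlh, by omega, le_rfl, FillInv.init hP hS⟩
  · intro m τ hs ⟨h1, h2, h3, h4, h5⟩ hb
    have e0 : τ.reg 0 = σ.reg 0 := by rw [hs.reg 0 rfl]; simp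
    have e19 : τ.reg 19 = σ.reg 19 := by rw [hs.reg 19 rfl]; simp
    have e21 : τ.reg 21 = σ.reg 21 := by rw [hs.reg 21 rfl]; simp
    have e22 : τ.reg 22 = σ.reg 22 := by rw [hs.reg 22 rfl]; simp
    have e5 : τ.arr 5 = σ.arr 5 := by rw [hs.arr 5 rfl]; simp
    have e11 : τ.arr 11 = σ.arr 11 := by rw [hs.arr 11 rfl]; simp
    have e12 : τ.arr 12 = σ.arr 12 := by rw [hs.arr 12 rfl]; simp
    have e13 : τ.arr 13 = σ.arr 13 := by rw [hs.arr 13 rfl]; simp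
    simp only [Test.Holds, Expr.val, e19] at hb
    have hcur : τ.arr 10 (τ.reg 14) = σ.arr 10 (τ.reg 14) := h5.eq_of_ge _ (Or.inr le_rfl)
    have hcB' : ∀ p, τ.arr 10 p ≤ B := by
      intro p
      by_cases hp : σ.arr 10 p = σ.reg 0
      · by_cases hp' : σ.reg 18 ≤ p ∧ p < τ.reg 14
        · rcases h5.eq_or_eq p hp'.1 hp'.2 hp with h | h <;> rw [h] <;> assumption
        · rw [h5.eq_of_ge p (by omega)]
          exact hcB p
      · rw [h5.eq_of_ne p hp]
        exact hcB p
    simp only [fillStep, runs_seq, runs_store, runs_assign, runs_branch, runs_skip, Test.Holds,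
      Expr.val, State.setReg_reg, State.setArr_reg, if_true, State.setReg_arr,
      State.setArr_arr, e0, e21, e22, e5, e11, e12, e13, Nat.reduceEqDiff,
      if_false, Nat.add_zero, hcur]
    have hmem : σ.arr 10 (τ.reg 14) = σ.reg 0 → τ.reg 14 ∈ S := fun h => hSk _ h1 hb h
    refine ⟨fun hk => ⟨fun ha => ⟨hcB' _, by omega, ⟨by omega, by omega, by omega, by omega, ?_⟩,
        by omega⟩,
      fun ha => ⟨fun hlt => ⟨hc₂, by omega, ⟨by omega, by omega, by omega, by omega, ?_⟩, by omega⟩,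
        fun hge => ⟨hc₁, by omega, by omega, ⟨by omega, by omega, by omega, by omega, ?_⟩,
            by omega⟩⟩⟩,
      fun hk => ⟨by omega, ⟨by omega, by omega, by omega, by omega, ?_⟩, by omega⟩⟩
    · have ha' : Attached S (σ.arr 5) (σ.arr 12) (σ.arr 13) (τ.reg 14) := ⟨hmem hk, ha⟩
      have hpl := hP.par_lt ha'
      exact h5.step h1 hk (hmem hk) hS hcol hP
        (h5.eq_or_eq _ (hS _ hpl.1) hpl.2 (by rw [← hcol _ ha', hk]))
        (fun _ => ⟨rfl, rfl⟩) (fun h => absurd ha' h) (fun h => absurd ha' h)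
    · exact h5.step h1 hk (hmem hk) hS hcol hP (Or.inr rfl) (fun h => absurd h.2 ha)
        (fun _ => by rw [if_neg hne.symm]; rfl)
        (fun _ _ => lt_of_lt_of_le hlt (hP.weight_le _ (hmem hk)))
    · exact h5.step h1 hk (hmem hk) hS hcol hP (Or.inl rfl) (fun h => absurd h.2 ha)
        (fun _ => by rw [if_pos rfl]; omega)
        (fun _ h => absurd rfl h)
    · exact h5.skip h1 hk hcol
  · intro m τ hs ⟨h1, h2, h3, h4, h5⟩ hb
    have e19 : τ.reg 19 = σ.reg 19 := by rw [hs.reg 19 rfl]; simp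
    simp only [Test.Holds, Expr.val, e19] at hb
    have : τ.reg 14 = σ.reg 19 := by omega
    rw [this] at h5
    exact ⟨by omega, h5⟩

end RAM


/-! ### Trees divided into blocks along a path -/

/-- The vertices `0, …, n - 1` of a tree, rooted at `0`, are divided into `N` intervals; `par p` is
the parent of `p`, the first vertices of the intervals form a path, and the other vertices have
their parents in the same interval. -/
structure Blocks (n N : ℕ) (par blk start : ℕ → ℕ) : Prop where
  start_zero : start 0 = 0
  start_last : start N = n
  start_lt : ∀ j < N, start j < start (j + 1)
  blk_eq : ∀ j < N, ∀ p, start j ≤ p → p < start (j + 1) → blk p = j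
  par_inner : ∀ j < N, ∀ p, start j < p → p < start (j + 1) → start j ≤ par p ∧ par p < p
  par_start : ∀ j, j + 1 < N → par (start (j + 1)) = start j

namespace Blocks

variable {n N : ℕ} {par blk start : ℕ → ℕ}

/-- Blocks are nonempty, so a window has at least as many vertices as blocks. Estimates and running
times in terms of blocks are turned into ones in terms of vertices by this. -/
theorem start_add_le (hT : Blocks n N par blk start) {i j : ℕ} (hij : i ≤ j) (hj : j ≤ N) :
    start i + (j - i) ≤ start j := by
  induction j, hij using Nat.le_induction with
  | base => simp
  | succ j hij ih =>
    have h1 := ih (by omega)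
    have h2 := hT.start_lt j (by omega)
    omega

theorem start_le (hT : Blocks n N par blk start) {i j : ℕ} (hij : i ≤ j) (hj : j ≤ N) :
    start i ≤ start j := by
  have := hT.start_add_le hij hj
  omega

theorem start_le_n (hT : Blocks n N par blk start) {i : ℕ} (hi : i ≤ N) : start i ≤ n := by
  have := hT.start_le hi le_rfl
  rwa [hT.start_last] at this

theorem lt_of_start_lt (hT : Blocks n N par blk start) {i j : ℕ} (hi : i ≤ N)
    (h : start i < start j) : i < j := by
  by_contra hc
  have := hT.start_le (not_lt.1 hc) hi
  omega

theorem blk_spec (hT : Blocks n N par blk start) {p : ℕ} (hp : p < n) :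
    blk p < N ∧ start (blk p) ≤ p ∧ p < start (blk p + 1) := by
  have key : ∀ j ≤ N, p < start j → ∃ i < j, start i ≤ p ∧ p < start (i + 1) := by
    intro j
    induction j with
    | zero =>
      intro _ h
      rw [hT.start_zero] at h
      omega
    | succ j ih =>
      intro hj h
      by_cases hc : p < start j
      · obtain ⟨i, hi, h'⟩ := ih (by omega) hc
        exact ⟨i, by omega, h'⟩
      · exact ⟨j, by omega, by omega, h⟩
  obtain ⟨i, hi, h1, h2⟩ := key N le_rfl (by rwa [hT.start_last])
  rw [hT.blk_eq i hi p h1 h2]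
  exact ⟨hi, h1, h2⟩

theorem blk_between (hT : Blocks n N par blk start) {b₀ b₁ p : ℕ} (hb : b₁ ≤ N) (h₀ : b₀ ≤ N)
    (hlo : start b₀ ≤ p) (hhi : p < start b₁) : b₀ ≤ blk p ∧ blk p < b₁ := by
  have hpn : p < n := lt_of_lt_of_le hhi (hT.start_le_n hb)
  obtain ⟨h1, h2, h3⟩ := hT.blk_spec hpn
  constructor
  · have := hT.lt_of_start_lt h₀ (show start b₀ < start (blk p + 1) by omega)
    omega
  · exact hT.lt_of_start_lt h1.le (by omega)

theorem par_lt (hT : Blocks n N par blk start) {p : ℕ} (hp : p < n) (h0 : 0 < p) : par p < p := by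
  obtain ⟨h1, h2, h3⟩ := hT.blk_spec hp
  rcases h2.eq_or_lt with h | h
  · obtain ⟨j, hj⟩ : ∃ j, blk p = j + 1 := by
      refine ⟨blk p - 1, ?_⟩
      have : blk p ≠ 0 := by
        intro hc
        rw [hc, hT.start_zero] at h
        omega
      omega
    have h4 := hT.par_start j (by omega)
    have h5 := hT.start_lt j (by omega)
    rw [← hj] at h4 h5
    rw [h] at h4 h5
    omega
  · exact (hT.par_inner _ h1 p h h3).2

end Blocks

/-! ### The cyclic shift of a sequence of blocks -/

/-- The position that is reached from `x` by a cyclic shift by `t` of the positions between `lo` and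
`hi`. -/
def landing (lo hi t x : ℕ) : ℕ := if x + t < hi then x + t else x + t - (hi - lo)

theorem landing_mem {lo hi t x : ℕ} (h1 : lo ≤ x) (h2 : x < hi) (ht : t ≤ hi - lo) :
    lo ≤ landing lo hi t x ∧ landing lo hi t x < hi := by
  unfold landing
  split_ifs <;> omega

/-- The number of positions between `lo` and `x` in blocks of size at least `s`. -/
def bigMass (blk start : ℕ → ℕ) (s lo x : ℕ) : ℕ :=
  ∑ p ∈ Finset.Ico lo x, if s ≤ start (blk p + 1) - start (blk p) then 1 else 0

/-- The number of blocks of size at least `s` among those from `b₀` to `i`. -/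
def bigCount (start : ℕ → ℕ) (s b₀ i : ℕ) : ℕ :=
  ∑ j ∈ Finset.Ico b₀ i, if s ≤ start (j + 1) - start j then 1 else 0

theorem bigMass_mono (blk start : ℕ → ℕ) (s lo : ℕ) {x y : ℕ} (h : x ≤ y) :
    bigMass blk start s lo x ≤ bigMass blk start s lo y :=
  Finset.sum_le_sum_of_subset (Finset.Ico_subset_Ico_right h)

section Shift

variable {n N : ℕ} {par blk start : ℕ → ℕ} {b₀ b₁ s t : ℕ}

theorem bigMass_of_big (hT : Blocks n N par blk start) (hb : b₁ ≤ N) {i x : ℕ} (h0 : b₀ ≤ i)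
    (hi : i < b₁) (hs : s ≤ start (i + 1) - start i) (hx : start i ≤ x) (hx' : x ≤ start (i + 1)) :
    bigMass blk start s (start b₀) x = bigMass blk start s (start b₀) (start i) + (x - start i) := by
  unfold bigMass
  rw [← Finset.sum_Ico_consecutive _ (hT.start_le h0 (by omega)) hx]
  congr 1
  rw [Finset.sum_congr rfl (g := fun _ => 1)]
  · simp
  · intro p hp
    rw [Finset.mem_Ico] at hp
    rw [hT.blk_eq i (by omega) p hp.1 (by omega), if_pos hs]

theorem bigMass_of_small (hT : Blocks n N par blk start) (hb : b₁ ≤ N) {i : ℕ} (h0 : b₀ ≤ i)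
    (hi : i < b₁) (hs : start (i + 1) - start i < s) :
    bigMass blk start s (start b₀) (start (i + 1)) = bigMass blk start s (start b₀) (start i) := by
  unfold bigMass
  rw [← Finset.sum_Ico_consecutive _ (hT.start_le h0 (by omega)) (hT.start_lt i (by omega)).le]
  rw [add_eq_left]
  refine Finset.sum_eq_zero fun p hp => ?_
  rw [Finset.mem_Ico] at hp
  rw [hT.blk_eq i (by omega) p hp.1 (by omega), if_neg (by omega)]

theorem mul_bigCount_le (hT : Blocks n N par blk start) (hb : b₁ ≤ N) {i : ℕ} (h0 : b₀ ≤ i)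
    (hi : i ≤ b₁) : s * bigCount start s b₀ i ≤ bigMass blk start s (start b₀) (start i) := by
  induction i, h0 using Nat.le_induction with
  | base => simp [bigCount]
  | succ i h0 ih =>
    have ih' := ih (by omega)
    have h1 : bigCount start s b₀ (i + 1) = bigCount start s b₀ i +
        if s ≤ start (i + 1) - start i then 1 else 0 := Finset.sum_Ico_succ_top h0 _
    by_cases hs : s ≤ start (i + 1) - start i
    · rw [bigMass_of_big hT hb h0 (by omega) hs (hT.start_lt i (by omega)).le le_rfl, h1, if_pos hs,
        mul_add]
      omega
    · rw [bigMass_of_small hT hb h0 (by omega) (by omega), h1, if_neg hs]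
      omega

theorem bigMass_le (blk start : ℕ → ℕ) (s lo x : ℕ) : bigMass blk start s lo x ≤ x - lo := by
  unfold bigMass
  refine (Finset.sum_le_card_nsmul _ _ 1 fun p _ => ?_).trans (by simp)
  split_ifs <;> omega

/-- The first block of the maximal run of blocks, up to the block `b₀ + j`, whose starts are
shifted to the same block without going round. -/
def runStart (blk start : ℕ → ℕ) (b₀ b₁ t : ℕ) : ℕ → ℕ
  | 0 => b₀
  | j + 1 =>
    if landing (start b₀) (start b₁) t (start (runStart blk start b₀ b₁ t j)) + start (b₀ +
        (j + 1)) =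
          landing (start b₀) (start b₁) t (start (b₀ + (j + 1))) +
            start (runStart blk start b₀ b₁ t j) ∧
        landing (start b₀) (start b₁) t (start (b₀ + (j + 1))) <
          start (blk (landing (start b₀) (start b₁) t (start (runStart blk start b₀ b₁ t j))) + 1)
      then runStart blk start b₀ b₁ t j else b₀ + (j + 1)

theorem runStart_le (blk start : ℕ → ℕ) (b₀ b₁ t : ℕ) (j : ℕ) :
    b₀ ≤ runStart blk start b₀ b₁ t j ∧ runStart blk start b₀ b₁ t j ≤ b₀ + j := by
  induction j with
  | zero => simp [runStart]
  | succ j ih =>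
    rw [runStart]
    split_ifs <;> omega

/-- The equality of the displacements says that the shift does not go round between the two starts;
so the later one lands to the right of the earlier one, and by the test in `runStart` before the end
of the same block. -/
theorem runStart_spec (hT : Blocks n N par blk start) (hb : b₁ ≤ N) (ht : t ≤ start b₁ - start b₀)
    {j : ℕ} (hj : b₀ + j < b₁) :
    landing (start b₀) (start b₁) t (start (runStart blk start b₀ b₁ t j)) + start (b₀ + j) =
      landing (start b₀) (start b₁) t (start (b₀ + j)) + start (runStart blk start b₀ b₁ t j) ∧
    blk (landing (start b₀) (start b₁) t (start (runStart blk start b₀ b₁ t j))) =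
      blk (landing (start b₀) (start b₁) t (start (b₀ + j))) := by
  cases j with
  | zero => simp [runStart]
  | succ j =>
    rw [runStart]
    split_ifs with h
    · refine ⟨h.1, ?_⟩
      have hr := runStart_le blk start b₀ b₁ t j
      set r := runStart blk start b₀ b₁ t j
      have h1 := hT.start_le hr.1 (by omega)
      have h2 := hT.start_le (show r ≤ b₀ + (j + 1) by omega) (by omega)
      have h3 := hT.start_lt (b₀ + (j + 1)) (by omega)
      have h4 := hT.start_le (show b₀ + (j + 1) + 1 ≤ b₁ by omega) hb
      have h5 := landing_mem (t := t) h1 (by omega) ht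
      have h6 := hT.start_le_n hb
      obtain ⟨g1, g2, g3⟩ := hT.blk_spec (lt_of_lt_of_le h5.2 h6)
      exact (hT.blk_eq _ g1 _ (by omega) h.2).symm
    · exact ⟨rfl, rfl⟩

/-- If no window of blocks that are shifted to the same block is dense, then almost half of the
vertices are in large blocks. -/
theorem le_bigMass_of_runs (hT : Blocks n N par blk start) (hb : b₁ ≤ N) (hb' : b₀ < b₁)
    (ht : t < start b₁ - start b₀)
    (hs : ∀ i, b₀ ≤ i → i < b₁ → s ≤ start (blk (landing (start b₀) (start b₁) t (start i)) + 1) -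
      start (blk (landing (start b₀) (start b₁) t (start i))))
    (hsN : 4 * (start b₁ - start b₀) < s * (b₁ - b₀))
    (hfail : ∀ j, b₀ + j < b₁ →
      14 * (start b₁ - start b₀) * (b₀ + j - runStart blk start b₀ b₁ t j) <
        (b₁ - b₀) * (19 * (start (b₀ + j) - start (runStart blk start b₀ b₁ t j)) +
          2 * (start (blk (landing (start b₀) (start b₁) t (start (b₀ + j))) + 1) -
            start (blk (landing (start b₀) (start b₁) t (start (b₀ + j))))))) :
    28 * (start b₁ - start b₀) ≤ 60 * bigMass blk start s (start b₀) (start b₁) := by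
  set lo := start b₀ with hlo
  set hi := start b₁ with hhi
  set M := bigMass blk start s lo with hM
  set X : ℕ → ℕ := fun i => landing lo hi t (start i) with hX
  set L : ℕ → ℕ := fun i => blk (X i) with hL
  set r := runStart blk start b₀ b₁ t with hr
  -- The correction `o` is added once the shift has gone round, so that `M (X i) + o i` does not
  -- decrease with `i`.
  set o : ℕ → ℕ := fun i => if start i + t < hi then 0 else M hi with ho
  have hlohi : lo < hi := by
    have := hT.start_add_le hb'.le hb
    omega
  have hst : ∀ i, b₀ ≤ i → i < b₁ → lo ≤ start i ∧ start i < hi := fun i h0 h1 => by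
    have := hT.start_le h0 (by omega)
    have := hT.start_lt i (by omega)
    have := hT.start_le (show i + 1 ≤ b₁ by omega) hb
    omega
  have hXm : ∀ i, b₀ ≤ i → i < b₁ → lo ≤ X i ∧ X i < hi := fun i h0 h1 =>
    landing_mem (hst i h0 h1).1 (hst i h0 h1).2 ht.le
  have hLs : ∀ i, b₀ ≤ i → i < b₁ → b₀ ≤ L i ∧ L i < b₁ ∧ start (L i) ≤ X i ∧
      X i < start (L i + 1) := fun i h0 h1 => by
    have h2 := hXm i h0 h1
    have h3 := hT.blk_between hb (by omega) h2.1 h2.2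
    have h4 := hT.blk_spec (lt_of_lt_of_le h2.2 (hT.start_le_n hb))
    exact ⟨h3.1, h3.2, h4.2.1, h4.2.2⟩
  have hMX : ∀ i, b₀ ≤ i → i < b₁ → M (X i) = M (start (L i)) + (X i - start (L i)) ∧
      M (start (L i + 1)) = M (start (L i)) + (start (L i + 1) - start (L i)) := fun i h0 h1 => by
    have h2 := hLs i h0 h1
    exact ⟨bigMass_of_big hT hb h2.1 h2.2.1 (hs i h0 h1) h2.2.2.1 h2.2.2.2.le,
      bigMass_of_big hT hb h2.1 h2.2.1 (hs i h0 h1) (h2.2.2.1.trans h2.2.2.2.le) le_rfl⟩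
  have hLend : ∀ i, b₀ ≤ i → i < b₁ → start (L i + 1) ≤ hi := fun i h0 h1 =>
    hT.start_le (hLs i h0 h1).2.1 hb
  -- The density test for a run leaves out the last of its `m + 1` blocks. Doubling the failed test
  -- gives `38 * v + 4 * z`, and the `28 * (hi - lo)` for the missing block is paid by `4 * (hi -
  -- lo) < s * (b₁ - b₀)` and `s ≤ z`, taken seven times: `4 + 7 = 11`.
  have hstep : ∀ c v z m : ℕ, 14 * (hi - lo) * m < (b₁ - b₀) * (19 * v + 2 * z) → s ≤ z →
      28 * (hi - lo) * (m + 1) ≤ (b₁ - b₀) * (38 * v + 11 * z) := by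
    intro c v z m h1 h2
    have h3 : s * (b₁ - b₀) ≤ (b₁ - b₀) * z := by rw [mul_comm]; exact Nat.mul_le_mul_left _ h2
    nlinarith
  -- The sum over the runs that ended before the current one. The lengths of the runs are measured
  -- by the large mass that their images cover, which is possible since every target is large; the
  -- sizes of the targets are measured by the large mass up to the current target.
  have key : ∀ j, b₀ + j < b₁ →
      28 * (hi - lo) * (r j - b₀) ≤ (b₁ - b₀) * (38 * (M (X (r j)) + o (r j) - M (lo + t)) +
        11 * (M (start (L (r j))) + o (r j))) ∧ M (lo + t) ≤ M (X (r j)) + o (r j) ∧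
      o (r j) = o (b₀ + j) := by
    intro j
    induction j with
    | zero =>
      intro hj
      have e : r 0 = b₀ := rfl
      have eo : o b₀ = 0 := by
        simp only [ho]
        rw [if_pos]
        omega
      have eX : X b₀ = lo + t := by
        simp only [hX, landing]
        rw [if_pos (by omega)]
      rw [e, eo, eX]
      simp [eo]
    | succ j ih =>
      intro hj
      obtain ⟨ih1, ih2, ih3⟩ := ih (by omega)
      have hrj := runStart_le blk start b₀ b₁ t j
      have hspec := runStart_spec hT hb ht.le (show b₀ + j < b₁ by omega)
      have hf := hfail j (by omega)
      rw [← hr] at hrj hspec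
      have hXi : X (r j) + start (b₀ + j) = X (b₀ + j) + start (r j) := hspec.1
      have hLi : L (r j) = L (b₀ + j) := hspec.2
      by_cases hc : X (r j) + start (b₀ + (j + 1)) = X (b₀ + (j + 1)) + start (r j) ∧
          X (b₀ + (j + 1)) < start (L (r j) + 1)
      · have er : r (j + 1) = r j := by
          rw [hr, runStart]
          exact if_pos hc
        rw [er]
        refine ⟨ih1, ih2, ?_⟩
        have hc1 := hc.1
        simp only [hX, landing] at hc1
        simp only [ho]
        have h1 := hst (r j) (by omega) (by omega)
        have h2 := hst (b₀ + (j + 1)) (by omega) (by omega)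
        split_ifs at hc1 ⊢ <;> omega
      · have er : r (j + 1) = b₀ + (j + 1) := by
          rw [hr, runStart]
          exact if_neg hc
        rw [er]
        set i := b₀ + j with hi_def
        have hii : b₀ + (j + 1) = i + 1 := by omega
        rw [hii] at hc ⊢
        have hi1 := hst (i + 1) (by omega) (by omega)
        have hi0 := hst i (by omega) (by omega)
        have hlt := hT.start_lt i (by omega)
        have hL1 := hLs (i + 1) (by omega) (by omega)
        have hL0 := hLs i (by omega) (by omega)
        have hM0 := hMX i (by omega) (by omega)
        have hM1 := hMX (i + 1) (by omega) (by omega)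
        have hr0 := hT.start_le (show r j ≤ i by omega) (by omega)
        have hMr := hMX (r j) (by omega) (by omega)
        have hLr := hLs (r j) (by omega) (by omega)
        rw [hLi] at hMr hLr
        -- A new run has either a new target further to the right, or it begins because the shift
        -- goes round, and then `o` increases. In both cases the old target is counted completely
        -- before the new one begins.
        have hend : M (start (L i + 1)) + o i ≤ M (start (L (i + 1))) + o (i + 1) := by
          by_cases hw : start i + t < hi
          · by_cases hw' : start (i + 1) + t < hi
            · have e1 : X i = start i + t := by simp only [hX, landing]; rw [if_pos hw]
              have e2 : X (i + 1) = start (i + 1) + t := by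
                simp only [hX, landing]; rw [if_pos hw']
              have e3 : start (L i + 1) ≤ X (i + 1) := by
                rw [hLi] at hc
                by_contra hcc
                exact hc ⟨by omega, by omega⟩
              have e4 : L i < L (i + 1) := by
                have := hT.lt_of_start_lt (i := L i + 1) (j := L (i + 1) + 1) (by omega) (by omega)
                omega
              have e5 := hT.start_le (show L i + 1 ≤ L (i + 1) by omega) (by omega)
              have e6 : M (start (L i + 1)) ≤ M (start (L (i + 1))) := bigMass_mono _ _ _ _ e5
              have e7 : o i = 0 := by simp only [ho]; rw [if_pos hw]
              omega
            · have e7 : o i = 0 := by simp only [ho]; rw [if_pos hw]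
              have e8 : o (i + 1) = M hi := by simp only [ho]; rw [if_neg hw']
              have e9 : M (start (L i + 1)) ≤ M hi :=
                bigMass_mono _ _ _ _ (hLend i (by omega) (by omega))
              omega
          · have hw' : ¬ start (i + 1) + t < hi := by omega
            have e1 : X i = start i + t - (hi - lo) := by
              simp only [hX, landing]; rw [if_neg hw]
            have e2 : X (i + 1) = start (i + 1) + t - (hi - lo) := by
              simp only [hX, landing]; rw [if_neg hw']
            have e3 : start (L i + 1) ≤ X (i + 1) := by
              rw [hLi] at hc
              by_contra hcc
              exact hc ⟨by omega, by omega⟩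
            have e4 : L i < L (i + 1) := by
              have := hT.lt_of_start_lt (i := L i + 1) (j := L (i + 1) + 1) (by omega) (by omega)
              omega
            have e5 := hT.start_le (show L i + 1 ≤ L (i + 1) by omega) (by omega)
            have e6 : M (start (L i + 1)) ≤ M (start (L (i + 1))) := bigMass_mono _ _ _ _ e5
            have e7 : o i = M hi := by simp only [ho]; rw [if_neg hw]
            have e8 : o (i + 1) = M hi := by simp only [ho]; rw [if_neg hw']
            omega
        have hbound := hstep 0 _ _ _ hf (hs i (by omega) (by omega))
        refine ⟨?_, by omega, rfl⟩
        have e1 : i + 1 - b₀ = (r j - b₀) + (i - r j + 1) := by omega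
        rw [e1, mul_add]
        refine (add_le_add ih1 hbound).trans ?_
        rw [← mul_add]
        refine Nat.mul_le_mul_left _ ?_
        change _ + (38 * (start i - start (r j)) + 11 * (start (L i + 1) - start (L i))) ≤ _
        rw [hLi]
        omega
  obtain ⟨j, hj⟩ : ∃ j, b₁ = b₀ + j + 1 := ⟨b₁ - b₀ - 1, by omega⟩
  obtain ⟨k1, k2, k3⟩ := key j (by omega)
  have hrj := runStart_le blk start b₀ b₁ t j
  have hspec := runStart_spec hT hb ht.le (show b₀ + j < b₁ by omega)
  have hf := hfail j (by omega)
  rw [← hr] at hrj hspec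
  have hXi : X (r j) + start (b₀ + j) = X (b₀ + j) + start (r j) := hspec.1
  have hLi : L (r j) = L (b₀ + j) := hspec.2
  have hbound := hstep 0 _ _ _ hf (hs (b₀ + j) (by omega) (by omega))
  have hMr := hMX (r j) (by omega) (by omega)
  have hMi := hMX (b₀ + j) (by omega) (by omega)
  have hLr := hLs (b₀ + j) (by omega) (by omega)
  have hLr' := hLs (r j) (by omega) (by omega)
  have hr0 := hT.start_le (show r j ≤ b₀ + j by omega) (by omega)
  have hend : M (start (L (b₀ + j) + 1)) ≤ M hi :=
    bigMass_mono _ _ _ _ (hLend (b₀ + j) (by omega) (by omega))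
  have hoM : o (b₀ + j) ≤ M hi := by
    simp only [ho]
    split_ifs <;> omega
  -- The images start at `lo + t` and do not return to it, so together they cover the large mass at
  -- most once.
  have hXo : M (X (b₀ + j)) + o (b₀ + j) ≤ M (lo + t) + M hi := by
    have h1 := hst (b₀ + j) (by omega) (by omega)
    by_cases hw : start (b₀ + j) + t < hi
    · have e7 : o (b₀ + j) = 0 := by simp only [ho]; rw [if_pos hw]
      have e8 : M (X (b₀ + j)) ≤ M hi :=
        bigMass_mono _ _ _ _ (hXm (b₀ + j) (by omega) (by omega)).2.le
      omega
    · have e7 : o (b₀ + j) = M hi := by simp only [ho]; rw [if_neg hw]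
      have e8 : M (X (b₀ + j)) ≤ M (lo + t) := by
        refine bigMass_mono _ _ _ _ ?_
        simp only [hX, landing]
        rw [if_neg hw]
        omega
      omega
  -- The images of the runs are disjoint, but a block can be a target twice, before and after the
  -- shift goes round; hence `38 + 2 * 11 = 60`.
  have hfin : 28 * (hi - lo) * (b₁ - b₀) ≤ (b₁ - b₀) * (60 * M hi) := by
    have e1 : b₁ - b₀ = (r j - b₀) + (b₀ + j - r j + 1) := by omega
    calc 28 * (hi - lo) * (b₁ - b₀)
        = 28 * (hi - lo) * (r j - b₀) + 28 * (hi - lo) * (b₀ + j - r j + 1) := by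
          rw [← mul_add, ← e1]
      _ ≤ _ := add_le_add k1 hbound
      _ = (b₁ - b₀) * _ := (mul_add _ _ _).symm
      _ ≤ _ := by
        refine Nat.mul_le_mul_left _ ?_
        change _ + (38 * (start (b₀ + j) - start (r j)) +
          11 * (start (L (b₀ + j) + 1) - start (L (b₀ + j)))) ≤ _
        rw [hLi] at hMr hLr' ⊢
        omega
  rw [mul_comm] at hfin
  exact Nat.le_of_mul_le_mul_left hfin (by omega)

/-- The first block of the run of blocks smaller than `s` that ends just before the block
`b₀ + j`. -/
def clusterStart (start : ℕ → ℕ) (s b₀ : ℕ) : ℕ → ℕ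
  | 0 => b₀
  | j + 1 => if start (b₀ + j + 1) - start (b₀ + j) < s then clusterStart start s b₀ j
      else b₀ + j + 1

theorem clusterStart_le (start : ℕ → ℕ) (s b₀ j : ℕ) :
    b₀ ≤ clusterStart start s b₀ j ∧ clusterStart start s b₀ j ≤ b₀ + j := by
  induction j with
  | zero => simp [clusterStart]
  | succ j ih =>
    rw [clusterStart]
    split_ifs <;> omega

/-- A large block closes a cluster of `b` blocks with `y` vertices. Both the block itself and the
summand `2 * s` in the failed test of the cluster are charged to the increase of `v`, the number of
large blocks. -/
theorem cluster_step {u Z s a b x y v : ℕ} (h1 : 14 * u * a ≤ 14 * u * v + Z * (19 * x + 2 * s * v))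
    (h2 : 14 * u * b ≤ Z * (19 * y + 2 * s)) (_h3 : 4 * u ≤ Z * s) :
    14 * u * (a + b + 1) ≤ 14 * u * (v + 1) + Z * (19 * (x + y) + 2 * s * (v + 1)) := by
  have e1 : 14 * u * (a + b + 1) = 14 * u * a + 14 * u * b + 14 * u := by ring
  have e2 : 14 * u * (v + 1) + Z * (19 * (x + y) + 2 * s * (v + 1)) =
    14 * u * v + Z * (19 * x + 2 * s * v) + Z * (19 * y + 2 * s) + 14 * u := by ring
  omega

/-- After doubling, `28 * u * v ≤ 7 * Z * s * v` by `hs`, and `4 * s * v + 4 * s ≤ 8 * s * v` by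
`hv`; with `s * v ≤ m` this makes `7 + 8 = 15` times `m`. -/
theorem cluster_bound {u Z s v w m : ℕ} (hZ : 0 < Z) (hs : 4 * u ≤ Z * s) (hv : 1 ≤ v)
    (hm : s * v ≤ m) (h : 14 * u * Z ≤ 14 * u * v + Z * (19 * w + 2 * s * v + 2 * s)) :
    28 * u ≤ 38 * w + 15 * m := by
  refine Nat.le_of_mul_le_mul_left ?_ hZ
  have h1 : 4 * u * v ≤ Z * s * v := Nat.mul_le_mul_right _ hs
  have h2 : Z * s * 1 ≤ Z * s * v := Nat.mul_le_mul_left _ hv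
  have h3 : Z * (s * v) ≤ Z * m := Nat.mul_le_mul_left _ hm
  have e1 : 14 * u * Z = 14 * (Z * u) := by ring
  have e2 : 14 * u * v + Z * (19 * w + 2 * s * v + 2 * s) =
    14 * (u * v) + 19 * (Z * w) + 2 * (Z * s * v) + 2 * (Z * s) := by ring
  have e3 : 4 * u * v = 4 * (u * v) := by ring
  have e4 : Z * (s * v) = Z * s * v := by ring
  have e5 : Z * (28 * u) = 28 * (Z * u) := by ring
  have e6 : Z * (38 * w + 15 * m) = 38 * (Z * w) + 15 * (Z * m) := by ring
  omega

/-- If no window of small blocks is dense, then most of the vertices are in small blocks. -/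
theorem bigMass_le_of_clusters (hT : Blocks n N par blk start) (hb : b₁ ≤ N) (hb' : b₀ < b₁)
    (hsN : 4 * (start b₁ - start b₀) < s * (b₁ - b₀))
    (hbig : ∃ i, b₀ ≤ i ∧ i < b₁ ∧ s ≤ start (i + 1) - start i)
    (hfail : ∀ j, b₀ + j < b₁ → start (b₀ + j + 1) - start (b₀ + j) < s →
      14 * (start b₁ - start b₀) * (b₀ + j + 1 - clusterStart start s b₀ j) <
        (b₁ - b₀) * (19 * (start (b₀ + j + 1) - start (clusterStart start s b₀ j)) + 2 * s)) :
    23 * bigMass blk start s (start b₀) (start b₁) ≤ 10 * (start b₁ - start b₀) := by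
  set lo := start b₀ with hlo
  set hi := start b₁ with hhi
  set M := bigMass blk start s lo with hM
  set c := clusterStart start s b₀ with hc
  set nb := bigCount start s b₀ with hnb
  have hnbs : ∀ i, b₀ ≤ i → nb (i + 1) = nb i + if s ≤ start (i + 1) - start i then 1 else 0 :=
    fun i h0 => Finset.sum_Ico_succ_top h0 _
  -- The sum over the clusters that have been closed, where `c j` is the beginning of the open one.
  -- The open cluster contains no large block, which is the second claim; the third makes the failed
  -- test for its last block available when it is closed.
  have key : ∀ j, b₀ + j ≤ b₁ →
      14 * (hi - lo) * (c j - b₀) ≤ 14 * (hi - lo) * nb (b₀ + j) +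
        (b₁ - b₀) * (19 * (start (c j) - lo - M (start (c j))) + 2 * s * nb (b₀ + j)) ∧
      M (start (b₀ + j)) = M (start (c j)) ∧ (c j < b₀ + j →
        start (b₀ + j) - start (b₀ + j - 1) < s ∧ c (j - 1) = c j) := by
    intro j
    induction j with
    | zero =>
      intro _
      have e : c 0 = b₀ := rfl
      rw [e]
      simp
    | succ j ih =>
      intro hj
      obtain ⟨ih1, ih2, ih3⟩ := ih (by omega)
      have hcj := clusterStart_le start s b₀ j
      rw [← hc] at hcj
      by_cases hsm : start (b₀ + j + 1) - start (b₀ + j) < s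
      · have e : c (j + 1) = c j := by
          rw [hc, clusterStart, if_pos hsm]
        have e1 : nb (b₀ + (j + 1)) = nb (b₀ + j) := by
          rw [← add_assoc, hnbs _ (by omega), if_neg (by omega)]
          rfl
        rw [e, e1]
        refine ⟨ih1, ?_, fun _ => ⟨?_, ?_⟩⟩
        · rw [← ih2, ← add_assoc]
          exact bigMass_of_small hT hb (by omega) (by omega) hsm
        · exact hsm
        · rfl
      · have e : c (j + 1) = b₀ + j + 1 := by
          rw [hc, clusterStart, if_neg hsm]
        have e1 : nb (b₀ + (j + 1)) = nb (b₀ + j) + 1 := by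
          rw [← add_assoc, hnbs _ (by omega), if_pos (by omega)]
        rw [e, e1]
        refine ⟨?_, by rw [← add_assoc], fun h => absurd h (by omega)⟩
        have hM1 : M (start (b₀ + j + 1)) = M (start (b₀ + j)) +
            (start (b₀ + j + 1) - start (b₀ + j)) :=
          bigMass_of_big hT hb (by omega) (by omega) (by omega)
            (hT.start_lt _ (by omega)).le le_rfl
        have hst := hT.start_le hcj.2 (by omega)
        have hst' := hT.start_le hcj.1 (by omega)
        have hlt := hT.start_lt (b₀ + j) (by omega)
        have hMle : M (start (c j)) ≤ start (c j) - lo := bigMass_le _ _ _ _ _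
        have e3 : start (b₀ + j + 1) - lo - M (start (b₀ + j + 1)) =
            (start (c j) - lo - M (start (c j))) + (start (b₀ + j) - start (c j)) := by
          omega
        have e4 : b₀ + j + 1 - b₀ = (c j - b₀) + (b₀ + j - c j) + 1 := by omega
        have hadd : 14 * (hi - lo) * (b₀ + j - c j) ≤
            (b₁ - b₀) * (19 * (start (b₀ + j) - start (c j)) + 2 * s) := by
          rcases hcj.2.eq_or_lt with h | h
          · rw [show b₀ + j - c j = 0 by omega, mul_zero]
            exact Nat.zero_le _
          · obtain ⟨g1, g2⟩ := ih3 h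
            obtain ⟨j', rfl⟩ : ∃ j', j = j' + 1 := ⟨j - 1, by omega⟩
            have hf := hfail j' (by omega) g1
            simp only [Nat.add_sub_cancel] at g2
            rw [g2] at hf
            exact hf.le
        rw [e3, e4]
        exact cluster_step ih1 hadd (by rw [mul_comm (_ - _) s]; exact hsN.le)
  obtain ⟨j, hj⟩ : ∃ j, b₁ = b₀ + j + 1 := ⟨b₁ - b₀ - 1, by omega⟩
  obtain ⟨k1, k2, k3⟩ := key (j + 1) (by omega)
  have hcj := clusterStart_le start s b₀ (j + 1)
  rw [← hc] at hcj
  have eb : b₀ + (j + 1) = b₁ := by omega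
  rw [eb] at k1 k2 k3 hcj
  have hst := hT.start_le hcj.2 (by omega)
  have hst' := hT.start_le hcj.1 (by omega)
  have hadd : 14 * (hi - lo) * (b₁ - c (j + 1)) ≤
      (b₁ - b₀) * (19 * (hi - start (c (j + 1))) + 2 * s) := by
    rcases hcj.2.eq_or_lt with h | h
    · rw [show b₁ - c (j + 1) = 0 by omega, mul_zero]
      exact Nat.zero_le _
    · obtain ⟨g1, g2⟩ := k3 h
      have hf := hfail j (by omega) (by rw [show b₀ + j + 1 = b₁ by omega,
        show b₀ + j = b₁ - 1 by omega]; exact g1)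
      simp only [Nat.add_sub_cancel] at g2
      rw [g2, show b₀ + j + 1 = b₁ by omega] at hf
      exact hf.le
  have hnb1 : 1 ≤ nb b₁ := by
    obtain ⟨i, h1, h2, h3⟩ := hbig
    rw [hnb, bigCount]
    refine le_trans ?_ (Finset.single_le_sum (f := fun j => if s ≤ start (j + 1) - start j then 1
      else 0) (fun _ _ => Nat.zero_le _) (Finset.mem_Ico.2 ⟨h1, h2⟩))
    simp [h3]
  have hsnb : s * nb b₁ ≤ M hi := mul_bigCount_le hT hb hb'.le le_rfl
  have hMhi : M hi ≤ hi - lo := bigMass_le _ _ _ _ _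
  have hMle : M (start (c (j + 1))) ≤ start (c (j + 1)) - lo := bigMass_le _ _ _ _ _
  have hpos : 0 < b₁ - b₀ := by omega
  set Z := b₁ - b₀ with hZ
  set u := hi - lo with hu
  set m := M hi with hm
  set v := nb b₁ with hv
  -- No large block follows the last cluster, so there is one summand `2 * s` more than there are
  -- large blocks.
  have e1 : 14 * u * Z ≤ 14 * u * v + Z * (19 * (u - m) + 2 * s * v + 2 * s) := by
    have e2 : Z = (c (j + 1) - b₀) + (b₁ - c (j + 1)) := by omega
    have e3 : u - m = (start (c (j + 1)) - lo - M (start (c (j + 1)))) +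
        (hi - start (c (j + 1))) := by omega
    calc 14 * u * Z = 14 * u * (c (j + 1) - b₀) + 14 * u * (b₁ - c (j + 1)) := by
          rw [← mul_add, ← e2]
      _ ≤ _ := add_le_add k1 hadd
      _ = _ := by rw [e3]; ring
  have e6 := cluster_bound hpos (by rw [mul_comm Z s]; exact hsN.le) hnb1 hsnb e1
  omega

end Shift


/-! ### The search for a window that can be refined -/

/-- The window of the blocks from `z₀` to `z₁`, together with the cyclic shift of the block `a`
that ends in the block `l`, reduces the task of cutting off `t` vertices to a smaller one. -/
structure Refinement (blk start : ℕ → ℕ) (b₀ b₁ t z₀ z₁ a l : ℕ) : Prop where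
  le_left : b₀ ≤ z₀
  lt : z₀ < z₁
  le_right : z₁ ≤ b₁
  le_source : b₀ ≤ a
  source_lt : a < b₁
  target_eq : l = blk (landing (start b₀) (start b₁) t (start a))
  target : l < z₀ ∨ z₁ ≤ l
  dense : (b₁ - b₀) * (19 * (start z₁ - start z₀) + 2 * (start (l + 1) - start l)) ≤
    14 * (start b₁ - start b₀) * (z₁ - z₀)

/-- Among the blocks from `b₀` to `i`, the block `a` is one for which the size `s` of the block `l` to
which it is shifted is minimal. -/
structure MinTarget (blk start : ℕ → ℕ) (b₀ b₁ t i s a l : ℕ) : Prop where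
  le_source : b₀ ≤ a
  source_lt : a < i
  target_eq : l = blk (landing (start b₀) (start b₁) t (start a))
  size_eq : s = start (l + 1) - start l
  le_size : ∀ j, b₀ ≤ j → j < i →
    s ≤ start (blk (landing (start b₀) (start b₁) t (start j)) + 1) -
      start (blk (landing (start b₀) (start b₁) t (start j)))

section

variable {n N : ℕ} {par blk start : ℕ → ℕ} {b₀ b₁ t : ℕ}

theorem Blocks.landing_spec (hT : Blocks n N par blk start) (hb : b₁ ≤ N)
    (ht : t ≤ start b₁ - start b₀) {i : ℕ} (h0 : b₀ ≤ i) (h1 : i < b₁) :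
    start b₀ ≤ start i ∧ start i < start b₁ ∧
    start b₀ ≤ landing (start b₀) (start b₁) t (start i) ∧
    landing (start b₀) (start b₁) t (start i) < start b₁ ∧
    b₀ ≤ blk (landing (start b₀) (start b₁) t (start i)) ∧
    blk (landing (start b₀) (start b₁) t (start i)) < b₁ ∧
    start (blk (landing (start b₀) (start b₁) t (start i))) ≤
      landing (start b₀) (start b₁) t (start i) ∧
    landing (start b₀) (start b₁) t (start i) <
      start (blk (landing (start b₀) (start b₁) t (start i)) + 1) := by
  have h2 := hT.start_le h0 (by omega)
  have h3 := hT.start_lt i (by omega)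
  have h4 := hT.start_le (show i + 1 ≤ b₁ by omega) hb
  have h5 := landing_mem (t := t) h2 (show start i < start b₁ by omega) ht
  have h6 := hT.blk_between hb (by omega) h5.1 h5.2
  have h7 := hT.blk_spec (lt_of_lt_of_le h5.2 (hT.start_le_n hb))
  exact ⟨h2, by omega, h5.1, h5.2, h6.1, h6.2, h7.2.1, h7.2.2⟩

/-- All starts from the beginning of the run to `start (b₀ + j)` land in the same block. That block
is thus longer than the distance of these starts, and cannot lie between them. To have this, the
window must exclude the last block of the run. -/
theorem Refinement.of_run (hT : Blocks n N par blk start) (hb : b₁ ≤ N)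
    (ht : t ≤ start b₁ - start b₀) {j : ℕ} (hj : b₀ + j < b₁)
    (h : ¬ 14 * (start b₁ - start b₀) * (b₀ + j - runStart blk start b₀ b₁ t j) <
        (b₁ - b₀) * (19 * (start (b₀ + j) - start (runStart blk start b₀ b₁ t j)) +
          2 * (start (blk (landing (start b₀) (start b₁) t (start (b₀ + j))) + 1) -
            start (blk (landing (start b₀) (start b₁) t (start (b₀ + j))))))) :
    Refinement blk start b₀ b₁ t (runStart blk start b₀ b₁ t j) (b₀ + j)
      (runStart blk start b₀ b₁ t j) (blk (landing (start b₀) (start b₁) t (start (b₀ + j)))) := by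
  have hr := runStart_le blk start b₀ b₁ t j
  have hs := runStart_spec hT hb ht hj
  have h1 := hT.landing_spec hb ht (show b₀ ≤ b₀ + j by omega) hj
  have h2 := hT.landing_spec hb ht hr.1 (by omega)
  set r := runStart blk start b₀ b₁ t j
  set x := landing (start b₀) (start b₁) t (start (b₀ + j))
  set x' := landing (start b₀) (start b₁) t (start r)
  have hrs := hT.start_le hr.2 (by omega)
  rw [hs.2] at h2
  refine ⟨hr.1, ?_, by omega, hr.1, by omega, hs.2.symm, ?_, not_lt.1 h⟩
  -- An empty window always fails the test, because targets are nonempty.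
  · refine lt_of_le_of_ne hr.2 fun he => h ?_
    rw [he, Nat.sub_self, mul_zero]
    exact Nat.mul_pos (by omega) (by omega)
  · by_contra hc
    have h3 := hT.start_le (show r ≤ blk x by omega) (by omega)
    have h4 := hT.start_le (show blk x + 1 ≤ b₀ + j by omega) (by omega)
    omega

theorem clusterStart_small {start : ℕ → ℕ} {b₀ s j : ℕ} : ∀ i,
    clusterStart start s b₀ j ≤ i → i < b₀ + j →
    start (i + 1) - start i < s := by
  induction j with
  | zero =>
    intro i h1 h2
    simp only [clusterStart] at h1
    omega
  | succ j ih =>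
    intro i h1 h2
    rw [clusterStart] at h1
    split_ifs at h1 with h
    · rcases Nat.lt_succ_iff_lt_or_eq.1 (show i < b₀ + j + 1 by omega) with h' | rfl
      · exact ih i h1 h'
      · exact h
    · omega

/-- Every block of the cluster is smaller than `s`, while the target `l` has size exactly `s`; so
the window avoids it. The cyclic interval can always be the one with the smallest target, which is
independent of the cluster. -/
theorem Refinement.of_cluster {s a l j : ℕ} (hm : MinTarget blk start b₀ b₁ t b₁ s a l)
    (hj : b₀ + j < b₁) (hs : start (b₀ + j + 1) - start (b₀ + j) < s)
    (h : ¬ 14 * (start b₁ - start b₀) * (b₀ + j + 1 - clusterStart start s b₀ j) <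
        (b₁ - b₀) * (19 * (start (b₀ + j + 1) - start (clusterStart start s b₀ j)) + 2 * s)) :
    Refinement blk start b₀ b₁ t (clusterStart start s b₀ j) (b₀ + j + 1) a l := by
  have hr := clusterStart_le start s b₀ j
  refine ⟨hr.1, by omega, by omega, hm.le_source, hm.source_lt, hm.target_eq, ?_, ?_⟩
  · by_contra hc
    have := hm.size_eq
    by_cases hl : l < b₀ + j
    · have := clusterStart_small (start := start) (b₀ := b₀) (s := s) (j := j) l (by omega) hl
      omega
    · obtain rfl : l = b₀ + j := by omega
      omega
  · rw [← hm.size_eq]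
    exact not_lt.1 h

theorem MinTarget.keep {i s a l : ℕ} (h : MinTarget blk start b₀ b₁ t i s a l)
    (hs : s ≤ start (blk (landing (start b₀) (start b₁) t (start i)) + 1) -
      start (blk (landing (start b₀) (start b₁) t (start i)))) :
    MinTarget blk start b₀ b₁ t (i + 1) s a l := by
  refine ⟨h.le_source, h.source_lt.trans i.lt_succ_self, h.target_eq, h.size_eq, fun j h0 h1 => ?_⟩
  rcases Nat.lt_succ_iff_lt_or_eq.1 h1 with h' | rfl
  exacts [h.le_size j h0 h', hs]

theorem MinTarget.replace {i s a l s' l' : ℕ} (h : MinTarget blk start b₀ b₁ t i s a l)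
    (hl : l' = blk (landing (start b₀) (start b₁) t (start i)))
    (hs' : s' = start (l' + 1) - start l') (hs : s' < s) :
    MinTarget blk start b₀ b₁ t (i + 1) s' i l' := by
  refine ⟨h.le_source.trans h.source_lt.le, i.lt_succ_self, hl, hs', fun j h0 h1 => ?_⟩
  rcases Nat.lt_succ_iff_lt_or_eq.1 h1 with h' | rfl
  exacts [hs.le.trans (h.le_size j h0 h'), by rw [hs', hl]]

/-- One of the two searches is successful. -/
theorem exists_dense_window {s a l : ℕ} (hT : Blocks n N par blk start) (hb : b₁ ≤ N)
    (hb' : b₀ < b₁) (ht : t < start b₁ - start b₀) (hm : MinTarget blk start b₀ b₁ t b₁ s a l)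
    (hsN : 4 * (start b₁ - start b₀) < s * (b₁ - b₀))
    (h1 : ∀ j, b₀ + j < b₁ →
      14 * (start b₁ - start b₀) * (b₀ + j - runStart blk start b₀ b₁ t j) <
        (b₁ - b₀) * (19 * (start (b₀ + j) - start (runStart blk start b₀ b₁ t j)) +
          2 * (start (blk (landing (start b₀) (start b₁) t (start (b₀ + j))) + 1) -
            start (blk (landing (start b₀) (start b₁) t (start (b₀ + j)))))))
    (h2 : ∀ j, b₀ + j < b₁ → start (b₀ + j + 1) - start (b₀ + j) < s →
      14 * (start b₁ - start b₀) * (b₀ + j + 1 - clusterStart start s b₀ j) <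
        (b₁ - b₀) * (19 * (start (b₀ + j + 1) - start (clusterStart start s b₀ j)) + 2 * s)) :
    False := by
  have h3 := le_bigMass_of_runs hT hb hb' ht hm.le_size hsN h1
  have hl := hT.landing_spec hb ht.le hm.le_source hm.source_lt
  have h4 := bigMass_le_of_clusters hT hb hb' hsN ⟨l, by rw [hm.target_eq]; omega,
    by rw [hm.target_eq]; omega, hm.size_eq.le⟩ h2
  -- With `u` vertices of which `M` are in large blocks, `28 * u ≤ 60 * M` and `23 * M ≤ 10 * u`. As
  -- `28 * 23 = 644` and `60 * 10 = 600`, this forces `u = 0`.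
  omega

end

/-! ### The two searches as programs -/

namespace RAM

/-- Shift the start of the block in register `13`. -/
def landProg : Program :=
  35 ⟵ A 8 (R 13) +ₑ R 17 ;;
  Program.branch (R 35 <ₑ R 26) Program.skip (35 ⟵ R 35 -ₑ (R 26 -ₑ R 25)) ;;
  36 ⟵ A 7 (R 35) ;;
  43 ⟵ A 8 (R 36 +ₑ K 1) -ₑ A 8 (R 36)

/-- Begin a new run of blocks with the block in register `13`. -/
def newRun : Program := 32 ⟵ R 13 ;; 33 ⟵ R 35 ;; 34 ⟵ A 8 (R 36 +ₑ K 1)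

/-- The block in register `13` is shifted to the smallest block so far. -/
def newMin : Program := 28 ⟵ R 43 ;; 29 ⟵ R 13 ;; 30 ⟵ R 36

/-- Treat the block in register `13` in the search for a dense run. -/
def treatBlock : Program :=
  Program.branch (R 43 <ₑ R 28) newMin Program.skip ;;
  Program.branch (Test.and (R 33 +ₑ A 8 (R 13) =ₑ R 35 +ₑ A 8 (R 32)) (R 35 <ₑ R 34))
    Program.skip newRun ;;
  Program.branch (K 14 *ₑ (R 26 -ₑ R 25) *ₑ (R 13 -ₑ R 32) <ₑ
      (R 24 -ₑ R 23) *ₑ (K 19 *ₑ (A 8 (R 13) -ₑ A 8 (R 32)) +ₑ K 2 *ₑ R 43))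
    Program.skip
    (31 ⟵ K 1 ;; 37 ⟵ R 32 ;; 38 ⟵ R 13 ;; 39 ⟵ R 32 ;; 40 ⟵ R 36) ;;
  13 ⟵ R 13 +ₑ K 1

/-- Search for a dense run of blocks that are shifted to the same block. -/
def scanRuns : Program :=
  31 ⟵ K 0 ;; 13 ⟵ R 23 ;; landProg ;; newRun ;; newMin ;; 13 ⟵ R 13 +ₑ K 1 ;;
  Program.loop (R 13 <ₑ R 24)
    (landProg ;; treatBlock)

/-- Search for a dense cluster of small blocks. -/
def scanClusters : Program :=
  13 ⟵ R 23 ;; 32 ⟵ R 23 ;;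
  Program.loop (R 13 <ₑ R 24)
    (Program.branch (A 8 (R 13 +ₑ K 1) -ₑ A 8 (R 13) <ₑ R 28)
      (Program.branch (K 14 *ₑ (R 26 -ₑ R 25) *ₑ (R 13 +ₑ K 1 -ₑ R 32) <ₑ
          (R 24 -ₑ R 23) *ₑ (K 19 *ₑ (A 8 (R 13 +ₑ K 1) -ₑ A 8 (R 32)) +ₑ K 2 *ₑ R 28))
        Program.skip
        (31 ⟵ K 1 ;; 37 ⟵ R 32 ;; 38 ⟵ R 13 +ₑ K 1 ;; 39 ⟵ R 29 ;; 40 ⟵ R 30))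
      (32 ⟵ R 13 +ₑ K 1) ;;
    13 ⟵ R 13 +ₑ K 1)

/-- The machine is about to cut off a number of vertices of the blocks from `b₀` to `b₁`. -/
structure WindowState (n N : ℕ) (par blk start : ℕ → ℕ) (B b₀ b₁ t : ℕ) (σ : State) : Prop where
  blocks : Blocks n N par blk start
  lt : b₀ < b₁
  le : b₁ ≤ N
  t_le : t ≤ start b₁ - start b₀
  bound : 2 * n + 2 ≤ B
  arr_blk : σ.arr 7 = blk
  arr_start : σ.arr 8 = start
  reg_t : σ.reg 17 = t
  reg_left : σ.reg 23 = b₀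
  reg_right : σ.reg 24 = b₁
  reg_lo : σ.reg 25 = start b₀
  reg_hi : σ.reg 26 = start b₁

variable {n N : ℕ} {par blk start : ℕ → ℕ} {B b₀ b₁ t : ℕ} {σ : State}

theorem WindowState.le_bound (h : WindowState n N par blk start B b₀ b₁ t σ) {i : ℕ} (hi : i ≤ b₁) :
    2 * start i + 2 ≤ B ∧ 2 * i + 2 ≤ B := by
  have h1 := h.blocks.start_le_n (hi.trans h.le)
  have h2 := h.blocks.start_add_le (Nat.zero_le i) (hi.trans h.le)
  have h3 := h.bound
  omega

theorem runs_landProg (h : WindowState n N par blk start B b₀ b₁ t σ) (h0 : b₀ ≤ σ.reg 13)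
    (h1 : σ.reg 13 < b₁) :
    Runs B landProg σ fun m τ => m = 0 ∧
      τ.reg 35 = landing (start b₀) (start b₁) t (start (σ.reg 13)) ∧
      τ.reg 36 = blk (landing (start b₀) (start b₁) t (start (σ.reg 13))) ∧
      τ.reg 43 = start (blk (landing (start b₀) (start b₁) t (start (σ.reg 13))) + 1) -
        start (blk (landing (start b₀) (start b₁) t (start (σ.reg 13)))) := by
  have hl := h.blocks.landing_spec h.le h.t_le h0 h1
  have hb := h.le_bound le_rfl
  have hb1 := h.le_bound (show blk (landing (start b₀) (start b₁) t (start (σ.reg 13))) + 1 ≤ b₁ by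
    omega)
  have ht := h.t_le
  simp only [landProg, runs_seq, runs_assign, runs_branch, runs_skip, Test.Holds, Expr.val,
    State.setReg_reg, State.setReg_arr, if_true, Nat.reduceEqDiff, if_false, h.arr_blk, h.arr_start,
    h.reg_t, h.reg_lo, h.reg_hi, add_zero]
  refine ⟨by omega, fun hlt => ?_, fun hge => ⟨by omega, ?_⟩⟩
  · have e : landing (start b₀) (start b₁) t (start (σ.reg 13)) = start (σ.reg 13) + t := if_pos hlt
    rw [e] at hl hb1 ⊢
    exact ⟨by omega, by omega, trivial, rfl, rfl, rfl⟩
  · have e : landing (start b₀) (start b₁) t (start (σ.reg 13)) =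
      start (σ.reg 13) + t - (start b₁ - start b₀) := if_neg hge
    rw [e] at hl hb1 ⊢
    exact ⟨by omega, by omega, trivial, rfl, rfl, rfl⟩

theorem WindowState.of_same {p : Program} {τ : State}
    (h : WindowState n N par blk start B b₀ b₁ t σ)
    (hs : Same p σ τ) (h7 : p.writesArr 7 = false) (h8 : p.writesArr 8 = false)
    (h17 : p.writesReg 17 = false) (h23 : p.writesReg 23 = false) (h24 : p.writesReg 24 = false)
    (h25 : p.writesReg 25 = false) (h26 : p.writesReg 26 = false) :
    WindowState n N par blk start B b₀ b₁ t τ :=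
  ⟨h.blocks, h.lt, h.le, h.t_le, h.bound, (hs.arr 7 h7).trans h.arr_blk,
    (hs.arr 8 h8).trans h.arr_start, (hs.reg 17 h17).trans h.reg_t,
    (hs.reg 23 h23).trans h.reg_left, (hs.reg 24 h24).trans h.reg_right,
    (hs.reg 25 h25).trans h.reg_lo, (hs.reg 26 h26).trans h.reg_hi⟩

/-- What is known after the runs up to the block `b₀ + j` have been searched. -/
structure RunsInv (blk start : ℕ → ℕ) (b₀ b₁ t j : ℕ) (τ : State) : Prop where
  lt : b₀ + j < b₁
  reg_next : τ.reg 13 = b₀ + j + 1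
  reg_run : τ.reg 32 = runStart blk start b₀ b₁ t j
  reg_land : τ.reg 33 = landing (start b₀) (start b₁) t (start (runStart blk start b₀ b₁ t j))
  reg_end : τ.reg 34 =
    start (blk (landing (start b₀) (start b₁) t (start (runStart blk start b₀ b₁ t j))) + 1)
  min : MinTarget blk start b₀ b₁ t (b₀ + j + 1) (τ.reg 28) (τ.reg 29) (τ.reg 30)
  not_found : τ.reg 31 = 0 → ∀ i ≤ j,
    14 * (start b₁ - start b₀) * (b₀ + i - runStart blk start b₀ b₁ t i) <
      (b₁ - b₀) * (19 * (start (b₀ + i) - start (runStart blk start b₀ b₁ t i)) +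
        2 * (start (blk (landing (start b₀) (start b₁) t (start (b₀ + i))) + 1) -
          start (blk (landing (start b₀) (start b₁) t (start (b₀ + i))))))
  found : τ.reg 31 ≠ 0 →
    Refinement blk start b₀ b₁ t (τ.reg 37) (τ.reg 38) (τ.reg 39) (τ.reg 40)

theorem runs_treatBlock {j : ℕ} (h : WindowState n N par blk start B b₀ b₁ t σ)
    (hI : RunsInv blk start b₀ b₁ t j σ) (hj : b₀ + j + 1 < b₁)
    (h35 : σ.reg 35 = landing (start b₀) (start b₁) t (start (b₀ + j + 1)))
    (h36 : σ.reg 36 = blk (landing (start b₀) (start b₁) t (start (b₀ + j + 1))))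
    (h43 : σ.reg 43 = start (blk (landing (start b₀) (start b₁) t (start (b₀ + j + 1))) + 1) -
        start (blk (landing (start b₀) (start b₁) t (start (b₀ + j + 1))))) :
    Runs B treatBlock σ fun m τ => m = 0 ∧ RunsInv blk start b₀ b₁ t (j + 1) τ := by
  have hT := h.blocks
  have hl := hT.landing_spec h.le h.t_le (show b₀ ≤ b₀ + j + 1 by omega) hj
  have hb0 := h.le_bound (show b₀ + j + 1 + 1 ≤ b₁ by omega)
  have hb1 := h.le_bound le_rfl
  have hbl := h.le_bound (show blk (landing (start b₀) (start b₁) t (start (b₀ + j + 1))) + 1 ≤ b₁ by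
    omega)
  have hr := runStart_le blk start b₀ b₁ t j
  have hr1 := runStart_le blk start b₀ b₁ t (j + 1)
  have hlr := hT.landing_spec h.le h.t_le hr1.1 (by omega)
  rw [treatBlock, runs_seq]
  have hmin : Runs B (Program.branch (R 43 <ₑ R 28) newMin Program.skip) σ fun m τ =>
      m = 0 ∧ MinTarget blk start b₀ b₁ t (b₀ + j + 1 + 1) (τ.reg 28) (τ.reg 29) (τ.reg 30) := by
    simp only [newMin, runs_seq, runs_assign, runs_branch, runs_skip, Test.Holds, Expr.val,
      State.setReg_reg, if_true, Nat.reduceEqDiff, if_false, add_zero, true_and]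
    refine ⟨fun hlt => ⟨by omega, by rw [hI.reg_next]; omega, by omega, ?_⟩, fun hge => ?_⟩
    · rw [hI.reg_next]
      exact hI.min.replace h36 (by rw [h43, h36]) hlt
    · exact hI.min.keep (by rw [← h43]; omega)
  refine hmin.mono fun m τ hs hq => ?_
  obtain ⟨rfl, hmin'⟩ := hq
  have g13 : τ.reg 13 = b₀ + j + 1 := (hs.reg 13 rfl).trans hI.reg_next
  have g35 := (hs.reg 35 rfl).trans h35
  have g36 := (hs.reg 36 rfl).trans h36
  have g33 := (hs.reg 33 rfl).trans hI.reg_land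
  have g34 := (hs.reg 34 rfl).trans hI.reg_end
  have g32 := (hs.reg 32 rfl).trans hI.reg_run
  have g43 := (hs.reg 43 rfl).trans h43
  have hτ := h.of_same hs rfl rfl rfl rfl rfl rfl rfl
  rw [runs_seq]
  have hrun : Runs B (Program.branch
      (Test.and (R 33 +ₑ A 8 (R 13) =ₑ R 35 +ₑ A 8 (R 32)) (R 35 <ₑ R 34))
      Program.skip newRun) τ fun m ρ => m = 0 ∧ ρ.reg 32 = runStart blk start b₀ b₁ t (j + 1) ∧
        ρ.reg 33 = landing (start b₀) (start b₁) t (start (runStart blk start b₀ b₁ t (j + 1))) ∧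
        ρ.reg 34 = start (blk (landing (start b₀) (start b₁) t
          (start (runStart blk start b₀ b₁ t (j + 1)))) + 1) := by
    simp only [newRun, runs_seq, runs_assign, runs_branch, runs_skip, Test.Holds, Expr.val,
      State.setReg_reg, State.setReg_arr, Nat.reduceEqDiff, if_false, add_zero, true_and,
      g13, g35, g36, g33, g34, g32, hτ.arr_start]
    constructor
    · intro hc
      have e : runStart blk start b₀ b₁ t (j + 1) = runStart blk start b₀ b₁ t j := if_pos hc
      rw [e]
      exact ⟨rfl, rfl, rfl⟩
    · intro hc
      have e : runStart blk start b₀ b₁ t (j + 1) = b₀ + j + 1 := if_neg hc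
      rw [e]
      exact ⟨by omega, by omega, by omega, rfl, rfl, rfl⟩
  refine hrun.mono fun m ρ hs' hq => ?_
  obtain ⟨rfl, f32, f33, f34⟩ := hq
  have f13 := (hs'.reg 13 rfl).trans g13
  have f36 := (hs'.reg 36 rfl).trans g36
  have f43 := (hs'.reg 43 rfl).trans g43
  have f31 : ρ.reg 31 = σ.reg 31 := (hs'.reg 31 rfl).trans (hs.reg 31 rfl)
  have f37 : ρ.reg 37 = σ.reg 37 := (hs'.reg 37 rfl).trans (hs.reg 37 rfl)
  have f38 : ρ.reg 38 = σ.reg 38 := (hs'.reg 38 rfl).trans (hs.reg 38 rfl)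
  have f39 : ρ.reg 39 = σ.reg 39 := (hs'.reg 39 rfl).trans (hs.reg 39 rfl)
  have f40 : ρ.reg 40 = σ.reg 40 := (hs'.reg 40 rfl).trans (hs.reg 40 rfl)
  have hρ := hτ.of_same hs' rfl rfl rfl rfl rfl rfl rfl
  have hmin : MinTarget blk start b₀ b₁ t (b₀ + (j + 1) + 1) (ρ.reg 28) (ρ.reg 29) (ρ.reg 30) := by
    rw [hs'.reg 28 rfl, hs'.reg 29 rfl, hs'.reg 30 rfl]
    exact hmin'
  simp only [runs_seq, runs_assign, runs_branch, runs_skip, Test.Holds, Expr.val,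
    State.setReg_reg, Nat.reduceEqDiff, if_false, add_zero, true_and,
    f13, f36, f43, f32, hρ.arr_start, hρ.reg_lo, hρ.reg_hi, hρ.reg_left, hρ.reg_right]
  refine ⟨fun hlt => ⟨by omega, ⟨hj, ?_, ?_, ?_, ?_, ?_, ?_, ?_⟩⟩, fun hge => ⟨by omega, by omega,
    by omega, by omega, by omega, by omega, ⟨hj, ?_, ?_, ?_, ?_, ?_, ?_, ?_⟩⟩⟩
  all_goals simp only [State.setReg_reg, if_true, Nat.reduceEqDiff, if_false]
  · rfl
  · exact f32
  · exact f33
  · exact f34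
  · exact hmin
  · intro h0 i hi
    rcases Nat.lt_succ_iff_lt_or_eq.1 (Nat.lt_succ_of_le hi) with h' | rfl
    · exact hI.not_found (by rw [← f31]; exact h0) i (by omega)
    · exact hlt
  · rw [f31, f37, f38, f39, f40]
    exact hI.found
  · rfl
  · exact f32
  · exact f33
  · exact f34
  · exact hmin
  · intro h0
    exact h0.elim
  · intro _
    exact Refinement.of_run hT h.le h.t_le hj hge

/-- The first block is treated before the loop, since it begins the first run and is the first
candidate for the smallest target; `b₁ - b₀ - 1` is the index of the last block. -/
theorem runs_scanRuns (h : WindowState n N par blk start B b₀ b₁ t σ) :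
    Runs B scanRuns σ fun m τ => m ≤ b₁ - b₀ ∧ RunsInv blk start b₀ b₁ t (b₁ - b₀ - 1) τ := by
  have hlt := h.lt
  have hT := h.blocks
  have hl0 := hT.landing_spec h.le h.t_le le_rfl hlt
  have hb0 := h.le_bound hlt.le
  have hb1 := h.le_bound le_rfl
  have hbl := h.le_bound (show blk (landing (start b₀) (start b₁) t (start b₀)) + 1 ≤ b₁ by omega)
  simp only [scanRuns, runs_seq, runs_assign, State.setReg_reg, Expr.val,
    Nat.reduceEqDiff, if_false, h.reg_left, zero_add]
  refine ⟨by omega, by omega, ?_⟩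
  have hσ : WindowState n N par blk start B b₀ b₁ t ((σ.setReg 31 0).setReg 13 b₀) := by
    refine ⟨h.blocks, h.lt, h.le, h.t_le, h.bound, ?_, ?_, ?_, ?_, ?_, ?_, ?_⟩ <;>
      simp [h.arr_blk, h.arr_start, h.reg_t, h.reg_left, h.reg_right, h.reg_lo, h.reg_hi]
  refine (runs_landProg hσ ?_ ?_).mono fun m τ hs hq => ?_
  · simp
  · simpa using hlt
  simp only [State.setReg_reg, if_true] at hq
  obtain ⟨rfl, g35, g36, g43⟩ := hq
  have g13 : τ.reg 13 = b₀ := by rw [hs.reg 13 rfl]; simp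
  have g31 : τ.reg 31 = 0 := by rw [hs.reg 31 rfl]; simp
  have hτ := hσ.of_same hs rfl rfl rfl rfl rfl rfl rfl
  simp only [newRun, newMin, runs_seq, runs_assign, State.setReg_reg, Expr.val,
    Nat.reduceEqDiff, if_false, State.setReg_arr, g13, g35, g36, g43, hτ.arr_start, zero_add]
  refine ⟨by omega, by omega, by omega, by omega, by omega, by omega, by omega, ?_⟩
  refine runs_loop (fun m τ' => WindowState n N par blk start B b₀ b₁ t τ' ∧
    RunsInv blk start b₀ b₁ t m τ') (fun τ' => b₁ - τ'.reg 13) ⟨?_, ?_⟩ ?_ ?_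
  · refine ⟨h.blocks, h.lt, h.le, h.t_le, h.bound, ?_, ?_, ?_, ?_, ?_, ?_, ?_⟩ <;>
      simp [hτ.arr_blk, hτ.arr_start, hτ.reg_t, hτ.reg_left, hτ.reg_right, hτ.reg_lo, hτ.reg_hi]
  · constructor
    all_goals simp only [State.setReg_reg, if_true, Nat.reduceEqDiff, if_false, runStart, g31,
      add_zero, ne_eq, not_true_eq_false, false_imp_iff, true_imp_iff]
    · exact hlt
    · refine ⟨le_rfl, by omega, rfl, rfl, fun j h1 h2 => ?_⟩
      obtain rfl : j = b₀ := by omega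
      exact le_rfl
    · intro i hi
      obtain rfl : i = 0 := by omega
      simp only [runStart, add_zero, Nat.sub_self, mul_zero, zero_add]
      exact Nat.mul_pos (by omega) (by omega)
  · rintro m τ' - ⟨hτ', hI⟩ hb
    simp only [Test.Holds, Expr.val, hτ'.reg_right, hI.reg_next] at hb
    rw [runs_seq]
    refine (runs_landProg hτ' (by rw [hI.reg_next]; omega)
      (by rw [hI.reg_next]; omega)).mono fun l ρ hs' hq => ?_
    obtain ⟨rfl, f35, f36, f43⟩ := hq
    rw [hI.reg_next] at f35 f36 f43
    have hρ := hτ'.of_same hs' rfl rfl rfl rfl rfl rfl rfl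
    have hIρ : RunsInv blk start b₀ b₁ t m ρ := by
      refine ⟨hI.lt, ?_, ?_, ?_, ?_, ?_, ?_, ?_⟩
      · rw [hs'.reg 13 rfl, hI.reg_next]
      · rw [hs'.reg 32 rfl, hI.reg_run]
      · rw [hs'.reg 33 rfl, hI.reg_land]
      · rw [hs'.reg 34 rfl, hI.reg_end]
      · rw [hs'.reg 28 rfl, hs'.reg 29 rfl, hs'.reg 30 rfl]
        exact hI.min
      · rw [hs'.reg 31 rfl]
        exact hI.not_found
      · rw [hs'.reg 31 rfl, hs'.reg 37 rfl, hs'.reg 38 rfl, hs'.reg 39 rfl, hs'.reg 40 rfl]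
        exact hI.found
    refine (runs_treatBlock hρ hIρ hb f35 f36 f43).mono fun l ρ' hs'' hq => ?_
    obtain ⟨rfl, hI'⟩ := hq
    refine ⟨⟨hρ.of_same hs'' rfl rfl rfl rfl rfl rfl rfl, hI'⟩, ?_⟩
    rw [hI'.reg_next, hI.reg_next]
    omega
  · rintro m τ' - ⟨hτ', hI⟩ hb
    simp only [Test.Holds, Expr.val, hτ'.reg_right, hI.reg_next] at hb
    have := hI.lt
    obtain rfl : m = b₁ - b₀ - 1 := by omega
    exact ⟨by omega, hI⟩

/-- What is known after the clusters before the block `b₀ + j` have been searched. -/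
structure ClustersInv (blk start : ℕ → ℕ) (b₀ b₁ t s j : ℕ) (τ : State) : Prop where
  le : b₀ + j ≤ b₁
  reg_next : τ.reg 13 = b₀ + j
  reg_cluster : τ.reg 32 = clusterStart start s b₀ j
  not_found : τ.reg 31 = 0 → ∀ i < j, start (b₀ + i + 1) - start (b₀ + i) < s →
    14 * (start b₁ - start b₀) * (b₀ + i + 1 - clusterStart start s b₀ i) <
      (b₁ - b₀) * (19 * (start (b₀ + i + 1) - start (clusterStart start s b₀ i)) + 2 * s)
  found : τ.reg 31 ≠ 0 →
    Refinement blk start b₀ b₁ t (τ.reg 37) (τ.reg 38) (τ.reg 39) (τ.reg 40)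

theorem runs_scanClusters (h : WindowState n N par blk start B b₀ b₁ t σ)
    (hm : MinTarget blk start b₀ b₁ t b₁ (σ.reg 28) (σ.reg 29) (σ.reg 30)) (h31 : σ.reg 31 = 0) :
    Runs B scanClusters σ fun m τ => m ≤ b₁ - b₀ ∧
      ClustersInv blk start b₀ b₁ t (σ.reg 28) (b₁ - b₀) τ := by
  have hlt := h.lt
  have hT := h.blocks
  have hb1 := h.le_bound le_rfl
  simp only [scanClusters, runs_seq, runs_assign, State.setReg_reg, Expr.val,
    Nat.reduceEqDiff, if_false, h.reg_left, zero_add]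
  refine ⟨by omega, by omega, ?_⟩
  have hσ : WindowState n N par blk start B b₀ b₁ t ((σ.setReg 13 b₀).setReg 32 b₀) := by
    refine ⟨h.blocks, h.lt, h.le, h.t_le, h.bound, ?_, ?_, ?_, ?_, ?_, ?_, ?_⟩ <;>
      simp [h.arr_blk, h.arr_start, h.reg_t, h.reg_left, h.reg_right, h.reg_lo, h.reg_hi]
  refine runs_loop (fun m τ => WindowState n N par blk start B b₀ b₁ t τ ∧
    ClustersInv blk start b₀ b₁ t (σ.reg 28) m τ) (fun τ' => b₁ - τ'.reg 13) ⟨hσ, ?_⟩ ?_ ?_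
  · constructor
    all_goals simp only [State.setReg_reg, if_true, Nat.reduceEqDiff, if_false, clusterStart, h31,
      add_zero, ne_eq, not_true_eq_false, false_imp_iff, true_imp_iff]
    · exact hlt.le
    · intro i hi
      omega
  · rintro m τ hs ⟨hτ, hI⟩ hb
    simp only [Test.Holds, Expr.val, hτ.reg_right, hI.reg_next] at hb
    have hb0 := h.le_bound (show b₀ + m + 1 ≤ b₁ by omega)
    have hc := clusterStart_le start (σ.reg 28) b₀ m
    have hal := hm.source_lt
    have e28 : τ.reg 28 = σ.reg 28 := by rw [hs.reg 28 rfl]; simp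
    have e29 : τ.reg 29 = σ.reg 29 := by rw [hs.reg 29 rfl]; simp
    have e30 : τ.reg 30 = σ.reg 30 := by rw [hs.reg 30 rfl]; simp
    have hl := hT.landing_spec h.le h.t_le hm.le_source hm.source_lt
    rw [← hm.target_eq] at hl
    refine Runs.mono (Q := fun l ρ => l = 0 ∧
      ClustersInv blk start b₀ b₁ t (σ.reg 28) (m + 1) ρ) ?_ ?_
    · simp only [runs_seq, runs_assign, runs_branch, runs_skip, Test.Holds, Expr.val,
        State.setReg_reg, Nat.reduceEqDiff, if_false, add_zero, true_and,
        hI.reg_next, hI.reg_cluster, e28, e29, e30, hτ.arr_start, hτ.reg_lo, hτ.reg_hi,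
        hτ.reg_left, hτ.reg_right]
      refine ⟨fun hsm => ⟨fun hd => ⟨by omega, ⟨by omega, ?_, ?_, ?_, ?_⟩⟩, fun hd => ⟨by omega,
        by omega, by omega, by omega, by omega, by omega, ⟨by omega, ?_, ?_, ?_, ?_⟩⟩⟩,
        fun hge => ⟨by omega, by omega, ⟨by omega, ?_, ?_, ?_, ?_⟩⟩⟩
      all_goals simp only [State.setReg_reg, if_true, Nat.reduceEqDiff, if_false]
      · rfl
      · rw [clusterStart, if_pos hsm, hI.reg_cluster]
      · intro h0 i hi hs'
        rcases Nat.lt_succ_iff_lt_or_eq.1 hi with h' | rfl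
        · exact hI.not_found h0 i h' hs'
        · exact hd
      · exact hI.found
      · rfl
      · rw [clusterStart, if_pos hsm, hI.reg_cluster]
      · exact fun h0 => h0.elim
      · exact fun _ => Refinement.of_cluster hm hb hsm hd
      · rfl
      · rw [clusterStart, if_neg hge]
      · intro h0 i hi hs'
        rcases Nat.lt_succ_iff_lt_or_eq.1 hi with h' | rfl
        · exact hI.not_found h0 i h' hs'
        · exact absurd hs' hge
      · exact hI.found
    · rintro l ρ hs' ⟨rfl, hI'⟩
      refine ⟨⟨hτ.of_same hs' rfl rfl rfl rfl rfl rfl rfl, hI'⟩, ?_⟩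
      rw [hI'.reg_next, hI.reg_next]
      omega
  · rintro m τ - ⟨hτ, hI⟩ hb
    simp only [Test.Holds, Expr.val, hτ.reg_right, hI.reg_next] at hb
    have := hI.le
    obtain rfl : m = b₁ - b₀ := by omega
    exact ⟨le_rfl, hI⟩

end RAM


/-! ### Cutting off a number of vertices: one step -/

/-- Apart from the path edges between consecutive starts, parents are in the same block. So the edge
above `start x` is the only one that crosses this boundary, and any cut along boundaries of blocks
costs one edge for each. -/
theorem Blocks.par_lt_start_iff {n N : ℕ} {par blk start : ℕ → ℕ} (hT : Blocks n N par blk start)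
    {p x : ℕ} (hp : p < n) (h0 : 0 < p) (hx : x ≤ N) (hne : p ≠ start x) :
    par p < start x ↔ p < start x := by
  obtain ⟨h1, h2, h3⟩ := hT.blk_spec hp
  set j := blk p with hj
  constructor
  · intro h
    by_contra hc
    rcases h2.eq_or_lt with he | hlt
    · obtain ⟨i, hi⟩ : ∃ i, j = i + 1 := by
        refine ⟨j - 1, ?_⟩
        have : j ≠ 0 := by
          intro hc
          rw [hc, hT.start_zero] at he
          omega
        omega
      have h4 := hT.par_start i (by omega)
      rw [← hi, he] at h4
      have h5 := hT.lt_of_start_lt (i := i) (j := x) (by omega) (by omega)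
      have h6 := hT.start_le (show j ≤ x by omega) hx
      omega
    · have h4 := hT.par_inner j h1 p hlt h3
      have h5 := hT.lt_of_start_lt (i := j) (j := x) (by omega) (by omega)
      have h6 := hT.start_le (show j + 1 ≤ x by omega) hx
      omega
  · intro h
    exact (hT.par_lt hp h0).trans h

theorem Blocks.le_par {n N : ℕ} {par blk start : ℕ → ℕ} (hT : Blocks n N par blk start)
    {p x : ℕ} (hp : p < n) (hx : x ≤ N) (hlt : start x < p) : start x ≤ par p := by
  by_contra hc
  have := (hT.par_lt_start_iff hp (by omega) hx (by omega)).1 (not_le.1 hc)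
  omega

/-- The distance from `a` to `p` when the positions between `lo` and `hi` are arranged in a cycle. -/
def cyclicDist (lo hi a p : ℕ) : ℕ := if p < a then p + (hi - lo) - a else p - a

theorem card_cyclicDist_lt {lo hi a len : ℕ} (h1 : lo ≤ a) (h2 : a < hi) (hl : len ≤ hi - lo) :
    ((Finset.Ico lo hi).filter fun p => cyclicDist lo hi a p < len).card = len := by
  have e : ((Finset.Ico lo hi).filter fun p => cyclicDist lo hi a p < len) =
      Finset.Ico a (min hi (a + len)) ∪ Finset.Ico lo (lo + (a + len - hi)) := by
    ext p
    simp only [Finset.mem_filter, Finset.mem_union, Finset.mem_Ico]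
    unfold cyclicDist
    split_ifs <;> omega
  rw [e, Finset.card_union_of_disjoint]
  · simp only [Nat.card_Ico]
    omega
  · rw [Finset.disjoint_left]
    intro p
    simp only [Finset.mem_Ico]
    omega

/-- Membership in the cyclic interval from `a` to `e` depends only on the sides of `a` and `e` on
which a position lies. Applied to a vertex and its parent, it shows that an edge crossing neither
boundary is not cut. -/
theorem cyclicDist_lt_iff {lo hi a e p q : ℕ} (h2 : a < hi) (h3 : lo ≤ e)
    (h4 : e < hi) (h5 : lo ≤ p) (h6 : p < hi) (h7 : lo ≤ q) (h8 : q < hi) (ha : q < a ↔ p < a)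
    (he : q < e ↔ p < e) :
    cyclicDist lo hi a p < cyclicDist lo hi a e ↔ cyclicDist lo hi a q < cyclicDist lo hi a e := by
  unfold cyclicDist
  split_ifs <;> omega

theorem sum_Ico_indicator {lo hi a b : ℕ} (h1 : lo ≤ a) (h2 : b ≤ hi) (Q : ℕ → Prop)
    [DecidablePred Q] :
    ∑ p ∈ Finset.Ico lo hi, (if (a ≤ p ∧ p < b) ∧ Q p then 1 else 0) =
      ∑ p ∈ Finset.Ico a b, if Q p then 1 else 0 := by
  rw [← Finset.sum_subset (Finset.Ico_subset_Ico h1 h2)]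
  · refine Finset.sum_congr rfl fun p hp => ?_
    rw [Finset.mem_Ico] at hp
    simp [hp]
  · intro p _ hp
    rw [Finset.mem_Ico] at hp
    rw [if_neg fun h => hp h.1]

/-- The number of edges to parents with differently coloured ends, between the positions `lo` and
`hi`. -/
def innerCut (par col : ℕ → ℕ) (lo hi : ℕ) : ℕ :=
  ((Finset.Ioo lo hi).filter fun p => col p ≠ col (par p)).card

/-- Between the positions `lo` and `hi`, the vertices get the colours `c₁` and `c₂`, and `t` of them
the colour `c₁`. -/
structure CutOff (lo hi t c₁ c₂ : ℕ) (col₀ col : ℕ → ℕ) : Prop where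
  eq_of_not_mem : ∀ p, p < lo ∨ hi ≤ p → col p = col₀ p
  eq_or_eq : ∀ p, lo ≤ p → p < hi → col p = c₁ ∨ col p = c₂
  count : ∑ p ∈ Finset.Ico lo hi, (if col p = c₁ then 1 else 0) = t

/-- Every vertex has at most `Δ` neighbours. -/
def DegreeLE (n : ℕ) (par : ℕ → ℕ) (Δ : ℕ) : Prop :=
  ∀ p < n, ((Finset.Ico 1 n).filter fun q => q = p ∨ par q = p).card ≤ Δ

/-- An edge, represented by its lower end, is charged to one of its marked ends. -/
theorem DegreeLE.card_le {n Δ : ℕ} {par mark : ℕ → ℕ} (h : DegreeLE n par Δ) {S : Finset ℕ}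
    (hS : ∀ p ∈ S, p < n) :
    (S.filter fun p => 1 ≤ p ∧ (mark p ≠ 0 ∨ par p ∈ S ∧ mark (par p) ≠ 0)).card ≤
      (S.filter fun p => mark p ≠ 0).card * Δ := by
  refine le_trans (Finset.card_le_card ?_) (Finset.card_biUnion_le_card_mul
    (S.filter fun p => mark p ≠ 0)
    (fun p => (Finset.Ico 1 n).filter fun q => q = p ∨ par q = p) Δ fun p hp =>
      h p (hS p (Finset.mem_filter.1 hp).1))
  intro p hp
  simp only [Finset.mem_filter, Finset.mem_biUnion, Finset.mem_Ico] at hp ⊢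
  have hpn := hS p hp.1
  rcases hp.2.2 with h' | h'
  · exact ⟨p, ⟨hp.1, h'⟩, ⟨hp.2.1, hpn⟩, Or.inl rfl⟩
  · exact ⟨par p, h', ⟨hp.2.1, hpn⟩, Or.inr rfl⟩

open RAM

section

variable {n N : ℕ} {par blk start : ℕ → ℕ} {b₀ b₁ t z₀ z₁ a l Δ c₁ c₂ : ℕ}

/-- The sizes of the parts of the cyclic shift. -/
theorem Blocks.shift_spec (hT : Blocks n N par blk start) (hb : b₁ ≤ N)
    (ht : t < start b₁ - start b₀) (ha : b₀ ≤ a) (ha' : a < b₁)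
    (hl : l = blk (landing (start b₀) (start b₁) t (start a))) :
    cyclicDist (start b₀) (start b₁) (start a) (start l) ≤ t ∧
    t < cyclicDist (start b₀) (start b₁) (start a) (start l) + (start (l + 1) - start l) ∧
    cyclicDist (start b₀) (start b₁) (start a) (start l) < start b₁ - start b₀ := by
  have h := hT.landing_spec hb ht.le ha ha'
  rw [← hl] at h
  have h1 := hT.start_le h.2.2.2.2.1 (by omega)
  have h2 : start a < start l → start (a + 1) ≤ start l := fun hlt =>
    hT.start_le (hT.lt_of_start_lt (by omega) hlt) (by omega)
  have h3 : start l < start a → start (l + 1) ≤ start a := fun hlt =>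
    hT.start_le (hT.lt_of_start_lt (by omega) hlt) (by omega)
  have h4 := hT.start_lt l (by omega)
  have h5 := hT.start_le (show l + 1 ≤ b₁ by omega) hb
  clear hl
  unfold cyclicDist
  unfold landing at h
  split_ifs at h ⊢ <;> omega

/-- The colouring `col₁` arises from a refinement: the cyclic interval from `a` to `l` gets the colour
`c₁`, and so do some pieces of the block `l`; the window between `z₀` and `z₁` is left. -/
structure RefinedCut (par start : ℕ → ℕ) (b₀ b₁ t t' z₀ z₁ a l c₁ c₂ : ℕ)
    (w mark rt col₀ col₁ : ℕ → ℕ) : Prop where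
  eq_of_not_mem : ∀ p, p < start b₀ ∨ start b₁ ≤ p → col₁ p = col₀ p
  cyclic : ∀ p, start b₀ ≤ p → p < start b₁ → ¬ (start l ≤ p ∧ p < start (l + 1)) →
    ¬ (start z₀ ≤ p ∧ p < start z₁) →
    col₁ p = if cyclicDist (start b₀) (start b₁) (start a) p <
      cyclicDist (start b₀) (start b₁) (start a) (start l) then c₁ else c₂
  eq_or_eq : ∀ p, start l ≤ p → p < start (l + 1) → col₁ p = c₁ ∨ col₁ p = c₂
  attached : ∀ p, Attached (Finset.Ico (start l) (start (l + 1))) par mark rt p →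
    col₁ p = col₁ (par p)
  pieces : Pieces (start z₁ - start z₀) (Finset.Ico (start l) (start (l + 1))) par w mark rt
  count : t = t' + (∑ p ∈ Finset.Ico (start b₀) (start b₁),
      if cyclicDist (start b₀) (start b₁) (start a) p <
        cyclicDist (start b₀) (start b₁) (start a) (start l) ∧ ¬ (start z₀ ≤ p ∧ p < start z₁)
      then 1 else 0) +
    ∑ p ∈ Finset.Ico (start l) (start (l + 1)), if col₁ p = c₁ then 1 else 0

variable {t' : ℕ} {w mark rt col₀ col₁ col : ℕ → ℕ}

theorem Refinement.bounds (hT : Blocks n N par blk start) (hb : b₁ ≤ N)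
    (ht : t < start b₁ - start b₀) (hr : Refinement blk start b₀ b₁ t z₀ z₁ a l) :
    b₀ ≤ l ∧ l < b₁ ∧ start b₀ ≤ start l ∧ start l < start (l + 1) ∧ start (l + 1) ≤ start b₁ ∧
    start b₀ ≤ start z₀ ∧ start z₀ < start z₁ ∧ start z₁ ≤ start b₁ ∧ start b₀ ≤ start a ∧
    start a < start b₁ ∧ (start (l + 1) ≤ start z₀ ∨ start z₁ ≤ start l) ∧
    z₁ - z₀ ≤ start z₁ - start z₀ := by
  have h := hT.landing_spec hb ht.le hr.le_source hr.source_lt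
  rw [← hr.target_eq] at h
  have h0 := hr.lt
  have h1 := hr.le_right
  have h2 := hr.le_left
  have h3 := hT.start_le h.2.2.2.2.1 (by omega)
  have h4 := hT.start_lt l (by omega)
  have h5 := hT.start_le (show l + 1 ≤ b₁ by omega) hb
  have h6 := hT.start_le h2 (by omega)
  have h7 := hT.start_add_le h0.le (by omega)
  have h8 := hT.start_le h1 hb
  refine ⟨by omega, by omega, h3, h4, h5, h6, by omega, h8, h.1, h.2.1, ?_, by omega⟩
  rcases hr.target with h9 | h9
  · exact Or.inl (hT.start_le h9 (by omega))
  · exact Or.inr (hT.start_le h9 (by omega))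

/-- The target block, the window and the remaining positions are disjoint. `count` of the refinement
settles all but the window, and the recursive result supplies the `t'` vertices there. -/
theorem RefinedCut.toCutOff (hT : Blocks n N par blk start) (hb : b₁ ≤ N)
    (ht : t < start b₁ - start b₀) (hr : Refinement blk start b₀ b₁ t z₀ z₁ a l)
    (h : RefinedCut par start b₀ b₁ t t' z₀ z₁ a l c₁ c₂ w mark rt col₀ col₁)
    (hco : CutOff (start z₀) (start z₁) t' c₁ c₂ col₁ col)
    (hc : c₁ ≠ c₂) :
    CutOff (start b₀) (start b₁) t c₁ c₂ col₀ col := by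
  obtain ⟨g1, g2, g3, g4, g5, g6, g7, g8, g9, g10, g11, g12⟩ := hr.bounds hT hb ht
  have hcy : ∀ p, start b₀ ≤ p → p < start b₁ → ¬ (start z₀ ≤ p ∧ p < start z₁) →
      col p = col₁ p := fun p _ _ hz => hco.eq_of_not_mem p (by omega)
  refine ⟨fun p hp => ?_, fun p hp hp' => ?_, ?_⟩
  · rw [hco.eq_of_not_mem p (by omega), h.eq_of_not_mem p hp]
  · by_cases hz : start z₀ ≤ p ∧ p < start z₁
    · exact hco.eq_or_eq p hz.1 hz.2
    · rw [hcy p hp hp' hz]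
      by_cases hl : start l ≤ p ∧ p < start (l + 1)
      · exact h.eq_or_eq p hl.1 hl.2
      · rw [h.cyclic p hp hp' hl hz]
        split_ifs <;> simp
  · have e1 := h.count
    rw [← hco.count, ← sum_Ico_indicator g6 g8, ← sum_Ico_indicator g3 g5,
      ← Finset.sum_add_distrib, ← Finset.sum_add_distrib] at e1
    rw [e1]
    refine Finset.sum_congr rfl fun p hp => ?_
    rw [Finset.mem_Ico] at hp
    by_cases hz : start z₀ ≤ p ∧ p < start z₁
    · have hl : ¬ (start l ≤ p ∧ p < start (l + 1)) := by omega
      simp [hz, hl]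
    · rw [hcy p hp.1 hp.2 hz]
      by_cases hl : start l ≤ p ∧ p < start (l + 1)
      -- The cyclic interval stops where the block `l` begins, so the two summands do not count any
      -- vertex twice.
      · have hd : ¬ cyclicDist (start b₀) (start b₁) (start a) p <
            cyclicDist (start b₀) (start b₁) (start a) (start l) := by
          have h1 := hT.landing_spec hb ht.le hr.le_source hr.source_lt
          have h2 : start l < start a → start (l + 1) ≤ start a := fun hlt =>
            hT.start_le (hT.lt_of_start_lt (by omega) hlt) (by have := hr.source_lt; omega)
          unfold cyclicDist
          split_ifs <;> omega
        simp [hz, hl, hd]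
      · rw [h.cyclic p hp.1 hp.2 hl hz]
        by_cases hd : cyclicDist (start b₀) (start b₁) (start a) p <
            cyclicDist (start b₀) (start b₁) (start a) (start l)
        · simp [hz, hl, hd]
        · simp [hz, hl, hd, hc.symm]

/-- The origin of the constants in the density condition. Multiply `cut` by `2 * N'`: the five
boundary edges contribute `10 * N' ≤ 5 * v * Δ`, the marked vertices at most `2 * T * Δ` since `N' ≤
v + 1`, and the recursion `14 * v * Δ`. The sum is `(19 * v + 2 * T) * Δ`. -/
theorem refined_arith {Z u T v N' m c Δ cut : ℕ} (hN : 1 ≤ N') (hv : N' ≤ v) (hΔ : 2 ≤ Δ)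
    (hm : (v + 1) * m ≤ T) (hc : N' * c ≤ 7 * v * Δ)
    (hd : Z * (19 * v + 2 * T) ≤ 14 * u * N') (hcut : cut ≤ 5 + m * Δ + c) :
    Z * cut ≤ 7 * u * Δ := by
  suffices h : 2 * N' * (Z * cut) ≤ 2 * N' * (7 * u * Δ) from
    Nat.le_of_mul_le_mul_left h (by omega)
  have h1 : 2 * N' * cut ≤ 5 * v * Δ + 2 * T * Δ + 14 * v * Δ := by
    have h2 : 2 * N' * cut ≤ 2 * N' * (5 + m * Δ + c) := Nat.mul_le_mul_left _ hcut
    have h3 : 2 * (N' * 5) ≤ 5 * v * Δ := by nlinarith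
    have h4 : N' * (m * Δ) ≤ T * Δ := by
      rw [← mul_assoc]
      refine Nat.mul_le_mul_right _ (le_trans (Nat.mul_le_mul_right _ ?_) hm)
      omega
    nlinarith
  calc 2 * N' * (Z * cut) = Z * (2 * N' * cut) := by ring
    _ ≤ Z * (5 * v * Δ + 2 * T * Δ + 14 * v * Δ) := Nat.mul_le_mul_left _ h1
    _ = Z * (19 * v + 2 * T) * Δ := by ring
    _ ≤ 14 * u * N' * Δ := Nat.mul_le_mul_right _ hd
    _ = _ := by ring

/-- An edge can be cut only if its lower end is at one of five boundaries (two of the target, two of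
the window, and the beginning of the cyclic interval), if it has a marked end in the target, or if
it is cut inside the window by the recursion. -/
theorem RefinedCut.innerCut_le (hT : Blocks n N par blk start) (hb : b₁ ≤ N)
    (ht : t < start b₁ - start b₀) (hr : Refinement blk start b₀ b₁ t z₀ z₁ a l)
    (h : RefinedCut par start b₀ b₁ t t' z₀ z₁ a l c₁ c₂ w mark rt col₀ col₁)
    (hco : CutOff (start z₀) (start z₁) t' c₁ c₂ col₁ col)
    (hΔ : 2 ≤ Δ) (hdeg : DegreeLE n par Δ)
    (hcut : (z₁ - z₀) * innerCut par col (start z₀) (start z₁) ≤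
      7 * (start z₁ - start z₀) * Δ) :
    (b₁ - b₀) * innerCut par col (start b₀) (start b₁) ≤ 7 * (start b₁ - start b₀) * Δ := by
  obtain ⟨g1, g2, g3, g4, g5, g6, g7, g8, g9, g10, g11, g12⟩ := hr.bounds hT hb ht
  have gn := hT.start_le_n hb
  have r1 := hr.lt
  have r2 := hr.le_right
  have r3 := hr.source_lt
  have hcy : ∀ p, start b₀ ≤ p → p < start b₁ → ¬ (start z₀ ≤ p ∧ p < start z₁) →
      col p = col₁ p := fun p _ _ hz => hco.eq_of_not_mem p (by omega)
  set S := Finset.Ico (start l) (start (l + 1)) with hS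
  have hm := h.pieces.card_le
  have hScard : S.card = start (l + 1) - start l := Nat.card_Ico _ _
  rw [hScard] at hm
  have hD := hdeg.card_le (mark := mark) (S := S) fun p hp => by
    rw [hS, Finset.mem_Ico] at hp
    omega
  refine refined_arith (by omega) g12 hΔ hm hcut hr.dense
    (le_trans ?_ (Nat.add_le_add_right (Nat.add_le_add_left hD 5) _))
  have h5 : ({start l, start (l + 1), start z₀, start z₁, start a} : Finset ℕ).card ≤ 5 :=
    Finset.card_le_five
  unfold innerCut
  refine le_trans (Finset.card_le_card ?_) ((Finset.card_union_le _ _).trans (Nat.add_le_add_right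
    ((Finset.card_union_le _ _).trans (Nat.add_le_add_right h5 _)) _))
  intro p hp
  simp only [Finset.mem_filter, Finset.mem_Ioo, Finset.mem_union, Finset.mem_insert,
    Finset.mem_singleton] at hp ⊢
  obtain ⟨⟨hp1, hp2⟩, hp3⟩ := hp
  by_contra hcon
  push Not at hcon
  obtain ⟨⟨⟨n1, n2, n3, n4, n5⟩, hc2⟩, hc3⟩ := hcon
  have hpn : p < n := by omega
  have hp0 : 0 < p := by omega
  have s1 := hT.par_lt_start_iff hpn hp0 (show l ≤ N by omega) n1
  have s2 := hT.par_lt_start_iff hpn hp0 (show l + 1 ≤ N by omega) n2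
  have s3 := hT.par_lt_start_iff hpn hp0 (show z₀ ≤ N by omega) n3
  have s4 := hT.par_lt_start_iff hpn hp0 (show z₁ ≤ N by omega) n4
  have s5 := hT.par_lt_start_iff hpn hp0 (show a ≤ N by omega) n5
  have s6 := hT.le_par hpn (show b₀ ≤ N by omega) hp1
  have s7 := hT.par_lt hpn hp0
  by_cases hz : start z₀ ≤ p ∧ p < start z₁
  · exact hp3 (hc3 ⟨by omega, by omega⟩)
  · rw [hcy p hp1.le hp2 hz, hcy (par p) s6 (by omega) (by omega)] at hp3
    by_cases hl : start l ≤ p ∧ p < start (l + 1)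
    · have hpS : p ∈ S := by rw [hS, Finset.mem_Ico]; exact hl
      have hpS' : par p ∈ S := by rw [hS, Finset.mem_Ico]; omega
      have hc4 := hc2 hpS hp0
      exact hp3 (h.attached p ⟨hpS, (h.pieces.rt_eq p hpS).2 ⟨hpS', s7⟩, hc4.1, hc4.2 hpS'⟩)
    · rw [h.cyclic p hp1.le hp2 hl hz, h.cyclic (par p) s6 (by omega) (by omega) (by omega)] at hp3
      exact hp3 (if_congr (cyclicDist_lt_iff g10 g3 (by omega) hp1.le hp2 s6 (by omega) s5 s1)
        rfl rfl)

/-- A cyclic interval that ends in a small block is cut off by few edges. -/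
theorem innerCut_le_of_cyclic (hT : Blocks n N par blk start) (hb : b₁ ≤ N)
    (ht : t < start b₁ - start b₀) (ha : b₀ ≤ a) (ha' : a < b₁)
    (hl : l = blk (landing (start b₀) (start b₁) t (start a)))
    (hcol : ∀ p, start b₀ ≤ p → p < start b₁ →
      col p = if cyclicDist (start b₀) (start b₁) (start a) p < t then c₁ else c₂)
    (hs : (start (l + 1) - start l) * (b₁ - b₀) ≤ 4 * (start b₁ - start b₀)) (hΔ : 2 ≤ Δ) :
    (b₁ - b₀) * innerCut par col (start b₀) (start b₁) ≤ 7 * (start b₁ - start b₀) * Δ := by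
  have g := hT.landing_spec hb ht.le ha ha'
  rw [← hl] at g
  have gn := hT.start_le_n hb
  have gN := hT.start_add_le (show b₀ ≤ b₁ by omega) hb
  have h4 := hT.start_lt l (by omega)
  -- Inside the target block nothing is known, so all its vertices are counted; otherwise only the
  -- edges above `start (l + 1)` and `start a` can be cut.
  have hcut : innerCut par col (start b₀) (start b₁) ≤ 2 + (start (l + 1) - start l) := by
    have h5 : ({start (l + 1), start a} : Finset ℕ).card ≤ 2 := Finset.card_le_two
    rw [← Nat.card_Ico (start l)]
    refine le_trans (Finset.card_le_card ?_) ((Finset.card_union_le _ _).trans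
      (Nat.add_le_add_right h5 _))
    intro p hp
    simp only [Finset.mem_filter, Finset.mem_Ioo, Finset.mem_union, Finset.mem_insert,
      Finset.mem_singleton, Finset.mem_Ico] at hp ⊢
    obtain ⟨⟨hp1, hp2⟩, hp3⟩ := hp
    by_contra hcon
    push Not at hcon
    obtain ⟨⟨n1, n2⟩, n3⟩ := hcon
    have hpn : p < n := by omega
    have hp0 : 0 < p := by omega
    have s1 := hT.par_lt_start_iff hpn hp0 (show l ≤ N by omega)
    have s2 := hT.par_lt_start_iff hpn hp0 (show l + 1 ≤ N by omega) n1
    have s5 := hT.par_lt_start_iff hpn hp0 (show a ≤ N by omega) n2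
    have s6 := hT.le_par hpn (show b₀ ≤ N by omega) hp1
    have s7 := hT.par_lt hpn hp0
    have hne : p ≠ start l := by
      rintro rfl
      have := n3 le_rfl
      omega
    have s1 := s1 hne
    rw [hcol p hp1.le hp2, hcol (par p) s6 (by omega)] at hp3
    apply hp3
    refine if_congr ?_ rfl rfl
    unfold cyclicDist
    unfold landing at g
    split_ifs at g ⊢ <;> omega
  -- With `Z` blocks and `u` vertices, `Z ≤ u` bounds this by `2 * u + 4 * u`. That is below `7 * u
  -- * Δ` with room to spare.
  calc (b₁ - b₀) * innerCut par col (start b₀) (start b₁)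
      ≤ (b₁ - b₀) * (2 + (start (l + 1) - start l)) := Nat.mul_le_mul_left _ hcut
    _ ≤ 7 * (start b₁ - start b₀) * 2 := by
      rw [mul_add, mul_comm (b₁ - b₀) (_ - _)]
      omega
    _ ≤ _ := Nat.mul_le_mul_left _ hΔ

end


/-! ### Cutting off a number of vertices: the program -/

namespace RAM

/-- Give the colour in register `21` to the cyclic interval of length `len` (register `42`) from the
block in register `39`, except for the window of the registers `37` and `38`, and the colour in
register `22` to the other positions. -/
def paint : Program :=
  14 ⟵ R 25 ;;
  Program.loop (R 14 <ₑ R 26)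
    (Program.branch (R 14 <ₑ A 8 (R 39)) (41 ⟵ R 14 +ₑ (R 26 -ₑ R 25) -ₑ A 8 (R 39))
      (41 ⟵ R 14 -ₑ A 8 (R 39)) ;;
    Program.branch (Test.and (R 41 <ₑ R 42)
        (Test.not (Test.and (Test.not (R 14 <ₑ A 8 (R 37))) (R 14 <ₑ A 8 (R 38)))))
      (Program.store 10 (R 14) (R 21) ;; 17 ⟵ R 17 -ₑ K 1)
      (Program.store 10 (R 14) (R 22)) ;;
    14 ⟵ R 14 +ₑ K 1)

/-- The hypothesis `hsum` ensures that the subtractions from register `17` are never truncated, so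
that the final balance is an equality. -/
theorem runs_paint {B : ℕ} {σ : State} (hlh : σ.reg 25 ≤ σ.reg 26) (hB : 2 * σ.reg 26 ≤ B)
    (ht : σ.reg 17 ≤ B) (hc₁ : σ.reg 21 ≤ B) (hc₂ : σ.reg 22 ≤ B)
    (hsum : ∑ p ∈ Finset.Ico (σ.reg 25) (σ.reg 26),
      (if cyclicDist (σ.reg 25) (σ.reg 26) (σ.arr 8 (σ.reg 39)) p < σ.reg 42 ∧
        ¬ (σ.arr 8 (σ.reg 37) ≤ p ∧ p < σ.arr 8 (σ.reg 38)) then 1 else 0) ≤ σ.reg 17) :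
    Runs B paint σ fun m τ => m ≤ σ.reg 26 - σ.reg 25 ∧
      (∀ p, p < σ.reg 25 ∨ σ.reg 26 ≤ p → τ.arr 10 p = σ.arr 10 p) ∧
      (∀ p, σ.reg 25 ≤ p → p < σ.reg 26 → τ.arr 10 p =
        if cyclicDist (σ.reg 25) (σ.reg 26) (σ.arr 8 (σ.reg 39)) p < σ.reg 42 ∧
          ¬ (σ.arr 8 (σ.reg 37) ≤ p ∧ p < σ.arr 8 (σ.reg 38)) then σ.reg 21 else σ.reg 22) ∧
      σ.reg 17 = τ.reg 17 + ∑ p ∈ Finset.Ico (σ.reg 25) (σ.reg 26),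
        (if cyclicDist (σ.reg 25) (σ.reg 26) (σ.arr 8 (σ.reg 39)) p < σ.reg 42 ∧
          ¬ (σ.arr 8 (σ.reg 37) ≤ p ∧ p < σ.arr 8 (σ.reg 38)) then 1 else 0) := by
  set lo := σ.reg 25
  set hi := σ.reg 26
  set sa := σ.arr 8 (σ.reg 39)
  set s₀ := σ.arr 8 (σ.reg 37)
  set s₁ := σ.arr 8 (σ.reg 38)
  set len := σ.reg 42
  set f : ℕ → ℕ := fun p =>
    if cyclicDist lo hi sa p < len ∧ ¬ (s₀ ≤ p ∧ p < s₁) then 1 else 0 with hf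
  simp only [paint, runs_seq, runs_assign, zero_add]
  refine ⟨by simp [Expr.val]; omega, ?_⟩
  refine runs_loop (fun m τ => lo ≤ τ.reg 14 ∧ τ.reg 14 ≤ hi ∧ m + lo = τ.reg 14 ∧
    (∀ p, p < lo ∨ τ.reg 14 ≤ p → τ.arr 10 p = σ.arr 10 p) ∧
    (∀ p, lo ≤ p → p < τ.reg 14 → τ.arr 10 p =
      if cyclicDist lo hi sa p < len ∧ ¬ (s₀ ≤ p ∧ p < s₁) then σ.reg 21 else σ.reg 22) ∧
    σ.reg 17 = τ.reg 17 + ∑ p ∈ Finset.Ico lo (τ.reg 14), f p) (fun τ => hi - τ.reg 14) ?_ ?_ ?_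
  · simp only [State.setReg_reg, Expr.val, if_true, State.setReg_arr, Nat.reduceEqDiff, if_false]
    refine ⟨le_rfl, hlh, by omega, fun _ _ => trivial, fun p _ _ => by omega, ?_⟩
    change _ = _ + ∑ p ∈ Finset.Ico lo lo, f p
    simp
  · intro m τ hs ⟨h1, h2, h3, h4, h5, h6⟩ hb
    have e25 : τ.reg 25 = lo := by rw [hs.reg 25 rfl]; simp [lo]
    have e26 : τ.reg 26 = hi := by rw [hs.reg 26 rfl]; simp [hi]
    have e21 : τ.reg 21 = σ.reg 21 := by rw [hs.reg 21 rfl]; simp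
    have e22 : τ.reg 22 = σ.reg 22 := by rw [hs.reg 22 rfl]; simp
    have e42 : τ.reg 42 = len := by rw [hs.reg 42 rfl]; simp [len]
    have e39 : τ.arr 8 (τ.reg 39) = sa := by rw [hs.reg 39 rfl, hs.arr 8 rfl]; simp [sa]
    have e37 : τ.arr 8 (τ.reg 37) = s₀ := by rw [hs.reg 37 rfl, hs.arr 8 rfl]; simp [s₀]
    have e38 : τ.arr 8 (τ.reg 38) = s₁ := by rw [hs.reg 38 rfl, hs.arr 8 rfl]; simp [s₁]
    simp only [Test.Holds, Expr.val, e26] at hb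
    have hsum' : ∑ p ∈ Finset.Ico lo (τ.reg 14), f p + f (τ.reg 14) ≤ σ.reg 17 := by
      rw [← Finset.sum_Ico_succ_top h1]
      exact (Finset.sum_le_sum_of_subset (Finset.Ico_subset_Ico_right hb)).trans hsum
    have hy : Runs B (Program.branch (R 14 <ₑ A 8 (R 39))
        (41 ⟵ R 14 +ₑ (R 26 -ₑ R 25) -ₑ A 8 (R 39)) (41 ⟵ R 14 -ₑ A 8 (R 39))) τ
        fun l ρ => l = 0 ∧ ρ.reg 41 = cyclicDist lo hi sa (τ.reg 14) := by
      simp only [runs_branch, runs_assign, Test.Holds, Expr.val, State.setReg_reg, if_true, e25,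
        e26, e39, cyclicDist, true_and]
      exact ⟨fun h => ⟨by omega, by rw [if_pos h]⟩, fun h => ⟨by omega, by rw [if_neg h]⟩⟩
    rw [runs_seq]
    refine hy.mono fun l ρ hs' hq => ?_
    obtain ⟨rfl, g41⟩ := hq
    have g14 := hs'.reg 14 rfl
    have g10 := hs'.arr 10 rfl
    have g17 := hs'.reg 17 rfl
    have g37 : ρ.arr 8 (ρ.reg 37) = s₀ := by rw [hs'.reg 37 rfl, hs'.arr 8 rfl, e37]
    have g38 : ρ.arr 8 (ρ.reg 38) = s₁ := by rw [hs'.reg 38 rfl, hs'.arr 8 rfl, e38]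
    have g42 := (hs'.reg 42 rfl).trans e42
    have g21 := (hs'.reg 21 rfl).trans e21
    have g22 := (hs'.reg 22 rfl).trans e22
    simp only [runs_seq, runs_store, runs_assign, runs_branch, Test.Holds, Expr.val,
      State.setReg_reg, State.setArr_reg, if_true, State.setReg_arr, State.setArr_arr,
      Nat.reduceEqDiff, if_false, add_zero, g14, g10, g17, g37, g38, g42, g21, g22, g41, not_lt]
    refine ⟨fun hc => ⟨hc₁, by omega, by omega, ⟨by omega, by omega, by omega, fun p hp => ?_,
      fun p hp hp' => ?_, ?_⟩, by omega⟩, fun hc => ⟨hc₂, by omega, ⟨by omega, by omega, by omega,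
      fun p hp => ?_, fun p hp hp' => ?_, ?_⟩, by omega⟩⟩
    · rw [Function.update_of_ne (by omega)]
      exact h4 p (by omega)
    · rcases eq_or_ne p (τ.reg 14) with rfl | hne
      · rw [Function.update_self, if_pos hc]
      · rw [Function.update_of_ne hne]
        exact h5 p hp (by omega)
    · rw [Finset.sum_Ico_succ_top h1]
      have : f (τ.reg 14) = 1 := if_pos hc
      omega
    · rw [Function.update_of_ne (by omega)]
      exact h4 p (by omega)
    · rcases eq_or_ne p (τ.reg 14) with rfl | hne
      · rw [Function.update_self, if_neg hc]
      · rw [Function.update_of_ne hne]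
        exact h5 p hp (by omega)
    · rw [Finset.sum_Ico_succ_top h1]
      have : f (τ.reg 14) = 0 := if_neg hc
      omega
  · intro m τ hs ⟨h1, h2, h3, h4, h5, h6⟩ hb
    have e26 : τ.reg 26 = hi := by rw [hs.reg 26 rfl]; simp [hi]
    simp only [Test.Holds, Expr.val, e26] at hb
    have e : τ.reg 14 = hi := by omega
    rw [e] at h4 h5 h6
    exact ⟨by omega, h4, h5, h6⟩

/-- Mark the block in register `40` as not coloured. -/
def clearBlock : Program :=
  18 ⟵ A 8 (R 40) ;; 19 ⟵ A 8 (R 40 +ₑ K 1) ;; 14 ⟵ R 18 ;;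
  Program.loop (R 14 <ₑ R 19) (Program.store 10 (R 14) (R 0) ;; 14 ⟵ R 14 +ₑ K 1)

theorem runs_clearBlock {B : ℕ} {σ : State} (hlh : σ.arr 8 (σ.reg 40) ≤ σ.arr 8 (σ.reg 40 + 1))
    (hB : σ.arr 8 (σ.reg 40 + 1) ≤ B) (hk : σ.reg 0 ≤ B) :
    Runs B clearBlock σ fun m τ => m ≤ σ.arr 8 (σ.reg 40 + 1) - σ.arr 8 (σ.reg 40) ∧
      τ.reg 18 = σ.arr 8 (σ.reg 40) ∧ τ.reg 19 = σ.arr 8 (σ.reg 40 + 1) ∧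
      (∀ p, p < σ.arr 8 (σ.reg 40) ∨ σ.arr 8 (σ.reg 40 + 1) ≤ p → τ.arr 10 p = σ.arr 10 p) ∧
      (∀ p, σ.arr 8 (σ.reg 40) ≤ p → p < σ.arr 8 (σ.reg 40 + 1) → τ.arr 10 p = σ.reg 0) := by
  set lo := σ.arr 8 (σ.reg 40) with hlo
  set hi := σ.arr 8 (σ.reg 40 + 1) with hhi
  simp only [clearBlock, runs_seq, runs_assign, zero_add, Expr.val, State.setReg_reg,
    State.setReg_arr, Nat.reduceEqDiff, if_true, if_false, ← hlo, ← hhi]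
  refine ⟨by omega, by omega, by omega, ?_⟩
  refine runs_loop (fun m τ => lo ≤ τ.reg 14 ∧ τ.reg 14 ≤ hi ∧ m + lo = τ.reg 14 ∧
    (∀ p, p < lo ∨ τ.reg 14 ≤ p → τ.arr 10 p = σ.arr 10 p) ∧
    (∀ p, lo ≤ p → p < τ.reg 14 → τ.arr 10 p = σ.reg 0)) (fun τ => hi - τ.reg 14) ?_ ?_ ?_
  · simp only [State.setReg_reg, if_true, State.setReg_arr]
    exact ⟨le_rfl, hlh, by omega, fun _ _ => trivial, fun p _ _ => by omega⟩
  · intro m τ hs ⟨h1, h2, h3, h4, h5⟩ hb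
    have e19 : τ.reg 19 = hi := by rw [hs.reg 19 rfl]; simp
    have e0 : τ.reg 0 = σ.reg 0 := by rw [hs.reg 0 rfl]; simp
    simp only [Test.Holds, Expr.val, e19] at hb
    simp only [runs_seq, runs_store, runs_assign, Expr.val, State.setReg_reg, State.setArr_reg,
      if_true, State.setReg_arr, State.setArr_arr, e0]
    refine ⟨hk, by omega, ⟨by omega, by omega, by omega, fun p hp => ?_, fun p hp hp' => ?_⟩,
      by omega⟩
    · rw [Function.update_of_ne (by omega)]
      exact h4 p (by omega)
    · rcases eq_or_ne p (τ.reg 14) with rfl | hne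
      · rw [Function.update_self]
      · rw [Function.update_of_ne hne]
        exact h5 p hp (by omega)
  · intro m τ hs ⟨h1, h2, h3, h4, h5⟩ hb
    have e19 : τ.reg 19 = hi := by rw [hs.reg 19 rfl]; simp
    have e18 : τ.reg 18 = lo := by rw [hs.reg 18 rfl]; simp
    simp only [Test.Holds, Expr.val, e19] at hb
    have e : τ.reg 14 = hi := by omega
    rw [e] at h4 h5
    exact ⟨by omega, e18, e19, h4, h5⟩

/-- Colour everything except the window that is refined. -/
def refineCut : Program :=
  Program.branch (A 8 (R 40) <ₑ A 8 (R 39)) (42 ⟵ A 8 (R 40) +ₑ (R 26 -ₑ R 25) -ₑ A 8 (R 39))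
    (42 ⟵ A 8 (R 40) -ₑ A 8 (R 39)) ;;
  paint ;; clearBlock ;; 20 ⟵ A 8 (R 38) -ₑ A 8 (R 37) ;; chop ;; fill ;; 23 ⟵ R 37 ;; 24 ⟵ R 38

/-- Colour a cyclic interval and its complement. -/
def finishCut : Program :=
  39 ⟵ R 29 ;; 42 ⟵ R 17 ;; 37 ⟵ R 23 ;; 38 ⟵ R 23 ;; paint ;; 27 ⟵ K 1

variable {n N : ℕ} {par blk start : ℕ → ℕ} {B b₀ b₁ t : ℕ} {σ : State}

/-- The pieces of the target are allowed to be as large as the window. This is what makes the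
chopping cheap, and what makes the remaining number small enough to be cut off from the window. The
passes are one round of painting over all positions, and four rounds over the target. -/
theorem runs_refineCut (h : WindowState n N par blk start B b₀ b₁ t σ)
    (ht : t < start b₁ - start b₀)
    (hr : Refinement blk start b₀ b₁ t (σ.reg 37) (σ.reg 38) (σ.reg 39) (σ.reg 40))
    (h5 : σ.arr 5 = par) (hk : σ.reg 0 ≤ B) (hc₁ : σ.reg 21 ≤ B) (hc₂ : σ.reg 22 ≤ B)
    (hne : σ.reg 21 ≠ σ.reg 22) (hcB : ∀ p, σ.arr 10 p ≤ B) :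
    Runs B refineCut σ fun m τ => m ≤ 5 * (start b₁ - start b₀) ∧
      (∃ w mark rt, RefinedCut par start b₀ b₁ t (τ.reg 17) (σ.reg 37) (σ.reg 38) (σ.reg 39)
        (σ.reg 40) (σ.reg 21) (σ.reg 22) w mark rt (σ.arr 10) (τ.arr 10)) ∧
      τ.reg 17 ≤ start (σ.reg 38) - start (σ.reg 37) ∧ τ.reg 23 = σ.reg 37 ∧
      τ.reg 24 = σ.reg 38 ∧ ∀ p, τ.arr 10 p ≤ B := by
  have hT := h.blocks
  obtain ⟨g1, g2, g3, g4, g5, g6, g7, g8, g9, g10, g11, g12⟩ := hr.bounds hT h.le ht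
  have hsh := hT.shift_spec h.le ht hr.le_source hr.source_lt hr.target_eq
  have hb1 := h.le_bound le_rfl
  have hz₁ := h.le_bound hr.le_right
  have hzlt := hr.lt
  set z₀ := σ.reg 37 with hz₀_def
  set z₁ := σ.reg 38 with hz₁_def
  set a := σ.reg 39 with ha_def
  set l := σ.reg 40 with hl_def
  set len := cyclicDist (start b₀) (start b₁) (start a) (start l) with hlen
  rw [refineCut, runs_seq]
  have hlenr : Runs B (Program.branch (A 8 (R 40) <ₑ A 8 (R 39))
      (42 ⟵ A 8 (R 40) +ₑ (R 26 -ₑ R 25) -ₑ A 8 (R 39)) (42 ⟵ A 8 (R 40) -ₑ A 8 (R 39))) σ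
      fun m τ => m = 0 ∧ τ.reg 42 = len := by
    simp only [runs_branch, runs_assign, Test.Holds, Expr.val, State.setReg_reg, if_true,
      h.arr_start, h.reg_lo, h.reg_hi, ← ha_def, ← hl_def, hlen, cyclicDist, true_and]
    exact ⟨fun h => ⟨by omega, by rw [if_pos h]⟩, fun h => ⟨by omega, by rw [if_neg h]⟩⟩
  refine hlenr.mono fun m τ hs hq => ?_
  obtain ⟨rfl, e42⟩ := hq
  have hτ := h.of_same hs rfl rfl rfl rfl rfl rfl rfl
  have e37 : τ.reg 37 = z₀ := hs.reg 37 rfl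
  have e38 : τ.reg 38 = z₁ := hs.reg 38 rfl
  have e39 : τ.reg 39 = a := hs.reg 39 rfl
  have e40 : τ.reg 40 = l := hs.reg 40 rfl
  have e21 : τ.reg 21 = σ.reg 21 := hs.reg 21 rfl
  have e22 : τ.reg 22 = σ.reg 22 := hs.reg 22 rfl
  have e0 : τ.reg 0 = σ.reg 0 := hs.reg 0 rfl
  have e10 : τ.arr 10 = σ.arr 10 := hs.arr 10 rfl
  have e5 : τ.arr 5 = par := (hs.arr 5 rfl).trans h5
  have hcard := card_cyclicDist_lt g9 g10 (len := len) hsh.2.2.le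
  rw [Finset.card_filter] at hcard
  -- The window may overlap the cyclic interval. The part of the interval in the window stays
  -- uncoloured, and the missing vertices have to be supplied by the target and the window.
  have hsplit : len = (∑ p ∈ Finset.Ico (start b₀) (start b₁),
      if cyclicDist (start b₀) (start b₁) (start a) p < len ∧ ¬ (start z₀ ≤ p ∧ p < start z₁)
        then 1 else 0) + ∑ p ∈ Finset.Ico (start z₀) (start z₁),
      if cyclicDist (start b₀) (start b₁) (start a) p < len then 1 else 0 := by
    conv_lhs => rw [← hcard]
    rw [← sum_Ico_indicator g6 g8, ← Finset.sum_add_distrib]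
    refine Finset.sum_congr rfl fun p _ => ?_
    by_cases hz : start z₀ ≤ p ∧ p < start z₁ <;> simp [hz]
  have hzle : (∑ p ∈ Finset.Ico (start z₀) (start z₁),
      if cyclicDist (start b₀) (start b₁) (start a) p < len then 1 else 0) ≤
        start z₁ - start z₀ := by
    rw [← Finset.card_filter]
    exact (Finset.card_filter_le _ _).trans (Nat.card_Ico _ _).le
  have hp := runs_paint (B := B) (σ := τ)
  rw [hτ.reg_lo, hτ.reg_hi, hτ.reg_t, hτ.arr_start, e37, e38, e39, e42, e21, e22, e10] at hp
  rw [runs_seq]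
  refine (hp (by omega) (by omega) (by omega) hc₁ hc₂ (by omega)).mono fun m₁ τ₁ hs₁ hq => ?_
  obtain ⟨p1, p2, p3, p4⟩ := hq
  have q8 := (hs₁.arr 8 rfl).trans hτ.arr_start
  have q40 := (hs₁.reg 40 rfl).trans e40
  have q0 := (hs₁.reg 0 rfl).trans e0
  have hcl := runs_clearBlock (B := B) (σ := τ₁)
  rw [q8, q40, q0] at hcl
  rw [runs_seq]
  refine (hcl g4.le (by omega) hk).mono fun m₂ τ₂ hs₂ hq => ?_
  obtain ⟨r1, r18, r19, r4, r5⟩ := hq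
  have u37 : τ₂.reg 37 = z₀ := by rw [hs₂.reg 37 rfl, hs₁.reg 37 rfl, e37]
  have u38 : τ₂.reg 38 = z₁ := by rw [hs₂.reg 38 rfl, hs₁.reg 38 rfl, e38]
  have u8 := (hs₂.arr 8 rfl).trans q8
  have u0 := (hs₂.reg 0 rfl).trans q0
  have u5 : τ₂.arr 5 = par := by rw [hs₂.arr 5 rfl, hs₁.arr 5 rfl, e5]
  have u17 := hs₂.reg 17 rfl
  have u21 : τ₂.reg 21 = σ.reg 21 := by rw [hs₂.reg 21 rfl, hs₁.reg 21 rfl, e21]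
  have u22 : τ₂.reg 22 = σ.reg 22 := by rw [hs₂.reg 22 rfl, hs₁.reg 22 rfl, e22]
  rw [runs_seq, runs_assign]
  refine ⟨by simp only [Expr.val, u37, u38, u8]; omega, ?_⟩
  simp only [Expr.val, u37, u38, u8]
  have hch := runs_chop (B := B) (σ := τ₂.setReg 20 (start z₁ - start z₀))
  simp only [State.setReg_reg, State.setReg_arr, Nat.reduceEqDiff, if_true, if_false, r18, r19,
    u5, u0] at hch
  rw [runs_seq]
  refine (hch (by omega) g4.le (by omega)
    (hT.par_inner l (by have := h.le; omega))).mono fun m₃ τ₃ hs₃ hq => ?_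
  obtain ⟨c1, c2⟩ := hq
  have hS : (Finset.Ico (start l) (start (l + 1))).filter (fun p => τ₂.arr 10 p = σ.reg 0) =
      Finset.Ico (start l) (start (l + 1)) := by
    rw [Finset.filter_true_of_mem]
    intro p hp
    rw [Finset.mem_Ico] at hp
    exact r5 p hp.1 hp.2
  rw [hS] at c2
  have v18 : τ₃.reg 18 = start l := by rw [hs₃.reg 18 rfl]; simp [r18]
  have v19 : τ₃.reg 19 = start (l + 1) := by rw [hs₃.reg 19 rfl]; simp [r19]
  have v17 : τ₃.reg 17 = τ₁.reg 17 := by rw [hs₃.reg 17 rfl]; simp [u17]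
  have v21 : τ₃.reg 21 = σ.reg 21 := by rw [hs₃.reg 21 rfl]; simp [u21]
  have v22 : τ₃.reg 22 = σ.reg 22 := by rw [hs₃.reg 22 rfl]; simp [u22]
  have v0 : τ₃.reg 0 = σ.reg 0 := by rw [hs₃.reg 0 rfl]; simp [u0]
  have v37 : τ₃.reg 37 = z₀ := by rw [hs₃.reg 37 rfl]; simp [u37]
  have v38 : τ₃.reg 38 = z₁ := by rw [hs₃.reg 38 rfl]; simp [u38]
  have v10 : τ₃.arr 10 = τ₂.arr 10 := by rw [hs₃.arr 10 rfl]; simp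
  have v5 : τ₃.arr 5 = par := by rw [hs₃.arr 5 rfl]; simp [u5]
  have hfi := runs_fill (B := B) (σ := τ₃) (q := start z₁ - start z₀)
    (S := Finset.Ico (start l) (start (l + 1)))
  rw [v18, v19, v17, v21, v22, v0, v10, v5] at hfi
  have hcol2 : ∀ p, τ₂.arr 10 p ≤ B := by
    intro p
    by_cases hp : start l ≤ p ∧ p < start (l + 1)
    · rw [r5 p hp.1 hp.2]
      exact hk
    · rw [r4 p (by omega)]
      by_cases hp' : start b₀ ≤ p ∧ p < start b₁
      · rw [p3 p hp'.1 hp'.2]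
        split_ifs <;> assumption
      · rw [p2 p (by omega)]
        exact hcB p
  rw [runs_seq]
  refine (hfi (by omega) hc₁ hc₂ (by omega) g4.le hcol2 hne (fun p hp => (Finset.mem_Ico.1 hp).1)
    (fun p hp hp' _ => Finset.mem_Ico.2 ⟨hp, hp'⟩) c2 (fun c hc => ?_)).mono
      fun m₄ τ₄ hs₄ hq => ?_
  · have hpc := c2.par_lt hc
    have h1 := Finset.mem_Ico.1 hc.1
    have h2 := Finset.mem_Ico.1 hpc.1
    rw [r5 c h1.1 h1.2, r5 _ h2.1 h2.2]
  obtain ⟨f1, f2⟩ := hq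
  have w37 : τ₄.reg 37 = z₀ := by rw [hs₄.reg 37 rfl, v37]
  have w38 : τ₄.reg 38 = z₁ := by rw [hs₄.reg 38 rfl, v38]
  simp only [runs_seq, runs_assign, Expr.val, State.setReg_reg, State.setReg_arr,
    Nat.reduceEqDiff, if_true, if_false, w37, w38]
  have hcount : τ₁.reg 17 = τ₄.reg 17 + ∑ p ∈ Finset.Ico (start l) (start (l + 1)),
      if τ₄.arr 10 p = σ.reg 21 then 1 else 0 := by
    have h1 := f2.count
    rw [Finset.sum_eq_zero (s := Finset.Ico (start l) (start (l + 1)))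
      (f := fun c => if start (l + 1) ≤ c ∧ _ then τ₃.arr 11 c else 0), add_zero] at h1
    · rw [h1]
      congr 1
      refine Finset.sum_congr rfl fun p hp => ?_
      rw [Finset.mem_Ico] at hp
      simp [r5 p hp.1 hp.2]
    · intro c hc
      rw [Finset.mem_Ico] at hc
      rw [if_neg]
      omega
  refine ⟨by omega, by omega, by omega, ⟨_, _, _, ⟨fun p hp => ?_, fun p hp hp' hpl hpz => ?_,
    fun p hp hp' => f2.eq_or_eq p hp hp' (r5 p hp hp'), fun p hp => ?_, c2, ?_⟩⟩, ?_, trivial,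
        trivial, fun p => ?_⟩
  · rw [f2.eq_of_ge p (by omega), r4 p (by omega), p2 p hp]
  · rw [f2.eq_of_ge p (by omega), r4 p (by omega), p3 p hp hp']
    exact if_congr (and_iff_left hpz) rfl rfl
  · have h1 := Finset.mem_Ico.1 hp.1
    exact f2.attached p h1.1 h1.2 hp
  · rw [← hlen]
    omega
  -- Either a piece was refused, and fewer vertices are missing than the window has; or the whole
  -- target got the first colour. In the second case the shift ends inside the target, so the
  -- missing vertices are fewer than those by which the window overlaps the cyclic interval.
  · rcases f2.lt_or with h1 | h1
    · exact h1.le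
    · have h2 : ∑ p ∈ Finset.Ico (start l) (start (l + 1)),
          (if τ₄.arr 10 p = σ.reg 21 then 1 else 0) = start (l + 1) - start l := by
        rw [Finset.sum_congr rfl (g := fun _ => 1), Finset.sum_const, Nat.card_Ico, smul_eq_mul,
          mul_one]
        intro p hp
        rw [Finset.mem_Ico] at hp
        rw [if_pos (h1 p hp.1 hp.2 (r5 p hp.1 hp.2))]
      omega
  · by_cases hp : start l ≤ p ∧ p < start (l + 1)
    · rcases f2.eq_or_eq p hp.1 hp.2 (r5 p hp.1 hp.2) with h1 | h1 <;> rw [h1] <;> assumption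
    · rw [f2.eq_of_ge p (by omega)]
      exact hcol2 p

/-- One step of cutting off: reduce the task to a smaller window, or finish. -/
def cutStep : Program :=
  25 ⟵ A 8 (R 23) ;; 26 ⟵ A 8 (R 24) ;; scanRuns ;;
  Program.branch (Test.and (R 17 <ₑ R 26 -ₑ R 25)
      (K 4 *ₑ (R 26 -ₑ R 25) <ₑ R 28 *ₑ (R 24 -ₑ R 23)))
    (Program.branch (R 31 =ₑ K 0) scanClusters Program.skip ;; refineCut)
    finishCut

/-- Give the colour in register `21` to as many vertices of the blocks between the registers `23` and
`24` as register `17` says, and the colour in register `22` to the others. -/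
def cutOff : Program := 27 ⟵ K 0 ;; Program.loop (R 27 =ₑ K 0) cutStep

/-- The machine is ready for cutting off `t` vertices of the blocks from `b₀` to `b₁`. -/
structure CutReady (n N : ℕ) (par blk start : ℕ → ℕ) (B b₀ b₁ t c₁ c₂ : ℕ) (σ : State) :
    Prop where
  blocks : Blocks n N par blk start
  lt : b₀ < b₁
  le : b₁ ≤ N
  t_le : t ≤ start b₁ - start b₀
  bound : 2 * n + 2 ≤ B
  arr_par : σ.arr 5 = par
  arr_blk : σ.arr 7 = blk
  arr_start : σ.arr 8 = start
  reg_t : σ.reg 17 = t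
  reg_left : σ.reg 23 = b₀
  reg_right : σ.reg 24 = b₁
  reg_c₁ : σ.reg 21 = c₁
  reg_c₂ : σ.reg 22 = c₂
  ne : c₁ ≠ c₂
  k_le : σ.reg 0 ≤ B
  c₁_le : c₁ ≤ B
  c₂_le : c₂ ≤ B
  col_le : ∀ p, σ.arr 10 p ≤ B

variable {c₁ c₂ Δ : ℕ}

/-- If all vertices are wanted, one colour remains and nothing is cut. Otherwise the cyclic interval
begins at the block with the smallest target, and `innerCut_le_of_cyclic` applies. -/
theorem runs_finishCut (h : WindowState n N par blk start B b₀ b₁ t σ)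
    (hc : CutReady n N par blk start B b₀ b₁ t c₁ c₂ σ) (hΔ : 2 ≤ Δ)
    (hm : MinTarget blk start b₀ b₁ t b₁ (σ.reg 28) (σ.reg 29) (σ.reg 30))
    (hfin : t = start b₁ - start b₀ ∨ σ.reg 28 * (b₁ - b₀) ≤ 4 * (start b₁ - start b₀)) :
    Runs B finishCut σ fun m τ => m ≤ start b₁ - start b₀ ∧ τ.reg 27 = 1 ∧
      CutOff (start b₀) (start b₁) t c₁ c₂ (σ.arr 10) (τ.arr 10) ∧
      (b₁ - b₀) * innerCut par (τ.arr 10) (start b₀) (start b₁) ≤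
        7 * (start b₁ - start b₀) * Δ := by
  have hT := h.blocks
  have hl := hT.landing_spec h.le h.t_le hm.le_source hm.source_lt
  have hb := h.le_bound le_rfl
  have hb0 := h.le_bound h.lt.le
  have hba := h.le_bound hm.source_lt.le
  have ht := h.t_le
  have hcard := card_cyclicDist_lt hl.1 hl.2.1 h.t_le
  have hB1 : 1 ≤ B := by omega
  rw [Finset.card_filter] at hcard
  -- The window that `paint` spares is made empty.
  have hz : ∀ p, ¬ (start b₀ ≤ p ∧ p < start b₀) := fun p => by omega
  simp only [finishCut, runs_seq, runs_assign, Expr.val, State.setReg_reg, State.setReg_arr,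
    Nat.reduceEqDiff, if_true, if_false, h.reg_t, h.reg_left]
  refine ⟨by omega, by omega, by omega, by omega, ?_⟩
  have hp := runs_paint (B := B)
    (σ := (((σ.setReg 39 (σ.reg 29)).setReg 42 t).setReg 37 b₀).setReg 38 b₀)
  simp only [State.setReg_reg, State.setReg_arr, Nat.reduceEqDiff, if_true, if_false, h.reg_lo,
    h.reg_hi, h.reg_t, h.arr_start, hc.reg_c₁, hc.reg_c₂, hz, not_false_eq_true, and_true,
    hcard] at hp
  refine (hp (by omega) (by omega) (by omega) hc.c₁_le hc.c₂_le le_rfl).mono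
    fun m τ hs hq => ?_
  obtain ⟨p1, p2, p3, p4⟩ := hq
  refine ⟨hB1, by omega, trivial, ⟨p2, fun p hp hp' => ?_, ?_⟩, ?_⟩
  · rw [p3 p hp hp']
    split_ifs <;> simp
  · rw [← hcard]
    refine Finset.sum_congr rfl fun p hp => ?_
    rw [Finset.mem_Ico] at hp
    rw [p3 p hp.1 hp.2]
    by_cases hd : cyclicDist (start b₀) (start b₁) (start (σ.reg 29)) p < t
    · simp [hd]
    · simp [hd, hc.ne.symm]
  · rcases h.t_le.eq_or_lt with hfin | hlt
    · have h0 : innerCut par (τ.arr 10) (start b₀) (start b₁) = 0 := by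
        rw [innerCut, Finset.card_eq_zero, Finset.filter_eq_empty_iff]
        intro p hp
        rw [Finset.mem_Ioo] at hp
        have hn := hT.start_le_n h.le
        have hpar := hT.le_par (show p < n by omega) (show b₀ ≤ N by have := h.le; omega) hp.1
        have hpar' := hT.par_lt (show p < n by omega) (by omega)
        have hall : ∀ q, start b₀ ≤ q → q < start b₁ → τ.arr 10 q = c₁ := fun q hq hq' => by
          rw [p3 q hq hq', if_pos]
          unfold cyclicDist
          split_ifs <;> omega
        rw [hall p (by omega) (by omega), hall _ hpar (by omega)]
        simp
      rw [h0]
      simp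
    · have hs := hfin.resolve_left hlt.ne
      rw [hm.size_eq] at hs
      exact innerCut_le_of_cyclic hT h.le hlt hm.le_source hm.source_lt hm.target_eq p3 hs hΔ

/-- The result of cutting off `t` vertices. -/
structure CutDone (par start : ℕ → ℕ) (b₀ b₁ t c₁ c₂ Δ : ℕ) (col₀ col : ℕ → ℕ) : Prop where
  cutOff : CutOff (start b₀) (start b₁) t c₁ c₂ col₀ col
  cut_le : (b₁ - b₀) * innerCut par col (start b₀) (start b₁) ≤ 7 * (start b₁ - start b₀) * Δ

/-- Each of the two searches passes once over the blocks, of which there are at most `u = start b₁ -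
start b₀`; with the `5 * u` passes of the refinement this makes `7 * u`. The last clause says that
whatever colouring solves the smaller task solves the given one. -/
theorem runs_cutStep (hc : CutReady n N par blk start B b₀ b₁ t c₁ c₂ σ) (hΔ : 2 ≤ Δ)
    (hdeg : DegreeLE n par Δ) (h27 : σ.reg 27 = 0) :
    Runs B cutStep σ fun m τ => m ≤ 7 * (start b₁ - start b₀) ∧
      ((τ.reg 27 = 1 ∧ CutDone par start b₀ b₁ t c₁ c₂ Δ (σ.arr 10) (τ.arr 10)) ∨
      (τ.reg 27 = 0 ∧ ∃ b₀' b₁' t', 19 * (start b₁' - start b₀') ≤ 14 * (start b₁ - start b₀) ∧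
        start b₀' < start b₁' ∧ CutReady n N par blk start B b₀' b₁' t' c₁ c₂ τ ∧
        ∀ col, CutDone par start b₀' b₁' t' c₁ c₂ Δ (τ.arr 10) col →
          CutDone par start b₀ b₁ t c₁ c₂ Δ (σ.arr 10) col)) := by
  have hT := hc.blocks
  have hN := hT.start_add_le hc.lt.le hc.le
  have hn := hT.start_le_n hc.le
  have hB := hc.bound
  have hlt := hc.lt
  simp only [cutStep, runs_seq, runs_assign, Expr.val, State.setReg_reg, State.setReg_arr,
    Nat.reduceEqDiff, if_false, hc.reg_left, hc.reg_right, hc.arr_start, zero_add]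
  refine ⟨by omega, by omega, ?_⟩
  set σ₁ := (σ.setReg 25 (start b₀)).setReg 26 (start b₁) with hσ₁
  have hw : WindowState n N par blk start B b₀ b₁ t σ₁ := by
    refine ⟨hc.blocks, hc.lt, hc.le, hc.t_le, hc.bound, ?_, ?_, ?_, ?_, ?_, ?_, ?_⟩ <;>
      simp [hσ₁, hc.arr_blk, hc.arr_start, hc.reg_t, hc.reg_left, hc.reg_right]
  have hready : CutReady n N par blk start B b₀ b₁ t c₁ c₂ σ₁ :=
    ⟨hc.blocks, hc.lt, hc.le, hc.t_le, hc.bound, hc.arr_par, hc.arr_blk, hc.arr_start, hc.reg_t,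
      hc.reg_left, hc.reg_right, hc.reg_c₁, hc.reg_c₂, hc.ne, hc.k_le, hc.c₁_le, hc.c₂_le,
      hc.col_le⟩
  have ready_same : ∀ (p : Program) (τ τ' : State), Same p τ τ' → p.writesArr 5 = false →
      p.writesArr 7 = false → p.writesArr 8 = false → p.writesArr 10 = false →
      p.writesReg 17 = false → p.writesReg 23 = false → p.writesReg 24 = false →
      p.writesReg 21 = false → p.writesReg 22 = false → p.writesReg 0 = false →
      CutReady n N par blk start B b₀ b₁ t c₁ c₂ τ →
      CutReady n N par blk start B b₀ b₁ t c₁ c₂ τ' := by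
    intro p τ τ' hs a5 a7 a8 a10 r17 r23 r24 r21 r22 r0 h
    exact ⟨h.blocks, h.lt, h.le, h.t_le, h.bound, (hs.arr 5 a5).trans h.arr_par,
      (hs.arr 7 a7).trans h.arr_blk, (hs.arr 8 a8).trans h.arr_start, (hs.reg 17 r17).trans h.reg_t,
      (hs.reg 23 r23).trans h.reg_left, (hs.reg 24 r24).trans h.reg_right,
      (hs.reg 21 r21).trans h.reg_c₁, (hs.reg 22 r22).trans h.reg_c₂, h.ne,
      (hs.reg 0 r0).le.trans h.k_le, h.c₁_le, h.c₂_le, by rw [hs.arr 10 a10]; exact h.col_le⟩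
  refine (runs_scanRuns hw).mono fun m τ hs hq => ?_
  obtain ⟨hm, hI⟩ := hq
  have hτw := hw.of_same hs rfl rfl rfl rfl rfl rfl rfl
  have hτr := ready_same _ _ _ hs rfl rfl rfl rfl rfl rfl rfl rfl rfl rfl hready
  have hτ10 : τ.arr 10 = σ.arr 10 := hs.arr 10 rfl
  have hτ27 : τ.reg 27 = 0 := (hs.reg 27 rfl).trans h27
  have hmin := hI.min
  rw [show b₀ + (b₁ - b₀ - 1) + 1 = b₁ by omega] at hmin
  rw [runs_branch]
  simp only [Test.Holds, Expr.val, hτw.reg_t, hτw.reg_lo, hτw.reg_hi, hτw.reg_left,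
    hτw.reg_right]
  constructor
  · rintro ⟨ht, hsN⟩
    rw [runs_seq]
    have hscan : Runs B (Program.branch (R 31 =ₑ K 0) scanClusters Program.skip) τ fun m ρ =>
        m ≤ b₁ - b₀ ∧
          Refinement blk start b₀ b₁ t (ρ.reg 37) (ρ.reg 38) (ρ.reg 39) (ρ.reg 40) := by
      rw [runs_branch, runs_skip]
      simp only [Test.Holds, Expr.val]
      refine ⟨fun h0 => (runs_scanClusters hτw hmin h0).mono fun m' ρ _ hq => ⟨hq.1, ?_⟩,
        fun h0 => ⟨Nat.zero_le _, hI.found h0⟩⟩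
      by_contra hcon
      have h31 : ρ.reg 31 = 0 := by
        by_contra h31
        exact hcon (hq.2.found h31)
      exact exists_dense_window hT hc.le hc.lt ht hmin hsN
        (fun j hj => hI.not_found h0 j (by omega))
        (fun j hj => hq.2.not_found h31 j (by omega))
    refine hscan.mono fun m₁ ρ hs' hq => ?_
    obtain ⟨hm₁, hr⟩ := hq
    have hρw := hτw.of_same hs' rfl rfl rfl rfl rfl rfl rfl
    have hρr := ready_same _ _ _ hs' rfl rfl rfl rfl rfl rfl rfl rfl rfl rfl hτr
    have hρ10 : ρ.arr 10 = σ.arr 10 := (hs'.arr 10 rfl).trans hτ10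
    have hρ27 : ρ.reg 27 = 0 := (hs'.reg 27 rfl).trans hτ27
    refine (runs_refineCut hρw ht hr hρr.arr_par hρr.k_le (by rw [hρr.reg_c₁]; exact hρr.c₁_le)
      (by rw [hρr.reg_c₂]; exact hρr.c₂_le) (by rw [hρr.reg_c₁, hρr.reg_c₂]; exact hρr.ne)
      hρr.col_le).mono fun m₂ τ₂ hs₂ hq => ?_
    obtain ⟨hm₂, ⟨w, mark, rt, hcut⟩, ht', h23, h24, hcB⟩ := hq
    obtain ⟨g1, g2, g3, g4, g5, g6, g7, g8, g9, g10, g11, g12⟩ := hr.bounds hT hc.le ht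
    refine ⟨by omega, Or.inr ⟨(hs₂.reg 27 rfl).trans hρ27, _, _, _, ?_, g7,
      ⟨hT, hr.lt, hr.le_right.trans hc.le, ht', hc.bound, (hs₂.arr 5 rfl).trans hρr.arr_par,
        (hs₂.arr 7 rfl).trans hρr.arr_blk, (hs₂.arr 8 rfl).trans hρr.arr_start, rfl, h23, h24,
        (hs₂.reg 21 rfl).trans hρr.reg_c₁, (hs₂.reg 22 rfl).trans hρr.reg_c₂, hc.ne,
        (hs₂.reg 0 rfl).le.trans hρr.k_le, hc.c₁_le, hc.c₂_le, hcB⟩, fun col hcol => ?_⟩⟩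
    -- As the window has at most `b₁ - b₀` blocks, its density already bounds its number of
    -- vertices.
    · have h1 := hr.dense
      have h3 : ρ.reg 38 - ρ.reg 37 ≤ b₁ - b₀ := by
        have := hr.le_right
        have := hr.le_left
        omega
      refine Nat.le_of_mul_le_mul_left (a := _) (b := _) (c := b₁ - b₀) ?_ (by omega)
      calc (b₁ - b₀) * (19 * (start (ρ.reg 38) - start (ρ.reg 37)))
          ≤ _ := Nat.mul_le_mul_left _ (Nat.le_add_right _ _)
        _ ≤ _ := h1
        _ ≤ 14 * (start b₁ - start b₀) * (b₁ - b₀) := Nat.mul_le_mul_left _ h3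
        _ = _ := mul_comm _ _
    · rw [hρr.reg_c₁, hρr.reg_c₂, hρ10] at hcut
      exact ⟨hcut.toCutOff hT hc.le ht hr hcol.cutOff hc.ne,
        hcut.innerCut_le hT hc.le ht hr hcol.cutOff hΔ hdeg hcol.cut_le⟩
  · intro hcon
    refine (runs_finishCut hτw hτr hΔ hmin ?_).mono fun m₁ ρ _ hq => ?_
    · have := hc.t_le
      by_cases ht : t < start b₁ - start b₀
      · exact Or.inr (not_lt.1 fun h => hcon ⟨ht, h⟩)
      · exact Or.inl (by omega)
    · rw [hτ10] at hq
      exact ⟨by omega, Or.inl ⟨hq.2.1, hq.2.2.1, hq.2.2.2⟩⟩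

/-- A geometric series with ratio `14 / 19`: a step takes at most `7 * u` passes, and one more for
the loop itself, and `8 + 31 * 14 / 19 ≤ 31`. -/
theorem runs_cutOff (hc : CutReady n N par blk start B b₀ b₁ t c₁ c₂ σ) (hΔ : 2 ≤ Δ)
    (hdeg : DegreeLE n par Δ) :
    Runs B cutOff σ fun m τ => m ≤ 31 * (start b₁ - start b₀) ∧
      CutDone par start b₀ b₁ t c₁ c₂ Δ (σ.arr 10) (τ.arr 10) := by
  have key : ∀ d b₀ b₁ t (σ : State), start b₁ - start b₀ ≤ d → σ.reg 27 = 0 →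
      CutReady n N par blk start B b₀ b₁ t c₁ c₂ σ →
      Runs B (Program.loop (R 27 =ₑ K 0) cutStep) σ fun m τ => m ≤ 31 * (start b₁ - start b₀) ∧
        CutDone par start b₀ b₁ t c₁ c₂ Δ (σ.arr 10) (τ.arr 10) := by
    intro d
    induction d with
    | zero =>
      intro b₀ b₁ t σ hd h27 hc
      have := hc.blocks.start_add_le hc.lt.le hc.le
      have := hc.lt
      omega
    | succ d ih =>
      intro b₀ b₁ t σ hd h27 hc
      have hlt := hc.lt
      have hN := hc.blocks.start_add_le hc.lt.le hc.le
      refine runs_loop_of_true h27 ((runs_cutStep hc hΔ hdeg h27).mono fun m τ _ hq => ?_)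
      obtain ⟨hm, ⟨h1, h2⟩ | ⟨h0, b₀', b₁', t', h1, h2, h3, h4⟩⟩ := hq
      · refine runs_loop_of_false ?_ ⟨by omega, h2⟩
        simp [Test.Holds, Expr.val, h1]
      · refine (ih b₀' b₁' t' τ (by omega) h0 h3).mono fun l ρ _ hq => ⟨?_, h4 _ hq.2⟩
        have := hq.1
        omega
  have hB := hc.bound
  simp only [cutOff, runs_seq, runs_assign, Expr.val, zero_add]
  refine ⟨by omega, key _ b₀ b₁ t _ le_rfl (by simp) ?_⟩
  exact ⟨hc.blocks, hc.lt, hc.le, hc.t_le, hc.bound, hc.arr_par, hc.arr_blk, hc.arr_start, hc.reg_t,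
      hc.reg_left, hc.reg_right, hc.reg_c₁, hc.reg_c₂, hc.ne, hc.k_le, hc.c₁_le, hc.c₂_le,
      hc.col_le⟩

end RAM


/-! ### Distances in a tree that is given by parents -/

/-- The distance of two vertices in the tree in which `par p` is the parent of `p`. -/
def treeDist (par : ℕ → ℕ) (p q : ℕ) : ℕ :=
  if p = q then 0
  else if p < q then if par q < q then treeDist par p (par q) + 1 else 0
  else if par p < p then treeDist par (par p) q + 1 else 0
termination_by p + q

section

variable {par : ℕ → ℕ} {n : ℕ}

theorem treeDist_self (p : ℕ) : treeDist par p p = 0 := by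
  rw [treeDist, if_pos rfl]

theorem treeDist_right {p q : ℕ} (h : p < q) (hq : par q < q) :
    treeDist par p q = treeDist par p (par q) + 1 := by
  rw [treeDist, if_neg h.ne, if_pos h, if_pos hq]

theorem treeDist_left {p q : ℕ} (h : q < p) (hp : par p < p) :
    treeDist par p q = treeDist par (par p) q + 1 := by
  rw [treeDist, if_neg h.ne', if_neg h.not_gt, if_pos hp]

theorem treeDist_comm (hpar : ∀ p, 0 < p → p < n → par p < p) :
    ∀ p q, p < n → q < n → treeDist par p q = treeDist par q p := by
  have key : ∀ m p q, p + q = m → p < n → q < n → treeDist par p q = treeDist par q p := by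
    intro m
    induction m using Nat.strong_induction_on with
    | _ m ih =>
      intro p q hm hp hq
      rcases lt_trichotomy p q with h | rfl | h
      · have h1 := hpar q (by omega) hq
        rw [treeDist_right h h1, treeDist_left h h1, ih (p + par q) (by omega) p (par q) rfl hp
          (by omega)]
      · rfl
      · have h1 := hpar p (by omega) hp
        rw [treeDist_left h h1, treeDist_right h h1, ih (par p + q) (by omega) (par p) q rfl
          (by omega) hq]
  exact fun p q => key _ p q rfl

/-- Induction on the sum of the indices. Of three different indices the largest is replaced by its
parent, which shortens both distances from it by one. -/
theorem treeDist_triangle (hpar : ∀ p, 0 < p → p < n → par p < p) :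
    ∀ x y z, x < n → y < n → z < n → treeDist par x z ≤ treeDist par x y + treeDist par y z := by
  have key : ∀ m x y z, x + y + z = m → x < n → y < n → z < n →
      treeDist par x z ≤ treeDist par x y + treeDist par y z := by
    intro m
    induction m using Nat.strong_induction_on with
    | _ m ih =>
      intro x y z hm hx hy hz
      by_cases hxy : x = y
      · subst hxy
        omega
      by_cases hyz : y = z
      · subst hyz
        omega
      by_cases hxz : x = z
      · subst hxz
        rw [treeDist_self]
        omega
      by_cases hx' : y < x ∧ z < x
      · have h1 := hpar x (by omega) hx
        have h2 := ih (par x + y + z) (by omega) (par x) y z rfl (by omega) hy hz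
        rw [treeDist_left hx'.1 h1, treeDist_left hx'.2 h1]
        omega
      by_cases hy' : x < y ∧ z < y
      · have h1 := hpar y (by omega) hy
        have h2 := ih (x + par y + z) (by omega) x (par y) z rfl hx (by omega) hz
        rw [treeDist_right hy'.1 h1, treeDist_left hy'.2 h1]
        omega
      · have h1 := hpar z (by omega) hz
        have h2 := ih (x + y + par z) (by omega) x y (par z) rfl hx hy (by omega)
        rw [treeDist_right (show x < z by omega) h1, treeDist_right (show y < z by omega) h1]
        omega
  exact fun x y z => key _ x y z rfl

/-- The four-point condition. -/
theorem treeDist_four_point (hpar : ∀ p, 0 < p → p < n → par p < p) :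
    ∀ x y z w, x < n → y < n → z < n → w < n →
      treeDist par x y + treeDist par z w ≤
        max (treeDist par x z + treeDist par y w) (treeDist par x w + treeDist par y z) := by
  have key : ∀ m x y z w, x + y + z + w = m → x < n → y < n → z < n → w < n →
      treeDist par x y + treeDist par z w ≤
        max (treeDist par x z + treeDist par y w) (treeDist par x w + treeDist par y z) := by
    intro m
    induction m using Nat.strong_induction_on with
    | _ m ih =>
      intro x y z w hm hx hy hz hw
      have hcomm := treeDist_comm hpar
      have htri := treeDist_triangle hpar
      -- If two of the points coincide, the condition is a triangle inequality or one of the two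
      -- sums on the right.
      by_cases hxy : x = y
      · subst hxy
        have h1 := htri z x w hz hx hw
        have h2 := hcomm x z hx hz
        rw [treeDist_self]
        omega
      by_cases hzw : z = w
      · subst hzw
        have h1 := htri x z y hx hz hy
        have h2 := hcomm y z hy hz
        rw [treeDist_self]
        omega
      by_cases hxz : x = z
      · subst hxz
        have := hcomm x y hx hy
        omega
      by_cases hyw : y = w
      · subst hyw
        have := hcomm y z hy hz
        omega
      by_cases hxw : x = w
      · subst hxw
        have := hcomm x y hx hy
        have := hcomm z x hz hx
        omega
      by_cases hyz : y = z
      · subst hyz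
        omega
      -- The largest index occurs exactly once in each of the three sums; replacing it by its parent
      -- lowers all of them by one.
      by_cases hx' : y < x ∧ z < x ∧ w < x
      · have h1 := hpar x (by omega) hx
        have h2 := ih _ (by omega) (par x) y z w rfl (by omega) hy hz hw
        rw [treeDist_left hx'.1 h1, treeDist_left hx'.2.1 h1, treeDist_left hx'.2.2 h1]
        omega
      by_cases hy' : x < y ∧ z < y ∧ w < y
      · have h1 := hpar y (by omega) hy
        have h2 := ih _ (by omega) x (par y) z w rfl hx (by omega) hz hw
        rw [treeDist_right hy'.1 h1, treeDist_left hy'.2.1 h1, treeDist_left hy'.2.2 h1]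
        omega
      by_cases hz' : x < z ∧ y < z ∧ w < z
      · have h1 := hpar z (by omega) hz
        have h2 := ih _ (by omega) x y (par z) w rfl hx hy (by omega) hw
        rw [treeDist_right hz'.1 h1, treeDist_right hz'.2.1 h1, treeDist_left hz'.2.2 h1]
        omega
      · have h1 := hpar w (by omega) hw
        have h2 := ih _ (by omega) x y z (par w) rfl hx hy hz (by omega)
        rw [treeDist_right (show x < w by omega) h1, treeDist_right (show y < w by omega) h1,
          treeDist_right (show z < w by omega) h1]
        omega
  exact fun x y z w => key _ x y z w rfl

theorem treeDist_zero_left {D : ℕ → ℕ} (hpar : ∀ p, 0 < p → p < n → par p < p) (h0 : D 0 = 0)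
    (hD : ∀ p, 0 < p → p < n → D p = D (par p) + 1) : ∀ p < n, treeDist par 0 p = D p := by
  intro p
  induction p using Nat.strong_induction_on with
  | _ p ih =>
    intro hp
    rcases Nat.eq_zero_or_pos p with rfl | hpos
    · rw [treeDist_self, h0]
    · have h1 := hpar p hpos hp
      rw [treeDist_right hpos h1, ih _ h1 (by omega), hD p hpos hp]

end

/-! ### Orders of the vertices of a tree -/

/-- The vertices of `T` are `vert 0, …, vert (n - 1)`, and every vertex but the first is joined to an
earlier one, its parent. -/
structure TreeOrder {V : Type*} [Fintype V] (T : SimpleGraph V) (n : ℕ) (vert : ℕ → V)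
    (par : ℕ → ℕ) : Prop where
  card : Fintype.card V = n
  inj : ∀ p < n, ∀ q < n, vert p = vert q → p = q
  par_lt : ∀ p, 0 < p → p < n → par p < p
  adj : ∀ p, 0 < p → p < n → T.Adj (vert p) (vert (par p))

namespace TreeOrder

variable {V : Type*} [Fintype V] {T : SimpleGraph V} {n : ℕ} {vert : ℕ → V} {par : ℕ → ℕ}

theorem surj (h : TreeOrder T n vert par) (v : V) : ∃ p < n, vert p = v := by
  classical
  have h1 : (Finset.range n).image vert = Finset.univ := by
    rw [← Finset.card_eq_iff_eq_univ, Finset.card_image_of_injOn, Finset.card_range, h.card]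
    intro p hp q hq
    simp only [Finset.coe_range, Set.mem_Iio] at hp hq
    exact h.inj p hp q hq
  have h2 : v ∈ (Finset.range n).image vert := h1 ▸ Finset.mem_univ v
  simpa using h2

theorem parent_edge_inj (h : TreeOrder T n vert par) {p q : ℕ} (hp0 : 0 < p) (hp : p < n)
    (hq0 : 0 < q) (hq : q < n)
    (he : s(vert p, vert (par p)) = s(vert q, vert (par q))) : p = q := by
  have h1 := h.par_lt p hp0 hp
  have h2 := h.par_lt q hq0 hq
  rw [Sym2.eq_iff] at he
  rcases he with he | he
  · exact h.inj p hp q hq he.1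
  · have h3 := h.inj p hp _ (by omega) he.1
    have h4 := h.inj _ (by omega) q hq he.2
    omega

/-- The `n - 1` edges to parents are different, and a tree has no more edges than these. -/
theorem exists_of_mem_edgeSet (h : TreeOrder T n vert par) (hT : T.IsTree) {e : Sym2 V}
    (he : e ∈ T.edgeSet) : ∃ p, 0 < p ∧ p < n ∧ e = s(vert p, vert (par p)) := by
  classical
  have h1 : (Finset.Ico 1 n).image (fun p => s(vert p, vert (par p))) = T.edgeFinset := by
    refine Finset.eq_of_subset_of_card_le ?_ ?_
    · intro e he
      simp only [Finset.mem_image, Finset.mem_Ico] at he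
      obtain ⟨p, hp, rfl⟩ := he
      rw [SimpleGraph.mem_edgeFinset, SimpleGraph.mem_edgeSet]
      exact h.adj p hp.1 hp.2
    · rw [Finset.card_image_of_injOn, Nat.card_Ico]
      · have := hT.card_edgeFinset
        rw [h.card] at this
        omega
      · intro p hp q hq heq
        simp only [Finset.coe_Ico, Set.mem_Ico] at hp hq
        exact h.parent_edge_inj hp.1 hp.2 hq.1 hq.2 heq
  rw [← SimpleGraph.mem_edgeFinset, ← h1] at he
  simp only [Finset.mem_image, Finset.mem_Ico] at he
  obtain ⟨p, hp, hpe⟩ := he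
  exact ⟨p, hp.1, hp.2, hpe.symm⟩

theorem dist_le (h : TreeOrder T n vert par) (hT : T.Connected) :
    ∀ p q, p < n → q < n → T.dist (vert p) (vert q) ≤ treeDist par p q := by
  have key : ∀ m p q, p + q = m → p < n → q < n →
      T.dist (vert p) (vert q) ≤ treeDist par p q := by
    intro m
    induction m using Nat.strong_induction_on with
    | _ m ih =>
      intro p q hm hp hq
      rcases lt_trichotomy p q with hlt | rfl | hlt
      · have h1 := h.par_lt q (by omega) hq
        rw [treeDist_right hlt h1]
        have h2 := ih _ (by omega) p (par q) rfl hp (by omega)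
        have h3 := hT.dist_triangle (u := vert p) (v := vert (par q)) (w := vert q)
        rw [SimpleGraph.dist_eq_one_iff_adj.2 (h.adj q (by omega) hq).symm] at h3
        omega
      · simp
      · have h1 := h.par_lt p (by omega) hp
        rw [treeDist_left hlt h1]
        have h2 := ih _ (by omega) (par p) q rfl (by omega) hq
        have h3 := hT.dist_triangle (u := vert p) (v := vert (par p)) (w := vert q)
        rw [SimpleGraph.dist_eq_one_iff_adj.2 (h.adj p (by omega) hp)] at h3
        omega
  exact fun p q => key _ p q rfl

theorem treeDist_le_of_adj (h : TreeOrder T n vert par) (hT : T.IsTree) {x p q : ℕ} (hx : x < n)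
    (hp : p < n) (hq : q < n) (hpq : T.Adj (vert p) (vert q)) :
    treeDist par x q ≤ treeDist par x p + 1 := by
  obtain ⟨r, hr0, hr, he⟩ := h.exists_of_mem_edgeSet hT (SimpleGraph.mem_edgeSet _ |>.2 hpq)
  have h1 := h.par_lt r hr0 hr
  have h2 := treeDist_triangle h.par_lt x p q hx hp hq
  have h3 : treeDist par r (par r) = 1 := by
    rw [treeDist_left h1 h1, treeDist_self]
  have h4 : treeDist par (par r) r = 1 := by
    rw [treeDist_right h1 h1, treeDist_self]
  rw [Sym2.eq_iff] at he
  rcases he with he | he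
  · obtain rfl := h.inj p hp r hr he.1
    rw [h.inj q hq _ (by omega) he.2] at h2 ⊢
    omega
  · obtain rfl := h.inj q hq r hr he.2
    rw [h.inj p hp _ (by omega) he.1] at h2 ⊢
    omega

/-- Searching the tree from a vertex that is farthest from some vertex yields its diameter. -/
theorem diam_le {vert' : ℕ → V} {par' D D' : ℕ → ℕ} (h : TreeOrder T n vert par)
    (h' : TreeOrder T n vert' par') (hT : T.IsTree) (hn : 0 < n) (h0 : D 0 = 0)
    (hD : ∀ p, 0 < p → p < n → D p = D (par p) + 1)
    (hD' : ∀ p, 0 < p → p < n → D' p = D' (par' p) + 1)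
    (hmax : ∀ p < n, D p ≤ D (n - 1)) (hmax' : ∀ p < n, D' p ≤ D' (n - 1))
    (hroot : vert' 0 = vert (n - 1)) : T.diam ≤ D' (n - 1) := by
  have hne : Nonempty V := ⟨vert 0⟩
  obtain ⟨u, v, huv⟩ := T.exists_dist_eq_diam
  rw [← huv]
  obtain ⟨x, hx, rfl⟩ := h.surj u
  obtain ⟨y, hy, rfl⟩ := h.surj v
  refine (h.dist_le hT.connected x y hx hy).trans ?_
  -- Going down one edge of the second search tree increases the distance by at most one, so the
  -- depths there bound the distances from its root, measured in the first tree. Upper bounds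
  -- suffice, since only an upper bound for the diameter is wanted.
  have key : ∀ p < n, ∀ q < n, vert q = vert' p → treeDist par (n - 1) q ≤ D' p := by
    intro p
    induction p using Nat.strong_induction_on with
    | _ p ih =>
      intro hp q hq hqp
      rcases Nat.eq_zero_or_pos p with rfl | hpos
      · rw [hroot] at hqp
        rw [h.inj q hq _ (by omega) hqp, treeDist_self]
        exact Nat.zero_le _
      · have h1 := h'.par_lt p hpos hp
        obtain ⟨r, hr, hrp⟩ := h.surj (vert' (par' p))
        have h2 := ih _ h1 (by omega) r hr hrp
        have h3 := h'.adj p hpos hp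
        rw [← hqp, ← hrp] at h3
        have h4 := h.treeDist_le_of_adj hT (show n - 1 < n by omega) hr hq h3.symm
        rw [hD' p hpos hp]
        omega
  have key' : ∀ q < n, treeDist par (n - 1) q ≤ D' (n - 1) := fun q hq => by
    obtain ⟨p, hp, hpq⟩ := h'.surj (vert q)
    exact (key p hp q hq hpq.symm).trans (hmax' p hp)
  -- The vertex `n - 1` is farthest from the root, so its distance to `0` cancels against the
  -- distance of `x` or of `y` to `0`. What remains is that `x` and `y` are at most as far apart as
  -- one of them is from `n - 1`.
  have h1 := treeDist_four_point h.par_lt x y (n - 1) 0 hx hy (by omega) hn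
  have h2 := treeDist_zero_left h.par_lt h0 hD
  have h3 := treeDist_comm h.par_lt
  rw [h3 (n - 1) 0 (by omega) hn, h3 y 0 hy hn, h3 x 0 hx hn, h2 _ (by omega), h2 _ hx, h2 _ hy,
    h3 x (n - 1) hx (by omega), h3 y (n - 1) hy (by omega)] at h1
  have h4 := hmax x hx
  have h5 := hmax y hy
  have h6 := key' x hx
  have h7 := key' y hy
  omega

/-- An edge is named by its lower end. The name of an edge to a child is sent to the child, and `p`
itself to its parent; the root has no name for an edge upwards. -/
theorem card_le_maxDegree [DecidableRel T.Adj] (h : TreeOrder T n vert par) {p : ℕ} (hp : p < n) :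
    ((Finset.Ico 1 n).filter fun q => q = p ∨ par q = p).card ≤ T.maxDegree := by
  classical
  refine le_trans ?_ (T.degree_le_maxDegree (vert p))
  rw [← SimpleGraph.card_neighborFinset_eq_degree]
  refine Finset.card_le_card_of_injOn (fun q => if q = p then vert (par p) else vert q) ?_ ?_
  · intro q hq
    simp only [Finset.coe_filter, Finset.mem_Ico, Set.mem_ofPred_eq] at hq
    simp only [Finset.mem_coe, SimpleGraph.mem_neighborFinset]
    split_ifs with hqp
    · exact h.adj p (by omega) hp
    · have h1 := h.adj q (by omega) hq.1.2
      rw [hq.2.resolve_left hqp] at h1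
      exact h1.symm
  · intro q hq r hr hqr
    simp only [Finset.coe_filter, Finset.mem_Ico, Set.mem_ofPred_eq] at hq hr
    have h1 := h.par_lt q (by omega) hq.1.2
    have h2 := h.par_lt r (by omega) hr.1.2
    simp only at hqr
    split_ifs at hqr with h3 h4 h4
    · omega
    · subst h3
      have := h.inj _ (by omega) r hr.1.2 hqr
      omega
    · subst h4
      have := h.inj q hq.1.2 _ (by omega) hqr
      omega
    · exact h.inj q hq.1.2 r hr.1.2 hqr

theorem cutWidth_le {k : ℕ} {P : Fin k → Finset V} {col : ℕ → ℕ} (h : TreeOrder T n vert par)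
    (hT : T.IsTree) (hP : ∀ (l : Fin k) (p : ℕ), p < n → vert p ∈ P l → col p = l) :
    cutWidth T P ≤ ((Finset.Ico 1 n).filter fun p => col p ≠ col (par p)).card := by
  classical
  rw [cutWidth]
  refine le_trans (Set.ncard_le_ncard (t := (((Finset.Ico 1 n).filter fun p =>
    col p ≠ col (par p)).image fun p => s(vert p, vert (par p)) : Finset (Sym2 V))) ?_
    (Finset.finite_toSet _)) ?_
  · rintro e ⟨he, i, j, hij, v, w, rfl, hv, hw⟩
    obtain ⟨p, hp0, hp, hpe⟩ := h.exists_of_mem_edgeSet hT he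
    have hlt := h.par_lt p hp0 hp
    simp only [Finset.coe_image, Set.mem_image, Finset.coe_filter, Finset.mem_Ico,
        Set.mem_ofPred_eq]
    refine ⟨p, ⟨⟨hp0, hp⟩, fun hc => hij ?_⟩, hpe.symm⟩
    rw [Sym2.eq_iff] at hpe
    rcases hpe with ⟨rfl, rfl⟩ | ⟨rfl, rfl⟩
    · rw [hP i p hp hv, hP j _ (by omega) hw] at hc
      exact Fin.ext hc
    · rw [hP j p hp hw, hP i _ (by omega) hv] at hc
      exact Fin.ext hc.symm
  · rw [Set.ncard_coe_finset]
    exact Finset.card_image_le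

theorem cutWidth_lt {k : ℕ} {P : Fin k → Finset V} (h : TreeOrder T n vert par) (hT : T.IsTree) :
    cutWidth T P < n := by
  classical
  have h1 := hT.card_edgeFinset
  rw [h.card] at h1
  refine lt_of_le_of_lt (Set.ncard_le_ncard (t := (T.edgeFinset : Set (Sym2 V))) ?_
    (Finset.finite_toSet _)) ?_
  · rintro e ⟨he, -⟩
    simpa using he
  · rw [Set.ncard_coe_finset]
    omega

end TreeOrder


/-! ### Traversing the tree -/

namespace RAM

/-- The vertex `u` is in the adjacency list of `v`, where the list is stored in `al` from position
`off v` to `off (v + 1)`. -/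
def Listed (off al : ℕ → ℕ) (v u : ℕ) : Prop := ∃ e, off v ≤ e ∧ e < off (v + 1) ∧ al e = u

/-- The state of a breadth-first search from `root`, where `s` vertices have been listed before, and
the vertices in the queue are those between `head` and `tail`. -/
structure BfsInv (n : ℕ) (off al : ℕ → ℕ) (s root r b : ℕ) (ord₀ par₀ blk₀ vis₀ : ℕ → ℕ)
    (head tail : ℕ) (ord par depth blk vis : ℕ → ℕ) : Prop where
  le_head : s ≤ head
  head_le : head ≤ tail
  lt_tail : s < tail
  ord_old : ∀ p < s, ord p = ord₀ p
  par_old : ∀ p < s, par p = par₀ p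
  blk_old : ∀ p < s, blk p = blk₀ p
  ord_root : ord s = root
  par_root : par s = r
  depth_root : depth s = 0
  ord_lt : ∀ p, s ≤ p → p < tail → ord p < n
  blk_eq : ∀ p, s ≤ p → p < tail → blk p = b
  par_mem : ∀ p, s < p → p < tail → s ≤ par p ∧ par p < p
  listed : ∀ p, s < p → p < tail → Listed off al (ord (par p)) (ord p)
  depth_eq : ∀ p, s < p → p < tail → depth p = depth (par p) + 1
  vis₀_eq : ∀ p, s < p → p < tail → vis₀ (ord p) = 0
  depth_mono : ∀ p q, s ≤ p → p ≤ q → q < tail → depth p ≤ depth q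
  depth_le : ∀ p, s ≤ p → p < tail → head < tail → depth p ≤ depth head + 1
  depth_le_self : ∀ p, s ≤ p → p < tail → depth p ≤ p
  vis_iff : ∀ v, vis v ≠ 0 ↔ vis₀ v ≠ 0 ∨ ∃ p, s ≤ p ∧ p < tail ∧ ord p = v
  inj : ∀ p q, s ≤ p → p < tail → s ≤ q → q < tail → ord p = ord q → p = q
  closed : ∀ p, s ≤ p → p < head → ∀ v, Listed off al (ord p) v → vis v ≠ 0

variable {n : ℕ} {off al : ℕ → ℕ} {s root r b : ℕ} {ord₀ par₀ blk₀ vis₀ : ℕ → ℕ}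
  {head tail : ℕ} {ord par depth blk vis : ℕ → ℕ}

/-- The reference array already has the mark of the root, so the root need not be unvisited before
the search. This matters for the blocks: all vertices of the path are marked in advance, to keep the
searches apart. -/
theorem BfsInv.init (hroot : root < n) :
    BfsInv n off al s root r b ord₀ par₀ blk₀ (Function.update vis₀ root 1) s (s + 1)
      (Function.update ord₀ s root) (Function.update par₀ s r) (Function.update depth s 0)
      (Function.update blk₀ s b) (Function.update vis₀ root 1) := by
  have key : ∀ p, s ≤ p → p < s + 1 → p = s := fun p h1 h2 => by omega
  refine ⟨le_rfl, s.le_succ, s.lt_succ_self, fun p hp => ?_, fun p hp => ?_, fun p hp => ?_,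
    Function.update_self .., Function.update_self .., Function.update_self .., fun p h1 h2 => ?_,
    fun p h1 h2 => ?_, fun p h1 h2 => by omega, fun p h1 h2 => by omega, fun p h1 h2 => by omega,
    fun p h1 h2 => by omega, fun p q h1 h2 h3 => ?_, fun p h1 h2 _ => ?_, fun p h1 h2 => ?_,
    fun v => ⟨Or.inl, ?_⟩, fun p q h1 h2 h3 h4 _ => by omega, fun p h1 h2 => by omega⟩
  · rw [Function.update_of_ne (by omega)]
  · rw [Function.update_of_ne (by omega)]
  · rw [Function.update_of_ne (by omega)]
  · rw [key p h1 h2, Function.update_self]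
    exact hroot
  · rw [key p h1 h2, Function.update_self]
  · rw [key p h1 (by omega), key q (by omega) h3]
  · rw [key p h1 h2]
    exact Nat.le_succ _
  · rw [key p h1 h2, Function.update_self]
    exact Nat.zero_le _
  · rintro (h | ⟨p, h1, h2, rfl⟩)
    · exact h
    · rw [key p h1 h2, Function.update_self, Function.update_self]
      exact one_ne_zero

theorem BfsInv.tail_le (h : BfsInv n off al s root r b ord₀ par₀ blk₀ vis₀ head tail ord par depth
    blk vis) : tail ≤ s + n := by
  have h1 := Finset.card_le_card_of_injOn (s := Finset.Ico s tail) (t := Finset.range n) ord ?_ ?_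
  · rw [Nat.card_Ico, Finset.card_range] at h1
    omega
  · intro p hp
    simp only [Finset.coe_Ico, Set.mem_Ico] at hp
    simpa using h.ord_lt p hp.1 hp.2
  · intro p hp q hq hpq
    simp only [Finset.coe_Ico, Set.mem_Ico] at hp hq
    exact h.inj p q hp.1 hp.2 hq.1 hq.2 hpq

/-- Depths in the queue are monotone and exceed that of the head by at most one. So the new depth,
one more than that of the head, is the largest, and may be appended. -/
theorem BfsInv.push (h : BfsInv n off al s root r b ord₀ par₀ blk₀ vis₀ head tail ord par depth
    blk vis) {u : ℕ} (hht : head < tail) (hu : vis u = 0) (hun : u < n)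
    (hl : Listed off al (ord head) u) :
    BfsInv n off al s root r b ord₀ par₀ blk₀ vis₀ head (tail + 1) (Function.update ord tail u)
      (Function.update par tail head) (Function.update depth tail (depth head + 1))
      (Function.update blk tail b) (Function.update vis u 1) := by
  have hsh := h.le_head
  have hst := h.lt_tail
  have hnew : vis₀ u = 0 ∧ ∀ p, s ≤ p → p < tail → ord p ≠ u := by
    have := (h.vis_iff u).not.1 (not_not.2 hu)
    push Not at this
    exact ⟨this.1, fun p h1 h2 => this.2 p h1 h2⟩
  have key : ∀ p, p < tail + 1 → p = tail ∨ p < tail := fun p hp => by omega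
  refine ⟨h.le_head, by omega, by omega, fun p hp => ?_, fun p hp => ?_, fun p hp => ?_,
    ?_, ?_, ?_, fun p h1 h2 => ?_, fun p h1 h2 => ?_, fun p h1 h2 => ?_, fun p h1 h2 => ?_,
    fun p h1 h2 => ?_, fun p h1 h2 => ?_, fun p q h1 h2 h3 => ?_, fun p h1 h2 _ => ?_,
    fun p h1 h2 => ?_, fun v => ?_, fun p q h1 h2 h3 h4 h5 => ?_, fun p h1 h2 v hv => ?_⟩
  · rw [Function.update_of_ne (by omega), h.ord_old p hp]
  · rw [Function.update_of_ne (by omega), h.par_old p hp]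
  · rw [Function.update_of_ne (by omega), h.blk_old p hp]
  · rw [Function.update_of_ne (by omega), h.ord_root]
  · rw [Function.update_of_ne (by omega), h.par_root]
  · rw [Function.update_of_ne (by omega), h.depth_root]
  · rcases key p h2 with rfl | h3
    · rwa [Function.update_self]
    · rw [Function.update_of_ne h3.ne]
      exact h.ord_lt p h1 h3
  · rcases key p h2 with rfl | h3
    · rw [Function.update_self]
    · rw [Function.update_of_ne h3.ne]
      exact h.blk_eq p h1 h3
  · rcases key p h2 with rfl | h3
    · rw [Function.update_self]
      omega
    · rw [Function.update_of_ne h3.ne]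
      exact h.par_mem p h1 h3
  · rcases key p h2 with rfl | h3
    · rw [Function.update_self, Function.update_self, Function.update_of_ne hht.ne]
      exact hl
    · have h4 := h.par_mem p h1 h3
      rw [Function.update_of_ne (a := p) h3.ne, Function.update_of_ne (a := p) h3.ne,
        Function.update_of_ne (by omega)]
      exact h.listed p h1 h3
  · rcases key p h2 with rfl | h3
    · rw [Function.update_self, Function.update_self, Function.update_of_ne hht.ne]
    · have h4 := h.par_mem p h1 h3
      rw [Function.update_of_ne (a := p) h3.ne, Function.update_of_ne (a := p) h3.ne,
        Function.update_of_ne (by omega)]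
      exact h.depth_eq p h1 h3
  · rcases key p h2 with rfl | h3
    · rw [Function.update_self]
      exact hnew.1
    · rw [Function.update_of_ne h3.ne]
      exact h.vis₀_eq p h1 h3
  · rcases key q h3 with rfl | h4
    · rw [Function.update_self]
      rcases h2.eq_or_lt with rfl | h5
      · rw [Function.update_self]
      · rw [Function.update_of_ne h5.ne]
        exact h.depth_le p h1 h5 hht
    · rw [Function.update_of_ne h4.ne, Function.update_of_ne (by omega)]
      exact h.depth_mono p q h1 h2 h4
  · rw [Function.update_of_ne hht.ne]
    rcases key p h2 with rfl | h3
    · rw [Function.update_self]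
    · rw [Function.update_of_ne h3.ne]
      exact h.depth_le p h1 h3 hht
  · rcases key p h2 with rfl | h3
    · rw [Function.update_self]
      have := h.depth_le_self head hsh hht
      omega
    · rw [Function.update_of_ne h3.ne]
      exact h.depth_le_self p h1 h3
  · rcases eq_or_ne v u with rfl | hne
    · rw [Function.update_self]
      exact ⟨fun _ => Or.inr ⟨tail, by omega, by omega, Function.update_self ..⟩,
        fun _ => one_ne_zero⟩
    · rw [Function.update_of_ne hne, h.vis_iff v]
      refine or_congr Iff.rfl ⟨?_, ?_⟩
      · rintro ⟨p, h1, h2, rfl⟩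
        exact ⟨p, h1, by omega, by rw [Function.update_of_ne h2.ne]⟩
      · rintro ⟨p, h1, h2, h3⟩
        rcases key p h2 with rfl | h4
        · rw [Function.update_self] at h3
          exact absurd h3.symm hne
        · rw [Function.update_of_ne h4.ne] at h3
          exact ⟨p, h1, h4, h3⟩
  · rcases key p h2 with rfl | h6
    · rcases key q h4 with rfl | h7
      · rfl
      · rw [Function.update_self, Function.update_of_ne h7.ne] at h5
        exact absurd h5.symm (hnew.2 q h3 h7)
    · rw [Function.update_of_ne h6.ne] at h5
      rcases key q h4 with rfl | h7
      · rw [Function.update_self] at h5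
        exact absurd h5 (hnew.2 p h1 h6)
      · rw [Function.update_of_ne h7.ne] at h5
        exact h.inj p q h1 h6 h3 h7 h5
  · rw [Function.update_of_ne (by omega)] at hv
    have h3 := h.closed p h1 h2 v hv
    rcases eq_or_ne v u with rfl | hne
    · rw [Function.update_self]
      exact one_ne_zero
    · rwa [Function.update_of_ne hne]

theorem BfsInv.next (h : BfsInv n off al s root r b ord₀ par₀ blk₀ vis₀ head tail ord par depth
    blk vis) (hht : head < tail) (hcl : ∀ v, Listed off al (ord head) v → vis v ≠ 0) :
    BfsInv n off al s root r b ord₀ par₀ blk₀ vis₀ (head + 1) tail ord par depth blk vis := by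
  have hsh := h.le_head
  refine ⟨by omega, hht, h.lt_tail, h.ord_old, h.par_old, h.blk_old, h.ord_root, h.par_root,
    h.depth_root, h.ord_lt, h.blk_eq, h.par_mem, h.listed, h.depth_eq, h.vis₀_eq, h.depth_mono,
    fun p h1 h2 h3 => ?_, h.depth_le_self, h.vis_iff, h.inj, fun p h1 h2 => ?_⟩
  · have h4 := h.depth_le p h1 h2 hht
    have h5 := h.depth_mono head (head + 1) hsh (by omega) h3
    omega
  · rcases Nat.lt_succ_iff_lt_or_eq.1 h2 with h3 | rfl
    · exact h.closed p h1 h3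
    · exact hcl

/-- List the vertex in register `6` as a child of the head of the queue. -/
def pushVertex : Program :=
  Program.store 3 (R 6) (K 1) ;; Program.store 4 (R 3) (R 6) ;; Program.store 5 (R 3) (R 2) ;;
  Program.store 6 (R 3) (A 6 (R 2) +ₑ K 1) ;; Program.store 7 (R 3) (R 8) ;; 3 ⟵ R 3 +ₑ K 1

/-- Go through the adjacency list of the head of the queue. -/
def scanList : Program :=
  4 ⟵ A 0 (A 4 (R 2)) ;; 5 ⟵ A 0 (A 4 (R 2) +ₑ K 1) ;;
  Program.loop (R 4 <ₑ R 5)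
    (6 ⟵ A 1 (R 4) ;; Program.branch (A 3 (R 6) =ₑ K 0) pushVertex Program.skip ;;
    4 ⟵ R 4 +ₑ K 1)

/-- Breadth-first search from the vertex in register `7`. -/
def traverse : Program :=
  Program.store 3 (R 7) (K 1) ;; Program.store 4 (R 3) (R 7) ;; Program.store 5 (R 3) (R 9) ;;
  Program.store 6 (R 3) (K 0) ;; Program.store 7 (R 3) (R 8) ;; 3 ⟵ R 3 +ₑ K 1 ;;
  Program.loop (R 2 <ₑ R 3) (scanList ;; 2 ⟵ R 2 +ₑ K 1)

/-- Adjacency lists whose entries are vertices below `n`, in memory. -/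
structure ListsReady (n : ℕ) (off al : ℕ → ℕ) (B : ℕ) (σ : State) : Prop where
  bound : 2 * n + 2 ≤ B
  arr_off : σ.arr 0 = off
  arr_al : σ.arr 1 = al
  off_mono : ∀ v < n, off v ≤ off (v + 1)
  off_le : ∀ v < n, off (v + 1) + 1 ≤ B
  al_lt : ∀ v < n, ∀ e, off v ≤ e → e < off (v + 1) → al e < n

variable {B : ℕ} {σ : State}

theorem ListsReady.of_same {p : Program} {τ : State} (h : ListsReady n off al B σ)
    (hs : Same p σ τ) (h0 : p.writesArr 0 = false) (h1 : p.writesArr 1 = false) :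
    ListsReady n off al B τ :=
  ⟨h.bound, (hs.arr 0 h0).trans h.arr_off, (hs.arr 1 h1).trans h.arr_al, h.off_mono, h.off_le,
    h.al_lt⟩

/-- `BfsInv` for the contents of the memory. -/
abbrev BfsState (n : ℕ) (off al : ℕ → ℕ) (s root r b : ℕ) (ord₀ par₀ blk₀ vis₀ : ℕ → ℕ)
    (τ : State) : Prop :=
  BfsInv n off al s root r b ord₀ par₀ blk₀ vis₀ (τ.reg 2) (τ.reg 3) (τ.arr 4) (τ.arr 5) (τ.arr 6)
    (τ.arr 7) (τ.arr 3)

theorem runs_scanList (hL : ListsReady n off al B σ) (hs : s ≤ n) (hb : b ≤ B) (h8 : σ.reg 8 = b)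
    (h : BfsState n off al s root r b ord₀ par₀ blk₀ vis₀ σ) (hht : σ.reg 2 < σ.reg 3) :
    Runs B scanList σ fun m τ =>
      m = off (σ.arr 4 (σ.reg 2) + 1) - off (σ.arr 4 (σ.reg 2)) ∧
      (∀ p < σ.reg 3, τ.arr 4 p = σ.arr 4 p) ∧
      BfsState n off al s root r b ord₀ par₀ blk₀ vis₀ τ ∧ σ.reg 3 ≤ τ.reg 3 ∧
      ∀ v, Listed off al (σ.arr 4 (σ.reg 2)) v → τ.arr 3 v ≠ 0 := by
  have hvn := h.ord_lt _ h.le_head hht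
  set v := σ.arr 4 (σ.reg 2) with hv
  have hmono := hL.off_mono v hvn
  have hB := hL.bound
  have hle := hL.off_le v hvn
  simp only [scanList, runs_seq, runs_assign, Expr.val, State.setReg_reg, State.setReg_arr,
    Nat.reduceEqDiff, if_false, hL.arr_off, ← hv, zero_add]
  refine ⟨by omega, by omega, ?_⟩
  refine runs_loop (fun m τ => off v ≤ τ.reg 4 ∧ τ.reg 4 ≤ off (v + 1) ∧ m + off v = τ.reg 4 ∧
    (∀ p < σ.reg 3, τ.arr 4 p = σ.arr 4 p) ∧
    BfsState n off al s root r b ord₀ par₀ blk₀ vis₀ τ ∧ σ.reg 3 ≤ τ.reg 3 ∧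
    ∀ e, off v ≤ e → e < τ.reg 4 → τ.arr 3 (al e) ≠ 0) (fun τ => off (v + 1) - τ.reg 4) ?_ ?_ ?_
  · simp only [State.setReg_reg, if_true, State.setReg_arr, Nat.reduceEqDiff, if_false]
    exact ⟨le_rfl, hmono, by omega, fun _ _ => trivial, h, le_rfl, fun e h1 h2 => by omega⟩
  · intro m τ hs' ⟨h1, h2, h3, h4, h5, h6, h7⟩ hlt
    have e5 : τ.reg 5 = off (v + 1) := by rw [hs'.reg 5 rfl]; simp
    have e2 : τ.reg 2 = σ.reg 2 := by rw [hs'.reg 2 rfl]; simp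
    have e8 : τ.reg 8 = b := by rw [hs'.reg 8 rfl]; simp [h8]
    have e1 : τ.arr 1 = al := by rw [hs'.arr 1 rfl]; simp [hL.arr_al]
    simp only [Test.Holds, Expr.val, e5] at hlt
    have hal := hL.al_lt v hvn _ h1 hlt
    have hord : τ.arr 4 (σ.reg 2) = v := h4 _ hht
    have htl := h5.tail_le
    have hsh := h.le_head
    have hd := h5.depth_le_self (τ.reg 2) (by omega) (by omega)
    simp only [pushVertex, runs_seq, runs_store, runs_assign, runs_branch, runs_skip, Test.Holds,
      Expr.val, State.setReg_reg, State.setArr_reg, if_true, if_false, State.setReg_arr,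
      State.setArr_arr, Nat.reduceEqDiff, e1, e2, e8, add_zero]
    refine ⟨by omega, fun hnew => ⟨by omega, by omega, by omega, by rw [e2] at hd; omega, hb,
      by omega, by omega, ⟨by omega, by omega, by omega, fun p hp => ?_, ?_, by omega,
      fun e g1 g2 => ?_⟩, by omega⟩, fun hold => ⟨by omega, ⟨by omega, by omega, by omega, h4, h5,
      h6, fun e g1 g2 => ?_⟩, by omega⟩⟩
    · rw [Function.update_of_ne (by omega)]
      exact h4 p hp
    · have hp := h5.push (u := al (τ.reg 4)) (by omega) hnew hal
        (by rw [e2, hord]; exact ⟨_, h1, hlt, rfl⟩)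
      rw [e2] at hp
      simpa [BfsState, e2] using hp
    · rcases eq_or_ne (al e) (al (τ.reg 4)) with he | he
      · rw [he, Function.update_self]
        exact one_ne_zero
      · rw [Function.update_of_ne he]
        refine h7 e g1 (lt_of_le_of_ne (by omega) ?_)
        rintro rfl
        exact he rfl
    · rcases Nat.lt_succ_iff_lt_or_eq.1 g2 with g3 | rfl
      · exact h7 e g1 g3
      · exact hold
  · intro m τ hs' ⟨h1, h2, h3, h4, h5, h6, h7⟩ hlt
    have e5 : τ.reg 5 = off (v + 1) := by rw [hs'.reg 5 rfl]; simp
    simp only [Test.Holds, Expr.val, e5] at hlt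
    refine ⟨by omega, h4, h5, h6, ?_⟩
    rintro u ⟨e, g1, g2, rfl⟩
    exact h7 e g1 (by omega)

/-- The result of a breadth-first search; `m` is the number of passes. -/
theorem runs_traverse (hL : ListsReady n off al B σ) (h23 : σ.reg 2 = σ.reg 3) (hs : σ.reg 3 ≤ n)
    (h8 : σ.reg 8 ≤ B) (h9 : σ.reg 9 ≤ B) (hroot : σ.reg 7 < n) :
    Runs B traverse σ fun m τ => τ.reg 2 = τ.reg 3 ∧
      m = ∑ p ∈ Finset.Ico (σ.reg 3) (τ.reg 3),
        (1 + (off (τ.arr 4 p + 1) - off (τ.arr 4 p))) ∧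
      BfsState n off al (σ.reg 3) (σ.reg 7) (σ.reg 9) (σ.reg 8) (σ.arr 4) (σ.arr 5) (σ.arr 7)
        (Function.update (σ.arr 3) (σ.reg 7) 1) τ := by
  have hB := hL.bound
  simp only [traverse, runs_seq, runs_store, runs_assign, Expr.val, State.setArr_reg, zero_add]
  refine ⟨by omega, by omega, by omega, by omega, by omega, by omega, ?_⟩
  refine runs_loop (fun m τ => m = ∑ p ∈ Finset.Ico (σ.reg 3) (τ.reg 2),
      (1 + (off (τ.arr 4 p + 1) - off (τ.arr 4 p))) ∧
      BfsState n off al (σ.reg 3) (σ.reg 7) (σ.reg 9) (σ.reg 8) (σ.arr 4) (σ.arr 5) (σ.arr 7)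
        (Function.update (σ.arr 3) (σ.reg 7) 1) τ) (fun τ => σ.reg 3 + n - τ.reg 2) ?_ ?_ ?_
  · simp only [State.setReg_reg, State.setReg_arr, Nat.reduceEqDiff, if_false,
      State.setArr_reg, h23, Finset.Ico_self, Finset.sum_empty, true_and]
    have := BfsInv.init (off := off) (al := al) (s := σ.reg 3) (r := σ.reg 9) (b := σ.reg 8)
      (ord₀ := σ.arr 4) (par₀ := σ.arr 5) (blk₀ := σ.arr 7) (vis₀ := σ.arr 3) (depth := σ.arr 6)
      hroot
    simpa [BfsState, h23] using this
  · intro m τ hs' ⟨h1, h2⟩ hlt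
    simp only [Test.Holds, Expr.val] at hlt
    have hLτ : ListsReady n off al B τ := by
      refine ⟨hL.bound, ?_, ?_, hL.off_mono, hL.off_le, hL.al_lt⟩
      · rw [hs'.arr 0 rfl]; simp [hL.arr_off]
      · rw [hs'.arr 1 rfl]; simp [hL.arr_al]
    have e8 : τ.reg 8 = σ.reg 8 := by rw [hs'.reg 8 rfl]; simp
    rw [runs_seq]
    refine (runs_scanList hLτ hs h8 e8 h2 hlt).mono fun l ρ hs'' hq => ?_
    obtain ⟨g1, g2, g3, g4, g5⟩ := hq
    have f2 : ρ.reg 2 = τ.reg 2 := hs''.reg 2 rfl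
    have htl := g3.tail_le
    simp only [runs_assign, Expr.val, State.setReg_reg, State.setReg_arr, Nat.reduceEqDiff, if_true,
      if_false, f2, BfsState]
    have hle := h2.le_head
    refine ⟨by omega, ⟨?_, ?_⟩, by omega⟩
    · have hsum : ∑ p ∈ Finset.Ico (σ.reg 3) (τ.reg 2),
            (1 + (off (ρ.arr 4 p + 1) - off (ρ.arr 4 p))) =
          ∑ p ∈ Finset.Ico (σ.reg 3) (τ.reg 2), (1 + (off (τ.arr 4 p + 1) - off (τ.arr 4 p))) := by
        refine Finset.sum_congr rfl fun p hp => ?_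
        rw [Finset.mem_Ico] at hp
        rw [g2 p (by omega)]
      rw [Finset.sum_Ico_succ_top hle, hsum, h1, g1, g2 _ hlt]
      ring
    · have := g3.next (by omega) (by rw [f2, g2 _ hlt]; exact g5)
      rwa [f2] at this
  · intro m τ hs' ⟨h1, h2⟩ hlt
    simp only [Test.Holds, Expr.val] at hlt
    have := h2.head_le
    have e : τ.reg 2 = τ.reg 3 := by omega
    rw [e] at h1
    exact ⟨e, h1, h2⟩

end RAM


/-! ### Breadth-first searches of the whole tree -/

theorem SimpleGraph.Connected.mem_of_closed {V : Type*} {G : SimpleGraph V} (hG : G.Connected)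
    {S : Set V} (hS : S.Nonempty) (hcl : ∀ u v, u ∈ S → G.Adj u v → v ∈ S) (v : V) : v ∈ S := by
  obtain ⟨u, hu⟩ := hS
  obtain ⟨w⟩ := hG.preconnected u v
  induction w with
  | nil => exact hu
  | cons h _ ih => exact ih (hcl _ _ hu h)

/-- The entries of `off` and `al` are adjacency lists of `T`. -/
structure ListsOf {n : ℕ} (T : SimpleGraph (Fin n)) (off al : ℕ → ℕ) : Prop where
  listed_iff : ∀ v u, v < n → (RAM.Listed off al v u ↔
    ∃ (hv : v < n) (hu : u < n), T.Adj ⟨v, hv⟩ ⟨u, hu⟩)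

section

variable {n : ℕ} {T : SimpleGraph (Fin n)} {off al : ℕ → ℕ}

theorem ListsOf.adj [NeZero n] (h : ListsOf T off al) {v u : ℕ} (hv : v < n)
    (hl : RAM.Listed off al v u) : T.Adj (Fin.ofNat n v) (Fin.ofNat n u) ∧ u < n := by
  obtain ⟨hv, hu, ha⟩ := (h.listed_iff v u hv).1 hl
  refine ⟨?_, hu⟩
  convert ha using 1
  · exact Fin.ext (Nat.mod_eq_of_lt hv)
  · exact Fin.ext (Nat.mod_eq_of_lt hu)

/-- A list of distinct vertices that is closed under taking neighbours is complete. -/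
theorem ListsOf.eq_of_closed [NeZero n] (h : ListsOf T off al) (hT : T.Connected) {t : ℕ}
    {ord : ℕ → ℕ} (ht : 0 < t) (hord : ∀ p < t, ord p < n)
    (hinj : ∀ p q, p < t → q < t → ord p = ord q → p = q)
    (hcl : ∀ p < t, ∀ v, RAM.Listed off al (ord p) v → ∃ q < t, ord q = v) : t = n := by
  have hsurj := hT.mem_of_closed (S := {v | ∃ p < t, ord p = v.val})
    ⟨⟨ord 0, hord 0 ht⟩, 0, ht, rfl⟩ (by
      rintro u v ⟨p, hp, hpu⟩ huv
      refine hcl p hp v ?_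
      rw [hpu]
      exact (h.listed_iff u v u.2).2 ⟨u.2, v.2, huv⟩)
  have h1 : (Finset.range t).image ord = Finset.range n := by
    ext v
    simp only [Finset.mem_image, Finset.mem_range]
    constructor
    · rintro ⟨p, hp, rfl⟩
      exact hord p hp
    · intro hv
      exact hsurj ⟨v, hv⟩
  have h2 := congrArg Finset.card h1
  rw [Finset.card_image_of_injOn, Finset.card_range, Finset.card_range] at h2
  · exact h2
  · intro p hp q hq
    simp only [Finset.coe_range, Set.mem_Iio] at hp hq
    exact hinj p q hp hq

theorem ListsOf.treeOrder [NeZero n] (h : ListsOf T off al) {ord par : ℕ → ℕ}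
    (hord : ∀ p < n, ord p < n) (hinj : ∀ p q, p < n → q < n → ord p = ord q → p = q)
    (hpar : ∀ p, 0 < p → p < n → par p < p)
    (hl : ∀ p, 0 < p → p < n → RAM.Listed off al (ord (par p)) (ord p)) :
    TreeOrder T n (fun p => Fin.ofNat n (ord p)) par := by
  refine ⟨Fintype.card_fin n, fun p hp q hq hpq => ?_, hpar, fun p h0 hp => ?_⟩
  · have h1 := congrArg Fin.val hpq
    simp only [Fin.val_ofNat, Nat.mod_eq_of_lt (hord p hp), Nat.mod_eq_of_lt (hord q hq)] at h1
    exact hinj p q hp hq h1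
  · have h1 := hpar p h0 hp
    exact (h.adj (hord _ (by omega)) (hl p h0 hp)).1.symm

/-- Each vertex is scanned at most once, and the lengths of the lists telescope to `off n - off 0`.
This bounds the time of one search as well as of all block searches together. -/
theorem sum_lists_le {t : ℕ} {ord : ℕ → ℕ} (hmono : ∀ v < n, off v ≤ off (v + 1))
    (hord : ∀ p < t, ord p < n) (hinj : ∀ p q, p < t → q < t → ord p = ord q → p = q) :
    ∑ p ∈ Finset.range t, (1 + (off (ord p + 1) - off (ord p))) ≤ n + off n := by
  have h1 : ∑ p ∈ Finset.range t, (1 + (off (ord p + 1) - off (ord p))) =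
      ∑ v ∈ (Finset.range t).image ord, (1 + (off (v + 1) - off v)) := by
    rw [Finset.sum_image]
    intro p hp q hq
    simp only [Finset.coe_range, Set.mem_Iio] at hp hq
    exact hinj p q hp hq
  have h2 : (Finset.range t).image ord ⊆ Finset.range n := by
    intro v hv
    simp only [Finset.mem_image, Finset.mem_range] at hv ⊢
    obtain ⟨p, hp, rfl⟩ := hv
    exact hord p hp
  rw [h1]
  refine (Finset.sum_le_sum_of_subset h2).trans ?_
  have key : ∀ k ≤ n, ∑ v ∈ Finset.range k, (1 + (off (v + 1) - off v)) ≤ k + (off k - off 0) ∧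
      off 0 ≤ off k := by
    intro k
    induction k with
    | zero => simp
    | succ k ih =>
      intro hk
      have h3 := ih (by omega)
      have h4 := hmono k (by omega)
      rw [Finset.sum_range_succ]
      omega
  have := key n le_rfl
  omega

end

namespace RAM

/-- No vertex has been visited. -/
def clearVisited : Program :=
  13 ⟵ K 0 ;; Program.loop (R 13 <ₑ R 1) (Program.store 3 (R 13) (K 0) ;; 13 ⟵ R 13 +ₑ K 1)

/-- List all vertices in the order of a breadth-first search from the vertex in register `7`. -/
def sweep : Program :=
  clearVisited ;; 2 ⟵ K 0 ;; 3 ⟵ K 0 ;; 8 ⟵ K 0 ;; 9 ⟵ K 0 ;; traverse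

variable {B : ℕ} {σ : State} {n : ℕ} {off al : ℕ → ℕ}

theorem runs_clearVisited (hB : σ.reg 1 ≤ B) :
    Runs B clearVisited σ fun m τ => m = σ.reg 1 ∧ ∀ v < σ.reg 1, τ.arr 3 v = 0 := by
  simp only [clearVisited, runs_seq, runs_assign, Expr.val, zero_add]
  refine ⟨Nat.zero_le _, ?_⟩
  refine runs_loop (fun m τ => τ.reg 13 = m ∧ m ≤ σ.reg 1 ∧ ∀ v < m, τ.arr 3 v = 0)
    (fun τ => σ.reg 1 - τ.reg 13) ?_ ?_ ?_
  · simp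
  · rintro m τ hs ⟨h1, h2, h3⟩ hb
    have e1 : τ.reg 1 = σ.reg 1 := by rw [hs.reg 1 rfl]; simp
    simp only [Test.Holds, Expr.val, e1, h1] at hb
    simp only [runs_seq, runs_store, runs_assign, Expr.val, State.setReg_reg, State.setArr_reg,
      State.setReg_arr, State.setArr_arr, if_true, h1]
    refine ⟨Nat.zero_le _, by omega, ⟨trivial, by omega, fun v hv => ?_⟩, by omega⟩
    rw [Function.update_apply]
    split_ifs
    · rfl
    · exact h3 v (by omega)
  · rintro m τ hs ⟨h1, h2, h3⟩ hb
    have e1 : τ.reg 1 = σ.reg 1 := by rw [hs.reg 1 rfl]; simp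
    simp only [Test.Holds, Expr.val, e1, h1] at hb
    obtain rfl : m = σ.reg 1 := by omega
    exact ⟨rfl, h3⟩

/-- The result of a breadth-first search of the whole tree. -/
structure SweepDone {n : ℕ} [NeZero n] (T : SimpleGraph (Fin n)) (root : ℕ)
    (ord par depth : ℕ → ℕ) :
    Prop where
  order : TreeOrder T n (fun p => Fin.ofNat n (ord p)) par
  ord_lt : ∀ p < n, ord p < n
  ord_inj : ∀ p q, p < n → q < n → ord p = ord q → p = q
  ord_zero : ord 0 = root
  depth_zero : depth 0 = 0
  par_zero : par 0 = 0
  depth_eq : ∀ p, 0 < p → p < n → depth p = depth (par p) + 1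
  depth_le : ∀ p < n, depth p ≤ depth (n - 1)
  depth_le_self : ∀ p < n, depth p ≤ p

theorem runs_sweep [NeZero n] {T : SimpleGraph (Fin n)} (hL : ListsReady n off al B σ)
    (hA : ListsOf T off al) (hT : T.Connected) (h1 : σ.reg 1 = n) (h7 : σ.reg 7 < n) :
    Runs B sweep σ fun m τ => m ≤ 2 * n + off n ∧
      SweepDone T (σ.reg 7) (τ.arr 4) (τ.arr 5) (τ.arr 6) := by
  have hn : 0 < n := NeZero.pos n
  have hB := hL.bound
  rw [sweep, runs_seq]
  refine (runs_clearVisited (by omega)).mono fun m τ hs hq => ?_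
  obtain ⟨rfl, hvis⟩ := hq
  simp only [runs_seq, runs_assign, Expr.val, zero_add, Nat.zero_le, true_and]
  have hLτ : ListsReady n off al B ((((τ.setReg 2 0).setReg 3 0).setReg 8 0).setReg 9 0) := by
    refine ⟨hL.bound, ?_, ?_, hL.off_mono, hL.off_le, hL.al_lt⟩
    · exact (hs.arr 0 rfl).trans hL.arr_off
    · exact (hs.arr 1 rfl).trans hL.arr_al
  have e7 := hs.reg 7 rfl
  refine (runs_traverse hLτ (by simp) (by simp) (by simp) (by simp) (by simpa [e7])).mono
    fun m ρ _ hq => ?_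
  obtain ⟨g1, g2, g3⟩ := hq
  simp only [State.setReg_reg, State.setReg_arr, Nat.reduceEqDiff, if_false, if_true, e7] at g2 g3
  simp only [BfsState, g1] at g3
  have hord : ∀ p < ρ.reg 3, ρ.arr 4 p < n := fun p hp => g3.ord_lt p (Nat.zero_le _) hp
  have hinj : ∀ p q, p < ρ.reg 3 → q < ρ.reg 3 → ρ.arr 4 p = ρ.arr 4 q → p = q :=
    fun p q hp hq => g3.inj p q (Nat.zero_le _) hp (Nat.zero_le _) hq
  -- At the end the queue is empty, so all neighbours of listed vertices are visited; and visited
  -- vertices are listed, because all marks were cleared before. Connectedness gives the rest.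
  have htail : ρ.reg 3 = n := by
    refine hA.eq_of_closed hT g3.lt_tail hord hinj fun p hp v hv => ?_
    have hvn := (hA.adj (hord p hp) hv).2
    rcases (g3.vis_iff v).1 (g3.closed p (Nat.zero_le _) hp v hv) with h | ⟨q, -, h2, h3⟩
    · rcases eq_or_ne v (σ.reg 7) with rfl | hne
      · exact ⟨0, g3.lt_tail, g3.ord_root⟩
      · rw [Function.update_of_ne hne, hvis v (by omega)] at h
        exact absurd rfl h
    · exact ⟨q, h2, h3⟩
  rw [htail] at hord hinj g2
  rw [htail] at g3
  constructor
  · have := sum_lists_le hL.off_mono hord hinj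
    rw [Finset.range_eq_Ico] at this
    omega
  · exact ⟨hA.treeOrder hord hinj (fun p h0 hp => (g3.par_mem p h0 hp).2)
      (fun p h0 hp => g3.listed p h0 hp), hord, hinj, g3.ord_root, g3.depth_root, g3.par_root,
      fun p h0 hp => g3.depth_eq p h0 hp,
      fun p hp => g3.depth_mono p (n - 1) (Nat.zero_le _) (by omega) (by omega),
      fun p hp => g3.depth_le_self p (Nat.zero_le _) hp⟩

end RAM


/-! ### The blocks along a longest path -/

namespace RAM

/-- Store the path from the last vertex to the root in array `9`, and its number of vertices in
register `10`. -/
def storePath : Program :=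
  10 ⟵ A 6 (R 1 -ₑ K 1) +ₑ K 1 ;; 14 ⟵ R 1 -ₑ K 1 ;; 13 ⟵ K 0 ;;
  Program.loop (R 13 <ₑ R 10)
    (Program.store 9 (R 13) (A 4 (R 14)) ;; 14 ⟵ A 5 (R 14) ;; 13 ⟵ R 13 +ₑ K 1)

variable {B : ℕ} {σ : State} {n : ℕ} {off al : ℕ → ℕ}

/-- The first `N` entries of `P` are the vertices of a path. -/
structure PathDone {n : ℕ} (T : SimpleGraph (Fin n)) [NeZero n] (N : ℕ) (P : ℕ → ℕ) : Prop where
  lt : ∀ j < N, P j < n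
  inj : ∀ i j, i < N → j < N → P i = P j → i = j
  adj : ∀ j, j + 1 < N → T.Adj (Fin.ofNat n (P (j + 1))) (Fin.ofNat n (P j))

theorem runs_storePath [NeZero n] {T : SimpleGraph (Fin n)} {root : ℕ} (hB : 2 * n + 2 ≤ B)
    (h1 : σ.reg 1 = n) (hS : SweepDone T root (σ.arr 4) (σ.arr 5) (σ.arr 6)) :
    Runs B storePath σ fun m τ => m = σ.arr 6 (n - 1) + 1 ∧
      τ.reg 10 = σ.arr 6 (n - 1) + 1 ∧ PathDone T (σ.arr 6 (n - 1) + 1) (τ.arr 9) := by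
  have hn : 0 < n := NeZero.pos n
  have hd := hS.depth_le_self (n - 1) (by omega)
  set N := σ.arr 6 (n - 1) + 1 with hN
  simp only [storePath, runs_seq, runs_assign, Expr.val, State.setReg_reg,
    Nat.reduceEqDiff, if_false, h1, zero_add, ← hN]
  refine ⟨by omega, by omega, by omega, ?_⟩
  refine runs_loop (fun m τ => τ.reg 13 = m ∧ m ≤ N ∧
    (m < N → τ.reg 14 < n ∧ σ.arr 6 (τ.reg 14) = N - 1 - m) ∧
    (∀ i < m, ∃ q < n, τ.arr 9 i = σ.arr 4 q ∧ σ.arr 6 q = N - 1 - i) ∧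
    (∀ j, j + 1 < m → T.Adj (Fin.ofNat n (τ.arr 9 (j + 1))) (Fin.ofNat n (τ.arr 9 j))) ∧
    (∀ j, j + 1 = m → m < N →
      T.Adj (Fin.ofNat n (σ.arr 4 (τ.reg 14))) (Fin.ofNat n (τ.arr 9 j))))
    (fun τ => N - τ.reg 13) ?_ ?_ ?_
  · simp only [State.setReg_reg, State.setReg_arr, Nat.reduceEqDiff, if_false, if_true]
    exact ⟨trivial, Nat.zero_le _, fun _ => ⟨by omega, by rw [hN]; omega⟩, fun i hi => by omega,
      fun j hj => by omega, fun j hj => hj.elim⟩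
  · rintro m τ hs ⟨g1, g2, g3, g4, g5, g6⟩ hb
    have e10 : τ.reg 10 = N := by rw [hs.reg 10 rfl]; simp
    have e4 : τ.arr 4 = σ.arr 4 := by rw [hs.arr 4 rfl]; simp
    have e5 : τ.arr 5 = σ.arr 5 := by rw [hs.arr 5 rfl]; simp
    simp only [Test.Holds, Expr.val, e10, g1] at hb
    obtain ⟨g7, g8⟩ := g3 hb
    simp only [runs_seq, runs_store, runs_assign, Expr.val, State.setReg_reg, State.setArr_reg,
      State.setReg_arr, State.setArr_arr, if_true, if_false, Nat.reduceEqDiff, g1, e4, e5]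
    have hord := hS.ord_lt _ g7
    have hpos : m + 1 < N → 0 < τ.reg 14 := fun hm => by
      rcases Nat.eq_zero_or_pos (τ.reg 14) with h0 | h0
      · rw [h0, hS.depth_zero] at g8
        omega
      · exact h0
    refine ⟨by omega, ?_, by omega, ⟨by omega, by omega, fun hm => ?_, fun i hi => ?_,
      fun j hj => ?_, fun j hj hm => ?_⟩, by omega⟩
    · rcases Nat.eq_zero_or_pos (τ.reg 14) with h0 | h0
      · rw [h0, hS.par_zero]
        exact Nat.zero_le _
      · have := hS.order.par_lt _ h0 g7
        omega
    · have h6 := hS.depth_eq _ (hpos (by omega)) g7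
      have h7 := hS.order.par_lt _ (hpos (by omega)) g7
      exact ⟨by omega, by omega⟩
    · rcases eq_or_ne i m with rfl | hne
      · exact ⟨_, g7, by rw [Function.update_self], g8⟩
      · rw [Function.update_of_ne hne]
        exact g4 i (by omega)
    · rw [Function.update_of_ne (a := j) (by omega)]
      rcases eq_or_ne (j + 1) m with he | hne
      · rw [he, Function.update_self]
        exact g6 j he hb
      · rw [Function.update_of_ne hne]
        exact g5 j (by omega)
    · obtain rfl : j = m := by omega
      rw [Function.update_self]
      exact (hS.order.adj _ (hpos (by omega)) g7).symm
  · rintro m τ hs ⟨g1, g2, g3, g4, g5, g6⟩ hb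
    have e10 : τ.reg 10 = N := by rw [hs.reg 10 rfl]; simp
    simp only [Test.Holds, Expr.val, e10, g1] at hb
    obtain rfl : m = N := by omega
    refine ⟨rfl, e10, fun j hj => ?_, fun i j hi hj hij => ?_, g5⟩
    · obtain ⟨q, hq, hjq, -⟩ := g4 j hj
      rw [hjq]
      exact hS.ord_lt q hq
    -- Entry `i` lies at depth `N - 1 - i`, so the entries differ.
    · obtain ⟨q, hq, h1, h2⟩ := g4 i hi
      obtain ⟨r, hr, h3, h4⟩ := g4 j hj
      rw [h1, h3] at hij
      rw [hS.ord_inj q r hq hr hij] at h2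
      omega

/-- List the vertices of the subtrees that hang at the vertices of the path in array `9`. -/
def listBlocks : Program :=
  clearVisited ;; 13 ⟵ K 0 ;;
  Program.loop (R 13 <ₑ R 10) (Program.store 3 (A 9 (R 13)) (K 1) ;; 13 ⟵ R 13 +ₑ K 1) ;;
  2 ⟵ K 0 ;; 3 ⟵ K 0 ;; 8 ⟵ K 0 ;; 9 ⟵ K 0 ;;
  Program.loop (R 8 <ₑ R 10)
    (Program.store 8 (R 8) (R 3) ;; 7 ⟵ A 9 (R 8) ;; traverse ;; 9 ⟵ A 8 (R 8) ;;
    8 ⟵ R 8 +ₑ K 1) ;;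
  Program.store 8 (R 10) (R 3)

/-- The blocks at the first `j` vertices of the path `P` have been listed; they contain `s`
vertices. -/
structure LayoutInv (n : ℕ) (off al : ℕ → ℕ) (N : ℕ) (P : ℕ → ℕ) (j s : ℕ)
    (ord par blk start vis : ℕ → ℕ) : Prop where
  le : j ≤ N
  start_eq : start j = s
  blocks : Blocks s j par blk start
  ord_start : ∀ i < j, ord (start i) = P i
  ord_lt : ∀ p < s, ord p < n
  inj : ∀ p q, p < s → q < s → ord p = ord q → p = q
  listed : ∀ p, 0 < p → p < s → Listed off al (ord (par p)) (ord p)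
  vis_iff : ∀ v < n, vis v ≠ 0 ↔ (∃ p < s, ord p = v) ∨ ∃ i < N, P i = v
  ne_path : ∀ p < s, ∀ i, j ≤ i → i < N → ord p ≠ P i
  closed : ∀ p < s, ∀ v, Listed off al (ord p) v → vis v ≠ 0

/-- The path vertex `P j` has not been listed yet. -/
theorem LayoutInv.s_le {N j s : ℕ} {P ord par blk start vis : ℕ → ℕ}
    (h : LayoutInv n off al N P j s ord par blk start vis) (hP : ∀ i < N, P i < n)
    (hj : j < N) : s < n := by
  have h1 := Finset.card_le_card_of_injOn (s := Finset.range s)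
    (t := (Finset.range n).erase (P j)) ord ?_ ?_
  · rw [Finset.card_erase_of_mem (by simpa using hP j hj), Finset.card_range,
      Finset.card_range] at h1
    have := hP j hj
    omega
  · intro p hp
    simp only [Finset.coe_range, Set.mem_Iio] at hp
    simp only [Finset.coe_erase, Finset.coe_range, Set.mem_sdiff, Set.mem_Iio,
      Set.mem_singleton_iff]
    exact ⟨h.ord_lt p hp, h.ne_path p hp j le_rfl hj⟩
  · intro p hp q hq
    simp only [Finset.coe_range, Set.mem_Iio] at hp hq
    exact h.inj p q hp hq

/-- The search from `P j` only appends, so the old blocks stay as they are. Its root is attached to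
the start of the preceding block, which `hr` provides; for the first block there is none. -/
theorem LayoutInv.step [NeZero n] {T : SimpleGraph (Fin n)} {N j s s' r : ℕ}
    {P ord par blk start vis ord' par' depth' blk' vis' : ℕ → ℕ}
    (h : LayoutInv n off al N P j s ord par blk start vis)
    (hP : PathDone T N P) (hPl : ∀ i, i + 1 < N → Listed off al (P i) (P (i + 1)))
    (hj : j < N) (hr : ∀ i, i + 1 = j → r = start i)
    (hb : BfsInv n off al s (P j) r j ord par blk (Function.update vis (P j) 1) s' s' ord' par'
      depth' blk' vis') :
    LayoutInv n off al N P (j + 1) s' ord' par' blk' (Function.update start (j + 1) s') vis' := by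
  have hs := h.start_eq
  have hss := hb.lt_tail
  have hst : ∀ i ≤ j, Function.update start (j + 1) s' i = start i := fun i hi => by
    rw [Function.update_of_ne (by omega)]
  have hst' : Function.update start (j + 1) s' (j + 1) = s' := Function.update_self ..
  have hvisP : ∀ v, Function.update vis (P j) 1 v ≠ 0 ↔ vis v ≠ 0 := fun v => by
    rcases eq_or_ne v (P j) with rfl | hne
    · rw [Function.update_self]
      exact ⟨fun _ => (h.vis_iff _ (hP.lt j hj)).2 (Or.inr ⟨j, hj, rfl⟩), fun _ => one_ne_zero⟩
    · rw [Function.update_of_ne hne]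
  have hbs := h.blocks
  have hstart_lt : ∀ i < j, start i < s := fun i hi => by
    have := hbs.start_add_le hi.le le_rfl
    omega
  -- Apart from its root, the search finds unvisited vertices only, hence neither vertices of
  -- earlier blocks nor vertices of the path.
  have hnew : ∀ p, s < p → p < s' → (∀ q < s, ord q ≠ ord' p) ∧ ∀ i < N, P i ≠ ord' p := by
    intro p hp hp'
    have h1 : vis (ord' p) = 0 := by
      by_contra hc
      exact (hvisP _).2 hc (hb.vis₀_eq p hp hp')
    have h2 := (h.vis_iff _ (hb.ord_lt p hp.le hp')).not.1 (not_not.2 h1)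
    push Not at h2
    exact ⟨h2.1, h2.2⟩
  refine ⟨hj, hst', ⟨?_, hst', fun i hi => ?_, fun i hi p h1 h2 => ?_, fun i hi p h1 h2 => ?_,
    fun i hi => ?_⟩, fun i hi => ?_, fun p hp => ?_, fun p q hp hq hpq => ?_, fun p h0 hp => ?_,
    fun v hv => ?_, fun p hp i h1 h2 => ?_, fun p hp v hv => ?_⟩
  · rw [hst 0 (Nat.zero_le _), hbs.start_zero]
  · rw [hst i (by omega)]
    rcases Nat.lt_or_eq_of_le (Nat.le_of_lt_succ hi) with h1 | rfl
    · rw [hst (i + 1) h1]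
      exact hbs.start_lt i h1
    · rw [hst', hs]
      exact hss
  · rw [hst i (by omega)] at h1
    rcases Nat.lt_or_eq_of_le (Nat.le_of_lt_succ hi) with h3 | rfl
    · rw [hst (i + 1) h3] at h2
      have h4 := hbs.start_le_n (show i + 1 ≤ j by omega)
      rw [hb.blk_old p (by omega)]
      exact hbs.blk_eq i h3 p h1 h2
    · rw [hst'] at h2
      exact hb.blk_eq p (by omega) h2
  · rw [hst i (by omega)] at h1 ⊢
    rcases Nat.lt_or_eq_of_le (Nat.le_of_lt_succ hi) with h3 | rfl
    · rw [hst (i + 1) h3] at h2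
      have h4 := hbs.start_le_n (show i + 1 ≤ j by omega)
      rw [hb.par_old p (by omega)]
      exact hbs.par_inner i h3 p h1 h2
    · rw [hst'] at h2
      rw [hs] at h1 ⊢
      exact hb.par_mem p h1 h2
  · rw [hst i (by omega), hst (i + 1) (by omega)]
    rcases Nat.lt_or_eq_of_le (Nat.le_of_lt_succ hi) with h3 | h3
    · rw [hb.par_old _ (hstart_lt _ h3)]
      exact hbs.par_start i h3
    · rw [h3, hs, hb.par_root]
      exact hr i h3
  · rw [hst i (by omega)]
    rcases Nat.lt_or_eq_of_le (Nat.le_of_lt_succ hi) with h3 | rfl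
    · rw [hb.ord_old _ (hstart_lt _ h3)]
      exact h.ord_start i h3
    · rw [hs, hb.ord_root]
  · by_cases hps : p < s
    · rw [hb.ord_old p hps]
      exact h.ord_lt p hps
    · exact hb.ord_lt p (by omega) hp
  · have key : ∀ p q, p < s → s ≤ q → q < s' → ord' p ≠ ord' q := by
      intro p q hp hq hq'
      rw [hb.ord_old p hp]
      rcases hq.eq_or_lt with rfl | hlt
      · rw [hb.ord_root]
        exact h.ne_path p hp j le_rfl hj
      · exact (hnew q hlt hq').1 p hp
    by_cases hps : p < s
    · by_cases hqs : q < s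
      · rw [hb.ord_old p hps, hb.ord_old q hqs] at hpq
        exact h.inj p q hps hqs hpq
      · exact absurd hpq (key p q hps (by omega) hq)
    · by_cases hqs : q < s
      · exact absurd hpq.symm (key q p hqs (by omega) hp)
      · exact hb.inj p q (by omega) hp (by omega) hq hpq
  · rcases lt_trichotomy p s with h1 | rfl | h1
    · have h2 := hbs.par_lt h1 h0
      rw [hb.par_old p h1, hb.ord_old p h1, hb.ord_old _ (by omega)]
      exact h.listed p h0 h1
    · obtain ⟨i, rfl⟩ : ∃ i, j = i + 1 := by
        refine ⟨j - 1, ?_⟩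
        have : j ≠ 0 := by
          rintro rfl
          rw [hbs.start_zero] at hs
          omega
        omega
      rw [hb.par_root, hb.ord_root, hr i rfl, hb.ord_old _ (hstart_lt i (by omega)),
        h.ord_start i (by omega)]
      exact hPl i hj
    · exact hb.listed p h1 hp
  · rw [hb.vis_iff v, hvisP v, h.vis_iff v hv]
    constructor
    · rintro ((⟨p, hp, rfl⟩ | h1) | ⟨p, h1, h2, h3⟩)
      · exact Or.inl ⟨p, by omega, hb.ord_old p hp⟩
      · exact Or.inr h1
      · exact Or.inl ⟨p, h2, h3⟩
    · rintro (⟨p, hp, rfl⟩ | h1)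
      · by_cases hps : p < s
        · exact Or.inl (Or.inl ⟨p, hps, (hb.ord_old p hps).symm⟩)
        · exact Or.inr ⟨p, by omega, hp, rfl⟩
      · exact Or.inl (Or.inr h1)
  · rcases lt_trichotomy p s with h3 | rfl | h3
    · rw [hb.ord_old p h3]
      exact h.ne_path p h3 i (by omega) h2
    · rw [hb.ord_root]
      intro hc
      have := hP.inj j i hj h2 hc
      omega
    · exact ((hnew p h3 hp).2 i h2).symm
  · by_cases hps : p < s
    · rw [hb.ord_old p hps] at hv
      have h1 := h.closed p hps v hv
      rw [hb.vis_iff v, hvisP v]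
      exact Or.inl h1
    · exact hb.closed p (by omega) hp v hv

theorem LayoutInv.init {N : ℕ} {P ord par blk start vis : ℕ → ℕ} (h0 : start 0 = 0)
    (hvis : ∀ v < n, vis v ≠ 0 ↔ ∃ i < N, P i = v) :
    LayoutInv n off al N P 0 0 ord par blk start vis := by
  refine ⟨Nat.zero_le _, h0, ⟨h0, h0, ?_, ?_, ?_, ?_⟩, ?_, ?_, ?_, ?_, fun v hv => ?_, ?_, ?_⟩
  case refine_9 =>
    rw [hvis v hv]
    simp
  all_goals intros; omega

/-- The vertices of the tree are listed block by block. -/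
structure Layout {n : ℕ} [NeZero n] (T : SimpleGraph (Fin n)) (N : ℕ) (ord par blk start : ℕ → ℕ) :
    Prop where
  blocks : Blocks n N par blk start
  order : TreeOrder T n (fun p => Fin.ofNat n (ord p)) par
  ord_lt : ∀ p < n, ord p < n
  ord_inj : ∀ p q, p < n → q < n → ord p = ord q → p = q

/-- When all blocks have been searched, a visited vertex is a listed one, because the path vertices
are the roots of the blocks. So the list is closed under neighbours. -/
theorem LayoutInv.layout [NeZero n] {T : SimpleGraph (Fin n)} {N s : ℕ}
    {P ord par blk start vis : ℕ → ℕ} (h : LayoutInv n off al N P N s ord par blk start vis)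
    (hA : ListsOf T off al) (hT : T.Connected) (hN : 0 < N) :
    s = n ∧ Layout T N ord par blk start := by
  have h1 := h.blocks.start_add_le (Nat.zero_le N) le_rfl
  rw [h.start_eq] at h1
  have hsn : s = n := by
    refine hA.eq_of_closed hT (by omega) h.ord_lt h.inj fun p hp v hv => ?_
    rcases (h.vis_iff v (hA.adj (h.ord_lt p hp) hv).2).1 (h.closed p hp v hv) with h2 | ⟨i, hi, h2⟩
    · exact h2
    · refine ⟨start i, ?_, by rw [h.ord_start i hi, h2]⟩
      have := h.blocks.start_add_le hi.le le_rfl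
      rw [h.start_eq] at this
      omega
  subst hsn
  exact ⟨rfl, h.blocks, hA.treeOrder h.ord_lt h.inj (fun p h0 hp => h.blocks.par_lt hp h0) h.listed,
    h.ord_lt, h.inj⟩

theorem PathDone.listed [NeZero n] {T : SimpleGraph (Fin n)} {N : ℕ} {P : ℕ → ℕ}
    (hP : PathDone T N P) (hA : ListsOf T off al) {i : ℕ} (hi : i + 1 < N) :
    Listed off al (P i) (P (i + 1)) := by
  have h1 := hP.lt i (by omega)
  have h2 := hP.lt (i + 1) hi
  refine (hA.listed_iff _ _ h1).2 ⟨h1, h2, ?_⟩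
  have := (hP.adj i hi).symm
  convert this using 1
  · exact Fin.ext (Nat.mod_eq_of_lt h1).symm
  · exact Fin.ext (Nat.mod_eq_of_lt h2).symm

theorem runs_listBlocks [NeZero n] {T : SimpleGraph (Fin n)} (hL : ListsReady n off al B σ)
    (hA : ListsOf T off al) (hT : T.Connected) (h1 : σ.reg 1 = n) (hN : 0 < σ.reg 10)
    (hNn : σ.reg 10 ≤ n) (hP : PathDone T (σ.reg 10) (σ.arr 9)) :
    Runs B listBlocks σ fun m τ => m ≤ 4 * n + off n ∧
      Layout T (σ.reg 10) (τ.arr 4) (τ.arr 5) (τ.arr 7) (τ.arr 8) := by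
  have hn : 0 < n := NeZero.pos n
  have hB := hL.bound
  set N := σ.reg 10 with hN'
  set P := σ.arr 9 with hP'
  rw [listBlocks, runs_seq]
  refine (runs_clearVisited (by omega)).mono fun m τ hs hq => ?_
  obtain ⟨rfl, hvis⟩ := hq
  have e10 := hs.reg 10 rfl
  have e9 := hs.arr 9 rfl
  rw [h1] at hvis
  rw [← hN'] at e10
  rw [← hP'] at e9
  simp only [runs_seq, runs_assign, Expr.val, zero_add, Nat.zero_le, true_and, h1]
  refine runs_loop (fun m τ => τ.reg 13 = m ∧ m ≤ N ∧
    ∀ v < n, τ.arr 3 v ≠ 0 ↔ ∃ i < m, P i = v) (fun τ => N - τ.reg 13) ?_ ?_ ?_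
  · simp +contextual [hvis]
  · rintro m ρ hs' ⟨g1, g2, g3⟩ hb
    have f10 : ρ.reg 10 = N := by rw [hs'.reg 10 rfl]; simpa using e10
    have f9 : ρ.arr 9 = P := by rw [hs'.arr 9 rfl]; simpa using e9
    simp only [Test.Holds, Expr.val, f10, g1] at hb
    simp only [runs_seq, runs_store, runs_assign, Expr.val, State.setReg_reg, State.setArr_reg,
      State.setReg_arr, State.setArr_arr, if_true, g1, f9]
    refine ⟨by omega, by omega, ⟨trivial, by omega, fun v hv => ?_⟩, by omega⟩
    rw [Function.update_apply]
    split_ifs with h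
    · exact ⟨fun _ => ⟨m, by omega, h.symm⟩, fun _ => one_ne_zero⟩
    · rw [g3 v hv]
      constructor
      · rintro ⟨i, hi, h2⟩
        exact ⟨i, by omega, h2⟩
      · rintro ⟨i, hi, h2⟩
        have : i ≠ m := by
          rintro rfl
          exact h h2.symm
        exact ⟨i, by omega, h2⟩
  rintro m ρ hs' ⟨g1, g2, g3⟩ hb
  have f10 : ρ.reg 10 = N := by rw [hs'.reg 10 rfl]; simpa using e10
  have f9 : ρ.arr 9 = P := by rw [hs'.arr 9 rfl]; simpa using e9
  simp only [Test.Holds, Expr.val, f10, g1] at hb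
  obtain rfl : m = N := by omega
  have hLρ : ListsReady n off al B ρ := by
    refine ⟨hL.bound, ?_, ?_, hL.off_mono, hL.off_le, hL.al_lt⟩
    · rw [hs'.arr 0 rfl]
      exact (hs.arr 0 rfl).trans hL.arr_off
    · rw [hs'.arr 1 rfl]
      exact (hs.arr 1 rfl).trans hL.arr_al
  -- The boundary after the last finished block is written only when the next block begins, and
  -- after the loop for the end. The invariant therefore speaks of the array as it will be after
  -- this write.
  refine runs_loop (fun m τ => τ.reg 3 = τ.reg 2 ∧ (∀ i, i + 1 = τ.reg 8 → τ.reg 9 = τ.arr 8 i) ∧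
    (τ.reg 8 = 0 → τ.reg 9 = 0) ∧
    LayoutInv n off al N P (τ.reg 8) (τ.reg 3) (τ.arr 4) (τ.arr 5) (τ.arr 7)
      (Function.update (τ.arr 8) (τ.reg 8) (τ.reg 3)) (τ.arr 3) ∧
    m = τ.reg 8 + ∑ p ∈ Finset.range (τ.reg 3), (1 + (off (τ.arr 4 p + 1) - off (τ.arr 4 p))))
    (fun τ => N - τ.reg 8) ?_ ?_ ?_
  · simp only [State.setReg_reg, State.setReg_arr, Nat.reduceEqDiff, if_false, if_true]
    exact ⟨trivial, fun i hi => hi.elim, fun _ => trivial,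
      LayoutInv.init (Function.update_self ..) g3, by simp⟩
  · rintro m τ hs2 ⟨k1, k2, k3, k4, k5⟩ hb
    have c10 : τ.reg 10 = N := by rw [hs2.reg 10 rfl]; simpa using f10
    have c9 : τ.arr 9 = P := by rw [hs2.arr 9 rfl]; simpa using f9
    simp only [Test.Holds, Expr.val, c10] at hb
    have hsn := k4.s_le hP.lt hb
    have k9 : τ.reg 9 ≤ n := by
      rcases Nat.eq_zero_or_pos (τ.reg 8) with h0 | h0
      · rw [k3 h0]
        exact Nat.zero_le _
      · rw [k2 (τ.reg 8 - 1) (by omega)]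
        have h2 := k4.blocks.start_le_n (show τ.reg 8 - 1 ≤ τ.reg 8 by omega)
        rw [Function.update_of_ne (by omega)] at h2
        omega
    have hPj := hP.lt _ hb
    simp only [runs_seq, runs_store, runs_assign, Expr.val, State.setReg_reg, State.setArr_reg,
      State.setReg_arr, State.setArr_arr, if_true, if_false, Nat.reduceEqDiff, c9, zero_add,
      add_zero]
    refine ⟨by omega, by omega, ?_⟩
    have hLτ : ListsReady n off al B ((τ.setArr 8 (τ.reg 8) (τ.reg 3)).setReg 7 (P (τ.reg 8))) := by
      refine ⟨hL.bound, ?_, ?_, hL.off_mono, hL.off_le, hL.al_lt⟩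
      · simp only [State.setReg_arr, State.setArr_arr, Nat.reduceEqDiff, if_false]
        rw [hs2.arr 0 rfl]
        exact hLρ.arr_off
      · simp only [State.setReg_arr, State.setArr_arr, Nat.reduceEqDiff, if_false]
        rw [hs2.arr 1 rfl]
        exact hLρ.arr_al
    refine (runs_traverse hLτ ?_ ?_ ?_ ?_ ?_).mono fun l ξ hs3 hq => ?_
    iterate 5
      simp only [State.setReg_reg, State.setArr_reg, Nat.reduceEqDiff, if_false, if_true]
      omega
    obtain ⟨q1, q2, q3⟩ := hq
    simp only [State.setReg_reg, State.setArr_reg, State.setReg_arr, State.setArr_arr,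
      Nat.reduceEqDiff, if_false, if_true, BfsState] at q2 q3
    have d8 : ξ.reg 8 = τ.reg 8 := by rw [hs3.reg 8 rfl]; simp
    have a8 : ξ.arr 8 = Function.update (τ.arr 8) (τ.reg 8) (τ.reg 3) := by
      rw [hs3.arr 8 rfl]; simp
    rw [q1] at q3
    have hstep := k4.step hP (fun i hi => hP.listed hA hi) hb (fun i hi => ?_) q3
    · have hle := hstep.blocks.start_le_n (show τ.reg 8 ≤ τ.reg 8 + 1 by omega)
      rw [Function.update_of_ne (by omega), Function.update_self] at hle
      simp only [d8, a8, Function.update_self]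
      refine ⟨by omega, by omega, ⟨q1.symm, fun i hi => ?_, fun h => absurd h (by simp), hstep,
          ?_⟩, by omega⟩
      · obtain rfl : i = τ.reg 8 := by omega
        rw [Function.update_self]
      · have h5 : ∑ p ∈ Finset.range (τ.reg 3), (1 + (off (τ.arr 4 p + 1) - off (τ.arr 4 p))) =
            ∑ p ∈ Finset.range (τ.reg 3), (1 + (off (ξ.arr 4 p + 1) - off (ξ.arr 4 p))) :=
          Finset.sum_congr rfl fun p hp => by rw [q3.ord_old p (Finset.mem_range.1 hp)]
        have h6 := Finset.sum_range_add_sum_Ico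
          (fun p => 1 + (off (ξ.arr 4 p + 1) - off (ξ.arr 4 p))) hle
        rw [← h6, k5, q2, h5]
        omega
    · rw [k2 i hi, Function.update_of_ne (by omega)]
  · rintro m τ hs2 ⟨k1, k2, k3, k4, k5⟩ hb
    have c10 : τ.reg 10 = N := by rw [hs2.reg 10 rfl]; simpa using f10
    simp only [Test.Holds, Expr.val, c10] at hb
    have e8 : τ.reg 8 = N := by
      have := k4.le
      omega
    rw [e8] at k4
    obtain ⟨k6, k7⟩ := k4.layout hA hT hN
    simp only [runs_store, Expr.val, State.setArr_arr, Nat.reduceEqDiff, if_false, if_true, c10]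
    refine ⟨by omega, ?_, k7⟩
    have := sum_lists_le hL.off_mono k7.ord_lt k7.ord_inj
    rw [k6, e8] at k5
    omega

/-- Find a longest path, and list the vertices block by block. -/
def layOut : Program :=
  7 ⟵ K 0 ;; sweep ;; 7 ⟵ A 4 (R 1 -ₑ K 1) ;; sweep ;; storePath ;; listBlocks

/-- The second search starts at the last, hence farthest, vertex of the first, so its depth is at
least the diameter. The count is two searches of at most `2 * n + off n` passes each, at most `n`
passes for the path, and `4 * n + off n` for the blocks. -/
theorem runs_layOut [NeZero n] {T : SimpleGraph (Fin n)} (hL : ListsReady n off al B σ)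
    (hA : ListsOf T off al) (hT : T.IsTree) (h1 : σ.reg 1 = n) :
    Runs B layOut σ fun m τ => m ≤ 9 * n + 3 * off n ∧ 0 < τ.reg 10 ∧ τ.reg 10 ≤ n ∧
      T.diam ≤ τ.reg 10 - 1 ∧
      Layout T (τ.reg 10) (τ.arr 4) (τ.arr 5) (τ.arr 7) (τ.arr 8) := by
  have hn : 0 < n := NeZero.pos n
  have hB := hL.bound
  simp only [layOut, runs_seq, runs_assign, Expr.val, Nat.zero_le, true_and, zero_add]
  refine (runs_sweep (n := n) (off := off) (al := al) (T := T) (σ := σ.setReg 7 0)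
    ⟨hL.bound, hL.arr_off, hL.arr_al, hL.off_mono, hL.off_le, hL.al_lt⟩ hA hT.connected (by simpa)
    (by simpa)).mono fun m τ hs hq => ?_
  obtain ⟨g1, g2⟩ := hq
  simp only [State.setReg_reg, if_true] at g2
  have t1 : τ.reg 1 = n := by rw [hs.reg 1 rfl]; simpa
  have hroot : τ.arr 4 (τ.reg 1 - 1) < n := by
    rw [t1]
    exact g2.ord_lt _ (by omega)
  refine ⟨by omega, ?_⟩
  have hLτ : ListsReady n off al B τ :=
    ListsReady.of_same (σ := σ.setReg 7 0) (p := sweep)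
      ⟨hL.bound, hL.arr_off, hL.arr_al, hL.off_mono, hL.off_le, hL.al_lt⟩ hs rfl rfl
  refine (runs_sweep (n := n) (off := off) (al := al) (T := T)
    (σ := τ.setReg 7 (τ.arr 4 (τ.reg 1 - 1)))
    ⟨hL.bound, hLτ.arr_off, hLτ.arr_al, hL.off_mono, hL.off_le, hL.al_lt⟩ hA hT.connected (by simpa)
    (by simpa)).mono fun m' ρ hs' hq => ?_
  obtain ⟨g3, g4⟩ := hq
  simp only [State.setReg_reg, if_true, t1] at g4
  have r1 : ρ.reg 1 = n := by rw [hs'.reg 1 rfl]; simpa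
  have hLρ : ListsReady n off al B ρ :=
    ListsReady.of_same (σ := τ.setReg 7 (τ.arr 4 (τ.reg 1 - 1))) (p := sweep)
      ⟨hL.bound, hLτ.arr_off, hLτ.arr_al, hL.off_mono, hL.off_le, hL.al_lt⟩ hs' rfl rfl
  refine (runs_storePath hB r1 g4).mono fun m2 ξ hs2 hq => ?_
  obtain ⟨g5, g6, g7⟩ := hq
  have hd := g4.depth_le_self (n - 1) (by omega)
  rw [← g6] at g7
  refine (runs_listBlocks (hLρ.of_same hs2 rfl rfl) hA hT.connected ((hs2.reg 1 rfl).trans r1)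
    (by omega) (by omega) g7).mono fun m3 ζ hs3 hq => ?_
  obtain ⟨g8, g9⟩ := hq
  have z10 := hs3.reg 10 rfl
  rw [z10]
  refine ⟨by omega, by omega, by omega, ?_, g9⟩
  rw [g6, Nat.add_sub_cancel]
  exact g2.order.diam_le g4.order hT hn g2.depth_zero g2.depth_eq g4.depth_eq g2.depth_le
    g4.depth_le (by rw [g4.ord_zero])

end RAM


/-! ### The input -/

theorem List.getD_flatMap_range (f : ℕ → List ℕ) (d : ℕ) {n v i : ℕ} (hv : v < n)
    (hi : i < (f v).length) :
    ((List.range n).flatMap f).getD (∑ u ∈ Finset.range v, (f u).length + i) d = (f v).getD i d := by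
  have hlen : ∀ n, ((List.range n).flatMap f).length = ∑ u ∈ Finset.range n, (f u).length := by
    intro n
    induction n with
    | zero => simp
    | succ n ih => rw [List.range_succ, List.flatMap_append, List.length_append, ih,
        Finset.sum_range_succ, List.flatMap_singleton]
  induction n with
  | zero => omega
  | succ n ih =>
    rw [List.range_succ, List.flatMap_append, List.flatMap_singleton]
    rcases Nat.lt_or_eq_of_le (Nat.le_of_lt_succ hv) with h | rfl
    · rw [List.getD_append _ _ _ _ ?_, ih h]
      have h1 : ∑ u ∈ Finset.range (v + 1), (f u).length ≤ ∑ u ∈ Finset.range n, (f u).length :=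
        Finset.sum_le_sum_of_subset (Finset.range_mono h)
      rw [Finset.sum_range_succ] at h1
      rw [hlen]
      omega
    · rw [List.getD_append_right _ _ _ _ (by rw [hlen]; omega), hlen, Nat.add_sub_cancel_left]

namespace IsAdjacencyList

variable {n : ℕ} {T : SimpleGraph (Fin n)} {adj : Fin n → List (Fin n)}

/-- The list of `v`, as a list of natural numbers. -/
def natList (adj : Fin n → List (Fin n)) (v : ℕ) : List ℕ :=
  if h : v < n then (adj ⟨v, h⟩).map Fin.val else []

theorem arr_zero (k : ℕ) {v : ℕ} (hv : v ≤ n) :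
    (inputState k adj).arr 0 v = ∑ u ∈ Finset.range v, (natList adj u).length := by
  have h1 : ∀ u : Fin n, (if u.val < v then (adj u).length else 0) =
      (fun u : ℕ => if u < v then (natList adj u).length else 0) u.val := fun u => by
    simp [natList]
  simp only [inputState, if_true, if_pos hv]
  rw [Finset.sum_congr rfl fun u _ => h1 u,
    Fin.sum_univ_eq_sum_range (fun u : ℕ => if u < v then (natList adj u).length else 0) n,
    ← Finset.sum_filter]
  congr 1
  ext u
  simp only [Finset.mem_filter, Finset.mem_range]
  omega

theorem arr_one (k : ℕ) {v i : ℕ} (hv : v < n) (hi : i < (natList adj v).length) :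
    (inputState k adj).arr 1 ((inputState k adj).arr 0 v + i) = (natList adj v).getD i 0 := by
  rw [arr_zero k hv.le, ← List.getD_flatMap_range (natList adj) 0 hv hi]
  simp only [inputState, one_ne_zero, if_false, if_true]
  congr 1
  rw [List.map_flatMap, ← List.map_coe_finRange_eq_range, List.flatMap_map]
  congr 1
  ext1 u
  simp [natList]

theorem arr_zero_succ (k : ℕ) {v : ℕ} (hv : v < n) :
    (inputState k adj).arr 0 (v + 1) = (inputState k adj).arr 0 v + (natList adj v).length := by
  rw [arr_zero k hv, arr_zero k hv.le, Finset.sum_range_succ]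

/-- The lists have twice as many entries as the tree has edges; so the input has linear size, and
its indices fit into words. -/
theorem arr_zero_last [DecidableRel T.Adj] (h : IsAdjacencyList T adj) (hT : T.IsTree) (k : ℕ) :
    (inputState k adj).arr 0 n ≤ 2 * n := by
  have h1 : ∀ u : Fin n, (natList adj u).length = T.degree u := fun u => by
    rw [← T.card_neighborFinset_eq_degree, natList, dif_pos u.2, List.length_map,
      ← List.toFinset_card_of_nodup (h.nodup u)]
    congr 1
    ext w
    simp [h.mem_iff]
  have h2 := T.sum_degrees_eq_twice_card_edges
  have h3 := hT.card_edgeFinset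
  rw [Fintype.card_fin] at h3
  rw [arr_zero k le_rfl, ← Fin.sum_univ_eq_sum_range (fun u => (natList adj u).length),
    Finset.sum_congr rfl fun u _ => h1 u, h2]
  omega

theorem listed_iff (k : ℕ) {v u : ℕ} (hv : v < n) :
    RAM.Listed ((inputState k adj).arr 0) ((inputState k adj).arr 1) v u ↔
      u ∈ natList adj v := by
  rw [RAM.Listed, List.mem_iff_getElem]
  constructor
  · rintro ⟨e, h1, h2, h3⟩
    rw [arr_zero_succ k hv] at h2
    obtain ⟨i, rfl⟩ := Nat.exists_eq_add_of_le h1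
    have hi : i < (natList adj v).length := by omega
    rw [arr_one k hv hi, List.getD_eq_getElem _ _ hi] at h3
    exact ⟨i, hi, h3⟩
  · rintro ⟨i, hi, h3⟩
    refine ⟨_, Nat.le_add_right _ i, by rw [arr_zero_succ k hv]; omega, ?_⟩
    rw [arr_one k hv hi, List.getD_eq_getElem _ _ hi, h3]

theorem listsOf (h : IsAdjacencyList T adj) (k : ℕ) :
    ListsOf T ((inputState k adj).arr 0) ((inputState k adj).arr 1) where
  listed_iff v u hv := by
    rw [listed_iff k hv, natList, dif_pos hv, List.mem_map]
    constructor
    · rintro ⟨w, hw, rfl⟩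
      exact ⟨hv, w.2, (h.mem_iff _ _).1 hw⟩
    · rintro ⟨_, hu, ha⟩
      exact ⟨⟨u, hu⟩, (h.mem_iff _ _).2 ha, rfl⟩

theorem listsReady [DecidableRel T.Adj] (h : IsAdjacencyList T adj) (hT : T.IsTree) (k : ℕ) {B : ℕ}
    (hB : 2 * n + 2 ≤ B) :
    RAM.ListsReady n ((inputState k adj).arr 0) ((inputState k adj).arr 1) B
        (inputState k adj) where
  bound := hB
  arr_off := rfl
  arr_al := rfl
  off_mono v hv := by
    rw [arr_zero_succ k hv]
    omega
  off_le v hv := by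
    have h1 := h.arr_zero_last hT k
    have h2 : (inputState k adj).arr 0 (v + 1) ≤ (inputState k adj).arr 0 n := by
      rw [arr_zero k hv, arr_zero k le_rfl]
      exact Finset.sum_le_sum_of_subset (Finset.range_mono hv)
    omega
  al_lt v hv e h1 h2 := by
    have h3 := (listed_iff (adj := adj) k hv).1 ⟨e, h1, h2, rfl⟩
    rw [natList, dif_pos hv, List.mem_map] at h3
    obtain ⟨w, -, hw⟩ := h3
    rw [← hw]
    exact w.2

theorem bounded [DecidableRel T.Adj] (h : IsAdjacencyList T adj) (hT : T.IsTree) {k B : ℕ}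
    (hB : 2 * n + 2 ≤ B) (hk : k ≤ B) : (inputState k adj).Bounded B where
  reg r := by
    simp only [inputState]
    split_ifs <;> omega
  arr a i := by
    by_cases h0 : a = 0
    · subst h0
      by_cases hi : i ≤ n
      · have h1 := h.arr_zero_last hT k
        have h2 : (inputState k adj).arr 0 i ≤ (inputState k adj).arr 0 n := by
          rw [arr_zero k hi, arr_zero k le_rfl]
          exact Finset.sum_le_sum_of_subset (Finset.range_mono hi)
        omega
      · simp [inputState, hi]
    · by_cases h1 : a = 1
      · subst h1
        simp only [inputState, one_ne_zero, if_false, if_true]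
        have h2 : ∀ x ∈ ((List.finRange n).flatMap adj).map Fin.val, x < n := by
          intro x hx
          obtain ⟨w, -, rfl⟩ := List.mem_map.1 hx
          exact w.2
        by_cases hi : i < (((List.finRange n).flatMap adj).map Fin.val).length
        · rw [List.getD_eq_getElem _ _ hi]
          have := h2 _ (List.getElem_mem hi)
          omega
        · rw [List.getD_eq_default _ _ (by omega)]
          exact Nat.zero_le _
      · simp [inputState, h0, h1]

end IsAdjacencyList


/-! ### Bounded states, and copying -/

namespace RAM

variable {B : ℕ} {σ : State} {Q : ℕ → State → Prop}

theorem Run.bounded {p : Program} {σ τ : State} {m : ℕ} (h : Run B p σ m τ) :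
    σ.Bounded B → τ.Bounded B := by
  induction h with
  | skip σ => exact id
  | assign r e σ h => exact fun hσ => hσ.setReg h r
  | store a i e σ h => exact fun hσ => hσ.setArr h a _
  | seq _ _ ihp ihq => exact fun hσ => ihq (ihp hσ)
  | branch_true _ _ ih => exact ih
  | branch_false _ _ ih => exact ih
  | loop_true _ _ _ ihp ihl => exact fun hσ => ihl (ihp hσ)
  | loop_false _ => exact id

theorem Runs.bounded {p : Program} (h : Runs B p σ Q) (hσ : σ.Bounded B) :
    Runs B p σ fun m τ => Q m τ ∧ τ.Bounded B := by
  obtain ⟨m, τ, hr, hq⟩ := h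
  exact ⟨m, τ, hr, hq, hr.bounded hσ⟩

/-- Copy the first entries of array `b` to array `a`, as many as register `1` says. -/
def copyArray (a b : ℕ) : Program :=
  14 ⟵ K 0 ;; Program.loop (R 14 <ₑ R 1) (Program.store a (R 14) (A b (R 14)) ;; 14 ⟵ R 14 +ₑ K 1)

theorem runs_copyArray {a b : ℕ} (hab : b ≠ a) (h1 : σ.reg 1 ≤ B) (hb : ∀ i, σ.arr b i ≤ B) :
    Runs B (copyArray a b) σ fun m τ => m = σ.reg 1 ∧ ∀ i < σ.reg 1, τ.arr a i = σ.arr b i := by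
  simp only [copyArray, runs_seq, runs_assign, Expr.val, zero_add, Nat.zero_le, true_and]
  refine runs_loop (fun m τ => τ.reg 14 = m ∧ m ≤ σ.reg 1 ∧ ∀ i < m, τ.arr a i = σ.arr b i)
    (fun τ => σ.reg 1 - τ.reg 14) ?_ ?_ ?_
  · simp
  · rintro m τ hs ⟨g1, g2, g3⟩ hlt
    have e1 : τ.reg 1 = σ.reg 1 := by rw [hs.reg 1 rfl]; simp
    have eb : τ.arr b = σ.arr b := by rw [hs.arr b (by simp [Program.writesArr, hab])]; simp
    simp only [Test.Holds, Expr.val, e1, g1] at hlt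
    simp only [runs_seq, runs_store, runs_assign, Expr.val, State.setReg_reg, State.setArr_reg,
      State.setReg_arr, State.setArr_arr, if_true, g1, eb]
    refine ⟨hb _, by omega, ⟨trivial, by omega, fun i hi => ?_⟩, by omega⟩
    rw [Function.update_apply]
    split_ifs with h
    · rw [h]
    · exact g3 i (by omega)
  · rintro m τ hs ⟨g1, g2, g3⟩ hlt
    have e1 : τ.reg 1 = σ.reg 1 := by rw [hs.reg 1 rfl]; simp
    simp only [Test.Holds, Expr.val, e1, g1] at hlt
    obtain rfl : m = σ.reg 1 := by omega
    exact ⟨rfl, g3⟩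

/-- Give the colour in register `22` to all positions from register `25` to register `26`. -/
def paintRange : Program :=
  14 ⟵ R 25 ;; Program.loop (R 14 <ₑ R 26) (Program.store 10 (R 14) (R 22) ;; 14 ⟵ R 14 +ₑ K 1)

theorem runs_paintRange (hlh : σ.reg 25 ≤ σ.reg 26) (hB : σ.reg 26 ≤ B) (hc : σ.reg 22 ≤ B) :
    Runs B paintRange σ fun m τ => m ≤ σ.reg 26 ∧
      ∀ p, τ.arr 10 p = if σ.reg 25 ≤ p ∧ p < σ.reg 26 then σ.reg 22 else σ.arr 10 p := by
  simp only [paintRange, runs_seq, runs_assign, Expr.val, zero_add]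
  refine ⟨by omega, ?_⟩
  refine runs_loop (fun m τ => σ.reg 25 + m = τ.reg 14 ∧ τ.reg 14 ≤ σ.reg 26 ∧
    ∀ p, τ.arr 10 p = if σ.reg 25 ≤ p ∧ p < τ.reg 14 then σ.reg 22 else σ.arr 10 p)
    (fun τ => σ.reg 26 - τ.reg 14) ?_ ?_ ?_
  · simp only [State.setReg_reg, State.setReg_arr, if_true]
    refine ⟨rfl, hlh, fun p => ?_⟩
    rw [if_neg (by omega)]
  · rintro m τ hs ⟨g1, g2, g3⟩ hlt
    have e26 : τ.reg 26 = σ.reg 26 := by rw [hs.reg 26 rfl]; simp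
    have e22 : τ.reg 22 = σ.reg 22 := by rw [hs.reg 22 rfl]; simp
    simp only [Test.Holds, Expr.val, e26] at hlt
    simp only [runs_seq, runs_store, runs_assign, Expr.val, State.setReg_reg, State.setArr_reg,
      State.setReg_arr, State.setArr_arr, if_true, e22]
    refine ⟨by omega, by omega, ⟨by omega, by omega, fun p => ?_⟩, by omega⟩
    rw [Function.update_apply, g3 p]
    split_ifs <;> first | rfl | omega
  · rintro m τ hs ⟨g1, g2, g3⟩ hlt
    have e26 : τ.reg 26 = σ.reg 26 := by rw [hs.reg 26 rfl]; simp
    simp only [Test.Holds, Expr.val, e26] at hlt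
    have h : τ.reg 14 = σ.reg 26 := by omega
    rw [h] at g3
    exact ⟨by omega, g3⟩

/-! ### The tools -/

/-- There are `m` disjoint windows of `W` blocks, starting at the blocks `tl 0 < tl 1 < …`, that
contain few vertices. -/
structure ToolSet (n N W r : ℕ) (start tl : ℕ → ℕ) (m : ℕ) : Prop where
  le : ∀ j < m, tl j + W ≤ N
  small : ∀ j < m, 2 * r * (start (tl j + W) - start (tl j)) ≤ n
  sep : ∀ i j, i < j → j < m → tl i + W ≤ tl j

/-- The positions that belong to the `j`-th window. -/
def tool (W : ℕ) (start tl : ℕ → ℕ) (j : ℕ) : Finset ℕ :=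
  Finset.Ico (start (tl j)) (start (tl j + W))

theorem mem_tool {W : ℕ} {start tl : ℕ → ℕ} {j p : ℕ} :
    p ∈ tool W start tl j ↔ start (tl j) ≤ p ∧ p < start (tl j + W) := Finset.mem_Ico

/-- Compute the number of blocks of a window, choose the windows, and store their first blocks in
array `14`.  The positions in the windows get the colour `k + 1`, the others the colour `k`. -/
def selectTools : Program :=
  11 ⟵ R 10 /ₑ (K 3 *ₑ (R 0 -ₑ K 1)) ;; 25 ⟵ K 0 ;; 26 ⟵ R 1 ;; 22 ⟵ R 0 ;; paintRange ;;
  22 ⟵ R 0 +ₑ K 1 ;; 13 ⟵ K 0 ;; 15 ⟵ K 0 ;;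
  Program.loop (R 15 +ₑ K 1 <ₑ R 0)
    (25 ⟵ A 8 (R 13 *ₑ R 11) ;; 26 ⟵ A 8 (R 13 *ₑ R 11 +ₑ R 11) ;;
    Program.branch (K 2 *ₑ (R 0 -ₑ K 1) *ₑ (R 26 -ₑ R 25) <ₑ R 1 +ₑ K 1)
      (Program.store 14 (R 15) (R 13 *ₑ R 11) ;; 15 ⟵ R 15 +ₑ K 1 ;; paintRange) Program.skip ;;
    13 ⟵ R 13 +ₑ K 1)

/-- Pigeonhole: `3 * (k - 1)` consecutive windows of `W` blocks fit into the `N` blocks. A rejected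
window has more than `n / (2 * (k - 1))` vertices, so fewer than `2 * (k - 1)` are rejected, and at
least `k - 1` remain. -/
theorem runs_selectTools {n N k : ℕ} {par blk start : ℕ → ℕ} (hT : Blocks n N par blk start)
    (h0 : σ.reg 0 = k) (h1 : σ.reg 1 = n) (h10 : σ.reg 10 = N) (h8 : σ.arr 8 = start)
    (hk : 2 ≤ k) (hkB : k + 1 ≤ B) (hB : 2 * n + 2 ≤ B) (hW : 1 ≤ N / (3 * (k - 1))) :
    Runs B selectTools σ fun m τ => m ≤ n + 3 * (k - 1) * (n + 1) ∧
      τ.reg 11 = N / (3 * (k - 1)) ∧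
      ToolSet n N (N / (3 * (k - 1))) (k - 1) start (τ.arr 14) (k - 1) ∧
      ∀ p < n, ((∃ j < k - 1, p ∈ tool (N / (3 * (k - 1))) start (τ.arr 14) j) ∧
          τ.arr 10 p = k + 1) ∨
        ((∀ j < k - 1, p ∉ tool (N / (3 * (k - 1))) start (τ.arr 14) j) ∧ τ.arr 10 p = k) := by
  set W := N / (3 * (k - 1)) with hWdef
  have hNn : N ≤ n := by
    have := hT.start_add_le (Nat.zero_le N) le_rfl
    rw [hT.start_last] at this
    omega
  have hWN : 3 * (k - 1) * W ≤ N := Nat.mul_div_le _ _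
  have hW1 : W ≤ N := Nat.div_le_self _ _
  have h3N : 3 * (k - 1) ≤ N := (Nat.le_mul_of_pos_right _ hW).trans hWN
  simp only [selectTools, runs_seq, runs_assign, Expr.val, State.setReg_reg, Nat.reduceEqDiff,
    if_false, h0, h1, h10, zero_add, Nat.zero_le, true_and, ← hWdef]
  refine ⟨by omega, by omega, by omega, ?_⟩
  refine (runs_paintRange (by simp) (by simp; omega) (by simp; omega)).mono fun m τ hs hq => ?_
  obtain ⟨q1, q2⟩ := hq
  simp only [State.setReg_reg, State.setReg_arr, Nat.reduceEqDiff, if_false, if_true] at q1 q2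
  have e0 : τ.reg 0 = k := by rw [hs.reg 0 rfl]; simpa
  have e1 : τ.reg 1 = n := by rw [hs.reg 1 rfl]; simpa
  have e11 : τ.reg 11 = W := by rw [hs.reg 11 rfl]; simp
  have e8 : τ.arr 8 = start := by rw [hs.arr 8 rfl]; simpa
  simp only [e0]
  refine ⟨hkB, ?_⟩
  have hprod : ∀ i, i < 3 * (k - 1) → i * W + W ≤ N := fun i hi => by
    rw [← Nat.succ_mul]
    exact (Nat.mul_le_mul_right W hi).trans hWN
  refine runs_loop (fun l ρ => l ≤ ρ.reg 13 * (n + 1) ∧ ρ.reg 13 ≤ 3 * (k - 1) ∧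
    ρ.reg 15 ≤ ρ.reg 13 ∧ ρ.reg 15 ≤ k - 1 ∧
    (ρ.reg 13 - ρ.reg 15) * (n + 1) ≤ 2 * (k - 1) * start (ρ.reg 13 * W) ∧
    (∀ j < ρ.reg 15, ρ.arr 14 j + W ≤ ρ.reg 13 * W) ∧
    ToolSet n N W (k - 1) start (ρ.arr 14) (ρ.reg 15) ∧
    ∀ p < n, ((∃ j < ρ.reg 15, p ∈ tool W start (ρ.arr 14) j) ∧ ρ.arr 10 p = k + 1) ∨
        ((∀ j < ρ.reg 15, p ∉ tool W start (ρ.arr 14) j) ∧ ρ.arr 10 p = k))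
    (fun ρ => 3 * (k - 1) - ρ.reg 13) ?_ ?_ ?_
  · simp only [State.setReg_reg, State.setReg_arr, Nat.reduceEqDiff, if_false, if_true]
    refine ⟨Nat.zero_le _, Nat.zero_le _, le_rfl, Nat.zero_le _, by simp, fun j hj => by omega,
      ⟨fun j hj => by omega, fun j hj => by omega, fun i j _ hj => by omega⟩,
      fun p hp => Or.inr ⟨fun j hj => by omega, ?_⟩⟩
    rw [q2 p, if_pos ⟨Nat.zero_le _, hp⟩]
  · rintro l ρ hs2 ⟨g1, g2, g3, g4, g5, g6, g7, g8⟩ hb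
    have f0 : ρ.reg 0 = k := by rw [hs2.reg 0 rfl]; simpa
    have f1 : ρ.reg 1 = n := by rw [hs2.reg 1 rfl]; simpa
    have f11 : ρ.reg 11 = W := by rw [hs2.reg 11 rfl]; simpa
    have f8 : ρ.arr 8 = start := by rw [hs2.arr 8 rfl]; simpa
    have f22 : ρ.reg 22 = k + 1 := by rw [hs2.reg 22 rfl]; simp
    simp only [Test.Holds, Expr.val, f0] at hb
    set i := ρ.reg 13 with hi
    set c := ρ.reg 15 with hc
    -- If the windows ran out while fewer than `k - 1` are chosen, at least `2 * (k - 1)` would have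
    -- been rejected, and by `g5` they would contain more than `n` vertices.
    have hi3 : i < 3 * (k - 1) := by
      refine lt_of_le_of_ne g2 fun he => ?_
      have h2 : start (i * W) ≤ n := hT.start_le_n (by rw [he]; exact hWN)
      have h3 : (i - c) * (n + 1) ≤ 2 * (k - 1) * n := g5.trans (Nat.mul_le_mul_left _ h2)
      have h4 : 2 * (k - 1) * (n + 1) ≤ (i - c) * (n + 1) := Nat.mul_le_mul_right _ (by omega)
      have h5 : 2 * (k - 1) * n < 2 * (k - 1) * (n + 1) :=
        Nat.mul_lt_mul_of_pos_left (Nat.lt_succ_self n) (by omega)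
      omega
    have hiW := hprod i hi3
    have s1 := hT.start_le (show i * W ≤ i * W + W by omega) hiW
    have s2 := hT.start_le_n hiW
    have hstep : (i + 1) * W = i * W + W := Nat.succ_mul _ _
    have htick : l + n + 1 ≤ (i + 1) * (n + 1) := by
      rw [Nat.succ_mul]
      omega
    simp only [runs_seq, runs_store, runs_assign, runs_branch, runs_skip, Test.Holds, Expr.val,
      State.setReg_reg, State.setArr_reg, State.setReg_arr, if_true, if_false,
      Nat.reduceEqDiff, f0, f1, f11, f8, zero_add, add_zero, ← hi, ← hc]
    refine ⟨by omega, by omega, fun hlt => ⟨by omega, by omega, ?_⟩, fun hge => ⟨by omega,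
      ⟨by omega, by omega, by omega, g4, ?_, fun j hj => ?_, g7, g8⟩, by omega⟩⟩
    · refine (runs_paintRange (by simpa) (by simp; omega) (by simp [f22]; omega)).mono
        fun m' ξ hs3 hq => ?_
      obtain ⟨p1, p2⟩ := hq
      simp only [State.setReg_reg, State.setArr_reg, State.setReg_arr, State.setArr_arr,
        Nat.reduceEqDiff, if_false, if_true, f22] at p1 p2
      have x13 : ξ.reg 13 = i := by rw [hs3.reg 13 rfl]; simp [hi]
      have x15 : ξ.reg 15 = c + 1 := by rw [hs3.reg 15 rfl]; simp
      have x14 : ξ.arr 14 = Function.update (ρ.arr 14) c (i * W) := by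
        rw [hs3.arr 14 rfl]; simp
      have hold : ∀ j < c, Function.update (ρ.arr 14) c (i * W) j = ρ.arr 14 j := fun j hj => by
        rw [Function.update_of_ne (by omega)]
      have htool : ∀ j < c, tool W start (Function.update (ρ.arr 14) c (i * W)) j =
          tool W start (ρ.arr 14) j := fun j hj => by rw [tool, tool, hold j hj]
      have hnew : ∀ p, p ∈ tool W start (Function.update (ρ.arr 14) c (i * W)) c ↔
          start (i * W) ≤ p ∧ p < start (i * W + W) := fun p => by
        rw [mem_tool, Function.update_self]
      simp only [x13, x15, x14]
      refine ⟨by omega, ⟨by omega, by omega, by omega, by omega, ?_, fun j hj => ?_,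
        ⟨fun j hj => ?_, fun j hj => ?_, fun a j ha hj => ?_⟩, fun p hp => ?_⟩, by omega⟩
      · rw [hstep, Nat.add_sub_add_right]
        exact g5.trans (Nat.mul_le_mul_left _ s1)
      · rcases Nat.lt_or_eq_of_le (Nat.le_of_lt_succ hj) with h | rfl
        · rw [hold j h]
          have := g6 j h
          omega
        · rw [Function.update_self]
          omega
      · rcases Nat.lt_or_eq_of_le (Nat.le_of_lt_succ hj) with h | rfl
        · rw [hold j h]
          exact g7.le j h
        · rw [Function.update_self]
          exact hiW
      · rcases Nat.lt_or_eq_of_le (Nat.le_of_lt_succ hj) with h | rfl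
        · rw [hold j h]
          exact g7.small j h
        · rw [Function.update_self]
          omega
      · rw [hold a (by omega)]
        rcases Nat.lt_or_eq_of_le (Nat.le_of_lt_succ hj) with h | rfl
        · rw [hold j h]
          exact g7.sep a j ha h
        · rw [Function.update_self]
          exact g6 a ha
      · rw [p2 p]
        split_ifs with h
        · exact Or.inl ⟨⟨c, by omega, (hnew p).2 h⟩, rfl⟩
        · rcases g8 p hp with ⟨⟨j, hj, h3⟩, h4⟩ | ⟨h3, h4⟩
          · exact Or.inl ⟨⟨j, by omega, by rwa [htool j hj]⟩, h4⟩
          · refine Or.inr ⟨fun j hj => ?_, h4⟩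
            rcases Nat.lt_or_eq_of_le (Nat.le_of_lt_succ hj) with h5 | rfl
            · rw [htool j h5]
              exact h3 j h5
            · rwa [hnew]
    · rw [hstep]
      have h2 : i + 1 - c = i - c + 1 := by omega
      have h3 : start (i * W + W) = start (i * W) + (start (i * W + W) - start (i * W)) := by omega
      rw [h2, Nat.succ_mul, h3, Nat.mul_add (2 * (k - 1))]
      omega
    · have := g6 j hj
      omega
  · rintro l ρ hs2 ⟨g1, g2, g3, g4, g5, g6, g7, g8⟩ hb
    have f0 : ρ.reg 0 = k := by rw [hs2.reg 0 rfl]; simpa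
    have f11 : ρ.reg 11 = W := by rw [hs2.reg 11 rfl]; simpa
    simp only [Test.Holds, Expr.val, f0] at hb
    have h15 : ρ.reg 15 = k - 1 := by omega
    rw [h15] at g7 g8
    have := Nat.mul_le_mul_right (n + 1) g2
    exact ⟨by omega, f11, g7, g8⟩

end RAM


/-! ### Filling up the colours one after the other -/

namespace RAM

/-- The number of positions whose colour is at most `j`. -/
def countLE (n : ℕ) (col : ℕ → ℕ) (j : ℕ) : ℕ :=
  ∑ p ∈ Finset.Ico 0 n, if col p ≤ j then 1 else 0

theorem countLE_congr {n j : ℕ} {col col' : ℕ → ℕ} (h : ∀ p < n, (col' p ≤ j ↔ col p ≤ j)) :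
    countLE n col' j = countLE n col j :=
  Finset.sum_congr rfl fun p hp => by simp only [h p (Finset.mem_Ico.1 hp).2]

theorem countLE_eq_add {n j j' : ℕ} {col col' : ℕ → ℕ} {Q : ℕ → Prop} [DecidablePred Q]
    (h : ∀ p < n, (col' p ≤ j' ↔ col p ≤ j ∨ Q p)) (hQ : ∀ p < n, Q p → ¬ col p ≤ j) :
    countLE n col' j' = countLE n col j + ∑ p ∈ Finset.Ico 0 n, if Q p then 1 else 0 := by
  rw [countLE, countLE, ← Finset.sum_add_distrib]
  refine Finset.sum_congr rfl fun p hp => ?_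
  have h1 := h p (Finset.mem_Ico.1 hp).2
  have h2 := hQ p (Finset.mem_Ico.1 hp).2
  by_cases hq : Q p
  · rw [if_pos (h1.2 (Or.inr hq)), if_neg (h2 hq), if_pos hq]
  · by_cases hc : col p ≤ j
    · rw [if_pos (h1.2 (Or.inl hc)), if_pos hc, if_neg hq]
    · rw [if_neg (fun h => (h1.1 h).elim hc hq), if_neg hc, if_neg hq]

theorem innerCut_congr {n N : ℕ} {par blk start col col' : ℕ → ℕ} (hT : Blocks n N par blk start)
    {a b : ℕ} (hb : b ≤ N) (h : ∀ p, start a ≤ p → p < start b → col' p = col p) (hab : a ≤ b) :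
    innerCut par col' (start a) (start b) = innerCut par col (start a) (start b) := by
  have hn := hT.start_le_n hb
  rw [innerCut, innerCut]
  congr 1
  refine Finset.filter_congr fun p hp => ?_
  rw [Finset.mem_Ioo] at hp
  have h1 := hT.le_par (by omega) (show a ≤ N by omega) hp.1
  have h2 := hT.par_lt (show p < n by omega) (by omega)
  rw [h p hp.1.le hp.2, h _ h1 (by omega)]

/-- A tree whose blocks are divided into `k - 1` windows and the rest `S`, which is divided into
pieces. -/
structure Division (n N W k : ℕ) (par blk start tl : ℕ → ℕ) (S : Finset ℕ) (w mark rt : ℕ → ℕ) :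
    Prop where
  blocks : Blocks n N par blk start
  tools : ToolSet n N W (k - 1) start tl (k - 1)
  mem_or : ∀ p < n, p ∈ S ∨ ∃ j < k - 1, p ∈ tool W start tl j
  lt_of_mem : ∀ p ∈ S, p < n
  not_mem : ∀ p ∈ S, ∀ j < k - 1, p ∉ tool W start tl j
  pieces : Pieces W S par w mark rt
  two_le : 2 ≤ k
  pos : 1 ≤ W

/-- The colours below `l` have the right numbers of vertices. -/
structure Progress (n W k : ℕ) (par start tl : ℕ → ℕ) (S : Finset ℕ) (mark rt : ℕ → ℕ) (Δ l g : ℕ)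
    (col : ℕ → ℕ) : Prop where
  bulk : ∀ p ∈ S, col p < l ∨ col p = k
  done : ∀ j < l, ∀ p ∈ tool W start tl j, col p ≤ l
  todo : ∀ j, l ≤ j → j < k - 1 → ∀ p ∈ tool W start tl j, col p = k + 1
  countLE_eq : ∀ j < l, countLE n col j = (j + 1) * n / k
  countLE_self : countLE n col l = g
  le : g ≤ (l + 1) * n / k
  attached : ∀ c, Attached S par mark rt c → col c = col (par c)
  cut_le : ∀ j < l, W * innerCut par col (start (tl j)) (start (tl j + W)) ≤
    7 * (start (tl j + W) - start (tl j)) * Δ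

variable {n N W k : ℕ} {par blk start tl : ℕ → ℕ} {S : Finset ℕ} {w mark rt : ℕ → ℕ} {Δ l g : ℕ}
  {col col' : ℕ → ℕ}

namespace Division

theorem card_tool (j : ℕ) :
    (tool W start tl j).card = start (tl j + W) - start (tl j) := Nat.card_Ico _ _

/-- Since `k ≤ 2 * (k - 1)` for `k ≥ 2`, a window is not larger than the average colour class. This
prevents the rest of a window from overfilling the next colour. -/
theorem mul_card_tool_le (h : Division n N W k par blk start tl S w mark rt) {j : ℕ}
    (hj : j < k - 1) : k * (start (tl j + W) - start (tl j)) ≤ n := by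
  have h1 := h.two_le
  exact (Nat.mul_le_mul_right _ (by omega)).trans (h.tools.small j hj)

theorem card_tool_le (h : Division n N W k par blk start tl S w mark rt) {j : ℕ}
    (hj : j < k - 1) : start (tl j + W) - start (tl j) ≤ n / k := by
  rw [Nat.le_div_iff_mul_le (by have := h.two_le; omega), mul_comm]
  exact h.mul_card_tool_le hj

theorem disjoint (h : Division n N W k par blk start tl S w mark rt) {i j p : ℕ} (hi : i < k - 1)
    (hj : j < k - 1) (hpi : p ∈ tool W start tl i) (hpj : p ∈ tool W start tl j) :
    i = j := by
  rw [mem_tool] at hpi hpj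
  rcases lt_trichotomy i j with hlt | he | hlt
  · have h1 := h.tools.sep i j hlt hj
    have h2 := h.tools.le j hj
    have h3 := h.blocks.start_le h1 (by omega)
    omega
  · exact he
  · have h1 := h.tools.sep j i hlt hi
    have h2 := h.tools.le i hi
    have h3 := h.blocks.start_le h1 (by omega)
    omega

theorem tool_lt (h : Division n N W k par blk start tl S w mark rt) {j p : ℕ}
    (hj : j < k - 1) (hp : p ∈ tool W start tl j) : p < n := by
  rw [mem_tool] at hp
  have := h.blocks.start_le_n (h.tools.le j hj)
  omega

theorem par_mem (h : Division n N W k par blk start tl S w mark rt) {c : ℕ}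
    (hc : Attached S par mark rt c) : par c ∈ S := (h.pieces.par_lt hc).1

theorem progress_zero (h : Division n N W k par blk start tl S w mark rt)
    (hS : ∀ p ∈ S, col p = k) (ht : ∀ j < k - 1, ∀ p ∈ tool W start tl j, col p = k + 1) :
    Progress n W k par start tl S mark rt Δ 0 0 col where
  bulk p hp := Or.inr (hS p hp)
  done j hj := by omega
  todo j _ hj := ht j hj
  countLE_eq j hj := by omega
  countLE_self := by
    refine Finset.sum_eq_zero fun p hp => if_neg ?_
    have h2 := h.two_le
    rcases h.mem_or p (Finset.mem_Ico.1 hp).2 with h1 | ⟨j, hj, h1⟩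
    · rw [hS p h1]
      omega
    · rw [ht j hj p h1]
      omega
  le := Nat.zero_le _
  attached c hc := by rw [hS c hc.1, hS _ (h.par_mem hc)]
  cut_le j hj := by omega

/-- What is left for a window can be cut off from it. -/
theorem rest_le (h : Division n N W k par blk start tl S w mark rt) (hl : l < k - 1)
    (hP : Progress n W k par start tl S mark rt Δ l g col) {t : ℕ} {x : ℕ}
    (hx : countLE n col' l = x) (hxt : x + t = (l + 1) * n / k)
    (hbulk : ∀ p ∈ S, col' p ≤ l) (heq : ∀ p, col p ≠ k → col' p = col p) :
    t ≤ start (tl l + W) - start (tl l) := by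
  have hk := h.two_le
  -- If all vertices outside of the windows have colours up to `l`, then those missing are in window
  -- `l` or in one of the `k - 2 - l` later windows.
  have h1 : n ≤ x + ((tool W start tl l).card + (k - 2 - l) * (n / k)) := by
    have e1 : (Finset.Ico 0 n).card = n := by simp
    have e2 : countLE n col' l = ((Finset.Ico 0 n).filter fun p => col' p ≤ l).card := by
      rw [countLE, Finset.card_filter]
    have e3 : Finset.Ico 0 n ⊆ ((Finset.Ico 0 n).filter fun p => col' p ≤ l) ∪
        (tool W start tl l ∪ (Finset.Ioo l (k - 1)).biUnion (tool W start tl)) := by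
      intro p hp
      simp only [Finset.mem_union, Finset.mem_filter, Finset.mem_biUnion, Finset.mem_Ioo]
      rcases h.mem_or p (Finset.mem_Ico.1 hp).2 with h1 | ⟨j, hj, h1⟩
      · exact Or.inl ⟨hp, hbulk p h1⟩
      · rcases lt_trichotomy j l with h2 | rfl | h2
        · have h3 := hP.done j h2 p h1
          exact Or.inl ⟨hp, by rw [heq p (by omega)]; exact h3⟩
        · exact Or.inr (Or.inl h1)
        · exact Or.inr (Or.inr ⟨j, ⟨h2, hj⟩, h1⟩)
    have e4 := Finset.card_le_card e3
    have e5 := Finset.card_union_le ((Finset.Ico 0 n).filter fun p => col' p ≤ l)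
      (tool W start tl l ∪ (Finset.Ioo l (k - 1)).biUnion (tool W start tl))
    have e6 := Finset.card_union_le (tool W start tl l)
      ((Finset.Ioo l (k - 1)).biUnion (tool W start tl))
    have e7 := Finset.card_biUnion_le_card_mul (Finset.Ioo l (k - 1)) (tool W start tl) (n / k)
      (fun j hj => by
        rw [card_tool]
        exact h.card_tool_le (Finset.mem_Ioo.1 hj).2)
    rw [Nat.card_Ioo, show k - 1 - l - 1 = k - 2 - l by omega] at e7
    omega
  rw [card_tool] at h1
  -- The target for the first `l + 1` colours and the later windows together leave room: without
  -- rounding, the sum is `(k - 1) * n / k`.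
  have h2 : (l + 1) * n / k + (k - 2 - l) * (n / k) ≤ n := by
    have h3 : k * ((l + 1) * n / k) ≤ (l + 1) * n := Nat.mul_div_le _ _
    have h4 : k * (n / k) ≤ n := Nat.mul_div_le _ _
    refine Nat.le_of_mul_le_mul_left ?_ (show 0 < k by omega)
    have h5 : (k - 2 - l) * (k * (n / k)) ≤ (k - 2 - l) * n := Nat.mul_le_mul_left _ h4
    have h6 : (l + 1) * n + (k - 2 - l) * n ≤ k * n := by
      rw [← Nat.add_mul]
      exact Nat.mul_le_mul_right _ (by omega)
    have h7 : k * ((l + 1) * n / k + (k - 2 - l) * (n / k)) =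
        k * ((l + 1) * n / k) + (k - 2 - l) * (k * (n / k)) := by ring
    omega
  omega

end Division

/-- After the pieces have been distributed, `t` vertices are left for the window. -/
structure Filled (n W k : ℕ) (par start tl : ℕ → ℕ) (S : Finset ℕ) (mark rt : ℕ → ℕ) (Δ l t : ℕ)
    (col : ℕ → ℕ) : Prop where
  bulk : ∀ p ∈ S, col p ≤ l ∨ col p = k
  done : ∀ j < l, ∀ p ∈ tool W start tl j, col p ≤ l
  todo : ∀ j, l ≤ j → j < k - 1 → ∀ p ∈ tool W start tl j, col p = k + 1
  countLE_eq : ∀ j < l, countLE n col j = (j + 1) * n / k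
  countLE_self : countLE n col l + t = (l + 1) * n / k
  le : t ≤ start (tl l + W) - start (tl l)
  attached : ∀ c, Attached S par mark rt c → col c = col (par c)
  cut_le : ∀ j < l, W * innerCut par col (start (tl j)) (start (tl j + W)) ≤
    7 * (start (tl j + W) - start (tl j)) * Δ

/-- That the missing `t` vertices can come from window `l` has two reasons. If a piece was refused,
`t < W`, and a window of `W` blocks has at least `W` vertices. If none was refused, the vertices
outside of the windows are used up, and `rest_le` applies. -/
theorem Progress.fill (hP : Progress n W k par start tl S mark rt Δ l g col)
    (h : Division n N W k par blk start tl S w mark rt) (hl : l < k - 1) {t : ℕ}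
    (hF : FillInv W k l k 0 n S par w mark rt col ((l + 1) * n / k - g) n col' t) :
    Filled n W k par start tl S mark rt Δ l t col' := by
  have hk := h.two_le
  have hle := hP.le
  have hcase : ∀ p < n, col' p = col p ∨ col p = k ∧ (col' p = l ∨ col' p = k) := fun p hp => by
    by_cases hc : col p = k
    · exact Or.inr ⟨hc, hF.eq_or_eq p (Nat.zero_le _) hp hc⟩
    · exact Or.inl (hF.eq_of_ne p hc)
  have hcount := hF.count
  rw [Finset.sum_eq_zero (s := S) (fun c hc => if_neg fun h1 => by
    have := h.lt_of_mem c hc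
    omega), add_zero] at hcount
  have hself : countLE n col' l = g + ∑ p ∈ Finset.Ico 0 n,
      if col p = k ∧ col' p = l then 1 else 0 := by
    rw [countLE_eq_add (col := col) (j := l) (Q := fun p => col p = k ∧ col' p = l),
      hP.countLE_self]
    · intro p hp
      rcases hcase p hp with h1 | ⟨h1, h2 | h2⟩ <;> omega
    · intro p hp h1
      omega
  have hself' : countLE n col' l + t = (l + 1) * n / k := by omega
  have heq : ∀ j < k - 1, ∀ p ∈ tool W start tl j, col p ≠ k := fun j hj p hp => by
    rcases lt_or_ge j l with h1 | h1
    · have := hP.done j h1 p hp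
      omega
    · rw [hP.todo j h1 hj p hp]
      omega
  refine ⟨fun p hp => ?_, fun j hj p hp => ?_, fun j hj hj' p hp => ?_, fun j hj => ?_, hself', ?_,
    fun c hc => ?_, fun j hj => ?_⟩
  · have h1 := hP.bulk p hp
    rcases hcase p (h.lt_of_mem p hp) with h1 | ⟨h1, h2 | h2⟩ <;> omega
  · rw [hF.eq_of_ne p (heq j (by omega) p hp)]
    exact hP.done j hj p hp
  · rw [hF.eq_of_ne p (heq j hj' p hp)]
    exact hP.todo j hj hj' p hp
  · rw [countLE_congr (col := col), hP.countLE_eq j hj]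
    intro p hp
    rcases hcase p hp with h1 | ⟨h1, h2 | h2⟩ <;> omega
  · rcases hF.lt_or with h1 | h1
    · have h2 := h.blocks.start_add_le (Nat.le_add_right (tl l) W) (h.tools.le l hl)
      omega
    · refine h.rest_le hl hP rfl hself' (fun p hp => ?_) hF.eq_of_ne
      by_cases hc : col p = k
      · rw [h1 p (Nat.zero_le _) (h.lt_of_mem p hp) hc]
      · rw [hF.eq_of_ne p hc]
        have := hP.bulk p hp
        omega
  · exact hF.attached c (Nat.zero_le _) (h.lt_of_mem c hc.1) hc
  · rw [innerCut_congr (col := col) h.blocks (h.tools.le j (by omega)) _ (Nat.le_add_right _ _)]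
    · exact hP.cut_le j hj
    · intro p h1 h2
      exact hF.eq_of_ne p (heq j (by omega) p (mem_tool.2 ⟨h1, h2⟩))

/-- Here `g` is the number of vertices missing in colour `l`. Before the cut `(l + 1) * n / k - g`
vertices have colours up to `l`; afterwards all of the window has one of the colours up to `l + 1`,
which gives the new count. -/
theorem Filled.cutOff (hF : Filled n W k par start tl S mark rt Δ l g col)
    (h : Division n N W k par blk start tl S w mark rt) (hl : l < k - 1)
    (hc : CutDone par start (tl l) (tl l + W) g l (l + 1) Δ col col') :
    Progress n W k par start tl S mark rt Δ (l + 1)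
      ((l + 1) * n / k - g + (start (tl l + W) - start (tl l))) col' := by
  have hk := h.two_le
  have hle := hF.countLE_self
  have htl := h.tools.le l hl
  have hsn := h.blocks.start_le_n htl
  have hco := hc.cutOff
  have hout : ∀ p, p ∉ tool W start tl l → col' p = col p := fun p hp => by
    refine hco.eq_of_not_mem p ?_
    rw [mem_tool] at hp
    omega
  have hin : ∀ p ∈ tool W start tl l, col p = k + 1 ∧ (col' p = l ∨ col' p = l + 1) :=
    fun p hp => by
      refine ⟨hF.todo l le_rfl hl p hp, ?_⟩
      rw [mem_tool] at hp
      exact hco.eq_or_eq p hp.1 hp.2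
  have hne : ∀ j < k - 1, j ≠ l → ∀ p ∈ tool W start tl j, p ∉ tool W start tl l :=
    fun j hj hjl p hp hp' => hjl (h.disjoint hj hl hp hp')
  -- Colour `l + 1` is not in use before the rest of window `l` receives it. Also for `l + 1 < k` it
  -- differs from the codes `k` and `k + 1` of uncoloured vertices.
  have hno : ∀ p < n, col p ≠ l + 1 := fun p hp => by
    rcases h.mem_or p hp with h1 | ⟨j, hj, h1⟩
    · have := hF.bulk p h1
      omega
    · rcases lt_or_ge j l with h2 | h2
      · have := hF.done j h2 p h1
        omega
      · rw [hF.todo j h2 hj p h1]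
        omega
  have hsum : ∑ p ∈ Finset.Ico 0 n,
      (if (start (tl l) ≤ p ∧ p < start (tl l + W)) ∧ col' p = l then 1 else 0) = g := by
    rw [sum_Ico_indicator (Nat.zero_le _) hsn]
    exact hco.count
  have hsum' : ∑ p ∈ Finset.Ico 0 n,
      (if (start (tl l) ≤ p ∧ p < start (tl l + W)) ∧ True then 1 else 0) =
        start (tl l + W) - start (tl l) := by
    rw [sum_Ico_indicator (Nat.zero_le _) hsn (fun _ => True)]
    simp
  have hbulk : ∀ p ∈ S, col' p = col p := fun p hp => hout p (h.not_mem p hp l hl)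
  refine ⟨fun p hp => ?_, fun j hj p hp => ?_, fun j hj hj' p hp => ?_, fun j hj => ?_, ?_, ?_,
    fun c hc => ?_, fun j hj => ?_⟩
  · rw [hbulk p hp]
    have := hF.bulk p hp
    omega
  · rcases Nat.lt_or_eq_of_le (Nat.le_of_lt_succ hj) with h1 | rfl
    · rw [hout p (hne j (by omega) (by omega) p hp)]
      have := hF.done j h1 p hp
      omega
    · have := (hin p hp).2
      omega
  · rw [hout p (hne j hj' (by omega) p hp)]
    exact hF.todo j (by omega) hj' p hp
  · rcases Nat.lt_or_eq_of_le (Nat.le_of_lt_succ hj) with h1 | rfl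
    · rw [← hF.countLE_eq j h1]
      refine countLE_congr fun p hp => ?_
      by_cases hp' : p ∈ tool W start tl l
      · have := hin p hp'
        omega
      · rw [hout p hp']
    · rw [countLE_eq_add (col := col) (j := j)
        (Q := fun p => (start (tl j) ≤ p ∧ p < start (tl j + W)) ∧ col' p = j), hsum]
      · exact hle
      · intro p hp
        by_cases hp' : p ∈ tool W start tl j
        · have h1 := hin p hp'
          rw [mem_tool] at hp'
          omega
        · rw [hout p hp']
          rw [mem_tool] at hp'
          omega
      · rintro p hp ⟨h1, -⟩
        have := (hin p (mem_tool.2 h1)).1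
        omega
  · rw [countLE_eq_add (col := col) (j := l)
      (Q := fun p => (start (tl l) ≤ p ∧ p < start (tl l + W)) ∧ True), hsum']
    · omega
    · intro p hp
      simp only [and_true]
      by_cases hp' : p ∈ tool W start tl l
      · have h1 := hin p hp'
        rw [mem_tool] at hp'
        omega
      · rw [hout p hp']
        have := hno p hp
        rw [mem_tool] at hp'
        omega
    · rintro p hp ⟨h1, -⟩
      have := (hin p (mem_tool.2 h1)).1
      omega
  -- The target increases by at least `n / k` from one colour to the next, and the window
  -- contributes at most that much.
  · have h1 := h.card_tool_le hl
    have h2 : (l + 1) * n / k + n / k ≤ (l + 1 + 1) * n / k := by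
      rw [Nat.succ_mul (l + 1)]
      exact Nat.div_add_div_le_add_div
    omega
  · rw [hbulk c hc.1, hbulk _ (h.par_mem hc)]
    exact hF.attached c hc
  · rcases Nat.lt_or_eq_of_le (Nat.le_of_lt_succ hj) with h1 | rfl
    · rw [innerCut_congr (col := col) h.blocks (h.tools.le j (by omega)) _ (Nat.le_add_right _ _)]
      · exact hF.cut_le j h1
      · intro p h2 h3
        exact hout p (hne j (by omega) (by omega) p (mem_tool.2 ⟨h2, h3⟩))
    · have := hc.cut_le
      rwa [Nat.add_sub_cancel_left] at this

end RAM


namespace RAM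

variable {n N W k : ℕ} {par blk start tl : ℕ → ℕ} {S : Finset ℕ} {w mark rt w' mark' rt' : ℕ → ℕ}
  {Δ l g : ℕ} {col col' : ℕ → ℕ}

/-! ### The width of the cut -/

/-- The remaining vertices get the last colour. -/
def finalColour (k : ℕ) (col : ℕ → ℕ) (p : ℕ) : ℕ := if col p = k then k - 1 else col p

namespace Division

/-- An edge that crosses no end of a window has both ends in the same window or both ends outside of
all windows. In the latter case, if neither end is marked, its ends are in the same piece and have
the same colour. -/
theorem edge_cases (h : Division n N W k par blk start tl S w mark rt)
    (hP : Progress n W k par start tl S mark rt Δ (k - 1) g col) {p : ℕ} (h1 : 1 ≤ p) (hp : p < n)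
    (hne : finalColour k col p ≠ finalColour k col (par p)) :
    (p ∈ S ∧ 1 ≤ p ∧ (mark p ≠ 0 ∨ par p ∈ S ∧ mark (par p) ≠ 0)) ∨
    (∃ j < k - 1, p = start (tl j) ∨ p = start (tl j + W)) ∨
    ∃ j < k - 1, p ∈ Finset.Ioo (start (tl j)) (start (tl j + W)) ∧ col p ≠ col (par p) := by
  have hk := h.two_le
  have hlt := h.blocks.par_lt hp h1
  have hside : ∀ j < k - 1, p ≠ start (tl j) → p ≠ start (tl j + W) →
      (par p ∈ tool W start tl j ↔ p ∈ tool W start tl j) := fun j hj h2 h3 => by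
    have h4 := h.tools.le j hj
    have h5 := h.blocks.par_lt_start_iff hp h1 (show tl j ≤ N by omega) h2
    have h6 := h.blocks.par_lt_start_iff hp h1 h4 h3
    rw [mem_tool, mem_tool]
    omega
  by_contra hcon
  push Not at hcon
  obtain ⟨c1, c2, c3⟩ := hcon
  rcases h.mem_or p hp with hS | ⟨j, hj, ht⟩
  · rcases h.mem_or (par p) (by omega) with hS' | ⟨j, hj, ht⟩
    · have h2 := c1 hS h1
      have h3 : Attached S par mark rt p :=
        ⟨hS, (h.pieces.rt_eq p hS).2 ⟨hS', hlt⟩, h2.1, h2.2 hS'⟩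
      rw [finalColour, finalColour, hP.attached p h3] at hne
      exact hne rfl
    · exact h.not_mem p hS j hj ((hside j hj (c2 j hj).1 (c2 j hj).2).1 ht)
  · have ht' := (hside j hj (c2 j hj).1 (c2 j hj).2).2 ht
    have h2 := hP.done j hj p ht
    have h3 := hP.done j hj _ ht'
    rw [finalColour, finalColour, if_neg (by omega), if_neg (by omega)] at hne
    refine hne (c3 j hj ?_)
    have h4 := (c2 j hj).1
    rw [mem_tool] at ht
    rw [Finset.mem_Ioo]
    omega

/-- With `r = k - 1`, the marked vertices contribute at most `3 * r * n * Δ` to `N` times the width.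
The window ends contribute at most `2 * r * N * Δ`, and the cuts inside the windows `12.6 * r * n *
Δ`. As `3 + 12.6 ≤ 16`, the bound follows. -/
theorem cut_le (h : Division n N W k par blk start tl S w mark rt)
    (hP : Progress n W k par start tl S mark rt Δ (k - 1) g col) (hdeg : DegreeLE n par Δ)
    (hΔ : 1 ≤ Δ) (hN : N ≤ 3 * (k - 1) * (W + 1)) (hW : 5 ≤ W) :
    N * ((Finset.Ico 1 n).filter fun p => finalColour k col p ≠ finalColour k col (par p)).card ≤
      (k - 1) * (2 * N + 16 * n) * Δ := by
  have hk := h.two_le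
  set X := (S.filter fun p => mark p ≠ 0).card with hX
  set Y := ∑ j ∈ Finset.range (k - 1), innerCut par col (start (tl j)) (start (tl j + W)) with hY
  have hcut : ((Finset.Ico 1 n).filter fun p =>
      finalColour k col p ≠ finalColour k col (par p)).card ≤ X * Δ + 2 * (k - 1) + Y := by
    have e1 : ((Finset.Ico 1 n).filter fun p => finalColour k col p ≠ finalColour k col (par p)) ⊆
        ((S.filter fun p => 1 ≤ p ∧ (mark p ≠ 0 ∨ par p ∈ S ∧ mark (par p) ≠ 0)) ∪
        ((Finset.range (k - 1)).image (fun j => start (tl j)) ∪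
        (Finset.range (k - 1)).image (fun j => start (tl j + W)))) ∪
        (Finset.range (k - 1)).biUnion fun j =>
          (Finset.Ioo (start (tl j)) (start (tl j + W))).filter fun p => col p ≠ col (par p) := by
      intro p hp
      rw [Finset.mem_filter, Finset.mem_Ico] at hp
      simp only [Finset.mem_union, Finset.mem_filter, Finset.mem_image, Finset.mem_biUnion,
        Finset.mem_range]
      rcases h.edge_cases hP hp.1.1 hp.1.2 hp.2 with h1 | ⟨j, hj, h1 | h1⟩ | ⟨j, hj, h1⟩
      · exact Or.inl (Or.inl h1)
      · exact Or.inl (Or.inr (Or.inl ⟨j, hj, h1.symm⟩))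
      · exact Or.inl (Or.inr (Or.inr ⟨j, hj, h1.symm⟩))
      · exact Or.inr ⟨j, hj, h1⟩
    refine (Finset.card_le_card e1).trans ((Finset.card_union_le _ _).trans ?_)
    refine Nat.add_le_add ((Finset.card_union_le _ _).trans (Nat.add_le_add
      (hdeg.card_le h.lt_of_mem) ((Finset.card_union_le _ _).trans ?_))) Finset.card_biUnion_le
    have e2 := (Finset.range (k - 1)).card_image_le (f := fun j => start (tl j))
    have e3 := (Finset.range (k - 1)).card_image_le (f := fun j => start (tl j + W))
    rw [Finset.card_range] at e2 e3
    omega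
  have hXn : (W + 1) * X ≤ n := by
    refine h.pieces.card_le.trans ?_
    have := Finset.card_le_card (s := S) (t := Finset.range n)
      (fun p hp => Finset.mem_range.2 (h.lt_of_mem p hp))
    rwa [Finset.card_range] at this
  have hYn : 2 * (k - 1) * W * Y ≤ (k - 1) * (7 * n * Δ) := by
    rw [hY, Finset.mul_sum]
    refine (Finset.sum_le_card_nsmul _ _ (7 * n * Δ) fun j hj => ?_).trans ?_
    · rw [Finset.mem_range] at hj
      calc 2 * (k - 1) * W * innerCut par col (start (tl j)) (start (tl j + W))
          = 2 * (k - 1) * (W * innerCut par col (start (tl j)) (start (tl j + W))) := by ring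
        _ ≤ 2 * (k - 1) * (7 * (start (tl j + W) - start (tl j)) * Δ) :=
          Nat.mul_le_mul_left _ (hP.cut_le j hj)
        _ = 7 * (2 * (k - 1) * (start (tl j + W) - start (tl j))) * Δ := by ring
        _ ≤ 7 * n * Δ := Nat.mul_le_mul_right _ (Nat.mul_le_mul_left _ (h.tools.small j hj))
    · rw [Finset.card_range, smul_eq_mul]
  clear_value X Y
  generalize hr : k - 1 = r at *
  have h1 : N * (X * Δ) ≤ 3 * r * (n * Δ) :=
    calc N * (X * Δ) ≤ 3 * r * (W + 1) * (X * Δ) := Nat.mul_le_mul_right _ hN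
      _ = 3 * r * ((W + 1) * X * Δ) := by ring
      _ ≤ 3 * r * (n * Δ) := Nat.mul_le_mul_left _ (Nat.mul_le_mul_right _ hXn)
  -- Here `W ≥ 5` enters, as `W + 1 ≤ 6 * W / 5`: rounding in the definition of `W` costs only the
  -- factor `6 / 5`, and `3 * (6 / 5) * (7 / 2) = 12.6`.
  have h2 : 10 * (N * Y) ≤ 126 * (r * (n * Δ)) :=
    calc 10 * (N * Y) ≤ 10 * (3 * r * (W + 1) * Y) :=
          Nat.mul_le_mul_left _ (Nat.mul_le_mul_right _ hN)
      _ = (5 * (W + 1)) * (6 * r * Y) := by ring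
      _ ≤ (6 * W) * (6 * r * Y) := Nat.mul_le_mul_right _ (by omega)
      _ = 18 * (2 * r * W * Y) := by ring
      _ ≤ 18 * (r * (7 * n * Δ)) := Nat.mul_le_mul_left _ hYn
      _ = 126 * (r * (n * Δ)) := by ring
  have h3 : N * (2 * r) ≤ 2 * (r * N * Δ) :=
    calc N * (2 * r) = 2 * (r * N) := by ring
      _ ≤ 2 * (r * N * Δ) := Nat.mul_le_mul_left _ (Nat.le_mul_of_pos_right _ hΔ)
  have h4 := Nat.mul_le_mul_left N hcut
  have h5 : N * (X * Δ + 2 * r + Y) = N * (X * Δ) + N * (2 * r) + N * Y := by ring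
  have h6 : r * (2 * N + 16 * n) * Δ = 2 * (r * N * Δ) + 16 * (r * (n * Δ)) := by ring
  have h7 : 3 * r * (n * Δ) = 3 * (r * (n * Δ)) := by ring
  omega

theorem finalColour_lt (h : Division n N W k par blk start tl S w mark rt)
    (hP : Progress n W k par start tl S mark rt Δ (k - 1) g col) {p : ℕ} (hp : p < n) :
    finalColour k col p < k := by
  have hk := h.two_le
  rw [finalColour]
  rcases h.mem_or p hp with h1 | ⟨j, hj, h1⟩
  · have := hP.bulk p h1
    split_ifs <;> omega
  · have := hP.done j hj p h1
    split_ifs <;> omega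

theorem countLE_finalColour (h : Division n N W k par blk start tl S w mark rt)
    (hP : Progress n W k par start tl S mark rt Δ (k - 1) g col) {j : ℕ} (hj : j < k) :
    countLE n (finalColour k col) j = (j + 1) * n / k := by
  have hk := h.two_le
  rcases Nat.lt_or_ge j (k - 1) with h1 | h1
  · rw [← hP.countLE_eq j h1]
    refine countLE_congr fun p hp => ?_
    rw [finalColour]
    split_ifs <;> omega
  · rw [countLE, Finset.sum_congr rfl fun p hp => if_pos (by
      have := h.finalColour_lt hP (Finset.mem_Ico.1 hp).2
      omega)]
    rw [show j + 1 = k by omega, Nat.mul_div_cancel_left _ (by omega)]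
    simp

end Division

/-! ### Restored weights and marks -/

theorem Pieces.attached_congr {q : ℕ} (hP : Pieces q S par w mark rt)
    (hm : ∀ p ∈ S, mark' p = mark p) (hr : ∀ p ∈ S, rt' p = rt p) (c : ℕ) :
    Attached S par mark' rt' c ↔ Attached S par mark rt c := by
  by_cases hc : c ∈ S
  · by_cases h0 : rt c = 0
    · have h1 := ((hP.rt_eq c hc).1 h0).1
      simp only [Attached, hm c hc, hr c hc, hm _ h1]
    · simp only [Attached, hr c hc, h0, false_and, and_false]
  · simp only [Attached, hc, false_and]

/-- Cutting off chops blocks with the same arrays `11`, `12` and `13` that describe the pieces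
outside of the windows. These are restored from copies, but only below `n`; hence agreement on `S`
has to suffice. -/
theorem Pieces.congr {q : ℕ} (hP : Pieces q S par w mark rt) (hw : ∀ p ∈ S, w' p = w p)
    (hm : ∀ p ∈ S, mark' p = mark p) (hr : ∀ p ∈ S, rt' p = rt p) :
    Pieces q S par w' mark' rt' where
  weight_le p hp := (hw p hp).trans_le (hP.weight_le p hp)
  weight_marked p hp h := by
    rw [hm p hp] at h
    rw [hw p hp, hP.weight_marked p hp h]
  weight_eq p hp h := by
    rw [hm p hp] at h
    rw [hw p hp, hP.weight_eq p hp h]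
    congr 1
    refine Finset.sum_congr rfl fun c hc => ?_
    rw [hw c hc]
    exact if_congr (and_congr_left' (hP.attached_congr hm hr c).symm) rfl rfl
  rt_eq p hp := by
    rw [hr p hp]
    exact hP.rt_eq p hp
  card_le := by
    rw [Finset.filter_congr (q := fun p => mark p ≠ 0) fun p hp => by rw [hm p hp]]
    exact hP.card_le

theorem Division.congr (h : Division n N W k par blk start tl S w mark rt)
    (hw : ∀ p ∈ S, w' p = w p) (hm : ∀ p ∈ S, mark' p = mark p) (hr : ∀ p ∈ S, rt' p = rt p) :
    Division n N W k par blk start tl S w' mark' rt' :=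
  { h with pieces := h.pieces.congr hw hm hr }

theorem Progress.congr (h : Progress n W k par start tl S mark rt Δ l g col)
    (ha : ∀ c, Attached S par mark' rt' c → Attached S par mark rt c) :
    Progress n W k par start tl S mark' rt' Δ l g col :=
  { h with attached := fun c hc => h.attached c (ha c hc) }

/-! ### The main loop -/

/-- Restore the pieces from the arrays `15`, `16` and `17`. -/
def restore : Program := copyArray 11 15 ;; copyArray 12 16 ;; copyArray 13 17

/-- Complete the colour in register `15`. -/
def completeColour : Program :=
  restore ;; 18 ⟵ K 0 ;; 19 ⟵ R 1 ;;
  17 ⟵ (R 15 +ₑ K 1) *ₑ R 1 /ₑ R 0 -ₑ R 16 ;; 21 ⟵ R 15 ;; 22 ⟵ R 0 ;; fill ;;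
  23 ⟵ A 14 (R 15) ;; 24 ⟵ R 23 +ₑ R 11 ;;
  16 ⟵ (R 15 +ₑ K 1) *ₑ R 1 /ₑ R 0 -ₑ R 17 +ₑ (A 8 (R 24) -ₑ A 8 (R 23)) ;; 22 ⟵ R 15 +ₑ K 1 ;;
  cutOff ;; 15 ⟵ R 15 +ₑ K 1

/-- Divide the vertices outside of the windows into pieces, and keep the result in the arrays `15`,
`16` and `17`. -/
def divide : Program :=
  18 ⟵ K 0 ;; 19 ⟵ R 1 ;; 20 ⟵ R 11 ;; chop ;; copyArray 15 11 ;; copyArray 16 12 ;;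
  copyArray 17 13

/-- Complete all colours. -/
def completeColours : Program :=
  divide ;; 15 ⟵ K 0 ;; 16 ⟵ K 0 ;; Program.loop (R 15 +ₑ K 1 <ₑ R 0) completeColour

/-- The contents of the memory in the main loop. -/
structure MainState (n N W k : ℕ) (par blk start tl : ℕ → ℕ) (B : ℕ) (σ : State) : Prop where
  bounded : σ.Bounded B
  reg_k : σ.reg 0 = k
  reg_n : σ.reg 1 = n
  reg_W : σ.reg 11 = W
  arr_par : σ.arr 5 = par
  arr_blk : σ.arr 7 = blk
  arr_start : σ.arr 8 = start
  arr_tools : σ.arr 14 = tl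

variable {B : ℕ} {σ : State}

theorem MainState.of_same {p : Program} {τ : State}
    (h : MainState n N W k par blk start tl B σ) (hs : Same p σ τ) (hB : τ.Bounded B)
    (h0 : p.writesReg 0 = false) (h1 : p.writesReg 1 = false) (h11 : p.writesReg 11 = false)
    (h5 : p.writesArr 5 = false) (h7 : p.writesArr 7 = false) (h8 : p.writesArr 8 = false)
    (h14 : p.writesArr 14 = false) : MainState n N W k par blk start tl B τ :=
  ⟨hB, (hs.reg 0 h0).trans h.reg_k, (hs.reg 1 h1).trans h.reg_n, (hs.reg 11 h11).trans h.reg_W,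
    (hs.arr 5 h5).trans h.arr_par, (hs.arr 7 h7).trans h.arr_blk, (hs.arr 8 h8).trans h.arr_start,
    (hs.arr 14 h14).trans h.arr_tools⟩

theorem runs_restore (hB : σ.Bounded B) :
    Runs B restore σ fun m τ => m = 3 * σ.reg 1 ∧ (∀ i < σ.reg 1, τ.arr 11 i = σ.arr 15 i) ∧
      (∀ i < σ.reg 1, τ.arr 12 i = σ.arr 16 i) ∧ ∀ i < σ.reg 1, τ.arr 13 i = σ.arr 17 i := by
  rw [restore, runs_seq]
  refine (runs_copyArray (by decide) (hB.reg 1) (hB.arr 15)).mono fun m τ hs hq => ?_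
  rw [runs_seq]
  have e1 := hs.reg 1 rfl
  have e16 := hs.arr 16 rfl
  have e17 := hs.arr 17 rfl
  refine (runs_copyArray (by decide) (e1 ▸ hB.reg 1) (e16 ▸ hB.arr 16)).mono fun m' ρ hs' hq' => ?_
  have f1 := hs'.reg 1 rfl
  have f11 := hs'.arr 11 rfl
  have f17 := (hs'.arr 17 rfl).trans e17
  refine (runs_copyArray (by decide) (by rw [f1, e1]; exact hB.reg 1)
    (f17 ▸ hB.arr 17)).mono fun m2 ξ hs2 hq2 => ?_
  rw [hs2.arr 11 rfl, hs2.arr 12 rfl, f11]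
  rw [e1, e16] at hq'
  rw [f1, e1, f17] at hq2
  exact ⟨by omega, hq.2, hq'.2, hq2.2⟩

/-- The bound is `3 * n` for restoring, `n` for distributing pieces, and `31 * n` for cutting off.
-/
theorem runs_completeColour (hM : MainState n N W k par blk start tl B σ)
    (h : Division n N W k par blk start tl S (σ.arr 15) (σ.arr 16) (σ.arr 17))
    (hl : σ.reg 15 < k - 1)
    (hP : Progress n W k par start tl S (σ.arr 16) (σ.arr 17) Δ (σ.reg 15) (σ.reg 16) (σ.arr 10))
    (hΔ : 2 ≤ Δ) (hdeg : DegreeLE n par Δ) (hB : 2 * n + 2 ≤ B) (hkB : k ≤ B) :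
    Runs B completeColour σ fun m τ => m ≤ 35 * n ∧ τ.reg 15 = σ.reg 15 + 1 ∧
      Progress n W k par start tl S (σ.arr 16) (σ.arr 17) Δ (σ.reg 15 + 1) (τ.reg 16)
        (τ.arr 10) := by
  have hk := h.two_le
  set l := σ.reg 15 with hl'
  rw [completeColour, runs_seq]
  refine ((runs_restore hM.bounded).bounded hM.bounded).mono fun m₁ σ₁ hs₁ hq => ?_
  obtain ⟨⟨q1, q2, q3, q4⟩, b₁⟩ := hq
  rw [hM.reg_n] at q1 q2 q3 q4
  have M₁ := hM.of_same hs₁ b₁ rfl rfl rfl rfl rfl rfl rfl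
  have d₁ := h.congr (fun p hp => q2 p (h.lt_of_mem p hp)) (fun p hp => q3 p (h.lt_of_mem p hp))
    (fun p hp => q4 p (h.lt_of_mem p hp))
  have hatt := h.pieces.attached_congr (fun p hp => q3 p (h.lt_of_mem p hp))
    (fun p hp => q4 p (h.lt_of_mem p hp))
  have p₁ := hP.congr fun c => (hatt c).1
  have e10 := hs₁.arr 10 rfl
  have e15 := hs₁.reg 15 rfl
  have e16 := hs₁.reg 16 rfl
  rw [← e10] at p₁
  have hMl : (l + 1) * n / k ≤ n := by
    refine Nat.div_le_of_le_mul ?_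
    exact Nat.mul_le_mul_right _ (by omega)
  simp only [runs_seq, runs_assign, Expr.val, State.setReg_reg, State.setReg_arr, Nat.reduceEqDiff,
    if_false, if_true, M₁.reg_n, M₁.reg_k, e15, e16, ← hl']
  refine ⟨by omega, by omega, by omega, by omega, by omega, ?_⟩
  have hF := runs_fill (B := B) (q := W) (S := S)
    (σ := ((((σ₁.setReg 18 0).setReg 19 n).setReg 17
        ((l + 1) * n / k - σ.reg 16)).setReg 21 l).setReg
      22 k)
  simp only [State.setReg_reg, State.setReg_arr, Nat.reduceEqDiff, if_false, if_true, M₁.reg_k,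
    M₁.arr_par] at hF
  refine ((hF (by omega) (by omega) hkB (by omega) (Nat.zero_le _) (b₁.arr 10) (by omega)
    (fun p _ => Nat.zero_le p) (fun p _ hp hpk => ?_) d₁.pieces p₁.attached).bounded
      ((((((b₁.setReg (Nat.zero_le _) 18).setReg (by omega) 19).setReg (by omega) 17).setReg
        (by omega) 21).setReg hkB 22))).mono fun m₂ σ₂ hs₂ hq => ?_
  · rcases d₁.mem_or p hp with h1 | ⟨j, hj, h1⟩
    · exact h1
    · rcases lt_or_ge j l with h2 | h2
      · have := p₁.done j h2 p h1
        omega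
      · have := p₁.todo j h2 hj p h1
        omega
  obtain ⟨⟨r1, r2⟩, b₂⟩ := hq
  have f₂ := p₁.fill d₁ hl r2
  have g15 : σ₂.reg 15 = l := by rw [hs₂.reg 15 rfl]; simp [e15, hl']
  have g0 : σ₂.reg 0 = k := by rw [hs₂.reg 0 rfl]; simp [M₁.reg_k]
  have g1 : σ₂.reg 1 = n := by rw [hs₂.reg 1 rfl]; simp [M₁.reg_n]
  have g11 : σ₂.reg 11 = W := by rw [hs₂.reg 11 rfl]; simp [M₁.reg_W]
  have g21 : σ₂.reg 21 = l := by rw [hs₂.reg 21 rfl]; simp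
  have a5 : σ₂.arr 5 = par := by rw [hs₂.arr 5 rfl]; simp [M₁.arr_par]
  have a7 : σ₂.arr 7 = blk := by rw [hs₂.arr 7 rfl]; simp [M₁.arr_blk]
  have a8 : σ₂.arr 8 = start := by rw [hs₂.arr 8 rfl]; simp [M₁.arr_start]
  have a14 : σ₂.arr 14 = tl := by rw [hs₂.arr 14 rfl]; simp [M₁.arr_tools]
  have hself := f₂.countLE_self
  have htl := h.tools.le l hl
  have hstn := h.blocks.start_le_n htl
  have hNn := h.blocks.start_add_le (Nat.zero_le N) le_rfl
  rw [h.blocks.start_last] at hNn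
  simp only [g15, g0, g1, g11, a8, a14]
  have hpos := h.pos
  refine ⟨by omega, by omega, by omega, by omega, ?_⟩
  refine (runs_cutOff (n := n) (N := N) (par := par) (blk := blk) (start := start) (b₀ := tl l)
    (b₁ := tl l + W) (t := σ₂.reg 17) (c₁ := l) (c₂ := l + 1) (Δ := Δ)
    ⟨h.blocks, by omega, htl, f₂.le, hB, ?_, ?_, ?_, ?_, ?_, ?_, ?_, ?_, by omega, ?_, by omega,
      by omega, ?_⟩ hΔ hdeg).mono fun m₃ σ₃ hs₃ hq => ?_
  iterate 8 simp [a5, a7, a8, g21]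
  · simp [g0, hkB]
  · simpa using b₂.arr 10
  obtain ⟨t1, t2⟩ := hq
  simp only [State.setReg_arr] at t2
  have i15 : σ₃.reg 15 = l := by rw [hs₃.reg 15 rfl]; simp [g15]
  have i16 : σ₃.reg 16 = (l + 1) * n / k - σ₂.reg 17 + (start (tl l + W) - start (tl l)) := by
    rw [hs₃.reg 16 rfl]; simp
  rw [i15, i16]
  refine ⟨by omega, by omega, rfl, ?_⟩
  exact (f₂.cutOff d₁ hl t2).congr fun c => (hatt c).2

theorem runs_divide (hM : MainState n N W k par blk start tl B σ)
    (hT : Blocks n N par blk start) (hW : 1 ≤ W) (hB : 2 * n + 2 ≤ B) :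
    Runs B divide σ fun m τ => m ≤ 5 * n ∧
      Pieces W ((Finset.Ico 0 n).filter fun p => σ.arr 10 p = k) par (τ.arr 15) (τ.arr 16)
        (τ.arr 17) := by
  simp only [divide, runs_seq, runs_assign, Expr.val, State.setReg_reg, Nat.reduceEqDiff, if_false,
    hM.reg_n, hM.reg_W]
  have hWB : W ≤ B := hM.reg_W ▸ hM.bounded.reg 11
  refine ⟨by omega, by omega, hWB, ?_⟩
  have hc := runs_chop (B := B) (σ := ((σ.setReg 18 0).setReg 19 n).setReg 20 W)
  simp only [State.setReg_reg, State.setReg_arr, Nat.reduceEqDiff, if_false, if_true, hM.reg_k,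
    hM.arr_par] at hc
  refine ((hc (by omega) (Nat.zero_le _) hW fun p h0 hp => ⟨Nat.zero_le _, hT.par_lt hp h0⟩).bounded
    (((hM.bounded.setReg (Nat.zero_le _) 18).setReg (by omega) 19).setReg hWB 20)).mono
    fun m₁ σ₁ hs₁ hq => ?_
  obtain ⟨⟨q1, q2⟩, b₁⟩ := hq
  have e1 : σ₁.reg 1 = n := by rw [hs₁.reg 1 rfl]; simp [hM.reg_n]
  refine (runs_copyArray (by decide) (b₁.reg 1) (b₁.arr 11)).mono fun m₂ σ₂ hs₂ hq₂ => ?_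
  have f1 := (hs₂.reg 1 rfl).trans e1
  have f12 := hs₂.arr 12 rfl
  have f13 := hs₂.arr 13 rfl
  refine (runs_copyArray (by decide) (by omega) (f12 ▸ b₁.arr 12)).mono fun m₃ σ₃ hs₃ hq₃ => ?_
  have g1 := (hs₃.reg 1 rfl).trans f1
  have g13 := (hs₃.arr 13 rfl).trans f13
  refine (runs_copyArray (by decide) (by omega) (g13 ▸ b₁.arr 13)).mono fun m₄ σ₄ hs₄ hq₄ => ?_
  rw [e1] at hq₂
  rw [f1, f12] at hq₃
  rw [g1, g13] at hq₄
  have e15 : σ₄.arr 15 = σ₂.arr 15 := (hs₄.arr 15 rfl).trans (hs₃.arr 15 rfl)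
  have e16 : σ₄.arr 16 = σ₃.arr 16 := hs₄.arr 16 rfl
  rw [e15, e16]
  refine ⟨by omega, q2.congr (fun p hp => hq₂.2 p ?_) (fun p hp => hq₃.2 p ?_)
    (fun p hp => hq₄.2 p ?_)⟩ <;>
    exact (Finset.mem_Ico.1 (Finset.mem_filter.1 hp).1).2

theorem runs_completeColours (hM : MainState n N W k par blk start tl B σ)
    (hT : Blocks n N par blk start) (hk : 2 ≤ k) (hW : 1 ≤ W) (hB : 2 * n + 2 ≤ B)
    (htl : ToolSet n N W (k - 1) start tl (k - 1))
    (hcol : ∀ p < n, ((∃ j < k - 1, p ∈ tool W start tl j) ∧ σ.arr 10 p = k + 1) ∨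
      ((∀ j < k - 1, p ∉ tool W start tl j) ∧ σ.arr 10 p = k))
    (hΔ : 2 ≤ Δ) (hdeg : DegreeLE n par Δ) :
    Runs B completeColours σ fun m τ => m ≤ 5 * n + (k - 1) * (35 * n + 1) ∧
      ∃ S w mark rt g, Division n N W k par blk start tl S w mark rt ∧
        Progress n W k par start tl S mark rt Δ (k - 1) g (τ.arr 10) := by
  have hkB : k ≤ B := hM.reg_k ▸ hM.bounded.reg 0
  rw [completeColours, runs_seq]
  refine ((runs_divide hM hT hW hB).bounded hM.bounded).mono fun m₁ σ₁ hs₁ hq => ?_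
  obtain ⟨⟨q1, q2⟩, b₁⟩ := hq
  have M₁ := hM.of_same hs₁ b₁ rfl rfl rfl rfl rfl rfl rfl
  have e10 := hs₁.arr 10 rfl
  set S := (Finset.Ico 0 n).filter fun p => σ.arr 10 p = k with hS
  have hmem : ∀ p, p ∈ S ↔ p < n ∧ σ.arr 10 p = k := fun p => by simp [hS]
  have hdiv : Division n N W k par blk start tl S (σ₁.arr 15) (σ₁.arr 16) (σ₁.arr 17) := by
    refine ⟨hT, htl, fun p hp => ?_, fun p hp => ((hmem p).1 hp).1, fun p hp j hj hpj => ?_, q2,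
      hk, hW⟩
    · rcases hcol p hp with h1 | h1
      · exact Or.inr h1.1
      · exact Or.inl ((hmem p).2 ⟨hp, h1.2⟩)
    · obtain ⟨h1, h2⟩ := (hmem p).1 hp
      rcases hcol p h1 with h3 | h3
      · omega
      · exact h3.1 j hj hpj
  simp only [runs_seq, runs_assign, Expr.val, Nat.zero_le, true_and, zero_add]
  refine runs_loop (fun m τ => m ≤ τ.reg 15 * (35 * n + 1) ∧ τ.reg 15 ≤ k - 1 ∧ τ.Bounded B ∧
    Progress n W k par start tl S (σ₁.arr 16) (σ₁.arr 17) Δ (τ.reg 15) (τ.reg 16) (τ.arr 10))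
    (fun τ => k - τ.reg 15) ?_ ?_ ?_
  · simp only [State.setReg_reg, State.setReg_arr, Nat.reduceEqDiff, if_false, if_true]
    refine ⟨Nat.zero_le _, Nat.zero_le _, (b₁.setReg (Nat.zero_le _) 15).setReg (Nat.zero_le _) 16,
      hdiv.progress_zero (fun p hp => ?_) fun j hj p hp => ?_⟩
    · rw [e10]
      exact ((hmem p).1 hp).2
    · rw [e10]
      rcases hcol p (hdiv.tool_lt hj hp) with h1 | h1
      · exact h1.2
      · exact absurd hp (h1.1 j hj)
  · rintro m τ hs ⟨g1, g2, g3, g4⟩ hb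
    have e0 : τ.reg 0 = k := by rw [hs.reg 0 rfl]; simp [M₁.reg_k]
    simp only [Test.Holds, Expr.val, e0] at hb
    have e15 : τ.arr 15 = σ₁.arr 15 := by rw [hs.arr 15 rfl]; simp
    have e16 : τ.arr 16 = σ₁.arr 16 := by rw [hs.arr 16 rfl]; simp
    have e17 : τ.arr 17 = σ₁.arr 17 := by rw [hs.arr 17 rfl]; simp
    have M₂ : MainState n N W k par blk start tl B τ := by
      refine (MainState.of_same (σ := (σ₁.setReg 15 0).setReg 16 0) ?_ hs g3 rfl rfl rfl rfl rfl rfl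
        rfl)
      refine ⟨(b₁.setReg (Nat.zero_le _) 15).setReg (Nat.zero_le _) 16, ?_, ?_, ?_, M₁.arr_par,
        M₁.arr_blk, M₁.arr_start, M₁.arr_tools⟩
      · simp [M₁.reg_k]
      · simp [M₁.reg_n]
      · simp [M₁.reg_W]
    rw [← e16, ← e17] at g4
    have hdiv' := hdiv
    rw [← e15, ← e16, ← e17] at hdiv'
    refine ((runs_completeColour M₂ hdiv' (by omega) g4 hΔ hdeg hB hkB).bounded g3).mono
      fun m' ρ _ hq => ?_
    obtain ⟨⟨r1, r2, r3⟩, b₂⟩ := hq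
    rw [r2]
    rw [e16, e17] at r3
    refine ⟨⟨?_, by omega, b₂, r3⟩, by omega⟩
    rw [Nat.succ_mul]
    omega
  · rintro m τ hs ⟨g1, g2, g3, g4⟩ hb
    have e0 : τ.reg 0 = k := by rw [hs.reg 0 rfl]; simp [M₁.reg_k]
    simp only [Test.Holds, Expr.val, e0] at hb
    have h15 : τ.reg 15 = k - 1 := by omega
    rw [h15] at g1 g4
    exact ⟨by omega, S, _, _, _, _, hdiv, g4⟩

end RAM


/-! ### Sections from colourings -/

/-- The number of elements below `n` of colour `l`. -/
def colourCount (n : ℕ) (f : ℕ → ℕ) (l : ℕ) : ℕ := ((Finset.range n).filter fun v => f v = l).card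

/-- The colour classes. -/
def colourClasses (k n : ℕ) (f : ℕ → ℕ) (l : Fin k) : Finset (Fin n) :=
  Finset.univ.filter fun v => f v = l

theorem card_colourClasses {k n : ℕ} (f : ℕ → ℕ) (l : Fin k) :
    (colourClasses k n f l).card = colourCount n f l := by
  rw [colourClasses, colourCount, Finset.card_filter, Finset.card_filter,
    Fin.sum_univ_eq_sum_range (fun v => if f v = l then 1 else 0) n]

/-- The hypothesis `hc` is the condition on the sizes with denominators cleared: a class of size `c`
satisfies `n / k - 1 < c < n / k + 1`, which for integers means between floor and ceiling. -/
theorem isKSection_colourClasses {k n : ℕ} {f : ℕ → ℕ} (hf : ∀ v < n, f v < k)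
    (hc : ∀ l < k, n < k * (colourCount n f l + 1) ∧ k * colourCount n f l < n + k) :
    IsKSection (colourClasses k n f) where
  isCut := by
    refine ⟨fun l h hlh => ?_, fun v => ⟨⟨f v, hf v v.2⟩, by simp [colourClasses]⟩⟩
    rw [Finset.disjoint_left]
    intro v h1 h2
    simp only [colourClasses, Finset.mem_filter, Finset.mem_univ, true_and] at h1 h2
    exact hlh (Fin.ext (h1.symm.trans h2))
  floor_le l := by
    have h1 := (hc l l.2).1
    rw [card_colourClasses, Fintype.card_fin, Nat.floor_div_eq_div]
    exact Nat.le_of_lt_succ (Nat.div_lt_of_lt_mul h1)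
  le_ceil l := by
    have hk : (0 : ℚ) < k := by exact_mod_cast l.pos
    have h1 := (hc l l.2).2
    rw [card_colourClasses, Fintype.card_fin]
    by_contra hcon
    push Not at hcon
    have h2 : (n : ℚ) / k ≤ ⌈(n : ℚ) / k⌉₊ := Nat.le_ceil _
    rw [div_le_iff₀ hk] at h2
    have h3 : n ≤ ⌈(n : ℚ) / k⌉₊ * k := by exact_mod_cast h2
    have h4 := Nat.mul_le_mul_right k hcon
    rw [Nat.succ_mul] at h4
    rw [mul_comm] at h1
    omega

theorem colourCount_mod {k n l : ℕ} (hl : l < k) :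
    colourCount n (fun v => v % k) l = n / k + if l < n % k then 1 else 0 := by
  have h1 := Nat.count_modEq_card n (show 0 < k by omega) l
  rw [Nat.count_eq_card_filter_range, Nat.mod_eq_of_lt hl] at h1
  rw [colourCount, ← h1]
  congr 1
  refine Finset.filter_congr fun v _ => ?_
  rw [Nat.ModEq, Nat.mod_eq_of_lt hl]

theorem colourCount_mod_bounds {k n l : ℕ} (hl : l < k) :
    n < k * (colourCount n (fun v => v % k) l + 1) ∧
      k * colourCount n (fun v => v % k) l < n + k := by
  have h1 := Nat.div_add_mod n k
  have h2 := Nat.mod_lt n (show 0 < k by omega)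
  rw [colourCount_mod hl]
  split_ifs
  · rw [Nat.mul_add, Nat.mul_add]
    omega
  · rw [Nat.mul_add, Nat.add_zero]
    omega

/-- A class is the difference of two consecutive numbers `(j + 1) * n / k`. Rounding down both
changes the difference by less than one, so fixing the cumulative numbers balances all classes at
once. -/
theorem colourCount_of_countLE {k n : ℕ} {col : ℕ → ℕ} (hk : 0 < k)
    (h : ∀ j < k, RAM.countLE n col j = (j + 1) * n / k) {l : ℕ} (hl : l < k) :
    n < k * (colourCount n col l + 1) ∧ k * colourCount n col l < n + k := by
  have key : colourCount n col l + l * n / k = (l + 1) * n / k := by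
    rw [← h l hl, RAM.countLE, colourCount, Finset.card_filter, Finset.range_eq_Ico]
    rcases l with _ | l
    · rw [Nat.zero_mul, Nat.zero_div, Nat.add_zero]
      exact Finset.sum_congr rfl fun p _ => if_congr (by omega) rfl rfl
    · rw [← h l (by omega), RAM.countLE, ← Finset.sum_add_distrib]
      refine Finset.sum_congr rfl fun p _ => ?_
      split_ifs <;> omega
  have h1 := Nat.div_add_mod (l * n) k
  have h2 := Nat.div_add_mod ((l + 1) * n) k
  have h3 := Nat.mod_lt (l * n) hk
  have h4 := Nat.mod_lt ((l + 1) * n) hk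
  have h5 : k * colourCount n col l + k * (l * n / k) = k * ((l + 1) * n / k) := by
    rw [← key, Nat.mul_add]
  rw [Nat.succ_mul] at h2 h4 h5
  rw [Nat.mul_add]
  omega

theorem colourCount_comp {n : ℕ} {ord f col : ℕ → ℕ} (hlt : ∀ p < n, ord p < n)
    (hinj : ∀ p q, p < n → q < n → ord p = ord q → p = q) (hf : ∀ p < n, f (ord p) = col p)
    (l : ℕ) : colourCount n f l = colourCount n col l := by
  have hinj' : Set.InjOn ord (Finset.range n) := fun p hp q hq => by
    simp only [Finset.coe_range, Set.mem_Iio] at hp hq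
    exact hinj p q hp hq
  have himg : (Finset.range n).image ord = Finset.range n := by
    refine Finset.eq_of_subset_of_card_le (fun v hv => ?_) ?_
    · simp only [Finset.mem_image, Finset.mem_range] at hv ⊢
      obtain ⟨p, hp, rfl⟩ := hv
      exact hlt p hp
    · rw [Finset.card_image_of_injOn hinj']
  rw [colourCount, Finset.card_filter]
  conv_lhs => rw [← himg]
  rw [Finset.sum_image hinj', colourCount, Finset.card_filter]
  exact Finset.sum_congr rfl fun p hp => by rw [hf p (Finset.mem_range.1 hp)]

/-! ### The output -/

namespace RAM

variable {B : ℕ} {σ : State} {n k : ℕ}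

/-- The vertices get the colours `0, …, k - 1` in turn. -/
def storeResidues : Program :=
  13 ⟵ K 0 ;; Program.loop (R 13 <ₑ R 1)
    (Program.store 2 (R 13) (R 13 -ₑ R 13 /ₑ R 0 *ₑ R 0) ;; 13 ⟵ R 13 +ₑ K 1)

theorem runs_storeResidues (h0 : σ.reg 0 = k) (h1 : σ.reg 1 = n) (hB : n ≤ B) :
    Runs B storeResidues σ fun m τ => m = n ∧ ∀ v < n, τ.arr 2 v = v % k := by
  simp only [storeResidues, runs_seq, runs_assign, Expr.val, zero_add, Nat.zero_le, true_and]
  refine runs_loop (fun m τ => τ.reg 13 = m ∧ m ≤ n ∧ ∀ v < m, τ.arr 2 v = v % k)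
    (fun τ => n - τ.reg 13) ?_ ?_ ?_
  · simp
  · rintro m τ hs ⟨g1, g2, g3⟩ hb
    have e0 : τ.reg 0 = k := by rw [hs.reg 0 rfl]; simpa
    have e1 : τ.reg 1 = n := by rw [hs.reg 1 rfl]; simpa
    simp only [Test.Holds, Expr.val, e1, g1] at hb
    simp only [runs_seq, runs_store, runs_assign, Expr.val, State.setReg_reg, State.setArr_reg,
      State.setReg_arr, State.setArr_arr, if_true, g1, e0]
    have h2 : m - m / k * k = m % k := by
      have := Nat.div_add_mod m k
      rw [mul_comm]
      omega
    refine ⟨by omega, by omega, ⟨trivial, by omega, fun v hv => ?_⟩, by omega⟩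
    rw [Function.update_apply]
    split_ifs with h
    · rw [h, h2]
    · exact g3 v (by omega)
  · rintro m τ hs ⟨g1, g2, g3⟩ hb
    have e1 : τ.reg 1 = n := by rw [hs.reg 1 rfl]; simpa
    simp only [Test.Holds, Expr.val, e1, g1] at hb
    obtain rfl : m = n := by omega
    exact ⟨rfl, g3⟩

/-- The colours of the positions are stored as colours of the vertices. -/
def storeColours : Program :=
  13 ⟵ K 0 ;; Program.loop (R 13 <ₑ R 1)
    (Program.branch (A 10 (R 13) =ₑ R 0) (Program.store 2 (A 4 (R 13)) (R 0 -ₑ K 1))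
      (Program.store 2 (A 4 (R 13)) (A 10 (R 13))) ;; 13 ⟵ R 13 +ₑ K 1)

theorem runs_storeColours (h0 : σ.reg 0 = k) (h1 : σ.reg 1 = n) (hσ : σ.Bounded B)
    (hinj : ∀ p q, p < n → q < n → σ.arr 4 p = σ.arr 4 q → p = q) :
    Runs B storeColours σ fun m τ => m = n ∧
      ∀ p < n, τ.arr 2 (σ.arr 4 p) = finalColour k (σ.arr 10) p := by
  have hk : k ≤ B := h0 ▸ hσ.reg 0
  have hn : n ≤ B := h1 ▸ hσ.reg 1
  simp only [storeColours, runs_seq, runs_assign, Expr.val, zero_add, Nat.zero_le, true_and]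
  refine runs_loop (fun m τ => τ.reg 13 = m ∧ m ≤ n ∧
    ∀ p < m, τ.arr 2 (σ.arr 4 p) = finalColour k (σ.arr 10) p) (fun τ => n - τ.reg 13) ?_ ?_ ?_
  · simp
  · rintro m τ hs ⟨g1, g2, g3⟩ hb
    have e0 : τ.reg 0 = k := by rw [hs.reg 0 rfl]; simpa
    have e1 : τ.reg 1 = n := by rw [hs.reg 1 rfl]; simpa
    have e4 : τ.arr 4 = σ.arr 4 := by rw [hs.arr 4 rfl]; simp
    have e10 : τ.arr 10 = σ.arr 10 := by rw [hs.arr 10 rfl]; simp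
    simp only [Test.Holds, Expr.val, e1, g1] at hb
    have hupd : ∀ x, x = finalColour k (σ.arr 10) m → ∀ p < m + 1,
        Function.update (τ.arr 2) (σ.arr 4 m) x (σ.arr 4 p) = finalColour k (σ.arr 10) p := by
      intro x hx p hp
      rcases eq_or_ne p m with rfl | hne
      · rw [Function.update_self, hx]
      · rw [Function.update_of_ne fun h => hne (hinj p m (by omega) hb h)]
        exact g3 p (by omega)
    simp only [runs_seq, runs_store, runs_assign, runs_branch, Test.Holds, Expr.val,
      State.setReg_reg, State.setArr_reg, State.setReg_arr, State.setArr_arr, if_true, g1, e0, e4,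
      e10]
    refine ⟨fun hc => ⟨by omega, by omega, ⟨trivial, by omega, hupd _ ?_⟩, by omega⟩,
      fun hc => ⟨hσ.arr 10 m, by omega, ⟨trivial, by omega, hupd _ ?_⟩, by omega⟩⟩
    · rw [finalColour, if_pos hc]
    · rw [finalColour, if_neg hc]
  · rintro m τ hs ⟨g1, g2, g3⟩ hb
    have e1 : τ.reg 1 = n := by rw [hs.reg 1 rfl]; simpa
    simp only [Test.Holds, Expr.val, e1, g1] at hb
    obtain rfl : m = n := by omega
    exact ⟨rfl, g3⟩

/-! ### The algorithm -/

/-- Colour the vertices of a tree in which the paths are long. -/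
def sectionLong : Program := selectTools ;; completeColours ;; storeColours

/-- Compute a `k`-section of a tree. -/
def kSection : Program :=
  layOut ;; Program.branch (R 10 <ₑ K 16 *ₑ (R 0 -ₑ K 1) +ₑ K 2) storeResidues sectionLong

/-- What is known about the result for a tree with `N` blocks. -/
structure LongSection (n N k : ℕ) (par ord : ℕ → ℕ) (Δ : ℕ) (f : ℕ → ℕ) (col : ℕ → ℕ) : Prop where
  colour_eq : ∀ p < n, f (ord p) = col p
  lt : ∀ p < n, col p < k
  countLE_eq : ∀ j < k, countLE n col j = (j + 1) * n / k
  cut_le : N * ((Finset.Ico 1 n).filter fun p => col p ≠ col (par p)).card ≤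
    (k - 1) * (2 * N + 16 * n) * Δ

theorem runs_sectionLong {N Δ : ℕ} {par blk start ord : ℕ → ℕ} (hT : Blocks n N par blk start)
    (h0 : σ.reg 0 = k) (h1 : σ.reg 1 = n) (h10 : σ.reg 10 = N) (h4 : σ.arr 4 = ord)
    (h5 : σ.arr 5 = par) (h7 : σ.arr 7 = blk) (h8 : σ.arr 8 = start) (hσ : σ.Bounded B)
    (hk : 2 ≤ k) (hkB : k + 1 ≤ B) (hB : 2 * n + 2 ≤ B) (hN : 16 * (k - 1) + 2 ≤ N) (hΔ : 2 ≤ Δ)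
    (hdeg : DegreeLE n par Δ) (hinj : ∀ p q, p < n → q < n → ord p = ord q → p = q) :
    Runs B sectionLong σ fun m τ => m ≤ 7 * n + 3 * (k - 1) * (n + 1) + (k - 1) * (35 * n + 1) ∧
      ∃ col, LongSection n N k par ord Δ (τ.arr 2) col := by
  set W := N / (3 * (k - 1)) with hW
  -- The threshold for `N` is chosen such that `15 * (k - 1) ≤ N`.
  have hW5 : 5 ≤ W := (Nat.le_div_iff_mul_le (by omega)).2 (by omega)
  have hNW : N ≤ 3 * (k - 1) * (W + 1) := by
    have h2 := Nat.div_add_mod N (3 * (k - 1))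
    have h3 := Nat.mod_lt N (show 0 < 3 * (k - 1) by omega)
    rw [← hW] at h2
    rw [Nat.mul_add]
    omega
  rw [sectionLong, runs_seq]
  refine ((runs_selectTools hT h0 h1 h10 h8 hk hkB hB (by omega)).bounded hσ).mono
    fun m₁ σ₁ hs₁ hq => ?_
  obtain ⟨⟨q1, q2, q3, q4⟩, b₁⟩ := hq
  rw [← hW] at q2 q3 q4
  have hM : MainState n N W k par blk start (σ₁.arr 14) B σ₁ :=
    ⟨b₁, (hs₁.reg 0 rfl).trans h0, (hs₁.reg 1 rfl).trans h1, q2, (hs₁.arr 5 rfl).trans h5,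
      (hs₁.arr 7 rfl).trans h7, (hs₁.arr 8 rfl).trans h8, rfl⟩
  have e4 := (hs₁.arr 4 rfl).trans h4
  rw [runs_seq]
  refine ((runs_completeColours hM hT hk (by omega) hB q3 q4 hΔ hdeg).bounded b₁).mono
    fun m₂ σ₂ hs₂ hq => ?_
  obtain ⟨⟨r1, S, w, mark, rt, g, r2, r3⟩, b₂⟩ := hq
  have f4 := (hs₂.arr 4 rfl).trans e4
  refine (runs_storeColours ((hs₂.reg 0 rfl).trans hM.reg_k) ((hs₂.reg 1 rfl).trans hM.reg_n) b₂
    (by rwa [f4])).mono fun m₃ σ₃ _ hq => ?_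
  rw [f4] at hq
  exact ⟨by omega, _, hq.2, fun p hp => r2.finalColour_lt r3 hp,
    fun j hj => r2.countLE_finalColour r3 hj, r2.cut_le r3 hdeg (by omega) hNW hW5⟩

end RAM

/-! ### The width of the section and the assembled algorithm -/

theorem SimpleGraph.IsTree.one_le_diam {n : ℕ} {T : SimpleGraph (Fin n)} (hT : T.IsTree)
    (hn : 2 ≤ n) :
    1 ≤ T.diam := by
  have : Nontrivial (Fin n) := Fin.nontrivial_iff_two_le.2 hn
  exact Nat.one_le_iff_ne_zero.2 (T.connected_iff_diam_ne_zero.1 hT.connected)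

section

variable {k n N : ℕ} [NeZero n] {T : SimpleGraph (Fin n)} {ord par blk start : ℕ → ℕ}

theorem RAM.Layout.degreeLE [DecidableRel T.Adj] (hL : RAM.Layout T N ord par blk start) :
    DegreeLE n par T.maxDegree := fun _ hp => hL.order.card_le_maxDegree hp

/-- The second of three path vertices has an edge to each of the two others. The estimate `2 ≤ Δ`
pays for the edges at boundaries in `refined_arith`. -/
theorem RAM.Layout.two_le_maxDegree [DecidableRel T.Adj] (hL : RAM.Layout T N ord par blk start)
    (hN : 3 ≤ N) :
    2 ≤ T.maxDegree := by
  have h1 := hL.blocks.start_le_n (show 2 ≤ N by omega)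
  have h2 : start 1 < start 2 := hL.blocks.start_lt 1 (by omega)
  have h3 : start 0 < start 1 := hL.blocks.start_lt 0 (by omega)
  have h4 : start 2 < start 3 := hL.blocks.start_lt 2 (by omega)
  have h5 := hL.blocks.start_le_n (show 3 ≤ N by omega)
  refine le_trans ?_ (hL.degreeLE (start 1) (by omega))
  rw [← Finset.card_pair h2.ne]
  refine Finset.card_le_card fun q hq => ?_
  simp only [Finset.mem_insert, Finset.mem_singleton] at hq
  simp only [Finset.mem_filter, Finset.mem_Ico]
  rcases hq with rfl | rfl
  · exact ⟨⟨by omega, by omega⟩, Or.inl rfl⟩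
  · exact ⟨⟨by omega, by omega⟩, Or.inr (hL.blocks.par_start 1 (by omega))⟩

theorem RAM.Layout.one_le_maxDegree [DecidableRel T.Adj] (hL : RAM.Layout T N ord par blk start)
    (hn : 2 ≤ n) :
    1 ≤ T.maxDegree := by
  refine le_trans ?_ (hL.degreeLE 1 (by omega))
  rw [Finset.one_le_card]
  exact ⟨1, by simp; omega⟩

/-- The estimate has been proved with the number `N` of blocks in the denominator. Since `T.diam ≤
N`, replacing `N` by the diameter weakens it. -/
theorem RAM.LongSection.width_le [DecidableRel T.Adj] {f col : ℕ → ℕ}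
    (h : RAM.LongSection n N k par ord T.maxDegree f col)
    (hL : RAM.Layout T N ord par blk start) (hT : T.IsTree) (hk : 2 ≤ k) (hN : T.diam ≤ N - 1)
    (h2 : 2 ≤ n) (hN0 : 0 < N) :
    (cutWidth T (colourClasses k n f) : ℝ) ≤
      ((k : ℝ) - 1) * (2 + 16 * (n : ℝ) / (T.diam : ℝ)) * (T.maxDegree : ℝ) := by
  have h1 := hL.order.cutWidth_le (k := k) (P := colourClasses k n f) (col := col) hT
    fun l p hp hv => by
      simp only [colourClasses, Finset.mem_filter, Finset.mem_univ, true_and, Fin.val_ofNat,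
        Nat.mod_eq_of_lt (hL.ord_lt p hp)] at hv
      rw [← h.colour_eq p hp, hv]
  have h3 := (Nat.mul_le_mul_left N h1).trans h.cut_le
  have hd : (1 : ℝ) ≤ T.diam := by exact_mod_cast hT.one_le_diam h2
  have hNd : (T.diam : ℝ) ≤ N := by exact_mod_cast (by omega : T.diam ≤ N)
  have hNpos : (0 : ℝ) < N := by linarith
  have hk1 : (1 : ℝ) ≤ k := by exact_mod_cast (by omega : 1 ≤ k)
  have h4 : (N : ℝ) * cutWidth T (colourClasses k n f) ≤
      ((k : ℝ) - 1) * (2 * N + 16 * n) * T.maxDegree := by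
    have := (Nat.cast_le (α := ℝ)).2 h3
    push_cast [Nat.cast_sub (show 1 ≤ k by omega)] at this
    exact this
  have h5 : (cutWidth T (colourClasses k n f) : ℝ) ≤
      ((k : ℝ) - 1) * (2 + 16 * n / N) * T.maxDegree := by
    refine le_of_mul_le_mul_left (h4.trans_eq ?_) hNpos
    field_simp
  refine h5.trans ?_
  gcongr

/-- For `n ≥ 2` the diameter is positive and at most `16 * (k - 1)`, so the right-hand side is at
least `n`, more than the number of edges. For `n = 1` there are no edges, and it suffices that the
right-hand side is nonnegative. -/
theorem RAM.Layout.width_le [DecidableRel T.Adj] (hL : RAM.Layout T N ord par blk start)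
    (hT : T.IsTree) (hk : 2 ≤ k)
    (hN : T.diam ≤ 16 * (k - 1)) (P : Fin k → Finset (Fin n)) :
    (cutWidth T P : ℝ) ≤
      ((k : ℝ) - 1) * (2 + 16 * (n : ℝ) / (T.diam : ℝ)) * (T.maxDegree : ℝ) := by
  have hk1 : (1 : ℝ) ≤ k := by exact_mod_cast (by omega : 1 ≤ k)
  have h1 := hL.order.cutWidth_lt (P := P) hT
  rcases Nat.lt_or_ge n 2 with h2 | h2
  · have h3 : cutWidth T P = 0 := by omega
    rw [h3, Nat.cast_zero]
    have : (0 : ℝ) ≤ (k : ℝ) - 1 := by linarith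
    positivity
  · have hd : (1 : ℝ) ≤ T.diam := by exact_mod_cast hT.one_le_diam h2
    have hΔ : (1 : ℝ) ≤ T.maxDegree := by exact_mod_cast hL.one_le_maxDegree h2
    have hd' : (T.diam : ℝ) ≤ 16 * ((k : ℝ) - 1) := by
      have := (Nat.cast_le (α := ℝ)).2 hN
      push_cast [Nat.cast_sub (show 1 ≤ k by omega)] at this
      exact this
    have h3 : (cutWidth T P : ℝ) ≤ n := by exact_mod_cast h1.le
    have h4 : (n : ℝ) ≤ ((k : ℝ) - 1) * (2 + 16 * n / T.diam) := by
      have h5 : (n : ℝ) ≤ ((k : ℝ) - 1) * (16 * n / T.diam) := by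
        rw [← mul_div_assoc, le_div_iff₀ (by linarith)]
        nlinarith [Nat.cast_nonneg (α := ℝ) n]
      nlinarith
    have h5 : (0 : ℝ) ≤ n := Nat.cast_nonneg _
    calc (cutWidth T P : ℝ) ≤ n := h3
      _ ≤ ((k : ℝ) - 1) * (2 + 16 * n / T.diam) := h4
      _ ≤ _ := le_mul_of_one_le_right (h5.trans h4) hΔ

theorem RAM.LongSection.isKSection {Δ : ℕ} {f col : ℕ → ℕ}
    (h : RAM.LongSection n N k par ord Δ f col) (hL : RAM.Layout T N ord par blk start)
    (hk : 2 ≤ k) : IsKSection (colourClasses k n f) := by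
  have hc := colourCount_comp hL.ord_lt hL.ord_inj h.colour_eq
  refine isKSection_colourClasses (fun v hv => ?_) fun l hl => ?_
  · obtain ⟨p, hp, hpv⟩ := hL.order.surj ⟨v, hv⟩
    have h1 := congrArg Fin.val hpv
    simp only [Fin.val_ofNat, Nat.mod_eq_of_lt (hL.ord_lt p hp)] at h1
    rw [← h1, h.colour_eq p hp]
    exact h.lt p hp
  · rw [hc]
    exact colourCount_of_countLE (by omega) h.countLE_eq hl

theorem runs_kSection [DecidableRel T.Adj] {B : ℕ} {adj : Fin n → List (Fin n)} (hk : 2 ≤ k)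
    (hT : T.IsTree)
    (hadj : IsAdjacencyList T adj) (hkB : k + 1 ≤ B) (hB : 2 * n + 2 ≤ B) :
    RAM.Runs B RAM.kSection (inputState k adj) fun m τ => m ≤ 64 * (k * n) ∧
      IsKSection (colourClasses k n (τ.arr 2)) ∧
      (cutWidth T (colourClasses k n (τ.arr 2)) : ℝ) ≤
        ((k : ℝ) - 1) * (2 + 16 * (n : ℝ) / (T.diam : ℝ)) * (T.maxDegree : ℝ) := by
  have hn : 0 < n := NeZero.pos n
  have hoff := hadj.arr_zero_last hT k
  have hkn : n ≤ k * n := Nat.le_mul_of_pos_left _ (by omega)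
  rw [RAM.kSection, RAM.runs_seq]
  refine ((RAM.runs_layOut (hadj.listsReady hT k hB) (hadj.listsOf k) hT rfl).bounded
    (hadj.bounded hT hB (by omega))).mono fun m σ hs hq => ?_
  obtain ⟨⟨q1, q2, q3, q4, hL⟩, b⟩ := hq
  have e0 : σ.reg 0 = k := (hs.reg 0 rfl).trans rfl
  have e1 : σ.reg 1 = n := (hs.reg 1 rfl).trans rfl
  rw [RAM.runs_branch]
  simp only [RAM.Test.Holds, RAM.Expr.val, e0]
  refine ⟨fun hb => ?_, fun hb => ?_⟩
  · refine (RAM.runs_storeResidues e0 e1 (by omega)).mono fun m' τ _ hq => ?_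
    obtain ⟨r1, r2⟩ := hq
    refine ⟨by omega, ?_, hL.width_le hT hk (by omega) _⟩
    have h1 : colourClasses k n (τ.arr 2) = colourClasses k n fun v => v % k := by
      funext l
      exact Finset.filter_congr fun v _ => by rw [r2 v v.2]
    rw [h1]
    exact isKSection_colourClasses (fun v _ => Nat.mod_lt v (by omega))
      fun l hl => colourCount_mod_bounds hl
  · refine (RAM.runs_sectionLong hL.blocks e0 e1 rfl rfl rfl rfl rfl b hk hkB hB (by omega)
      (hL.two_le_maxDegree (by omega)) hL.degreeLE hL.ord_inj).mono fun m' τ _ hq => ?_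
    obtain ⟨r1, col, r2⟩ := hq
    -- The layout takes at most `15 * n` passes, as `off n ≤ 2 * n`. The rest takes `7 * n` and
    -- terms bounded by `6 * k * n` and `36 * k * n`; all together is below `64 * k * n`.
    refine ⟨?_, r2.isKSection hL hk, r2.width_le hL hT hk q4 (by omega) q2⟩
    have h1 : 3 * (k - 1) * (n + 1) ≤ 3 * k * (2 * n) := Nat.mul_le_mul (by omega) (by omega)
    have h2 : (k - 1) * (35 * n + 1) ≤ k * (36 * n) := Nat.mul_le_mul (by omega) (by omega)
    have h3 : 3 * k * (2 * n) = 6 * (k * n) := by ring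
    have h4 : k * (36 * n) = 36 * (k * n) := by ring
    omega

end


theorem theorem1 :
    ∃ (prog : RAM.Program) (C c : ℕ),
      ∀ (k n : ℕ), 2 ≤ k →
      ∀ (T : SimpleGraph (Fin n)) [DecidableRel T.Adj], T.IsTree →
      ∀ adj : Fin n → List (Fin n), IsAdjacencyList T adj →
        ∃ (t : ℕ) (τ : RAM.State) (V : Fin k → Finset (Fin n)),
          RAM.Exec ((k + n) ^ c) prog (inputState k adj) t τ ∧
          t ≤ C * (k * n) ∧
          OutputsCut τ V ∧
          IsKSection V ∧
          (cutWidth T V : ℝ) ≤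
            ((k : ℝ) - 1) * (2 + 16 * (n : ℝ) / (T.diam : ℝ)) * (T.maxDegree : ℝ) := by
  -- The `64 * k * n` passes and the one that `Run.exec` adds make `65`. The exponent is that of `B`
  -- as a power of `k + n`, times the exponent `unit` by which intermediate results may exceed `B`.
  refine ⟨RAM.kSection, RAM.kSection.unit * 65,
    (RAM.kSection.maxConst + 3) * RAM.kSection.unit, fun k n hk T _ hT adj hadj => ?_⟩
  have hn : 0 < n := by
    obtain ⟨v⟩ := hT.connected.nonempty
    exact v.pos
  have : NeZero n := ⟨hn.ne'⟩
  set B := (k + n) ^ (RAM.kSection.maxConst + 3) with hB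
  -- The summand `3` in the exponent makes `B` at least `9 * (k + n)`, which covers `k + 1` and `2 *
  -- n + 2`; the summand `maxConst` lets the constants of the program fit.
  have h3 : (k + n) ^ 3 ≤ B := Nat.pow_le_pow_right (by omega) (by omega)
  have h4 : 9 * (k + n) ≤ (k + n) ^ 3 := by
    rw [pow_succ]
    exact Nat.mul_le_mul_right _ (Nat.pow_le_pow_left (show 3 ≤ k + n by omega) 2)
  have h5 : RAM.kSection.maxConst ≤ B :=
    (Nat.lt_pow_self (show 1 < k + n by omega)).le.trans
      (Nat.pow_le_pow_right (by omega) (by omega))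
  obtain ⟨m, τ, hr, hm, hsec, hw⟩ :=
    runs_kSection (B := B) hk hT hadj (by omega) (by omega)
  obtain ⟨t, ht, hex, -⟩ := hr.exec (W := (k + n) ^ ((RAM.kSection.maxConst + 3) *
    RAM.kSection.unit)) (by omega) (hadj.bounded hT (by omega) (by omega)) h5 (by rw [hB, pow_mul])
  refine ⟨t, τ, colourClasses k n (τ.arr 2), hex, ?_, fun l v => by simp [colourClasses], hsec, hw⟩
  have hkn : 0 < k * n := Nat.mul_pos (by omega) hn
  rw [Nat.mul_assoc]
  exact ht.trans (Nat.mul_le_mul_left _ (by omega))
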